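/- Let $M$ be an $n$-dimensional smooth manifold (Hausdorff, second countable) with a volume form $\mu_M$, let $X=\mathbb{R}\times M$ with volume form $\mu=dt\wedge\mu_M$, and let $G$ be a finite-dimensional real Lie group with Lie algebra $\mathfrak{g}=T_eG$ (bracket of left invariant vector fields). For the trivial right principal bundle $P=X\times G\to X$ identify $J^1P$ with the bundle $L(TX,TG)$ over $X\times G$, and let $\mathcal{L}=\overline{\mathcal{L}}\,\mu$, with $\overline{\mathcal{L}}:J^1P\to\mathbb{R}$ smooth, be a Lagrangian density that is invariant under the right action $b\mapsto TR_h\circ b$ of $G$. Using $L(T_{(t,m)}X,\cdot)=L(T_t\mathbb{R},\cdot)\times L(T_mM,\cdot)$, an element of $J^1P$ is written as a pair (time part, space part). Let $\bar\ell(x,\sigma)=\overline{\mathcal{L}}(x,e,\sigma)$, $\sigma\in L(T_xX,\mathfrak{g})$, be the reduced Lagrangian. Let $I\subset\mathbb{R}$ be an open interval, $V\subset M$ open, $U=I\times V$, and let $\bar s:U\to G$ be smooth. Put $\bar\sigma=TR_{\bar s^{-1}}\circ T\bar s=(\bar\sigma^1,\bar\sigma^2)\in\Omega^1(U,\mathfrak{g})$,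 $\chi(t)(m)=\bar s(t,m)$, $\nu(t)=\dot\chi(t)\chi(t)^{-1}$ and $\gamma(t)=-\mathbf{d}\chi(t)\,\chi(t)^{-1}$. For a measurable region $D\subset V$, a smooth $\chi:V\to G$, $\dot\chi$ along $\chi$, and a $\mathfrak{g}$-valued one-form $\gamma$, put $$L(t,\chi,\dot\chi,\gamma)=\int_D\overline{\mathcal{L}}(t,\dot\chi,\mathbf{d}\chi-\chi\gamma)\,\mu_M,\qquad l(t,\nu,\gamma)=L(t,e,\nu,\gamma),\qquad L_0(t,\chi,\dot\chi)=L(t,\chi,\dot\chi,0).$$ Then $\nu(t)(m)=\bar\sigma^1(t,m)$ and $\gamma(t)(m)=-\bar\sigma^2(t,m)$. The functions $\bar\ell$ and $l$ are the reductions of $\overline{\mathcal{L}}$ and $L$: $$\overline{\mathcal{L}}(x,g,b)=\bar\ell(x,TR_{g^{-1}}\circ b),\qquad L(t,\chi,\dot\chi,\gamma)=l(t,\dot\chi\chi^{-1},\chi\gamma\chi^{-1}+\chi\,\mathbf{d}\chi^{-1}).$$ They satisfy $$l(t,\nu,\gamma)=\int_D\bar\ell(t,\nu,-\gamma)\,\mu_M$$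 for all $D$ (in particular $D=V$); for smooth $\nu$, $\gamma$ on $V$ the integral converges over every compact $D\subset V$. (A non-convergent integral is read as $0$; the integrands on the two sides of these identities agree.) Moreover the following are equivalent. In (i), (iii), (v), (vii), $K$ ranges over all compact subsets of $V$ (for (i), (iii)) or of $U$ (for (v), (vii)), the variations vanish outside $K$, and $\delta\int$ denotes the derivative at $\varepsilon=0$ of the action integral over the region $K$; in (i), (iii), $[t_1,t_2]$ ranges over all compact intervals $t_1<t_2$ in $I$. If $V$ is compact, (i) and (iii) allow all variations vanishing at the endpoints. * **(i)** Hamilton's principle $\delta\int_{t_1}^{t_2}L_0(t,\chi,\dot\chi)\,dt=0$ holds for all smooth families $\chi_\varepsilon$ with $\chi_0=\chi$ whose $\delta\chi=\partial_\varepsilon|_0\chi_\varepsilon$ vanishes at $t_1$, $t_2$. * **(ii)** $\chi$ satisfies on $I$ the Euler–Lagrange equations $\frac{d}{dt}\frac{\partial L_0}{\partial\dot\chi}=\frac{\partial L_0}{\partial\chi}$ on $\mathcal{F}(V,G)$, that is, in the coordinates $u=\psi\circ\chi$ given by charts $\psi$ of $G$, tested against all smooth $w$ with support in a compact $K\subset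 V$ that $\chi(t)$ maps into the domain of $\psi$ (with $L_0$ over $K$). * **(iii)** $\delta\int_{t_1}^{t_2}l(t,\nu,\gamma)\,dt=0$ for the variations $\delta\nu=\dot\zeta-[\nu,\zeta]$, $\delta\gamma=-\mathbf{d}^\gamma\zeta=-(\mathbf{d}\zeta+[\gamma,\zeta])$, with $\zeta:I\times V\to\mathfrak{g}$ smooth and vanishing at $t_1$, $t_2$. * **(iv)** The affine Euler–Poincaré equations hold on $I\times V$: $$\frac{\partial}{\partial t}\frac{\delta l}{\delta\nu}=-\operatorname{ad}^*_\nu\frac{\delta l}{\delta\nu}+\operatorname{div}^\gamma\frac{\delta l}{\delta\gamma}.$$ Here $\frac{\delta l}{\delta\nu}\in\mathcal{F}(V,\mathfrak{g}^*)$ and $\frac{\delta l}{\delta\gamma}\in\mathfrak{X}(V,\mathfrak{g}^*)$ are the functional derivatives for the pairings by contraction and integration against $\mu_M$, taken in compactly supported directions. Moreover $\langle\operatorname{ad}^*_\nu p,\eta\rangle=\langle p,[\nu,\eta]\rangle$ and $\langle\operatorname{div}^\gamma w,\eta\rangle=\langle\operatorname{div}w,\eta\rangle-\langle w,[\gamma,\eta]\rangle$,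 with the divergence taken with respect to $\mu_M$. * **(v)** $\delta\int_U\mathcal{L}(j^1s)=0$ holds for all smooth families $\bar s_\varepsilon$ with $\bar s_0=\bar s$ whose variation $\partial_\varepsilon|_0\bar s_\varepsilon$ has compact support in $U$. * **(vi)** $\bar s$ satisfies the covariant Euler–Lagrange equations on $U$. In all bundle charts, with coordinates $y^i$ on $X$ and $z^a$ on $G$, with $z_i^a$ the corresponding fibre coordinates on $J^1P$ and $\mu=\rho\,dy^0\wedge\dots\wedge dy^n$, these are $\sum_i\partial_i\big(\rho\,\frac{\partial\overline{\mathcal{L}}}{\partial z_i^a}\big)=\rho\,\frac{\partial\overline{\mathcal{L}}}{\partial z^a}$ along $j^1\bar s$. * **(vii)** $\delta\int_U\bar\ell(\bar\sigma)\,\mu=0$ holds for the variations $\delta\bar\sigma=\mathbf{d}\eta-[\bar\sigma,\eta]$ with $\eta:U\to\mathfrak{g}$ smooth and compactly supported. * **(viii)** The covariant Euler–Poincaré equations hold on $U$: $$\operatorname{div}\frac{\delta\bar\ell}{\delta\bar\sigma}=-\operatorname{Tr}\Big(\operatorname{ad}^*_{\bar\sigma}\frac{\delta\bar\ell}{\delta\bar\sigma}\Big).$$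 Here $\frac{\delta\bar\ell}{\delta\bar\sigma}(\zeta)=\frac{d}{d\varepsilon}\big|_0\bar\ell(\bar\sigma+\varepsilon\zeta)$ is the fibre derivative, $\langle\operatorname{Tr}(\operatorname{ad}^*_{\bar\sigma}w),\eta\rangle=\langle w,[\bar\sigma,\eta]\rangle$, and the divergence on $X$ is taken with respect to $\mu$. -/

import Mathlib

open scoped Manifold ContDiff
open MeasureTheory

noncomputable section

/-! ### Volume forms, their measures, and divergences -/

section Volume

variable {E : Type*} [NormedAddCommGroup E] [NormedSpace ℝ E]
  {H : Type*} [TopologicalSpace H] (I : ModelWithCorners ℝ E H)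
  {N : Type*} [TopologicalSpace N] [ChartedSpace H N]
  {d : ℕ} (b : Module.Basis (Fin d) ℝ E)

/-- The coefficient `Ω(∂₁, …, ∂_d)` of a top degree form `Ω`, in the chart at `x₀`, as a function
of the coordinates `y`; `∂ᵢ` is the coordinate vector field belonging to the vector `b i`. -/
def volCoeff (Ω : ∀ x : N, TangentSpace I x [⋀^Fin d]→ₗ[ℝ] ℝ) (x₀ : N) (y : E) : ℝ :=
  Ω ((extChartAt I x₀).symm y) fun i =>
    (mfderiv 𝓘(ℝ, E) I (extChartAt I x₀).symm y : E →L[ℝ] _) (b i)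

/-- A volume form: a smooth nowhere vanishing form of top degree. -/
structure IsVolumeForm (Ω : ∀ x : N, TangentSpace I x [⋀^Fin d]→ₗ[ℝ] ℝ) : Prop where
  ne_zero : ∀ x, Ω x ≠ 0
  smooth : ∀ x₀ : N, ContDiffOn ℝ ∞ (volCoeff I b Ω x₀) (extChartAt I x₀).target

/-- The measure of a volume form `Ω` (integration against `Ω` on the manifold oriented by `Ω`):
in the chart at each point it is `|Ω(∂₁, …, ∂_d)| dy¹ ⋯ dy^d`. The local measures agree on
overlaps and their supremum is the measure that restricts to all of them. -/
def volMeasure [FiniteDimensional ℝ E] [MeasurableSpace E] [BorelSpace E] [MeasurableSpace N]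
    (Ω : ∀ x : N, TangentSpace I x [⋀^Fin d]→ₗ[ℝ] ℝ) : Measure N :=
  ⨆ x₀ : N, ((b.addHaar.withDensity fun y => ENNReal.ofReal |volCoeff I b Ω x₀ y|).restrict
    (extChartAt I x₀).target).map (extChartAt I x₀).symm

variable {F : Type*} [AddCommGroup F] [Module ℝ F] [TopologicalSpace F] [ContinuousSMul ℝ F]
  [IsTopologicalAddGroup F]

/-- The elementary `F`-valued covector `dyⁱ ⊗ η` at `x`, with `dyⁱ` the `i`-th coordinate
differential of the chart at `x₀`. -/
def coordCovector [FiniteDimensional ℝ E] (x₀ : N) (i : Fin d) (x : N) (η : F) :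
    TangentSpace I x →L[ℝ] F :=
  ((LinearMap.toContinuousLinearMap (b.coord i)).comp
    (mfderiv I 𝓘(ℝ, E) (extChartAt I x₀) x : TangentSpace I x →L[ℝ] E)).smulRight η

/-- The divergence, with respect to the volume form `Ω`, of a vector field `w` with values in `F*`,
regarded as a section of the dual of `L(TN, F)`. In the chart at `x`, with components
`wⁱ(η) = w(dyⁱ ⊗ η)` and `Ω = ρ dy¹ ∧ ⋯ ∧ dy^d`, it is `(div w)(η) = ρ⁻¹ ∑ᵢ ∂ᵢ(ρ wⁱ(η))`. -/
def divergence [FiniteDimensional ℝ E] (Ω : ∀ x : N, TangentSpace I x [⋀^Fin d]→ₗ[ℝ] ℝ)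
    (w : ∀ x : N, (TangentSpace I x →L[ℝ] F) → ℝ) (x : N) (η : F) : ℝ :=
  (volCoeff I b Ω x (extChartAt I x x))⁻¹ *
    ∑ i, fderiv ℝ (fun y => volCoeff I b Ω x y *
      w ((extChartAt I x).symm y) (coordCovector I b x i ((extChartAt I x).symm y) η))
      (extChartAt I x x) (b i)

end Volume

/-! ### Spacetime `X = ℝ × M` -/

section Spacetime

/-- The model of the spacetime `ℝ × M`, for `M` of dimension `n`. -/
abbrev stModel (n : ℕ) :
    ModelWithCorners ℝ (ℝ × EuclideanSpace ℝ (Fin n)) (ModelProd ℝ (EuclideanSpace ℝ (Fin n))) :=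
  𝓘(ℝ, ℝ).prod (𝓡 n)

/-- The standard basis `(e₁, …, eₙ)` of `ℝⁿ`. -/
def spaceBasis (n : ℕ) : Module.Basis (Fin n) ℝ (EuclideanSpace ℝ (Fin n)) :=
  (EuclideanSpace.basisFun (Fin n) ℝ).toBasis

/-- The standard basis `(∂ₜ, e₁, …, eₙ)` of `ℝ × ℝⁿ`. -/
def stBasis (n : ℕ) : Module.Basis (Fin (n + 1)) ℝ (ℝ × EuclideanSpace ℝ (Fin n)) :=
  ((Module.Basis.singleton (Fin 1) ℝ).prod (spaceBasis n)).reindex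
    (finSumFinEquiv.trans (finCongr (Nat.add_comm 1 n)))

variable {n : ℕ} {M : Type*} [TopologicalSpace M] [ChartedSpace (EuclideanSpace ℝ (Fin n)) M]

/-- The form `dt ∧ Ω` on `ℝ × M`:
`(dt ∧ Ω)(u₀, …, uₙ) = ∑ᵢ (-1)ⁱ dt(uᵢ) Ω(u₀, …, uᵢ₋₁, uᵢ₊₁, …, uₙ)`. -/
def dtWedge (Ω : ∀ m : M, TangentSpace (𝓡 n) m [⋀^Fin n]→ₗ[ℝ] ℝ) (x : ℝ × M) :
    TangentSpace (stModel n) x [⋀^Fin (n + 1)]→ₗ[ℝ] ℝ :=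
  AlternatingMap.alternatizeUncurryFin
    ((LinearMap.fst ℝ ℝ (EuclideanSpace ℝ (Fin n))).smulRight
      ((Ω x.2 : EuclideanSpace ℝ (Fin n) [⋀^Fin n]→ₗ[ℝ] ℝ).compLinearMap
        (LinearMap.snd ℝ ℝ (EuclideanSpace ℝ (Fin n)))))

/-- The linear map `(τ, u) ↦ τ v + a(u)` on `T_{(t,m)}(ℝ × M) = ℝ × T_m M`: the splitting
`L(TX, F) = L(Tℝ, F) × L(TM, F)`, with `L(Tℝ, F)` identified with `F`. -/
def splitMap {F : Type*} [AddCommGroup F] [Module ℝ F] [TopologicalSpace F] [ContinuousSMul ℝ F]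
    [IsTopologicalAddGroup F] (t : ℝ) (m : M) (v : F) (a : TangentSpace (𝓡 n) m →L[ℝ] F) :
    TangentSpace (stModel n) ((t, m) : ℝ × M) →L[ℝ] F :=
  (ContinuousLinearMap.toSpanSingleton ℝ v).coprod a

/-- The time component of `σ ∈ L(T_{(t,m)}(ℝ × M), F)`. -/
def timePart {F : Type*} [AddCommGroup F] [Module ℝ F] [TopologicalSpace F] {t : ℝ} {m : M}
    (σ : TangentSpace (stModel n) ((t, m) : ℝ × M) →L[ℝ] F) : F :=
  σ ((1, 0) : ℝ × EuclideanSpace ℝ (Fin n))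

/-- The space component of `σ ∈ L(T_{(t,m)}(ℝ × M), F)`. -/
def spacePart {F : Type*} [AddCommGroup F] [Module ℝ F] [TopologicalSpace F] {t : ℝ} {m : M}
    (σ : TangentSpace (stModel n) ((t, m) : ℝ × M) →L[ℝ] F) : TangentSpace (𝓡 n) m →L[ℝ] F :=
  ContinuousLinearMap.comp (M₂ := ℝ × EuclideanSpace ℝ (Fin n)) σ
    (ContinuousLinearMap.inr ℝ ℝ (EuclideanSpace ℝ (Fin n)))

end Spacetime

/-! ### Lie groups -/

section LieGroups

variable {EG : Type*} [NormedAddCommGroup EG] [NormedSpace ℝ EG]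
  {G : Type*} [TopologicalSpace G] [ChartedSpace EG G] [Group G]

/-- The Lie algebra `𝔤 = T_e G`, with the bracket of left invariant vector fields. -/
abbrev LieAlg (EG : Type*) [NormedAddCommGroup EG] [NormedSpace ℝ EG] (G : Type*)
    [TopologicalSpace G] [ChartedSpace EG G] [Group G] : Type _ :=
  GroupLieAlgebra 𝓘(ℝ, EG) G

/-- `T R_{g⁻¹} : T_g G → 𝔤`, that is, `v ↦ v g⁻¹`. -/
def rightTriv (g : G) : TangentSpace 𝓘(ℝ, EG) g →L[ℝ] LieAlg EG G :=
  mfderiv 𝓘(ℝ, EG) 𝓘(ℝ, EG) (fun h : G => h * g⁻¹) g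

/-- `T L_g : 𝔤 → T_g G`, that is, `ξ ↦ g ξ`. -/
def leftTrans (g : G) : LieAlg EG G →L[ℝ] TangentSpace 𝓘(ℝ, EG) g :=
  mfderiv 𝓘(ℝ, EG) 𝓘(ℝ, EG) (fun h : G => g * h) 1

/-- The adjoint action `Ad_g ξ = g ξ g⁻¹`. -/
def AdMap (g : G) : LieAlg EG G →L[ℝ] LieAlg EG G :=
  mfderiv 𝓘(ℝ, EG) 𝓘(ℝ, EG) (fun h : G => g * h * g⁻¹) 1

/-- The continuous linear map `ξ ↦ [ξ, η]` on `𝔤`. -/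
def bracketRight [FiniteDimensional ℝ EG] [LieGroup 𝓘(ℝ, EG) ∞ G] (η : LieAlg EG G) :
    LieAlg EG G →L[ℝ] LieAlg EG G :=
  haveI : LieGroup 𝓘(ℝ, EG) (minSmoothness ℝ 3) G := by
    rw [minSmoothness_of_isRCLikeNormedField]; infer_instance
  haveI : T2Space (LieAlg EG G) := inferInstanceAs (T2Space EG)
  haveI : FiniteDimensional ℝ (LieAlg EG G) := inferInstanceAs (FiniteDimensional ℝ EG)
  LinearMap.toContinuousLinearMap
    { toFun := fun ξ => ⁅ξ, η⁆
      map_add' := fun ξ ξ' => add_lie ξ ξ' η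
      map_smul' := fun c ξ => smul_lie c ξ η }

variable {E : Type*} [NormedAddCommGroup E] [NormedSpace ℝ E]
  {H : Type*} [TopologicalSpace H] (I : ModelWithCorners ℝ E H)
  {N : Type*} [TopologicalSpace N] [ChartedSpace H N]

/-- Smoothness on `U` of a map into the vector space `𝔤`. -/
def LieSmoothOn (f : N → LieAlg EG G) (U : Set N) : Prop :=
  ContMDiffOn I 𝓘(ℝ, EG) ∞ (M' := EG) f U

/-- The differential of a map into the vector space `𝔤`. -/
def lieD (f : N → LieAlg EG G) (x : N) : TangentSpace I x →L[ℝ] LieAlg EG G :=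
  mfderiv I 𝓘(ℝ, EG) (M' := EG) f x

/-- Smoothness on `U` of a `𝔤`-valued one-form: its coordinate components are smooth. -/
def FormSmoothOn (α : ∀ x : N, TangentSpace I x →L[ℝ] LieAlg EG G) (U : Set N) : Prop :=
  ∀ (x₀ : N) (e : E), ContDiffOn ℝ ∞ (F := EG)
    (fun y => α ((extChartAt I x₀).symm y)
      ((mfderiv 𝓘(ℝ, E) I (extChartAt I x₀).symm y : E →L[ℝ] _) e))
    ((extChartAt I x₀).target ∩ (extChartAt I x₀).symm ⁻¹' U)

/-- Smoothness on `U` of a `𝔤*`-valued function. -/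
def DualSmoothOn (p : N → (LieAlg EG G →ₗ[ℝ] ℝ)) (U : Set N) : Prop :=
  ∀ η : LieAlg EG G, ContMDiffOn I 𝓘(ℝ, ℝ) ∞ (fun x => p x η) U

/-- Smoothness on `U` of a `𝔤*`-valued vector field, regarded as a section of the dual of
`L(TN, 𝔤)`: its coordinate components are smooth. -/
def DualFieldSmoothOn (w : ∀ x : N, (TangentSpace I x →L[ℝ] LieAlg EG G) →ₗ[ℝ] ℝ) (U : Set N) :
    Prop :=
  ∀ (x₀ : N) (A : E →L[ℝ] LieAlg EG G), ContDiffOn ℝ ∞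
    (fun y => w ((extChartAt I x₀).symm y)
      (A.comp (mfderiv I 𝓘(ℝ, E) (extChartAt I x₀) ((extChartAt I x₀).symm y) :
        TangentSpace I ((extChartAt I x₀).symm y) →L[ℝ] E)))
    ((extChartAt I x₀).target ∩ (extChartAt I x₀).symm ⁻¹' U)

end LieGroups

/-! ### Lagrangian densities on the first jet bundle of `X × G → X`, `X = ℝ × M` -/

section Densities

variable {n : ℕ} {M : Type*} [TopologicalSpace M] [ChartedSpace (EuclideanSpace ℝ (Fin n)) M]
  {EG : Type*} [NormedAddCommGroup EG] [NormedSpace ℝ EG]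
  {G : Type*} [TopologicalSpace G] [ChartedSpace EG G]

/-- Functions on `J¹P`, whose fibre over `(x, g)` is `L(T_x X, T_g G)`. A Lagrangian density is
such a function times the volume form of `X`. -/
abbrev JetFunction (n : ℕ) (M : Type*) [TopologicalSpace M]
    [ChartedSpace (EuclideanSpace ℝ (Fin n)) M] (EG : Type*) [NormedAddCommGroup EG]
    [NormedSpace ℝ EG] (G : Type*) [TopologicalSpace G] [ChartedSpace EG G] : Type _ :=
  ∀ (x : ℝ × M) (g : G), (TangentSpace (stModel n) x →L[ℝ] TangentSpace 𝓘(ℝ, EG) g) → ℝ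

/-- The expression of a function on `J¹P` in the bundle chart given by the charts of `X` at `x₀`
and of `G` at `g₀`. -/
def jetLocal (L : JetFunction n M EG G) (x₀ : ℝ × M) (g₀ : G)
    (y : ℝ × EuclideanSpace ℝ (Fin n)) (z : EG) (A : (ℝ × EuclideanSpace ℝ (Fin n)) →L[ℝ] EG) :
    ℝ :=
  L ((extChartAt (stModel n) x₀).symm y) ((extChartAt 𝓘(ℝ, EG) g₀).symm z)
    ((mfderiv 𝓘(ℝ, EG) 𝓘(ℝ, EG) (extChartAt 𝓘(ℝ, EG) g₀).symm z : EG →L[ℝ] _).comp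
      (A.comp (mfderiv (stModel n) 𝓘(ℝ, ℝ × EuclideanSpace ℝ (Fin n)) (extChartAt (stModel n) x₀)
        ((extChartAt (stModel n) x₀).symm y) :
        TangentSpace (stModel n) ((extChartAt (stModel n) x₀).symm y) →L[ℝ]
          (ℝ × EuclideanSpace ℝ (Fin n)))))

/-- Smoothness of a function on `J¹P`. -/
def JetSmooth (L : JetFunction n M EG G) : Prop :=
  ∀ (x₀ : ℝ × M) (g₀ : G), ContDiffOn ℝ ∞
    (fun q : (ℝ × EuclideanSpace ℝ (Fin n)) × EG × ((ℝ × EuclideanSpace ℝ (Fin n)) →L[ℝ] EG) =>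
      jetLocal L x₀ g₀ q.1 q.2.1 q.2.2)
    ((extChartAt (stModel n) x₀).target ×ˢ ((extChartAt 𝓘(ℝ, EG) g₀).target ×ˢ Set.univ))

/-- Invariance under the right action of `G` on `J¹P`. -/
def JetInvariant [Group G] (L : JetFunction n M EG G) : Prop :=
  ∀ (x : ℝ × M) (g h : G) (A : TangentSpace (stModel n) x →L[ℝ] TangentSpace 𝓘(ℝ, EG) g),
    L x (g * h) ((mfderiv 𝓘(ℝ, EG) 𝓘(ℝ, EG) (fun k : G => k * h) g).comp A) = L x g A

/-- The covariant Euler–Lagrange equations of the density `L dt ∧ Ω` for the section `s` on `U`,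
`∂ᵢ(ρ ∂L/∂z_i^a) = ρ ∂L/∂z^a` in all bundle charts, where `dt ∧ Ω = ρ dy⁰ ∧ ⋯ ∧ dyⁿ`. -/
def CovariantEulerLagrange (Ω : ∀ m : M, TangentSpace (𝓡 n) m [⋀^Fin n]→ₗ[ℝ] ℝ)
    (L : JetFunction n M EG G) (U : Set (ℝ × M)) (s : ℝ × M → G) : Prop :=
  ∀ (x₀ : ℝ × M) (g₀ : G),
    let ρ := volCoeff (stModel n) (stBasis n) (dtWedge Ω) x₀
    let σ := fun y => extChartAt 𝓘(ℝ, EG) g₀ (s ((extChartAt (stModel n) x₀).symm y))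
    ∀ y ∈ (extChartAt (stModel n) x₀).target, (extChartAt (stModel n) x₀).symm y ∈ U →
      s ((extChartAt (stModel n) x₀).symm y) ∈ (extChartAt 𝓘(ℝ, EG) g₀).source →
      ∀ v : EG,
        ∑ i, fderiv ℝ (fun y' => ρ y' *
            fderiv ℝ (fun A => jetLocal L x₀ g₀ y' (σ y') A) (fderiv ℝ σ y')
              ((LinearMap.toContinuousLinearMap ((stBasis n).coord i)).smulRight v))
          y (stBasis n i)
        = ρ y * fderiv ℝ (fun z => jetLocal L x₀ g₀ y z (fderiv ℝ σ y)) (σ y) v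

/-- The covariant variational principle `δ ∫_U L(j¹s) dt ∧ Ω = 0`. The variations are smooth
families `s_ε` with `s₀ = s` whose infinitesimal variation `δs` has compact support in `U`; the first
variation is that of the action of any compact `K ⊆ U` containing this support. -/
def CovariantPrinciple [MeasurableSpace M] (μ : Measure (ℝ × M)) (L : JetFunction n M EG G)
    (U : Set (ℝ × M))
    (s : ℝ × M → G) : Prop :=
  ∀ K ⊆ U, IsCompact K → ∀ r > (0 : ℝ), ∀ S : ℝ → ℝ × M → G,
    ContMDiffOn (𝓘(ℝ, ℝ).prod (stModel n)) 𝓘(ℝ, EG) ∞ (fun q : ℝ × (ℝ × M) => S q.1 q.2)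
      (Set.Ioo (-r) r ×ˢ U) →
    (∀ x ∈ U, S 0 x = s x) →
    (∀ x ∈ U \ K, mfderiv 𝓘(ℝ, ℝ) 𝓘(ℝ, EG) (fun ε => S ε x) 0 = 0) →
    HasDerivAt
      (fun ε : ℝ => ∫ x in K, L x (S ε x) (mfderiv (stModel n) 𝓘(ℝ, EG) (S ε) x) ∂μ) 0 0

end Densities

/-! ### Covariant reduction -/

section CovariantReduction

variable {n : ℕ} {M : Type*} [TopologicalSpace M] [ChartedSpace (EuclideanSpace ℝ (Fin n)) M]
  {EG : Type*} [NormedAddCommGroup EG] [NormedSpace ℝ EG]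
  {G : Type*} [TopologicalSpace G] [ChartedSpace EG G] [Group G]

/-- The reduced Lagrangian `ℓ` on `J¹P/G = L(TX, 𝔤)`: the class of `(x, e, σ)` is `σ`. -/
def reducedDensity (L : JetFunction n M EG G) (x : ℝ × M)
    (σ : TangentSpace (stModel n) x →L[ℝ] LieAlg EG G) : ℝ :=
  L x 1 σ

/-- The reduced first jet extension `σ(x) = T R_{s(x)⁻¹} ∘ T_x s`. -/
def reducedJet (s : ℝ × M → G) (x : ℝ × M) : TangentSpace (stModel n) x →L[ℝ] LieAlg EG G :=
  (rightTriv (s x)).comp (mfderiv (stModel n) 𝓘(ℝ, EG) s x)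

/-- The fibre derivative `δℓ/δσ`, the functional `ζ ↦ d/dε|₀ ℓ(σ(x) + ε ζ)` on `L(T_x X, 𝔤)`. -/
def fibreDeriv (l : ∀ x : ℝ × M, (TangentSpace (stModel n) x →L[ℝ] LieAlg EG G) → ℝ)
    (σ : ∀ x : ℝ × M, TangentSpace (stModel n) x →L[ℝ] LieAlg EG G) (x : ℝ × M)
    (ζ : TangentSpace (stModel n) x →L[ℝ] LieAlg EG G) : ℝ :=
  deriv (fun ε : ℝ => l x (σ x + ε • ζ)) 0

variable [FiniteDimensional ℝ EG] [LieGroup 𝓘(ℝ, EG) ∞ G]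

/-- The variational principle `δ ∫_U ℓ(σ) dt ∧ Ω = 0` for the variations `δσ = dη - [σ, η]`,
with `η` compactly supported in `U`. -/
def CovariantReducedPrinciple [MeasurableSpace M] (μ : Measure (ℝ × M))
    (l : ∀ x : ℝ × M, (TangentSpace (stModel n) x →L[ℝ] LieAlg EG G) → ℝ) (U : Set (ℝ × M))
    (σ : ∀ x : ℝ × M, TangentSpace (stModel n) x →L[ℝ] LieAlg EG G) : Prop :=
  ∀ K ⊆ U, IsCompact K → ∀ η : ℝ × M → LieAlg EG G,
    LieSmoothOn (stModel n) η Set.univ → (∀ x ∉ K, η x = 0) →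
    HasDerivAt
      (fun ε : ℝ => ∫ x in K, l x
        (σ x + ε • (lieD (stModel n) η x - (bracketRight (η x)).comp (σ x))) ∂μ) 0 0

/-- The covariant Euler–Poincaré equations `div δℓ/δσ = - Tr(ad*_σ δℓ/δσ)` on `U`, where
`⟨Tr(ad*_σ w), η⟩ = w([σ, η])`. -/
def CovariantEulerPoincare (Ω : ∀ m : M, TangentSpace (𝓡 n) m [⋀^Fin n]→ₗ[ℝ] ℝ)
    (l : ∀ x : ℝ × M, (TangentSpace (stModel n) x →L[ℝ] LieAlg EG G) → ℝ) (U : Set (ℝ × M))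
    (σ : ∀ x : ℝ × M, TangentSpace (stModel n) x →L[ℝ] LieAlg EG G) : Prop :=
  ∀ x ∈ U, ∀ η : LieAlg EG G,
    divergence (stModel n) (stBasis n) (dtWedge Ω) (fibreDeriv l σ) x η
      = - fibreDeriv l σ x ((bracketRight η).comp (σ x))

end CovariantReduction

/-! ### Dynamics on `F(V, G)` -/

section Dynamics

variable {n : ℕ} {M : Type*} [TopologicalSpace M] [ChartedSpace (EuclideanSpace ℝ (Fin n)) M]
  {EG : Type*} [NormedAddCommGroup EG] [NormedSpace ℝ EG]
  {G : Type*} [TopologicalSpace G] [ChartedSpace EG G]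

/-- The velocity `∂χ/∂t`, a tangent vector of `F(V, G)` at `χ(t)`. -/
def velocity (χ : ℝ → M → G) (t : ℝ) (m : M) : TangentSpace 𝓘(ℝ, EG) (χ t m) :=
  (mfderiv 𝓘(ℝ, ℝ) 𝓘(ℝ, EG) (fun τ => χ τ m) t : ℝ →L[ℝ] _) 1

variable [Group G]

/-- The instantaneous Lagrangian `L(t, χ, χ', γ) = ∫_D L(t, χ', dχ - χ γ) μ` over the region `D`. -/
def instLagrangian [MeasurableSpace M] (μ : Measure M) (L : JetFunction n M EG G) (D : Set M)
    (t : ℝ) (χ : M → G)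
    (v : ∀ m, TangentSpace 𝓘(ℝ, EG) (χ m))
    (γ : ∀ m : M, TangentSpace (𝓡 n) m →L[ℝ] LieAlg EG G) : ℝ :=
  ∫ m in D, L (t, m) (χ m)
    (splitMap t m (v m) (mfderiv (𝓡 n) 𝓘(ℝ, EG) χ m - (leftTrans (χ m)).comp (γ m))) ∂μ

/-- The Lagrangian `L₀` on `T F(V, G)`: the instantaneous Lagrangian at `γ₀ = 0`. -/
def zeroLagrangian [MeasurableSpace M] (μ : Measure M) (L : JetFunction n M EG G) (D : Set M)
    (t : ℝ) (χ : M → G)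
    (v : ∀ m, TangentSpace 𝓘(ℝ, EG) (χ m)) : ℝ :=
  instLagrangian μ L D t χ v fun _ => 0

/-- The reduced Lagrangian `l` on `F(V, 𝔤) × Ω¹(V, 𝔤)`: the class of `(e, ν, γ)` is `(ν, γ)`. -/
def reducedLagrangian [MeasurableSpace M] (μ : Measure M) (L : JetFunction n M EG G) (D : Set M)
    (t : ℝ)
    (ν : M → LieAlg EG G) (γ : ∀ m : M, TangentSpace (𝓡 n) m →L[ℝ] LieAlg EG G) : ℝ :=
  instLagrangian μ L D t (fun _ => 1) ν γ

/-- The affine action `θ_{χ⁻¹} γ = χ γ χ⁻¹ + χ dχ⁻¹` on `Ω¹(V, 𝔤)`. -/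
def affineAct (χ : M → G) (γ : ∀ m : M, TangentSpace (𝓡 n) m →L[ℝ] LieAlg EG G) (m : M) :
    TangentSpace (𝓡 n) m →L[ℝ] LieAlg EG G :=
  let T : TangentSpace 𝓘(ℝ, EG) (χ m)⁻¹ →L[ℝ] LieAlg EG G :=
    mfderiv 𝓘(ℝ, EG) 𝓘(ℝ, EG) (fun h : G => χ m * h) (χ m)⁻¹
  (AdMap (χ m)).comp (γ m) + T.comp (mfderiv (𝓡 n) 𝓘(ℝ, EG) (fun m' => (χ m')⁻¹) m)

/-- `ν = χ' χ⁻¹`. -/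
def nuOf (χ : ℝ → M → G) (t : ℝ) (m : M) : LieAlg EG G :=
  rightTriv (χ t m) (velocity χ t m)

/-- `γ = - dχ χ⁻¹`. -/
def gammaOf (χ : ℝ → M → G) (t : ℝ) (m : M) : TangentSpace (𝓡 n) m →L[ℝ] LieAlg EG G :=
  -(rightTriv (χ t m)).comp (mfderiv (𝓡 n) 𝓘(ℝ, EG) (χ t) m)

/-- Hamilton's principle for `L₀`, over all `[t₁, t₂] ⊆ J`. The variations are smooth families `χ_ε`
with `χ₀ = χ` whose infinitesimal variation `δχ` vanishes at the endpoints and has support in a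
compact `K ⊆ V`; the first variation is that of the action of the region `K`. -/
def HamiltonPrinciple [MeasurableSpace M] (μ : Measure M) (L : JetFunction n M EG G) (J : Set ℝ)
    (V : Set M)
    (χ : ℝ → M → G) : Prop :=
  ∀ t₁ ∈ J, ∀ t₂ ∈ J, t₁ < t₂ → ∀ K ⊆ V, IsCompact K → ∀ r > (0 : ℝ), ∀ C : ℝ → ℝ → M → G,
    ContMDiffOn (𝓘(ℝ, ℝ).prod (stModel n)) 𝓘(ℝ, EG) ∞
      (fun q : ℝ × (ℝ × M) => C q.1 q.2.1 q.2.2) (Set.Ioo (-r) r ×ˢ (J ×ˢ V)) →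
    (∀ t ∈ J, ∀ m ∈ V, C 0 t m = χ t m) →
    (∀ t ∈ J, ∀ m ∈ V \ K, mfderiv 𝓘(ℝ, ℝ) 𝓘(ℝ, EG) (fun ε => C ε t m) 0 = 0) →
    (∀ m ∈ V, mfderiv 𝓘(ℝ, ℝ) 𝓘(ℝ, EG) (fun ε => C ε t₁ m) 0 = 0) →
    (∀ m ∈ V, mfderiv 𝓘(ℝ, ℝ) 𝓘(ℝ, EG) (fun ε => C ε t₂ m) 0 = 0) →
    HasDerivAt
      (fun ε : ℝ => ∫ t in t₁..t₂, zeroLagrangian μ L K t (C ε t) (velocity (C ε) t)) 0 0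

/-- `L₀` over the region `K` in the coordinates `u = ψ ∘ χ` on `F(V, G)`, `u' = ∂u/∂t`, which the
chart `ψ` of `G` at `g₀` induces on the maps that send `K` into the domain of `ψ`. -/
def coordLagrangian [MeasurableSpace M] (μ : Measure M) (L : JetFunction n M EG G) (g₀ : G)
    (K : Set M) (t : ℝ)
    (u u' : M → EG) : ℝ :=
  zeroLagrangian μ L K t (fun m => (extChartAt 𝓘(ℝ, EG) g₀).symm (u m))
    (fun m => (mfderiv 𝓘(ℝ, EG) 𝓘(ℝ, EG) (extChartAt 𝓘(ℝ, EG) g₀).symm (u m) : EG →L[ℝ] _) (u' m))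

/-- The Euler–Lagrange equations `d/dt ∂L₀/∂u' = ∂L₀/∂u` on `F(V, G)`, in the coordinates induced by
the charts of `G`. Both sides are covectors, tested on the coordinate tangent vectors `w` of
`F(V, G)`, smooth maps with support in a compact `K ⊆ V` that `χ(t)` sends into the chart domain. -/
def EulerLagrange [MeasurableSpace M] (μ : Measure M) (L : JetFunction n M EG G) (J : Set ℝ)
    (V : Set M)
    (χ : ℝ → M → G) : Prop :=
  ∀ (g₀ : G), ∀ t ∈ J, ∀ K ⊆ V, IsCompact K →
    (∀ m ∈ K, χ t m ∈ (extChartAt 𝓘(ℝ, EG) g₀).source) →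
    ∀ w : M → EG, ContMDiff (𝓡 n) 𝓘(ℝ, EG) ∞ w → (∀ m ∉ K, w m = 0) →
    let u := fun τ m => extChartAt 𝓘(ℝ, EG) g₀ (χ τ m)
    let u' := fun τ m => deriv (fun τ' => u τ' m) τ
    HasDerivAt (fun τ => deriv (fun ε : ℝ => coordLagrangian μ L g₀ K τ (u τ) (u' τ + ε • w)) 0)
      (deriv (fun ε : ℝ => coordLagrangian μ L g₀ K t (u t + ε • w) (u' t)) 0) t

/-- `p ∈ F(V, 𝔤*)` is the functional derivative `δl/δν` of `l = (l_D)_D` at `(ν, γ)`, for the pairing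
`⟨p, ζ⟩ = ∫ p(ζ) μ`. -/
def IsNuDerivative [MeasurableSpace M] (μ : Measure M)
    (l : Set M → (M → LieAlg EG G) → (∀ m : M, TangentSpace (𝓡 n) m →L[ℝ] LieAlg EG G) → ℝ)
    (V : Set M) (ν : M → LieAlg EG G) (γ : ∀ m : M, TangentSpace (𝓡 n) m →L[ℝ] LieAlg EG G)
    (p : M → (LieAlg EG G →ₗ[ℝ] ℝ)) : Prop :=
  DualSmoothOn (𝓡 n) p V ∧
    ∀ K ⊆ V, IsCompact K → ∀ ζ : M → LieAlg EG G, LieSmoothOn (𝓡 n) ζ Set.univ →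
      (∀ m ∉ K, ζ m = 0) →
      HasDerivAt (fun ε : ℝ => l K (fun m => ν m + ε • ζ m) γ) (∫ m in K, p m (ζ m) ∂μ) 0

/-- `w ∈ 𝔛(V, 𝔤*)` is the functional derivative `δl/δγ` of `l = (l_D)_D` at `(ν, γ)`, for the pairing
`⟨w, α⟩ = ∫ w(α) μ`. -/
def IsGammaDerivative [MeasurableSpace M] (μ : Measure M)
    (l : Set M → (M → LieAlg EG G) → (∀ m : M, TangentSpace (𝓡 n) m →L[ℝ] LieAlg EG G) → ℝ)
    (V : Set M) (ν : M → LieAlg EG G) (γ : ∀ m : M, TangentSpace (𝓡 n) m →L[ℝ] LieAlg EG G)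
    (w : ∀ m : M, (TangentSpace (𝓡 n) m →L[ℝ] LieAlg EG G) →ₗ[ℝ] ℝ) : Prop :=
  DualFieldSmoothOn (𝓡 n) w V ∧
    ∀ K ⊆ V, IsCompact K → ∀ α : ∀ m : M, TangentSpace (𝓡 n) m →L[ℝ] LieAlg EG G,
      FormSmoothOn (𝓡 n) α Set.univ → (∀ m ∉ K, α m = 0) →
      HasDerivAt (fun ε : ℝ => l K ν (fun m => γ m + ε • α m)) (∫ m in K, w m (α m) ∂μ) 0

variable [FiniteDimensional ℝ EG] [LieGroup 𝓘(ℝ, EG) ∞ G]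

/-- The constrained variational principle for `l`, over all `[t₁, t₂] ⊆ J`, with the variations
`δν = ζ' - [ν, ζ]` and `δγ = - d^γ ζ = - (dζ + [γ, ζ])`, where `ζ` vanishes at the endpoints and
has spatial support in a compact `K ⊆ V`. -/
def ConstrainedPrinciple
    (l : Set M → ℝ → (M → LieAlg EG G) → (∀ m : M, TangentSpace (𝓡 n) m →L[ℝ] LieAlg EG G) → ℝ)
    (J : Set ℝ) (V : Set M) (ν : ℝ → M → LieAlg EG G)
    (γ : ℝ → ∀ m : M, TangentSpace (𝓡 n) m →L[ℝ] LieAlg EG G) : Prop :=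
  ∀ t₁ ∈ J, ∀ t₂ ∈ J, t₁ < t₂ → ∀ K ⊆ V, IsCompact K → ∀ ζ : ℝ → M → LieAlg EG G,
    LieSmoothOn (stModel n) (fun x : ℝ × M => ζ x.1 x.2) (J ×ˢ V) →
    (∀ t ∈ J, ∀ m ∉ K, ζ t m = 0) → (∀ m, ζ t₁ m = 0) → (∀ m, ζ t₂ m = 0) →
    HasDerivAt
      (fun ε : ℝ => ∫ t in t₁..t₂, l K t
        (fun m => ν t m + ε • (deriv (fun τ => ζ τ m) t - ⁅ν t m, ζ t m⁆))
        (fun m => γ t m + ε • (-(lieD (𝓡 n) (ζ t) m + (bracketRight (ζ t m)).comp (γ t m))))) 0 0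

/-- The affine Euler–Poincaré equations
`∂/∂t δl/δν = - ad*_ν δl/δν + div^γ δl/δγ` on `J × V`, where `⟨ad*_ν p, η⟩ = p([ν, η])` and
`⟨div^γ w, η⟩ = (div w)(η) - w([γ, η])`; the functional derivatives `p = δl/δν` and `w = δl/δγ`
are unique on `V`. -/
def AffineEulerPoincare [MeasurableSpace M] (μ : Measure M) (Ω : ∀ m : M, TangentSpace
    (𝓡 n) m [⋀^Fin n]→ₗ[ℝ] ℝ)
    (l : Set M → ℝ → (M → LieAlg EG G) → (∀ m : M, TangentSpace (𝓡 n) m →L[ℝ] LieAlg EG G) → ℝ)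
    (J : Set ℝ) (V : Set M) (ν : ℝ → M → LieAlg EG G)
    (γ : ℝ → ∀ m : M, TangentSpace (𝓡 n) m →L[ℝ] LieAlg EG G) : Prop :=
  ∃ (p : ℝ → M → (LieAlg EG G →ₗ[ℝ] ℝ))
    (w : ℝ → ∀ m : M, (TangentSpace (𝓡 n) m →L[ℝ] LieAlg EG G) →ₗ[ℝ] ℝ),
    (∀ t ∈ J, IsNuDerivative μ (fun D => l D t) V (ν t) (γ t) (p t)) ∧
    (∀ t ∈ J, IsGammaDerivative μ (fun D => l D t) V (ν t) (γ t) (w t)) ∧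
    ∀ t ∈ J, ∀ m ∈ V, ∀ η : LieAlg EG G,
      HasDerivAt (fun τ => p τ m η)
        (-(p t m ⁅ν t m, η⁆) +
          (divergence (𝓡 n) (spaceBasis n) Ω (fun m' => w t m') m η
            - w t m ((bracketRight η).comp (γ t m)))) t

end Dynamics

end

/-!
All eight statements say that one covector vanishes. Let `f` be the reduced density, `σ` the right
logarithmic derivative `ds s⁻¹` of `s` (`rightDer`), and `Φ` the fibre derivative of `f` along `σ`.
The Euler–Poincaré covector at `x` (`epForm`) is `η ↦ (div Φ)(η) + Φ([σ, η])`; the covariant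
Euler–Poincaré equations are its vanishing (`covariantEulerPoincare_iff`), and each other statement
is reduced to it.

*Variations.* By right invariance the density along `s` is `f(σ)`. Differentiating the structure
equation for `ds s⁻¹` (`fderiv_rightDer_sub`) in the direction of a parameter shows that a variation
of `s` with right trivialized velocity `η` induces `δσ = dη - [σ, η]` (`hasDerivAt_rightDer`).
Conversely every `η` is the velocity of the variation `φ⁻¹(φ(1) + ε η) s`, with `φ` the chart of the
group at `1` (`leftVariation`). The divergence theorem (`setIntegral_field_tder_eq_div`, from
integration by parts in charts and a partition of unity) turns the first variation `∫ Φ(dη - [σ, η])`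
into minus the integral of the Euler–Poincaré covector at `η` (`setIntegral_variation`), and the
fundamental lemma (`epForm_eq_zero_of_integral`) concludes. This settles the covariant variational
principle and its reduced form at once.

*Coordinates.* The Euler–Lagrange expression in a bundle chart is the density of the volume form
times the Euler–Poincaré covector at the trivialized coordinate vector
(`eulerLagrange_sub_eq_epForm`). The derivative of the density in the group coordinates is the
variation of `f(σ)` along `ψ⁻¹(ψ(s) + ε v)`, for a chart `ψ`, and the momenta are components of `Φ`,
so that the product rule for the divergence leaves only the covector.

*Time and space.* For `dt ∧ Ω` the divergence is `∂ₜ` of the time component of `Φ` plus the spatial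
divergence of its space component (`divAt_spacetime`). Integrating by parts in space alone gives the
Euler–Lagrange equations on `F(V, G)` (`setIntegral_slice_variation`, `hasDerivAt_coordMomentum`);
integrating also over a time interval gives Hamilton's principle and the constrained principle for
`l` (`setIntegral_time_variation`). The functional derivatives of `l` are unique
(`IsNuDerivative.eqOn`, `IsGammaDerivative.eqOn`), hence are the time component of `Φ` and minus its
space component, the sign being that of `γ = -dχ χ⁻¹`; with them the affine Euler–Poincaré equations
are the split form of the covariant ones (`affineEulerPoincare_at_iff`).

The tangent spaces and the Lie algebra are by definition the model vector spaces. Derivatives and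
densities are therefore treated as maps between model spaces (`tder`, and the definitions whose names
begin with `plain`), and statements about the intrinsic objects unfold to statements about these.
-/

open scoped Topology

set_option linter.unusedSectionVars false

noncomputable section
/-! ### Manifold derivatives as maps between the model spaces -/

section Derivative

variable {E : Type*} [NormedAddCommGroup E] [NormedSpace ℝ E]
  {H : Type*} [TopologicalSpace H] (I : ModelWithCorners ℝ E H)
  {N : Type*} [TopologicalSpace N] [ChartedSpace H N]
  {E' : Type*} [NormedAddCommGroup E'] [NormedSpace ℝ E']
  {H' : Type*} [TopologicalSpace H'] (I' : ModelWithCorners ℝ E' H')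
  {N' : Type*} [TopologicalSpace N'] [ChartedSpace H' N']
  {E'' : Type*} [NormedAddCommGroup E''] [NormedSpace ℝ E'']
  {H'' : Type*} [TopologicalSpace H''] (I'' : ModelWithCorners ℝ E'' H'')
  {N'' : Type*} [TopologicalSpace N''] [ChartedSpace H'' N'']

/-- The manifold derivative, regarded as a map between the model vector spaces. -/
def tder (f : N → N') (x : N) : E →L[ℝ] E' := mfderiv I I' f x

variable {I I' I''}

theorem tder_comp {g : N' → N''} {f : N → N'} {x : N}
    (hg : MDifferentiableAt I' I'' g (f x)) (hf : MDifferentiableAt I I' f x) :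
    tder I I'' (fun y => g (f y)) x = (tder I' I'' g (f x)).comp (tder I I' f x) :=
  mfderiv_comp x hg hf

theorem tder_congr {f g : N → N'} {x : N} (h : f =ᶠ[𝓝 x] g) :
    tder I I' f x = tder I I' g x := Filter.EventuallyEq.mfderiv_eq h

theorem tder_eq_fderiv (f : E → E') (x : E) : tder 𝓘(ℝ, E) 𝓘(ℝ, E') f x = fderiv ℝ f x :=
  mfderiv_eq_fderiv

theorem tder_const (c : N') (x : N) : tder I I' (fun _ : N => c) x = 0 := mfderiv_const

theorem tder_id (x : N) : tder I I (fun y : N => y) x = ContinuousLinearMap.id ℝ E := mfderiv_id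

variable [I.Boundaryless] [IsManifold I ∞ N]

theorem contMDiffAt_chart {c x : N} (h : x ∈ (extChartAt I c).source) :
    ContMDiffAt I 𝓘(ℝ, E) ∞ (extChartAt I c) x :=
  contMDiffAt_extChartAt' (by simpa using h)

theorem contMDiffAt_chart_symm {c : N} {y : E} (h : y ∈ (extChartAt I c).target) :
    ContMDiffAt 𝓘(ℝ, E) I ∞ (extChartAt I c).symm y :=
  (contMDiffOn_extChartAt_symm c y h).contMDiffAt ((isOpen_extChartAt_target c).mem_nhds h)

theorem tder_symm_comp_tder_chart {c : N} {y : E} (h : y ∈ (extChartAt I c).target) :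
    (tder 𝓘(ℝ, E) I (extChartAt I c).symm y).comp
      (tder I 𝓘(ℝ, E) (extChartAt I c) ((extChartAt I c).symm y)) = ContinuousLinearMap.id ℝ E := by
  have h1 := (contMDiffAt_chart_symm (I := I) h).mdifferentiableAt (by simp)
  have hs : (extChartAt I c).symm y ∈ (extChartAt I c).source := (extChartAt I c).map_target h
  have h2 := (contMDiffAt_chart (I := I) hs).mdifferentiableAt (by simp)
  have h3 := tder_comp (I := I) (I' := 𝓘(ℝ, E)) (I'' := I) (x := (extChartAt I c).symm y)
    (g := (extChartAt I c).symm) (f := extChartAt I c)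
    (by rw [(extChartAt I c).right_inv h]; exact h1) h2
  rw [(extChartAt I c).right_inv h] at h3
  rw [← h3, ← tder_id (I := I) ((extChartAt I c).symm y)]
  refine tder_congr ?_
  filter_upwards [(isOpen_extChartAt_source (I := I) c).mem_nhds hs] with z hz
  exact (extChartAt I c).left_inv hz

theorem tder_chart_comp_tder_symm {c : N} {y : E} (h : y ∈ (extChartAt I c).target) :
    (tder I 𝓘(ℝ, E) (extChartAt I c) ((extChartAt I c).symm y)).comp
      (tder 𝓘(ℝ, E) I (extChartAt I c).symm y) = ContinuousLinearMap.id ℝ E := by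
  have h1 := (contMDiffAt_chart_symm (I := I) h).mdifferentiableAt (by simp)
  have hs : (extChartAt I c).symm y ∈ (extChartAt I c).source := (extChartAt I c).map_target h
  have h2 := (contMDiffAt_chart (I := I) hs).mdifferentiableAt (by simp)
  rw [← tder_comp h2 h1, ← tder_id (I := 𝓘(ℝ, E)) y]
  refine tder_congr ?_
  filter_upwards [(isOpen_extChartAt_target (I := I) c).mem_nhds h] with z hz
  exact (extChartAt I c).right_inv hz

theorem tder_chart_self (x : N) :
    tder I 𝓘(ℝ, E) (extChartAt I x) x = ContinuousLinearMap.id ℝ E :=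
  have : IsManifold I 1 N := IsManifold.of_le (n := ∞) (by simp)
  mfderiv_extChartAt_self

theorem tder_chart_symm_self (x : N) :
    tder 𝓘(ℝ, E) I (extChartAt I x).symm (extChartAt I x x) = ContinuousLinearMap.id ℝ E := by
  have h := tder_symm_comp_tder_chart (I := I) (c := x) (mem_extChartAt_target x)
  rwa [extChartAt_to_inv, tder_chart_self, ContinuousLinearMap.comp_id] at h

end Derivative

/-! ### The right logarithmic derivative of a group valued map -/

section RightDerivative

variable {E : Type*} [NormedAddCommGroup E] [NormedSpace ℝ E]
  {H : Type*} [TopologicalSpace H] (I : ModelWithCorners ℝ E H)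
  {N : Type*} [TopologicalSpace N] [ChartedSpace H N]
  {EG : Type*} [NormedAddCommGroup EG] [NormedSpace ℝ EG]
  {G : Type*} [TopologicalSpace G] [ChartedSpace EG G] [Group G]

/-- The right logarithmic derivative `v ↦ (T_x S v) S(x)⁻¹` of a group valued map, as a linear map
between the model spaces. -/
def rightDer (S : N → G) (x : N) : E →L[ℝ] EG :=
  tder I 𝓘(ℝ, EG) (fun x' => S x' * (S x)⁻¹) x

variable {I}

theorem rightDer_mul_const (S : N → G) (h : G) (x : N) :
    rightDer I (fun y => S y * h) x = rightDer I (EG := EG) S x := by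
  simp [rightDer, mul_assoc]

theorem rightDer_congr {S T : N → G} {x : N} (h : S =ᶠ[𝓝 x] T) :
    rightDer I S x = rightDer I (EG := EG) T x := by
  refine tder_congr ?_
  filter_upwards [h] with y hy
  rw [hy, h.eq_of_nhds]

variable [LieGroup 𝓘(ℝ, EG) ∞ G]

theorem contMDiff_mul_const (h : G) :
    ContMDiff 𝓘(ℝ, EG) 𝓘(ℝ, EG) ∞ (fun k : G => k * h) :=
  contMDiff_id.mul contMDiff_const

theorem rightDer_eq {S : N → G} {x : N} (hS : MDifferentiableAt I 𝓘(ℝ, EG) S x) :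
    rightDer I S x = (tder 𝓘(ℝ, EG) 𝓘(ℝ, EG) (fun h : G => h * (S x)⁻¹) (S x)).comp
      (tder I 𝓘(ℝ, EG) S x) :=
  tder_comp (g := fun h : G => h * (S x)⁻¹)
    ((contMDiff_mul_const _).mdifferentiable (by simp) _) hS

variable {E' : Type*} [NormedAddCommGroup E'] [NormedSpace ℝ E']
  {H' : Type*} [TopologicalSpace H'] {I' : ModelWithCorners ℝ E' H'}
  {N' : Type*} [TopologicalSpace N'] [ChartedSpace H' N']

theorem rightDer_comp {S : N → G} {f : N' → N} {x : N'}
    (hS : MDifferentiableAt I 𝓘(ℝ, EG) S (f x)) (hf : MDifferentiableAt I' I f x) :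
    rightDer I' (fun y => S (f y)) x = (rightDer I (EG := EG) S (f x)).comp (tder I' I f x) :=
  tder_comp (g := fun y => S y * (S (f x))⁻¹) (f := f)
    (((contMDiff_mul_const _).mdifferentiable (by simp) _).comp (f x) hS) hf

variable (EG G) in
/-- The multiplication of the group in the chart at the identity. -/
def chartMul (p : EG × EG) : EG :=
  extChartAt 𝓘(ℝ, EG) (1 : G) ((extChartAt 𝓘(ℝ, EG) (1 : G)).symm p.1 *
    (extChartAt 𝓘(ℝ, EG) (1 : G)).symm p.2)

variable (EG G) in
/-- The coordinates of the identity. -/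
def chartOne : EG := extChartAt 𝓘(ℝ, EG) (1 : G) 1

theorem chart_symm_chartOne : (extChartAt 𝓘(ℝ, EG) (1 : G)).symm (chartOne EG G) = 1 :=
  extChartAt_to_inv _

theorem chartOne_mem : chartOne EG G ∈ (extChartAt 𝓘(ℝ, EG) (1 : G)).target :=
  mem_extChartAt_target _

theorem contDiffAt_chartMul :
    ContDiffAt ℝ ∞ (chartMul EG G) (chartOne EG G, chartOne EG G) := by
  rw [← contMDiffAt_iff_contDiffAt]
  have h := contMDiffAt_chart_symm (chartOne_mem (EG := EG) (G := G))
  have h1 : ContMDiffAt 𝓘(ℝ, EG × EG) 𝓘(ℝ, EG) ∞ (fun p : EG × EG =>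
      (extChartAt 𝓘(ℝ, EG) (1 : G)).symm p.1) (chartOne EG G, chartOne EG G) :=
    ContMDiffAt.comp (g := (extChartAt 𝓘(ℝ, EG) (1 : G)).symm) (f := Prod.fst)
      (I' := 𝓘(ℝ, EG)) (chartOne EG G, chartOne EG G) h contDiff_fst.contMDiff.contMDiffAt
  have h2 : ContMDiffAt 𝓘(ℝ, EG × EG) 𝓘(ℝ, EG) ∞ (fun p : EG × EG =>
      (extChartAt 𝓘(ℝ, EG) (1 : G)).symm p.2) (chartOne EG G, chartOne EG G) :=
    ContMDiffAt.comp (g := (extChartAt 𝓘(ℝ, EG) (1 : G)).symm) (f := Prod.snd)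
      (I' := 𝓘(ℝ, EG)) (chartOne EG G, chartOne EG G) h contDiff_snd.contMDiff.contMDiffAt
  refine ContMDiffAt.comp (g := extChartAt 𝓘(ℝ, EG) (1 : G)) (I' := 𝓘(ℝ, EG))
    (chartOne EG G, chartOne EG G) (contMDiffAt_chart ?_) (h1.mul h2)
  rw [chart_symm_chartOne, mul_one]
  exact mem_extChartAt_source 1

/-- In the chart at `1`, whose derivative there is the identity of the model space. -/
theorem rightDer_eq_fderiv {S : E' → G} {y : E'} (hS : MDifferentiableAt 𝓘(ℝ, E') 𝓘(ℝ, EG) S y) :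
    rightDer 𝓘(ℝ, E') (EG := EG) S y =
      fderiv ℝ (fun y' => extChartAt 𝓘(ℝ, EG) (1 : G) (S y' * (S y)⁻¹)) y := by
  have h := tder_comp (I := 𝓘(ℝ, E')) (I' := 𝓘(ℝ, EG)) (I'' := 𝓘(ℝ, EG))
    (g := extChartAt 𝓘(ℝ, EG) (1 : G)) (f := fun y' => S y' * (S y)⁻¹) (x := y)
    (((contMDiffAt_chart (by simp)).mdifferentiableAt (by simp)))
    (((contMDiff_mul_const _).mdifferentiable (by simp) _).comp y hS)
  rw [tder_eq_fderiv] at h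
  rw [h, mul_inv_cancel, tder_chart_self, ContinuousLinearMap.id_comp]; rfl

/-- The right logarithmic derivative of a smooth map is smooth. -/
theorem contDiffAt_rightDer {S : E' → G} {y : E'} (hS : ContMDiffAt 𝓘(ℝ, E') 𝓘(ℝ, EG) ∞ S y) :
    ContDiffAt ℝ ∞ (rightDer 𝓘(ℝ, E') (EG := EG) S) y := by
  have hev : ∀ᶠ z in 𝓝 y, ContMDiffAt 𝓘(ℝ, E') 𝓘(ℝ, EG) 1 S z :=
    (contMDiffAt_iff_contMDiffAt_nhds (by simp)).1 (hS.of_le (m := 1) (by simp))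
  have h : (rightDer 𝓘(ℝ, E') (EG := EG) S) =ᶠ[𝓝 y] fun z =>
      fderiv ℝ (fun y' => extChartAt 𝓘(ℝ, EG) (1 : G) (S y' * (S z)⁻¹)) z := by
    filter_upwards [hev] with z hz
    exact rightDer_eq_fderiv (hz.mdifferentiableAt (by simp))
  refine ContDiffAt.congr_of_eventuallyEq ?_ h
  refine ContDiffAt.fderiv (n := ∞) (f := fun z y' => extChartAt 𝓘(ℝ, EG) (1 : G) (S y' * (S z)⁻¹))
    (g := fun z => z) ?_ contDiffAt_id (by simp)
  rw [← contMDiffAt_iff_contDiffAt]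
  have h1 : ContMDiffAt 𝓘(ℝ, E' × E') 𝓘(ℝ, EG) ∞ (fun p : E' × E' => S p.1) (y, y) :=
    ContMDiffAt.comp (g := S) (f := Prod.fst) (I' := 𝓘(ℝ, E')) (y, y) hS
      contDiff_fst.contMDiff.contMDiffAt
  have h2 : ContMDiffAt 𝓘(ℝ, E' × E') 𝓘(ℝ, EG) ∞ (fun p : E' × E' => S p.2) (y, y) :=
    ContMDiffAt.comp (g := S) (f := Prod.snd) (I' := 𝓘(ℝ, E')) (y, y) hS
      contDiff_snd.contMDiff.contMDiffAt
  exact ContMDiffAt.comp (g := extChartAt 𝓘(ℝ, EG) (1 : G)) (I' := 𝓘(ℝ, EG)) (y, y)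
    (contMDiffAt_chart (by simp)) (h2.mul h1.inv)

end RightDerivative

/-! ### The Lie bracket in a chart and the structure equation -/

section StructureEquation

variable {EG : Type*} [NormedAddCommGroup EG] [NormedSpace ℝ EG] [FiniteDimensional ℝ EG]
  {G : Type*} [TopologicalSpace G] [ChartedSpace EG G] [Group G] [LieGroup 𝓘(ℝ, EG) ∞ G]

variable (EG G) in
/-- The second derivative at the identity of the multiplication in the chart at the identity. -/
def chartMulHess : (EG × EG) →L[ℝ] (EG × EG) →L[ℝ] EG :=
  fderiv ℝ (fderiv ℝ (chartMul EG G)) (chartOne EG G, chartOne EG G)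

variable (G) in
/-- The map `a ↦ [a, b]` on the model space of the Lie algebra. -/
def adRight (b : EG) : EG →L[ℝ] EG := bracketRight (EG := EG) (G := G) b

theorem two_le_infty : (2 : WithTop ℕ∞) ≤ ∞ :=
  WithTop.coe_le_coe.2 (le_top : (2 : ℕ∞) ≤ ⊤)

theorem one_add_one_le_infty : (1 + 1 : WithTop ℕ∞) ≤ ∞ := by
  rw [one_add_one_eq_two]; exact two_le_infty

theorem chart_one_mul_chart_symm :
    ∀ᶠ z in 𝓝 (chartOne EG G), chartMul EG G (chartOne EG G, z) = z := by
  filter_upwards [(isOpen_extChartAt_target (I := 𝓘(ℝ, EG)) (1 : G)).mem_nhds chartOne_mem] with z hz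
  rw [chartMul]
  show extChartAt 𝓘(ℝ, EG) (1 : G) ((extChartAt 𝓘(ℝ, EG) (1 : G)).symm (chartOne EG G) * _) = z
  rw [chart_symm_chartOne, one_mul]
  exact (extChartAt 𝓘(ℝ, EG) (1 : G)).right_inv hz

theorem chart_symm_mul_chart_one :
    ∀ᶠ z in 𝓝 (chartOne EG G), chartMul EG G (z, chartOne EG G) = z := by
  filter_upwards [(isOpen_extChartAt_target (I := 𝓘(ℝ, EG)) (1 : G)).mem_nhds chartOne_mem] with z hz
  rw [chartMul]
  show extChartAt 𝓘(ℝ, EG) (1 : G) (_ * (extChartAt 𝓘(ℝ, EG) (1 : G)).symm (chartOne EG G)) = z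
  rw [chart_symm_chartOne, mul_one]
  exact (extChartAt 𝓘(ℝ, EG) (1 : G)).right_inv hz

theorem hasFDerivAt_chartMul :
    HasFDerivAt (chartMul EG G) (fderiv ℝ (chartMul EG G) (chartOne EG G, chartOne EG G))
      (chartOne EG G, chartOne EG G) :=
  ((contDiffAt_chartMul (EG := EG) (G := G)).differentiableAt (by simp)).hasFDerivAt

theorem fderiv_chartMul_left (a : EG) :
    fderiv ℝ (chartMul EG G) (chartOne EG G, chartOne EG G) (a, 0) = a := by
  have h1 := HasFDerivAt.comp (chartOne EG G) (f := fun e => (e, chartOne EG G))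
    (hasFDerivAt_chartMul (EG := EG) (G := G))
      (hasFDerivAt_prodMk_left (𝕜 := ℝ) (chartOne EG G) (chartOne EG G))
  have h2 := (hasFDerivAt_id (𝕜 := ℝ) (chartOne EG G)).congr_of_eventuallyEq
    (chart_symm_mul_chart_one (EG := EG) (G := G))
  have := congrArg (fun f : EG →L[ℝ] EG => f a) (h1.unique h2)
  simpa using this

theorem fderiv_chartMul_right (a : EG) :
    fderiv ℝ (chartMul EG G) (chartOne EG G, chartOne EG G) (0, a) = a := by
  have h1 := (hasFDerivAt_chartMul (EG := EG) (G := G)).comp (chartOne EG G)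
    (hasFDerivAt_prodMk_right (𝕜 := ℝ) (chartOne EG G) (chartOne EG G))
  have h2 := (hasFDerivAt_id (𝕜 := ℝ) (chartOne EG G)).congr_of_eventuallyEq
    (chart_one_mul_chart_symm (EG := EG) (G := G))
  have := congrArg (fun f : EG →L[ℝ] EG => f a) (h1.unique h2)
  simpa using this

theorem eventually_differentiableAt_chartMul :
    ∀ᶠ p in 𝓝 (chartOne EG G, chartOne EG G), DifferentiableAt ℝ (chartMul EG G) p := by
  have := (contDiffAt_chartMul (EG := EG) (G := G)).of_le (m := 1) (by simp)
  filter_upwards [this.eventually (by simp)] with p hp using hp.differentiableAt (by simp)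

theorem hasFDerivAt_fderiv_chartMul :
    HasFDerivAt (fderiv ℝ (chartMul EG G)) (chartMulHess EG G) (chartOne EG G, chartOne EG G) :=
  (((contDiffAt_chartMul (EG := EG) (G := G)).fderiv_right (m := 1)
    one_add_one_le_infty).differentiableAt (by simp)).hasFDerivAt

theorem chartMulHess_symm (p q : EG × EG) : chartMulHess EG G p q = chartMulHess EG G q p :=
  ((contDiffAt_chartMul (EG := EG) (G := G)).isSymmSndFDerivAt (by simpa using two_le_infty)) p q

variable (G) in
/-- The left invariant vector field of `w`, read in the chart at the identity. -/
def leftField (w : EG) (z : EG) : EG :=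
  VectorField.mpullbackWithin 𝓘(ℝ, EG) 𝓘(ℝ, EG) (extChartAt 𝓘(ℝ, EG) (1 : G)).symm
    (mulInvariantVectorField (I := 𝓘(ℝ, EG)) (G := G) w) Set.univ z

/-- In the chart at `1`, the left invariant field of `w` at `z` is the derivative of the
multiplication at `(z, 1)` in the second argument, since `φ⁻¹(z) · φ⁻¹(y) = φ⁻¹(chartMul (z, y))`.
-/
theorem leftField_eventuallyEq (w : EG) :
    leftField G w =ᶠ[𝓝 (chartOne EG G)]
      fun z => fderiv ℝ (chartMul EG G) (z, chartOne EG G) (0, w) := by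
  have hc : Filter.Tendsto (fun z : EG => (z, chartOne EG G)) (𝓝 (chartOne EG G))
      (𝓝 (chartOne EG G, chartOne EG G)) :=
    (Continuous.prodMk_left (chartOne EG G)).tendsto _
  filter_upwards [(isOpen_extChartAt_target (I := 𝓘(ℝ, EG)) (1 : G)).mem_nhds chartOne_mem,
    hc.eventually eventually_differentiableAt_chartMul] with z hz hd
  set φ := extChartAt 𝓘(ℝ, EG) (1 : G) with hφ
  rw [leftField, VectorField.mpullbackWithin_apply, mfderivWithin_univ]
  have hinv : (tder 𝓘(ℝ, EG) 𝓘(ℝ, EG) φ.symm z).inverse = tder 𝓘(ℝ, EG) 𝓘(ℝ, EG) φ (φ.symm z) :=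
    ContinuousLinearMap.inverse_eq (tder_symm_comp_tder_chart hz) (tder_chart_comp_tder_symm hz)
  have hmul : MDifferentiableAt 𝓘(ℝ, EG) 𝓘(ℝ, EG) (fun h : G => φ.symm z * h) 1 :=
    (contMDiff_const.mul contMDiff_id : ContMDiff 𝓘(ℝ, EG) 𝓘(ℝ, EG) ∞ _).mdifferentiable (by simp) _
  have hsym : MDifferentiableAt 𝓘(ℝ, EG) 𝓘(ℝ, EG) φ.symm (chartOne EG G) :=
    (contMDiffAt_chart_symm chartOne_mem).mdifferentiableAt (by simp)
  have hφd : MDifferentiableAt 𝓘(ℝ, EG) 𝓘(ℝ, EG) φ (φ.symm z * 1) := by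
    rw [mul_one]
    exact (contMDiffAt_chart (φ.map_target hz)).mdifferentiableAt (by simp)
  show (tder 𝓘(ℝ, EG) 𝓘(ℝ, EG) φ.symm z).inverse
    (tder 𝓘(ℝ, EG) 𝓘(ℝ, EG) (fun h : G => φ.symm z * h) 1 w) = _
  have e1 := tder_comp (I := 𝓘(ℝ, EG)) (I' := 𝓘(ℝ, EG)) (I'' := 𝓘(ℝ, EG)) hφd hmul
  have hs1 : φ.symm (chartOne EG G) = 1 := chart_symm_chartOne
  have e2 := tder_comp (I := 𝓘(ℝ, EG)) (I' := 𝓘(ℝ, EG)) (I'' := 𝓘(ℝ, EG))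
    (g := fun h : G => φ (φ.symm z * h)) (f := φ.symm) (x := chartOne EG G)
    (by rw [hs1]; exact hφd.comp 1 hmul) hsym
  have hself : tder 𝓘(ℝ, EG) 𝓘(ℝ, EG) φ.symm (chartOne EG G) = ContinuousLinearMap.id ℝ EG :=
    tder_chart_symm_self (1 : G)
  rw [hs1, hself, ContinuousLinearMap.comp_id, e1, mul_one, tder_eq_fderiv] at e2
  rw [hinv, ← ContinuousLinearMap.comp_apply, ← e2]
  have h1 := hd.hasFDerivAt.comp (chartOne EG G)
    (hasFDerivAt_prodMk_right (𝕜 := ℝ) z (chartOne EG G))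
  have h2 : fderiv ℝ (fun y => φ (φ.symm z * φ.symm y)) (chartOne EG G) = _ := h1.fderiv
  rw [h2]
  simp

open VectorField in
/-- The Lie bracket of left invariant vector fields is the antisymmetrised mixed second derivative
at the identity of the multiplication in the chart. -/
theorem adRight_apply (a b : EG) :
    adRight G b a = chartMulHess EG G (a, 0) (0, b) - chartMulHess EG G (b, 0) (0, a) := by
  have key : ∀ w : EG, ∀ a : EG, fderivWithin ℝ (leftField G w) Set.univ (chartOne EG G) a
      = chartMulHess EG G (a, 0) (0, w) := by
    intro w a
    rw [fderivWithin_univ, (leftField_eventuallyEq (G := G) w).fderiv_eq]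
    have h1 := HasFDerivAt.comp (chartOne EG G) (f := fun e => (e, chartOne EG G))
      (hasFDerivAt_fderiv_chartMul (EG := EG) (G := G))
      (hasFDerivAt_prodMk_left (𝕜 := ℝ) (chartOne EG G) (chartOne EG G))
    have h2 := h1.clm_apply (hasFDerivAt_const ((0 : EG), w) (chartOne EG G))
    have h3 := h2.fderiv
    simp only [Function.comp_def] at h3
    rw [h3]
    simp
  have key2 : ∀ w : EG, leftField G w (chartOne EG G) = w := by
    intro w
    rw [(leftField_eventuallyEq (G := G) w).eq_of_nhds]
    exact fderiv_chartMul_right w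
  have h : adRight G b a = (tder 𝓘(ℝ, EG) 𝓘(ℝ, EG) (extChartAt 𝓘(ℝ, EG) (1 : G)) 1).inverse
      (lieBracketWithin ℝ
      (mpullbackWithin 𝓘(ℝ, EG) 𝓘(ℝ, EG) (extChartAt 𝓘(ℝ, EG) (1 : G)).symm
        (mulInvariantVectorField (I := 𝓘(ℝ, EG)) (G := G) a) (Set.range 𝓘(ℝ, EG)))
      (mpullbackWithin 𝓘(ℝ, EG) 𝓘(ℝ, EG) (extChartAt 𝓘(ℝ, EG) (1 : G)).symm
        (mulInvariantVectorField (I := 𝓘(ℝ, EG)) (G := G) b) (Set.range 𝓘(ℝ, EG)))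
      ((extChartAt 𝓘(ℝ, EG) (1 : G)).symm ⁻¹' Set.univ ∩ Set.range 𝓘(ℝ, EG)) (chartOne EG G)) :=
    rfl
  rw [h, tder_chart_self, ContinuousLinearMap.inverse_id, ContinuousLinearMap.id_apply]
  have hr : Set.range 𝓘(ℝ, EG) = Set.univ := by simp
  rw [hr, Set.preimage_univ, Set.inter_univ]
  refine Eq.trans (b := _ - _) rfl ?_
  exact congrArg₂ (· - ·) ((congrArg _ (key2 a)).trans (key b a))
    ((congrArg _ (key2 b)).trans (key a b))

variable {E' : Type*} [NormedAddCommGroup E'] [NormedSpace ℝ E']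

/-- The structure equation: the exterior derivative of the right logarithmic derivative `κ` of a
smooth group valued map is `[κ, κ]`. -/
theorem fderiv_rightDer_sub {S : E' → G} {y : E'} (hS : ContMDiffAt 𝓘(ℝ, E') 𝓘(ℝ, EG) ∞ S y)
    (u v : E') :
    fderiv ℝ (rightDer 𝓘(ℝ, E') (EG := EG) S) y u v - fderiv ℝ (rightDer 𝓘(ℝ, E') S) y v u
      = adRight G (rightDer 𝓘(ℝ, E') S y v) (rightDer 𝓘(ℝ, E') (EG := EG) S y u) := by
  -- the right logarithmic derivative does not change if `S` is multiplied by a constant,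
  -- so the value at `y` may be assumed to be the identity
  wlog h1 : S y = 1 generalizing S
  · have hS' : ContMDiffAt 𝓘(ℝ, E') 𝓘(ℝ, EG) ∞ (fun z => S z * (S y)⁻¹) y :=
      hS.mul contMDiffAt_const
    have e : rightDer 𝓘(ℝ, E') (EG := EG) (fun z => S z * (S y)⁻¹) = rightDer 𝓘(ℝ, E') S :=
      funext fun z => rightDer_mul_const S _ z
    simpa only [e] using this hS' (by simp)
  set φ := extChartAt 𝓘(ℝ, EG) (1 : G) with hφ
  set κ := rightDer 𝓘(ℝ, E') (EG := EG) S with hκ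
  set f : E' → EG := fun z => φ (S z) with hf
  have hfy : f y = chartOne EG G := by simp [hf, h1, chartOne, hφ]
  have hfs : ContDiffAt ℝ ∞ f y := by
    rw [← contMDiffAt_iff_contDiffAt]
    exact ContMDiffAt.comp (g := φ) (I' := 𝓘(ℝ, EG)) y
      (contMDiffAt_chart (by simp [h1])) hS
  have hκs : ContDiffAt ℝ ∞ κ y := contDiffAt_rightDer hS
  -- `Df = C(f) κ`, with `C(z)` the derivative at the identity of right multiplication by `z`
  have hC : ∀ᶠ z in 𝓝 y, ∀ v, fderiv ℝ f z v =
      fderiv ℝ (chartMul EG G) (chartOne EG G, f z) (κ z v, 0) := by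
    have hev : ∀ᶠ z in 𝓝 y, ContMDiffAt 𝓘(ℝ, E') 𝓘(ℝ, EG) 1 S z :=
      (contMDiffAt_iff_contMDiffAt_nhds (by simp)).1 (hS.of_le (m := 1) (by simp))
    have hsrc : ∀ᶠ z in 𝓝 y, S z ∈ φ.source :=
      hS.continuousAt.eventually_mem ((isOpen_extChartAt_source (I := 𝓘(ℝ, EG)) (1 : G)).mem_nhds
        (by simp [h1]))
    have hP : ∀ᶠ z in 𝓝 y, DifferentiableAt ℝ (chartMul EG G) (chartOne EG G, f z) := by
      have : Filter.Tendsto (fun z => (chartOne EG G, f z)) (𝓝 y)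
          (𝓝 (chartOne EG G, chartOne EG G)) := by
        have := (continuousAt_const (y := chartOne EG G)).prodMk hfs.continuousAt
        rwa [ContinuousAt, hfy] at this
      exact this.eventually eventually_differentiableAt_chartMul
    filter_upwards [hev, hsrc, hP] with z hz hzs hzP v
    have hzd := hz.mdifferentiableAt (by simp)
    have e0 : f =ᶠ[𝓝 z] fun z' => chartMul EG G (φ (S z' * (S z)⁻¹), f z) := by
      have : ∀ᶠ z' in 𝓝 z, S z' * (S z)⁻¹ ∈ φ.source :=
        (((contMDiff_mul_const (EG := EG) (S z)⁻¹).continuous.continuousAt).comp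
          hz.continuousAt).eventually_mem
          ((isOpen_extChartAt_source (I := 𝓘(ℝ, EG)) (1 : G)).mem_nhds (by simp))
      filter_upwards [this] with z' hz'
      simp only [chartMul, hf, ← hφ]
      rw [φ.left_inv hz', φ.left_inv hzs, inv_mul_cancel_right]
    have hd : HasFDerivAt (fun z' => φ (S z' * (S z)⁻¹)) (κ z) z := by
      rw [hκ, rightDer_eq_fderiv hzd]
      refine DifferentiableAt.hasFDerivAt ?_
      rw [← mdifferentiableAt_iff_differentiableAt]
      exact MDifferentiableAt.comp (g := φ) (I' := 𝓘(ℝ, EG)) z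
        ((contMDiffAt_chart (by simp)).mdifferentiableAt (by simp))
        (((contMDiff_mul_const _).mdifferentiable (by simp) _).comp z hzd)
    have hval : φ (S z * (S z)⁻¹) = chartOne EG G := by rw [mul_inv_cancel]; rfl
    have h2 := HasFDerivAt.comp z (f := fun z' => (φ (S z' * (S z)⁻¹), f z)) (g := chartMul EG G)
      (by rw [hval]; exact hzP.hasFDerivAt) (hd.prodMk (hasFDerivAt_const (f z) z))
    rw [e0.fderiv_eq]
    have h3 := h2.fderiv
    simp only [Function.comp_def] at h3
    rw [h3]
    simp
  have hCy : ∀ v, fderiv ℝ f y v = κ y v := fun v => by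
    rw [hC.self_of_nhds v, hfy, fderiv_chartMul_left]
  have hsymm : ∀ u v, fderiv ℝ (fderiv ℝ f) y u v = fderiv ℝ (fderiv ℝ f) y v u :=
    hfs.isSymmSndFDerivAt (by simpa using two_le_infty)
  have hd2 : ∀ u v, fderiv ℝ (fderiv ℝ f) y u v =
      chartMulHess EG G (κ y v, 0) (0, κ y u) + fderiv ℝ κ y u v := by
    intro u v
    have e1 : (fun z => fderiv ℝ f z v) =ᶠ[𝓝 y] fun z =>
      fderiv ℝ (chartMul EG G) (chartOne EG G, f z) (κ z v, 0) := hC.mono fun z hz => hz v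
    have hff : HasFDerivAt (fderiv ℝ f) (fderiv ℝ (fderiv ℝ f) y) y :=
      ((hfs.fderiv_right (m := 1) one_add_one_le_infty).differentiableAt (by simp)).hasFDerivAt
    have d1 := (hff.clm_apply (hasFDerivAt_const v y)).fderiv
    have hκd : HasFDerivAt κ (fderiv ℝ κ y) y := (hκs.differentiableAt (by simp)).hasFDerivAt
    have hfd : HasFDerivAt f (fderiv ℝ f y) y := (hfs.differentiableAt (by simp)).hasFDerivAt
    have d2 := HasFDerivAt.comp y (f := fun z => (chartOne EG G, f z))
      (g := fderiv ℝ (chartMul EG G))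
      (by rw [hfy]; exact hasFDerivAt_fderiv_chartMul)
      ((hasFDerivAt_const (chartOne EG G) y).prodMk hfd)
    have d3 := (d2.clm_apply
      ((hκd.clm_apply (hasFDerivAt_const v y)).prodMk (hasFDerivAt_const (0 : EG) y))).fderiv
    simp only [Function.comp_def] at d3
    have d4 := congrArg (fun A : E' →L[ℝ] EG => A u) (d1.symm.trans (e1.fderiv_eq.trans d3))
    simp only [hfy] at d4
    simp [hCy, fderiv_chartMul_left] at d4
    rw [d4, chartMulHess_symm, add_comm]
  have h3 := hsymm u v
  rw [hd2, hd2] at h3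
  rw [adRight_apply, sub_eq_sub_iff_add_eq_add, add_comm, h3, add_comm]

end StructureEquation

/-! ### The measure of a volume form -/

section VolumeMeasure

variable {E : Type*} [NormedAddCommGroup E] [NormedSpace ℝ E] [FiniteDimensional ℝ E]
  {H : Type*} [TopologicalSpace H] {I : ModelWithCorners ℝ E H} [I.Boundaryless]
  {N : Type*} [TopologicalSpace N] [ChartedSpace H N] [IsManifold I ∞ N]
  {d : ℕ} {b : Module.Basis (Fin d) ℝ E}
  {Ω : ∀ x : N, TangentSpace I x [⋀^Fin d]→ₗ[ℝ] ℝ}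

theorem alternating_comp_linearMap_basis (α : E [⋀^Fin d]→ₗ[ℝ] ℝ) (A : E →L[ℝ] E) :
    α (fun i => A (b i)) = A.det * α b := by
  have h := AlternatingMap.eq_smul_basis_det b α
  rw [h]
  simp only [AlternatingMap.smul_apply, Module.Basis.det_self, smul_eq_mul, mul_one]
  have := b.det_comp (A : E →ₗ[ℝ] E) b
  simp only [Module.Basis.det_self, mul_one] at this
  rw [mul_comm]
  congr 1

theorem volCoeff_eq (c : N) (y : E) : volCoeff I b Ω c y =
    (show N → (E [⋀^Fin d]→ₗ[ℝ] ℝ) from Ω) ((extChartAt I c).symm y)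
      (fun i => tder 𝓘(ℝ, E) I (extChartAt I c).symm y (b i)) := rfl

theorem volCoeff_ne_zero (hΩ : IsVolumeForm I b Ω) {c : N} {y : E}
    (hy : y ∈ (extChartAt I c).target) : volCoeff I b Ω c y ≠ 0 := by
  intro h
  set α : E [⋀^Fin d]→ₗ[ℝ] ℝ := (show N → (E [⋀^Fin d]→ₗ[ℝ] ℝ) from Ω)
    ((extChartAt I c).symm y) with hα
  refine hΩ.ne_zero ((extChartAt I c).symm y) (show α = 0 from ?_)
  set T := tder 𝓘(ℝ, E) I (extChartAt I c).symm y
  have h1 : α.compLinearMap (T : E →ₗ[ℝ] E) = 0 := by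
    rw [AlternatingMap.eq_smul_basis_det b (α.compLinearMap (T : E →ₗ[ℝ] E))]
    have : (α.compLinearMap (T : E →ₗ[ℝ] E)) b = 0 := h
    rw [this, zero_smul]
  ext v
  have h2 := tder_symm_comp_tder_chart (I := I) hy
  have h3 := congrArg (fun f : E [⋀^Fin d]→ₗ[ℝ] ℝ => f fun i =>
    tder I 𝓘(ℝ, E) (extChartAt I c) ((extChartAt I c).symm y) (v i)) h1
  have h4 : ∀ e, T (tder I 𝓘(ℝ, E) (extChartAt I c) ((extChartAt I c).symm y) e) = e :=
    fun e => congrArg (fun f : E →L[ℝ] E => f e) h2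
  simpa only [AlternatingMap.compLinearMap_apply, ContinuousLinearMap.coe_coe, h4,
    AlternatingMap.zero_apply] using h3

theorem hasFDerivAt_chart_change {c c' : N} {y : E} (hy : y ∈ (extChartAt I c).target)
    (hy' : (extChartAt I c).symm y ∈ (extChartAt I c').source) :
    HasFDerivAt (fun z => extChartAt I c' ((extChartAt I c).symm z))
      ((tder I 𝓘(ℝ, E) (extChartAt I c') ((extChartAt I c).symm y)).comp
        (tder 𝓘(ℝ, E) I (extChartAt I c).symm y)) y := by
  have h1 := (contMDiffAt_chart_symm (I := I) hy).mdifferentiableAt (by simp)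
  have h2 := (contMDiffAt_chart (I := I) hy').mdifferentiableAt (by simp)
  rw [← tder_comp h2 h1, tder_eq_fderiv]
  exact (mdifferentiableAt_iff_differentiableAt.1 (h2.comp y h1)).hasFDerivAt

/-- Coordinate coefficients of a volume form change by the determinant of the chart transition. -/
theorem volCoeff_change {c c' : N} {y : E}
    (hy' : (extChartAt I c).symm y ∈ (extChartAt I c').source) :
    volCoeff I b Ω c y = ((tder I 𝓘(ℝ, E) (extChartAt I c') ((extChartAt I c).symm y)).comp
        (tder 𝓘(ℝ, E) I (extChartAt I c).symm y)).det *
      volCoeff I b Ω c' (extChartAt I c' ((extChartAt I c).symm y)) := by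
  have h := tder_symm_comp_tder_chart (I := I) ((extChartAt I c').map_source hy')
  rw [(extChartAt I c').left_inv hy'] at h
  rw [volCoeff_eq, volCoeff_eq, (extChartAt I c').left_inv hy']
  set α : E [⋀^Fin d]→ₗ[ℝ] ℝ := (show N → (E [⋀^Fin d]→ₗ[ℝ] ℝ) from Ω) ((extChartAt I c).symm y)
  set T' := tder 𝓘(ℝ, E) I (extChartAt I c').symm (extChartAt I c' ((extChartAt I c).symm y))
  set A := (tder I 𝓘(ℝ, E) (extChartAt I c') ((extChartAt I c).symm y)).comp
        (tder 𝓘(ℝ, E) I (extChartAt I c).symm y)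
  have h2 := alternating_comp_linearMap_basis (b := b) (α.compLinearMap (T' : E →ₗ[ℝ] E)) A
  refine Eq.trans (congrArg α ?_) h2
  funext i
  exact (congrArg (fun f : E →L[ℝ] E => f (tder 𝓘(ℝ, E) I (extChartAt I c).symm y (b i))) h).symm

theorem continuousOn_volCoeff (hΩ : IsVolumeForm I b Ω) (c : N) :
    ContinuousOn (volCoeff I b Ω c) (extChartAt I c).target := (hΩ.smooth c).continuousOn

variable (I) in
/-- The part of a set that lies in a chart domain, in the coordinates of the chart. -/
def chartSet (c : N) (A : Set N) : Set E := (extChartAt I c).target ∩ (extChartAt I c).symm ⁻¹' A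

theorem isOpen_chartSet (c : N) {A : Set N} (hA : IsOpen A) : IsOpen (chartSet I c A) :=
  (continuousOn_extChartAt_symm c).isOpen_inter_preimage (isOpen_extChartAt_target c) hA

theorem image_chartSet {c c' : N} {A : Set N} (hA : A ⊆ (extChartAt I c).source)
    (hA' : A ⊆ (extChartAt I c').source) :
    (fun z => extChartAt I c' ((extChartAt I c).symm z)) '' chartSet I c A = chartSet I c' A := by
  ext z
  constructor
  · rintro ⟨y, ⟨hy, hyA⟩, rfl⟩
    refine ⟨(extChartAt I c').map_source (hA' hyA), ?_⟩
    rwa [Set.mem_preimage, (extChartAt I c').left_inv (hA' hyA)]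
  · rintro ⟨hz, hzA⟩
    refine ⟨extChartAt I c ((extChartAt I c').symm z), ⟨(extChartAt I c).map_source (hA hzA), ?_⟩, ?_⟩
    · rwa [Set.mem_preimage, (extChartAt I c).left_inv (hA hzA)]
    · simp only [(extChartAt I c).left_inv (hA hzA)]
      exact (extChartAt I c').right_inv hz

variable [MeasurableSpace E] [BorelSpace E]
  [SecondCountableTopology N] [MeasurableSpace N] [BorelSpace N]

theorem measurableSet_chartSet (c : N) {A : Set N} (hA : MeasurableSet A) :
    MeasurableSet (chartSet I c A) := by
  have h := (continuousOn_iff_continuous_domRestrict.1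
    (continuousOn_extChartAt_symm (I := I) c)).measurable hA
  have h2 := (isOpen_extChartAt_target (I := I) c).measurableSet.subtype_image h
  convert h2 using 1
  ext y
  exact ⟨fun h => ⟨⟨y, h.1⟩, h.2, rfl⟩, fun ⟨z, hz, e⟩ => e ▸ ⟨z.2, hz⟩⟩

variable (I b Ω) in
/-- The measure of a volume form in the domain of the chart at `c`. -/
def chartMeasure (c : N) : Measure N :=
  ((b.addHaar.withDensity fun y => ENNReal.ofReal |volCoeff I b Ω c y|).restrict
    (extChartAt I c).target).map (extChartAt I c).symm

theorem chartMeasure_apply (c : N) {A : Set N} (hA : MeasurableSet A) :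
    chartMeasure I b Ω c A =
      ∫⁻ y in chartSet I c A, ENNReal.ofReal |volCoeff I b Ω c y| ∂b.addHaar := by
  have hT := (isOpen_extChartAt_target (I := I) c).measurableSet
  rw [chartMeasure, Measure.map_apply_of_aemeasurable
    ((continuousOn_extChartAt_symm c).aemeasurable hT) hA, Measure.restrict_apply' hT,
    Set.inter_comm]
  exact withDensity_apply _ (measurableSet_chartSet c hA)

/-- The local measures of two charts agree on the common domain, by the change of variables formula.
-/
theorem chartMeasure_eq_of_subset {c c' : N} {A : Set N} (hA : MeasurableSet A)
    (h : A ⊆ (extChartAt I c).source) (h' : A ⊆ (extChartAt I c').source) :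
    chartMeasure I b Ω c A = chartMeasure I b Ω c' A := by
  rw [chartMeasure_apply c hA, chartMeasure_apply c' hA, ← image_chartSet h h',
    lintegral_image_eq_lintegral_abs_det_fderiv_mul b.addHaar (measurableSet_chartSet c hA)
      (fun y hy => (hasFDerivAt_chart_change hy.1 (h' hy.2)).hasFDerivWithinAt)]
  · refine setLIntegral_congr_fun (measurableSet_chartSet c hA) fun y hy => ?_
    rw [volCoeff_change (h' hy.2), abs_mul, ENNReal.ofReal_mul (abs_nonneg _)]
  · intro y hy z hz hyz
    have := (extChartAt I c').injOn (h' hy.2) (h' hz.2) hyz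
    exact (extChartAt I c).symm.injOn (by simpa using hy.1) (by simpa using hz.1) this

/-- On a chart domain, the measure of a volume form is given by the chart. The family of local
measures is bounded by the measure that is the local one on the chart domain and `∞` elsewhere. -/
theorem volMeasure_apply_of_subset {c : N} {A : Set N} (hA : MeasurableSet A)
    (h : A ⊆ (extChartAt I c).source) :
    volMeasure I b Ω A = chartMeasure I b Ω c A := by
  refine le_antisymm ?_ (le_iSup (chartMeasure I b Ω) c A)
  have hS := (isOpen_extChartAt_source (I := I) c).measurableSet
  -- a supremum of measures is bounded by any common bound
  have key : volMeasure I b Ω ≤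
      chartMeasure I b Ω c + (⊤ : Measure N).restrict (extChartAt I c).sourceᶜ := by
    refine iSup_le fun c' => Measure.le_iff.2 fun B hB => ?_
    show chartMeasure I b Ω c' B ≤ _
    have hT : chartMeasure I b Ω c' (extChartAt I c').sourceᶜ = 0 := by
      rw [chartMeasure_apply _ (isOpen_extChartAt_source (I := I) c').measurableSet.compl]
      have : chartSet I c' (extChartAt I c').sourceᶜ = ∅ := by
        ext y
        simp only [chartSet, Set.mem_inter_iff, Set.mem_preimage, Set.mem_compl_iff,
          Set.mem_empty_iff_false, iff_false, not_and, not_not]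
        exact fun hy => (extChartAt I c').map_target hy
      rw [this]; simp
    set S' := (extChartAt I c').source
    have hS' : MeasurableSet S' := (isOpen_extChartAt_source (I := I) c').measurableSet
    calc chartMeasure I b Ω c' B
        ≤ chartMeasure I b Ω c' (B ∩ (extChartAt I c).source ∩ S')
          + chartMeasure I b Ω c' (B \ (extChartAt I c).source) + chartMeasure I b Ω c' S'ᶜ := by
          refine (measure_mono ?_).trans ((measure_union_le _ _).trans
            (add_le_add_left (measure_union_le _ _) _))
          intro x hx
          by_cases h1 : x ∈ (extChartAt I c).source
          · by_cases h2 : x ∈ S'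
            · exact Or.inl (Or.inl ⟨⟨hx, h1⟩, h2⟩)
            · exact Or.inr h2
          · exact Or.inl (Or.inr ⟨hx, h1⟩)
      _ ≤ chartMeasure I b Ω c B +
          (⊤ : Measure N).restrict (extChartAt I c).sourceᶜ B := by
          rw [hT, add_zero, Measure.restrict_apply hB]
          refine add_le_add ?_ ?_
          · rw [← chartMeasure_eq_of_subset ((hB.inter hS).inter hS')
              (fun x hx => hx.1.2) (fun x hx => hx.2)]
            exact measure_mono fun x hx => hx.1.1
          · exact (le_top : chartMeasure I b Ω c' ≤ ⊤) _
  refine (key A).trans ?_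
  rw [Measure.add_apply, Measure.restrict_apply hA]
  have : A ∩ (extChartAt I c).sourceᶜ = ∅ := by
    ext x; simp only [Set.mem_inter_iff, Set.mem_compl_iff, Set.mem_empty_iff_false, iff_false]
    exact fun hx => hx.2 (h hx.1)
  rw [this, measure_empty, add_zero]

theorem isLocallyFiniteMeasure_volMeasure (hΩ : IsVolumeForm I b Ω) :
    IsLocallyFiniteMeasure (volMeasure I b Ω) := by
  refine ⟨fun x => ?_⟩
  set φ := extChartAt I x with hφ
  obtain ⟨K, hK, hKc⟩ := exists_compact_subset (isOpen_extChartAt_target (I := I) x)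
    (mem_extChartAt_target (I := I) x)
  set A : Set N := φ.source ∩ φ ⁻¹' interior K
  have hA : IsOpen A := (continuousOn_extChartAt x).isOpen_inter_preimage
    (isOpen_extChartAt_source x) isOpen_interior
  refine ⟨A, hA.mem_nhds ⟨mem_extChartAt_source x, hKc.1⟩, ?_⟩
  rw [volMeasure_apply_of_subset hA.measurableSet (c := x) fun z hz => hz.1,
    chartMeasure_apply x hA.measurableSet]
  have hsub : chartSet I x A ⊆ K := by
    rintro y ⟨hy, hyA⟩
    have := interior_subset hyA.2
    rwa [φ.right_inv hy] at this
  refine (lintegral_mono_set hsub).trans_lt ?_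
  have hint : IntegrableOn (fun y => |volCoeff I b Ω x y|) K b.addHaar :=
    ((continuousOn_volCoeff hΩ x).mono hKc.2).abs.integrableOn_compact hK
  have := hint.lintegral_lt_top
  exact this

theorem isOpenPosMeasure_volMeasure (hΩ : IsVolumeForm I b Ω) :
    (volMeasure I b Ω).IsOpenPosMeasure := by
  refine ⟨fun U hU ⟨x, hx⟩ h0 => ?_⟩
  set φ := extChartAt I x with hφ
  set A : Set N := φ.source ∩ U
  have hA : IsOpen A := (isOpen_extChartAt_source x).inter hU
  have h1 : volMeasure I b Ω A = 0 := measure_mono_null Set.inter_subset_right h0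
  rw [volMeasure_apply_of_subset hA.measurableSet (c := x) fun z hz => hz.1,
    chartMeasure_apply x hA.measurableSet] at h1
  have hO := isOpen_chartSet (I := I) x hA
  have hmem : φ x ∈ chartSet I x A := ⟨mem_extChartAt_target x, by simp [A, hφ, hx]⟩
  have hpos : 0 < b.addHaar (chartSet I x A) := hO.measure_pos _ ⟨_, hmem⟩
  have hm : AEMeasurable (fun y => ENNReal.ofReal |volCoeff I b Ω x y|)
      (b.addHaar.restrict (chartSet I x A)) :=
    (((continuousOn_volCoeff hΩ x).mono Set.inter_subset_left).abs.aemeasurable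
      hO.measurableSet).ennreal_ofReal
  rw [lintegral_eq_zero_iff' hm, Filter.EventuallyEq, ae_restrict_iff' hO.measurableSet] at h1
  refine hpos.ne' (measure_mono_null ?_ h1)
  intro y hy
  simp only [Set.mem_compl_iff, Set.mem_ofPred_eq, Pi.zero_apply, ENNReal.ofReal_eq_zero]
  intro h
  exact volCoeff_ne_zero hΩ hy.1 (abs_nonpos_iff.1 (h hy))

theorem restrict_volMeasure (c : N) :
    (volMeasure I b Ω).restrict (extChartAt I c).source = chartMeasure I b Ω c := by
  have hS := (isOpen_extChartAt_source (I := I) c).measurableSet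
  ext A hA
  rw [Measure.restrict_apply hA, volMeasure_apply_of_subset (hA.inter hS) Set.inter_subset_right,
    chartMeasure_apply c hA, chartMeasure_apply c (hA.inter hS)]
  congr 2
  ext y
  simp only [chartSet, Set.mem_inter_iff, Set.mem_preimage]
  exact ⟨fun h => ⟨h.1, h.2.1⟩, fun h => ⟨h.1, h.2, (extChartAt I c).map_target h.1⟩⟩

/-- Integration over a chart domain in coordinates. -/
theorem setIntegral_volMeasure (hΩ : IsVolumeForm I b Ω) (c : N) {h : N → ℝ}
    (hh : ContinuousOn h (extChartAt I c).source) :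
    ∫ x in (extChartAt I c).source, h x ∂(volMeasure I b Ω) =
      ∫ y in (extChartAt I c).target, |volCoeff I b Ω c y| * h ((extChartAt I c).symm y)
        ∂b.addHaar := by
  have hS := (isOpen_extChartAt_source (I := I) c).measurableSet
  have hT := (isOpen_extChartAt_target (I := I) c).measurableSet
  have hm : AEStronglyMeasurable h (chartMeasure I b Ω c) := by
    rw [← restrict_volMeasure]
    exact hh.aestronglyMeasurable hS
  have hd : AEMeasurable (fun y => ENNReal.ofReal |volCoeff I b Ω c y|)
      (b.addHaar.restrict (extChartAt I c).target) :=
    ((continuousOn_volCoeff hΩ c).abs.aemeasurable hT).ennreal_ofReal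
  rw [restrict_volMeasure]
  rw [chartMeasure] at hm ⊢
  rw [integral_map ((continuousOn_extChartAt_symm c).aemeasurable hT) hm,
    restrict_withDensity hT, integral_withDensity_eq_integral_toReal_smul₀ hd (by simp)]
  simp [ENNReal.toReal_ofReal]

end VolumeMeasure

/-! ### Functions in a chart -/

section ChartFunctions

variable {E : Type*} [NormedAddCommGroup E] [NormedSpace ℝ E]
  {H : Type*} [TopologicalSpace H] {I : ModelWithCorners ℝ E H} [I.Boundaryless]
  {N : Type*} [TopologicalSpace N] [ChartedSpace H N] [IsManifold I ∞ N]
  {F : Type*} [NormedAddCommGroup F] [NormedSpace ℝ F]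

theorem contDiffAt_of_contMDiffAt {f : N → F} {c : N} {y : E} (hy : y ∈ (extChartAt I c).target)
    (hf : ContMDiffAt I 𝓘(ℝ, F) ∞ f ((extChartAt I c).symm y)) :
    ContDiffAt ℝ ∞ (fun z => f ((extChartAt I c).symm z)) y := by
  rw [← contMDiffAt_iff_contDiffAt]
  exact ContMDiffAt.comp (g := f) y hf (contMDiffAt_chart_symm hy)

theorem contMDiffAt_of_contDiffAt {f : N → F} {c x : N} (hx : x ∈ (extChartAt I c).source)
    (hf : ContDiffAt ℝ ∞ (fun z => f ((extChartAt I c).symm z)) (extChartAt I c x)) :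
    ContMDiffAt I 𝓘(ℝ, F) ∞ f x := by
  rw [← contMDiffAt_iff_contDiffAt] at hf
  have h := ContMDiffAt.comp (g := fun z => f ((extChartAt I c).symm z)) x hf (contMDiffAt_chart hx)
  refine h.congr_of_eventuallyEq ?_
  filter_upwards [(isOpen_extChartAt_source (I := I) c).mem_nhds hx] with z hz
  simp only [Function.comp_def]
  rw [(extChartAt I c).left_inv hz]

theorem tder_eq_fderiv_comp {f : N → F} {c : N} {y : E} (hy : y ∈ (extChartAt I c).target)
    (hf : MDifferentiableAt I 𝓘(ℝ, F) f ((extChartAt I c).symm y)) :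
    tder I 𝓘(ℝ, F) f ((extChartAt I c).symm y) =
      (fderiv ℝ (fun z => f ((extChartAt I c).symm z)) y).comp
        (tder I 𝓘(ℝ, E) (extChartAt I c) ((extChartAt I c).symm y)) := by
  have h := tder_comp (g := f) (x := y) hf
    ((contMDiffAt_chart_symm (I := I) hy).mdifferentiableAt (by simp))
  rw [← tder_eq_fderiv, h, ContinuousLinearMap.comp_assoc, tder_symm_comp_tder_chart hy,
    ContinuousLinearMap.comp_id]

end ChartFunctions

/-! ### The divergence of a dual field in a chart -/

section Divergence

variable {E : Type*} [NormedAddCommGroup E] [NormedSpace ℝ E] [FiniteDimensional ℝ E]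
  {H : Type*} [TopologicalSpace H] {I : ModelWithCorners ℝ E H} [I.Boundaryless]
  {N : Type*} [TopologicalSpace N] [ChartedSpace H N] [IsManifold I ∞ N]
  {d : ℕ} {b : Module.Basis (Fin d) ℝ E}
  {Ω : ∀ x : N, TangentSpace I x [⋀^Fin d]→ₗ[ℝ] ℝ}
  {F : Type*} [NormedAddCommGroup F] [NormedSpace ℝ F]

variable (I) in
/-- The value of a dual field `w` on the covector field with constant coordinates `A`, in the
chart at `c`. -/
def fieldComp (c : N) (w : N → (E →L[ℝ] F) →ₗ[ℝ] ℝ) (A : E →L[ℝ] F) (y : E) : ℝ :=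
  w ((extChartAt I c).symm y) (A.comp (tder I 𝓘(ℝ, E) (extChartAt I c) ((extChartAt I c).symm y)))

variable (I) in
/-- Smoothness of a section of the dual of `L(TN, F)` on a set. -/
def SmoothDualField (w : N → (E →L[ℝ] F) →ₗ[ℝ] ℝ) (U : Set N) : Prop :=
  ∀ (c : N) (A : E →L[ℝ] F), ContDiffOn ℝ ∞ (fieldComp I c w A) (chartSet I c U)

variable (b) in
/-- The covector `bⁱ ⊗ η`. -/
def elemCovector (i : Fin d) (η : F) : E →L[ℝ] F :=
  (LinearMap.toContinuousLinearMap (b.coord i)).smulRight η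

variable (I b Ω) in
/-- The divergence of a dual field, computed in the chart at `c`. -/
def divAt (c : N) (w : N → (E →L[ℝ] F) →ₗ[ℝ] ℝ) (x : N) (η : F) : ℝ :=
  (volCoeff I b Ω c (extChartAt I c x))⁻¹ *
    ∑ i, fderiv ℝ (fun y => volCoeff I b Ω c y * fieldComp I c w (elemCovector b i η) y)
      (extChartAt I c x) (b i)

theorem smulRight_eq_sum (a : E →L[ℝ] ℝ) (η : F) :
    a.smulRight η = ∑ i, a (b i) • elemCovector b i η := by
  ext v
  simp only [ContinuousLinearMap.smulRight_apply, sum_apply,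
    smul_apply, elemCovector, LinearMap.coe_toContinuousLinearMap',
    Module.Basis.coord_apply, smul_smul, ← Finset.sum_smul]
  congr 1
  conv_lhs => rw [← b.sum_repr v, map_sum]
  exact Finset.sum_congr rfl fun i _ => by rw [map_smul, smul_eq_mul, mul_comm]

/-- The coordinate expression `∑ᵢ ∂ᵢg wⁱ(η)` of `w(dg ⊗ η)`. -/
theorem field_tder_eq (b : Module.Basis (Fin d) ℝ E)
    (w : N → (E →L[ℝ] F) →ₗ[ℝ] ℝ) {g : N → ℝ} {c : N} {y : E}
    (hy : y ∈ (extChartAt I c).target)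
    (hg : MDifferentiableAt I 𝓘(ℝ, ℝ) g ((extChartAt I c).symm y)) (η : F) :
    w ((extChartAt I c).symm y) ((tder I 𝓘(ℝ, ℝ) g ((extChartAt I c).symm y)).smulRight η) =
      ∑ i, fderiv ℝ (fun z => g ((extChartAt I c).symm z)) y (b i) *
        fieldComp I c w (elemCovector b i η) y := by
  rw [tder_eq_fderiv_comp hy hg]
  set T := tder I 𝓘(ℝ, E) (extChartAt I c) ((extChartAt I c).symm y)
  set D := fderiv ℝ (fun z => g ((extChartAt I c).symm z)) y
  have : (D.comp T).smulRight η = ∑ i, D (b i) • (elemCovector b i η).comp T := by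
    have h := congrArg (fun A : E →L[ℝ] F => A.comp T) (smulRight_eq_sum (b := b) D η)
    simp only [ContinuousLinearMap.finsetSum_comp, ContinuousLinearMap.smul_comp] at h
    exact h
  rw [this, map_sum]
  exact Finset.sum_congr rfl fun i _ => by rw [map_smul, smul_eq_mul]; rfl

theorem contDiffAt_fieldComp {w : N → (E →L[ℝ] F) →ₗ[ℝ] ℝ} {U : Set N} (hU : IsOpen U)
    (hw : SmoothDualField I w U) (c : N) (A : E →L[ℝ] F) {y : E} (hy : y ∈ chartSet I c U) :
    ContDiffAt ℝ ∞ (fieldComp I c w A) y :=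
  (hw c A y hy).contDiffAt ((isOpen_chartSet c hU).mem_nhds hy)

theorem mem_chartSet {c x : N} {U : Set N} (hx : x ∈ (extChartAt I c).source) (hU : x ∈ U) :
    extChartAt I c x ∈ chartSet I c U :=
  ⟨(extChartAt I c).map_source hx, by rwa [Set.mem_preimage, (extChartAt I c).left_inv hx]⟩

theorem contDiffAt_volCoeff (hΩ : IsVolumeForm I b Ω) {c : N} {y : E}
    (hy : y ∈ (extChartAt I c).target) : ContDiffAt ℝ ∞ (volCoeff I b Ω c) y :=
  (hΩ.smooth c y hy).contDiffAt ((isOpen_extChartAt_target (I := I) c).mem_nhds hy)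

theorem continuousOn_field_tder {w : N → (E →L[ℝ] F) →ₗ[ℝ] ℝ} {U : Set N}
    (hU : IsOpen U) (hw : SmoothDualField I w U) {g : N → ℝ} (hg : ContMDiffOn I 𝓘(ℝ, ℝ) ∞ g U)
    (η : F) : ContinuousOn (fun x => w x ((tder I 𝓘(ℝ, ℝ) g x).smulRight η)) U := by
  intro x hx
  refine ContinuousAt.continuousWithinAt ?_
  let b := Module.finBasis ℝ E
  set φ := extChartAt I x
  have hgx : ∀ y ∈ chartSet I x U, ContMDiffAt I 𝓘(ℝ, ℝ) ∞ g (φ.symm y) := fun y hy =>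
    (hg _ hy.2).contMDiffAt (hU.mem_nhds hy.2)
  have hmem : φ x ∈ chartSet I x U := mem_chartSet (mem_extChartAt_source x) hx
  have h1 : ContinuousAt (fun y => ∑ i, fderiv ℝ (fun z => g (φ.symm z)) y (b i) *
        fieldComp I x w (elemCovector b i η) y) (φ x) := by
    refine tendsto_finsetSum _ fun i _ => ContinuousAt.mul ?_ ?_
    · have := ((contDiffAt_of_contMDiffAt hmem.1 (hgx _ hmem)).fderiv_right
        (m := 0) (by simp)).continuousAt
      exact this.clm_apply continuousAt_const
    · exact (contDiffAt_fieldComp hU hw x _ hmem).continuousAt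
  have h2 := ContinuousAt.comp (f := φ) (x := x) h1 (continuousAt_extChartAt x)
  refine h2.congr ?_
  filter_upwards [(isOpen_extChartAt_source (I := I) x).mem_nhds (mem_extChartAt_source x),
    hU.mem_nhds hx] with z hz hzU
  have hm := mem_chartSet hz hzU
  have := field_tder_eq b w hm.1 ((hgx _ hm).mdifferentiableAt (by simp)) η
  rw [φ.left_inv hz] at this
  rw [this]
  rfl

theorem continuousOn_divAt (hΩ : IsVolumeForm I b Ω) {w : N → (E →L[ℝ] F) →ₗ[ℝ] ℝ} {U : Set N}
    (hU : IsOpen U) (hw : SmoothDualField I w U) (c : N) (η : F) :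
    ContinuousOn (fun x => divAt I b Ω c w x η) ((extChartAt I c).source ∩ U) := by
  rintro x ⟨hx, hxU⟩
  refine ContinuousAt.continuousWithinAt ?_
  have hmem := mem_chartSet hx hxU
  have hc := continuousAt_extChartAt' (I := I) hx
  refine ContinuousAt.mul ?_ (tendsto_finsetSum _ fun i _ => ?_)
  · exact (ContinuousAt.comp (f := extChartAt I c) (contDiffAt_volCoeff hΩ hmem.1).continuousAt
      hc).inv₀ (volCoeff_ne_zero hΩ hmem.1)
  · have h1 := (((contDiffAt_volCoeff hΩ hmem.1).mul (contDiffAt_fieldComp hU hw c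
      (elemCovector b i η) hmem)).fderiv_right (m := 0) (by simp)).continuousAt
    exact ContinuousAt.comp (g := fun y => fderiv ℝ (fun y => volCoeff I b Ω c y *
      fieldComp I c w (elemCovector b i η) y) y (b i)) (h1.clm_apply continuousAt_const) hc

variable [MeasurableSpace E] [BorelSpace E] [T2Space N]
  [SecondCountableTopology N] [MeasurableSpace N] [BorelSpace N]

/-- Integration by parts in a chart. -/
theorem integral_field_tder_eq_divAt (hΩ : IsVolumeForm I b Ω) {w : N → (E →L[ℝ] F) →ₗ[ℝ] ℝ}
    {U : Set N} (hU : IsOpen U) (hw : SmoothDualField I w U) (c : N) {g : N → ℝ}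
    (hg : ContMDiff I 𝓘(ℝ, ℝ) ∞ g) (hgc : HasCompactSupport g)
    (hgs : tsupport g ⊆ (extChartAt I c).source ∩ U) (η : F) :
    ∫ x, w x ((tder I 𝓘(ℝ, ℝ) g x).smulRight η) ∂(volMeasure I b Ω) =
      - ∫ x, g x * divAt I b Ω c w x η ∂(volMeasure I b Ω) := by
  set φ := extChartAt I c with hφ
  set ρ := volCoeff I b Ω c with hρ
  set v : Fin d → E → ℝ := fun i => fieldComp I c w (elemCovector b i η) with hv
  have hOs := isOpen_extChartAt_source (I := I) c
  have hTm := (isOpen_extChartAt_target (I := I) c).measurableSet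
  -- the coordinate expression of `g`, extended by zero
  set g' : E → ℝ := φ.target.indicator fun y => g (φ.symm y) with hg'
  have hcomp : IsCompact (φ '' tsupport g) :=
    hgc.isCompact.image_of_continuousOn ((continuousOn_extChartAt c).mono fun x hx => (hgs hx).1)
  have hsupp : tsupport g' ⊆ φ '' tsupport g := by
    refine closure_minimal ?_ hcomp.isClosed
    intro y hy
    have hyT : y ∈ φ.target := by
      by_contra h
      exact hy (Set.indicator_of_notMem h _)
    refine ⟨φ.symm y, subset_tsupport _ ?_, φ.right_inv hyT⟩
    have : g' y ≠ 0 := hy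
    rwa [hg', Set.indicator_of_mem hyT] at this
  have hsuppT : tsupport g' ⊆ chartSet I c U := fun y hy => by
    obtain ⟨x, hx, rfl⟩ := hsupp hy
    exact mem_chartSet (hgs hx).1 (hgs hx).2
  have hg'ev : ∀ y ∈ φ.target, g' =ᶠ[𝓝 y] fun y => g (φ.symm y) := fun y hy => by
    filter_upwards [(isOpen_extChartAt_target (I := I) c).mem_nhds hy] with z hz
    exact Set.indicator_of_mem hz _
  have hg's : ∀ y ∈ φ.target, ContDiffAt ℝ ∞ g' y := fun y hy =>
    (contDiffAt_of_contMDiffAt hy hg.contMDiffAt).congr_of_eventuallyEq (hg'ev y hy)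
  have hg'0 : ∀ y ∉ tsupport g', g' =ᶠ[𝓝 y] 0 := fun y hy => notMem_tsupport_iff_eventuallyEq.1 hy
  have hg'c : HasCompactSupport g' := HasCompactSupport.of_support_subset_isCompact hcomp
    ((subset_tsupport _).trans hsupp)
  -- products of functions that are continuous on the coordinate domain with functions supported
  -- like `g'` are integrable
  have hint : ∀ p q : E → ℝ, (∀ y ∈ chartSet I c U, ContinuousAt p y) →
      (∀ y ∈ tsupport g', ContinuousAt q y) → (∀ y ∉ tsupport g', q =ᶠ[𝓝 y] 0) →
      Integrable (fun y => p y * q y) b.addHaar := by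
    intro p q hp hq hq0
    have hzero : ∀ y ∉ tsupport g', (fun y => p y * q y) =ᶠ[𝓝 y] 0 := fun y hy => by
      filter_upwards [hq0 y hy] with z hz
      simp [hz]
    refine Continuous.integrable_of_hasCompactSupport ?_ ?_
    · rw [continuous_iff_continuousAt]
      intro y
      by_cases hy : y ∈ tsupport g'
      · exact (hp y (hsuppT hy)).mul (hq y hy)
      · exact continuousAt_const.congr (hzero y hy).symm
    · refine HasCompactSupport.of_support_subset_isCompact hg'c.isCompact fun y hy => ?_
      by_contra h
      exact hy ((hzero y h).self_of_nhds)
  have habs : ∀ y ∈ φ.target, ContDiffAt ℝ ∞ (fun y => |ρ y|) y := fun y hy =>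
    (contDiffAt_abs (volCoeff_ne_zero hΩ hy)).comp y (contDiffAt_volCoeff hΩ hy)
  have hvs : ∀ i, ∀ y ∈ chartSet I c U, ContDiffAt ℝ ∞ (v i) y := fun i y hy =>
    contDiffAt_fieldComp hU hw c _ hy
  have hρv : ∀ i, ∀ y ∈ chartSet I c U, ContDiffAt ℝ ∞ (fun y => |ρ y| * v i y) y :=
    fun i y hy => (habs y hy.1).mul (hvs i y hy)
  have hdg' : ∀ y, ∀ e, y ∉ tsupport g' → (fun y => fderiv ℝ g' y e) =ᶠ[𝓝 y] 0 :=
    fun y e hy => by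
      filter_upwards [(hg'0 y hy).fderiv (𝕜 := ℝ)] with z hz
      rw [hz]; simp
  -- the integration by parts for each coordinate
  have hparts : ∀ i, ∫ y, |ρ y| * v i y * fderiv ℝ g' y (b i) ∂b.addHaar =
      - ∫ y, fderiv ℝ (fun y => |ρ y| * v i y) y (b i) * g' y ∂b.addHaar := fun i =>
    integral_mul_fderiv_eq_neg_fderiv_mul_of_integrable
      (hint _ _ (fun y hy => (((hρv i y hy).fderiv_right (m := 0) (by simp)).continuousAt).clm_apply
        continuousAt_const) (fun y hy => (hg's y (hsuppT hy).1).continuousAt) hg'0)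
      (hint _ _ (fun y hy => (hρv i y hy).continuousAt)
        (fun y hy => (((hg's y (hsuppT hy).1).fderiv_right (m := 0) (by simp)).continuousAt).clm_apply
          continuousAt_const) (fun y hy => hdg' y _ hy))
      (hint _ _ (fun y hy => (hρv i y hy).continuousAt)
        (fun y hy => (hg's y (hsuppT hy).1).continuousAt) hg'0)
      (fun y hy => (hρv i y (hsuppT hy)).differentiableAt (by simp))
      (fun y _ => by
        by_cases hy : y ∈ tsupport g'
        · exact (hg's y (hsuppT hy).1).differentiableAt (by simp)
        · exact (differentiableAt_const (0 : ℝ)).congr_of_eventuallyEq (hg'0 y hy))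
  have hint1 : ∀ i, Integrable (fun y => |ρ y| * v i y * fderiv ℝ g' y (b i)) b.addHaar := fun i =>
    hint _ _ (fun y hy => (hρv i y hy).continuousAt)
        (fun y hy => (((hg's y (hsuppT hy).1).fderiv_right (m := 0) (by simp)).continuousAt).clm_apply
          continuousAt_const) (fun y hy => hdg' y _ hy)
  have hint2 : ∀ i, Integrable (fun y => fderiv ℝ (fun y => |ρ y| * v i y) y (b i) * g' y)
      b.addHaar := fun i =>
    hint _ _ (fun y hy => (((hρv i y hy).fderiv_right (m := 0) (by simp)).continuousAt).clm_apply
        continuousAt_const) (fun y hy => (hg's y (hsuppT hy).1).continuousAt) hg'0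
  -- the logarithmic derivatives of `ρ` and `|ρ|` agree
  have hdabs : ∀ i, ∀ y ∈ φ.target, |ρ y| * ((ρ y)⁻¹ * fderiv ℝ (fun y => ρ y * v i y) y (b i)) =
      fderiv ℝ (fun y => |ρ y| * v i y) y (b i) := by
    intro i y hy
    have hne := volCoeff_ne_zero hΩ hy
    have hcont := (contDiffAt_volCoeff hΩ hy).continuousAt
    rcases lt_or_gt_of_ne hne with h | h
    · have : (fun y => |ρ y| * v i y) =ᶠ[𝓝 y] fun y => -(ρ y * v i y) := by
        filter_upwards [hcont.eventually_lt continuousAt_const h] with z hz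
        rw [abs_of_neg hz, neg_mul]
      rw [this.fderiv_eq, abs_of_neg h, fderiv_fun_neg, ← mul_assoc, neg_mul, mul_inv_cancel₀ hne]
      simp
    · have : (fun y => |ρ y| * v i y) =ᶠ[𝓝 y] fun y => ρ y * v i y := by
        filter_upwards [continuousAt_const.eventually_lt hcont h] with z hz
        rw [abs_of_pos hz]
      rw [this.fderiv_eq, abs_of_pos h, ← mul_assoc, mul_inv_cancel₀ hne, one_mul]
  have hz1 : ∀ x ∉ φ.source, w x ((tder I 𝓘(ℝ, ℝ) g x).smulRight η) = 0 := fun x hx => by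
    have : g =ᶠ[𝓝 x] fun _ => 0 := notMem_tsupport_iff_eventuallyEq.1 fun h => hx (hgs h).1
    rw [tder_congr this, tder_const]
    simp
  have hz2 : ∀ x ∉ φ.source, g x * divAt I b Ω c w x η = 0 := fun x hx => by
    rw [image_eq_zero_of_notMem_tsupport fun h => hx (hgs h).1, zero_mul]
  -- continuity on the chart domain of functions supported in the support of `g`
  have hcont : ∀ h : N → ℝ, ContinuousOn h (φ.source ∩ U) → (∀ x ∉ tsupport g, h =ᶠ[𝓝 x] 0) →
      ContinuousOn h φ.source := fun h hh h0 x hx => by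
    refine ContinuousAt.continuousWithinAt ?_
    by_cases hxs : x ∈ tsupport g
    · exact (hh x (hgs hxs)).continuousAt ((hOs.inter hU).mem_nhds (hgs hxs))
    · exact continuousAt_const.congr (h0 x hxs).symm
  have hc1 : ContinuousOn (fun x => w x ((tder I 𝓘(ℝ, ℝ) g x).smulRight η)) φ.source :=
    hcont _ ((continuousOn_field_tder hU hw hg.contMDiffOn η).mono Set.inter_subset_right)
      fun x hx => by
        filter_upwards [(notMem_tsupport_iff_eventuallyEq.1 hx).eventually_nhds] with z hz
        have : g =ᶠ[𝓝 z] fun _ => 0 := hz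
        rw [tder_congr this, tder_const]
        simp
  have hc2 : ContinuousOn (fun x => g x * divAt I b Ω c w x η) φ.source :=
    hcont _ (hg.continuous.continuousOn.mul (continuousOn_divAt hΩ hU hw c η)) fun x hx => by
      filter_upwards [notMem_tsupport_iff_eventuallyEq.1 hx] with z hz
      simp [hz]
  rw [← setIntegral_eq_integral_of_forall_compl_eq_zero hz1,
    ← setIntegral_eq_integral_of_forall_compl_eq_zero hz2, setIntegral_volMeasure hΩ c hc1,
    setIntegral_volMeasure hΩ c hc2]
  have e1 : ∫ y in φ.target, |ρ y| * w (φ.symm y) ((tder I 𝓘(ℝ, ℝ) g (φ.symm y)).smulRight η)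
      ∂b.addHaar = ∫ y, ∑ i, |ρ y| * v i y * fderiv ℝ g' y (b i) ∂b.addHaar := by
    rw [← setIntegral_eq_integral_of_forall_compl_eq_zero (s := φ.target) (μ := b.addHaar)
      (f := fun y => ∑ i, |ρ y| * v i y * fderiv ℝ g' y (b i))]
    · refine setIntegral_congr_fun hTm fun y hy => ?_
      rw [field_tder_eq b w hy (hg.mdifferentiable (by simp) _) η, Finset.mul_sum,
        (hg'ev y hy).fderiv_eq]
      exact Finset.sum_congr rfl fun i _ => by ring
    · intro y hy
      refine Finset.sum_eq_zero fun i _ => ?_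
      have : y ∉ tsupport g' := fun h => hy (hsuppT h).1
      have := (hdg' y (b i) this).self_of_nhds
      simp only [Pi.zero_apply] at this
      rw [this, mul_zero]
  have e2 : ∫ y in φ.target, |ρ y| * (g (φ.symm y) * divAt I b Ω c w (φ.symm y) η) ∂b.addHaar =
      ∫ y, ∑ i, fderiv ℝ (fun y => |ρ y| * v i y) y (b i) * g' y ∂b.addHaar := by
    rw [← setIntegral_eq_integral_of_forall_compl_eq_zero (s := φ.target) (μ := b.addHaar)
      (f := fun y => ∑ i, fderiv ℝ (fun y => |ρ y| * v i y) y (b i) * g' y)]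
    · refine setIntegral_congr_fun hTm fun y hy => ?_
      simp only [divAt]
      rw [← hφ, φ.right_inv hy, (hg'ev y hy).eq_of_nhds, ← Finset.sum_mul,
        ← Finset.sum_congr rfl fun i _ => hdabs i y hy, ← Finset.mul_sum, ← Finset.mul_sum]
      ring
    · intro y hy
      refine Finset.sum_eq_zero fun i _ => ?_
      rw [show g' y = 0 from Set.indicator_of_notMem hy _, mul_zero]
  rw [e1, e2, integral_finsetSum _ fun i _ => hint1 i, integral_finsetSum _ fun i _ => hint2 i,
    ← Finset.sum_neg_distrib]
  exact Finset.sum_congr rfl fun i _ => hparts i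

end Divergence

/-! ### The fundamental lemma of the calculus of variations -/

section Fundamental

variable {E : Type*} [NormedAddCommGroup E] [NormedSpace ℝ E] [FiniteDimensional ℝ E]
  {H : Type*} [TopologicalSpace H] {I : ModelWithCorners ℝ E H} [I.Boundaryless]
  {N : Type*} [TopologicalSpace N] [ChartedSpace H N] [IsManifold I ∞ N] [T2Space N]
  [SecondCountableTopology N] [MeasurableSpace N] [BorelSpace N]

variable (I) in
/-- The fundamental lemma of the calculus of variations, for continuous functions. -/
theorem eqOn_zero_of_integral_mul_eq_zero {μ : Measure N} [IsLocallyFiniteMeasure μ]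
    [μ.IsOpenPosMeasure] {U : Set N} (hU : IsOpen U) {f : N → ℝ} (hf : ContinuousOn f U)
    (h : ∀ g : N → ℝ, ContMDiff I 𝓘(ℝ, ℝ) ∞ g → HasCompactSupport g → tsupport g ⊆ U →
      ∫ x, g x * f x ∂μ = 0) : ∀ x ∈ U, f x = 0 := by
  have : LocallyCompactSpace H := I.locallyCompactSpace
  have : LocallyCompactSpace N := ChartedSpace.locallyCompactSpace H N
  have : SigmaCompactSpace N := inferInstance
  have h1 := hU.ae_eq_zero_of_integral_contMDiff_smul_eq_zero I
    (hf.locallyIntegrableOn hU.measurableSet) h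
  have h2 : f =ᵐ[μ.restrict U] fun _ => 0 := (ae_restrict_iff' hU.measurableSet).2 h1
  have h3 : Set.EqOn f (fun _ => 0) U := Measure.eqOn_open_of_ae_eq h2 hU hf continuousOn_const
  exact fun x hx => h3 hx

/-- A function that is smooth on an open set `U` and vanishes on `U` outside a compact subset
of `U`, extended by zero, is smooth with compact support. -/
theorem contMDiff_indicator {F : Type*} [NormedAddCommGroup F] [NormedSpace ℝ F]
    {U K : Set N} (hU : IsOpen U) (hK : IsCompact K) (hKU : K ⊆ U) {g : N → F}
    (hg : ContMDiffOn I 𝓘(ℝ, F) ∞ g U) (h0 : ∀ x ∈ U \ K, g x = 0) :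
    ContMDiff I 𝓘(ℝ, F) ∞ (U.indicator g) ∧ tsupport (U.indicator g) ⊆ K := by
  have hs : tsupport (U.indicator g) ⊆ K := by
    refine closure_minimal (fun x hx => ?_) hK.isClosed
    by_contra hxK
    refine hx ?_
    by_cases hxU : x ∈ U
    · rw [Set.indicator_of_mem hxU, h0 x ⟨hxU, hxK⟩]
    · rw [Set.indicator_of_notMem hxU]
  refine ⟨contMDiff_of_tsupport fun x hx => ?_, hs⟩
  have hxU := hKU (hs hx)
  refine (hg.contMDiffAt (hU.mem_nhds hxU)).congr_of_eventuallyEq ?_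
  filter_upwards [hU.mem_nhds hxU] with z hz using Set.indicator_of_mem hz g

end Fundamental

/-! ### Derivatives of sums -/

section Sum

variable {E : Type*} [NormedAddCommGroup E] [NormedSpace ℝ E]
  {H : Type*} [TopologicalSpace H] {I : ModelWithCorners ℝ E H} [I.Boundaryless]
  {N : Type*} [TopologicalSpace N] [ChartedSpace H N] [IsManifold I ∞ N]
  {F : Type*} [NormedAddCommGroup F] [NormedSpace ℝ F]

theorem tder_add {f g : N → F} {x : N} (hf : MDifferentiableAt I 𝓘(ℝ, F) f x)
    (hg : MDifferentiableAt I 𝓘(ℝ, F) g x) :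
    tder I 𝓘(ℝ, F) (fun x => f x + g x) x = tder I 𝓘(ℝ, F) f x + tder I 𝓘(ℝ, F) g x :=
  mfderiv_add hf hg

theorem tder_sum {ι : Type*} [Fintype ι] {f : ι → N → F} {x : N}
    (hf : ∀ i, MDifferentiableAt I 𝓘(ℝ, F) (f i) x) :
    tder I 𝓘(ℝ, F) (fun x => ∑ i, f i x) x = ∑ i, tder I 𝓘(ℝ, F) (f i) x := by
  classical
  suffices h : ∀ s : Finset ι, MDifferentiableAt I 𝓘(ℝ, F) (fun x => ∑ i ∈ s, f i x) x ∧
      tder I 𝓘(ℝ, F) (fun x => ∑ i ∈ s, f i x) x = ∑ i ∈ s, tder I 𝓘(ℝ, F) (f i) x from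
    (h Finset.univ).2
  intro s
  induction s using Finset.induction_on with
  | empty => simpa using ⟨mdifferentiableAt_const, tder_const (I := I) (0 : F) x⟩
  | insert i s hi ih =>
    simp only [Finset.sum_insert hi]
    exact ⟨(hf i).add ih.1, by rw [tder_add (hf i) ih.1, ih.2]⟩

end Sum

/-! ### The divergence theorem -/

section DivergenceTheorem

variable {E : Type*} [NormedAddCommGroup E] [NormedSpace ℝ E] [FiniteDimensional ℝ E]
  {H : Type*} [TopologicalSpace H] {I : ModelWithCorners ℝ E H} [I.Boundaryless]
  {N : Type*} [TopologicalSpace N] [ChartedSpace H N] [IsManifold I ∞ N]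
  {d : ℕ} {b : Module.Basis (Fin d) ℝ E}
  {Ω : ∀ x : N, TangentSpace I x [⋀^Fin d]→ₗ[ℝ] ℝ}
  {F : Type*} [NormedAddCommGroup F] [NormedSpace ℝ F]
  [MeasurableSpace E] [BorelSpace E] [T2Space N]
  [SecondCountableTopology N] [MeasurableSpace N] [BorelSpace N]

/-- The divergence does not depend on the chart: in all charts it is the function that represents
the same functional on test functions. -/
theorem divAt_eq_divAt (hΩ : IsVolumeForm I b Ω) {w : N → (E →L[ℝ] F) →ₗ[ℝ] ℝ} {U : Set N}
    (hU : IsOpen U) (hw : SmoothDualField I w U) {c c' x : N} (hx : x ∈ (extChartAt I c).source)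
    (hx' : x ∈ (extChartAt I c').source) (hxU : x ∈ U) (η : F) :
    divAt I b Ω c w x η = divAt I b Ω c' w x η := by
  have := isLocallyFiniteMeasure_volMeasure hΩ
  have := isOpenPosMeasure_volMeasure hΩ
  set O := (extChartAt I c).source ∩ (extChartAt I c').source ∩ U
  have hO : IsOpen O :=
    ((isOpen_extChartAt_source c).inter (isOpen_extChartAt_source c')).inter hU
  have hc : ContinuousOn (fun x => divAt I b Ω c w x η) O :=
    (continuousOn_divAt hΩ hU hw c η).mono fun z hz => ⟨hz.1.1, hz.2⟩
  have hc' : ContinuousOn (fun x => divAt I b Ω c' w x η) O :=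
    (continuousOn_divAt hΩ hU hw c' η).mono fun z hz => ⟨hz.1.2, hz.2⟩
  refine sub_eq_zero.1 (eqOn_zero_of_integral_mul_eq_zero I (μ := volMeasure I b Ω) hO
    (hc.sub hc') (fun g hg hgc hgs => ?_) x ⟨⟨hx, hx'⟩, hxU⟩)
  have hi : ∀ f : N → ℝ, ContinuousOn f O →
      Integrable (fun x => g x * f x) (volMeasure I b Ω) := by
    intro f hf
    have : Continuous fun x => g x * f x := by
      refine (hg.continuous.continuousOn.mul hf).continuous_of_tsupport_subset hO ?_
      exact (tsupport_mul_subset_left).trans hgs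
    exact this.integrable_of_hasCompactSupport hgc.mul_right
  -- both divergences pair with `g` to minus the integral of `w(dg ⊗ η)`
  have e1 := integral_field_tder_eq_divAt hΩ hU hw c hg hgc
    (hgs.trans fun z hz => ⟨hz.1.1, hz.2⟩) η
  have e2 := integral_field_tder_eq_divAt hΩ hU hw c' hg hgc
    (hgs.trans fun z hz => ⟨hz.1.2, hz.2⟩) η
  have e3 : (fun x => g x * (divAt I b Ω c w x η - divAt I b Ω c' w x η)) =
      fun x => g x * divAt I b Ω c w x η - g x * divAt I b Ω c' w x η := by ext; ring
  refine (congrArg (fun f => ∫ x, f x ∂volMeasure I b Ω) e3).trans ?_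
  rw [integral_sub (hi _ hc) (hi _ hc'), sub_eq_zero]
  exact neg_injective (e1.symm.trans e2)

theorem continuousOn_divergence (hΩ : IsVolumeForm I b Ω) {w : N → (E →L[ℝ] F) →ₗ[ℝ] ℝ} {U : Set N}
    (hU : IsOpen U) (hw : SmoothDualField I w U) (η : F) :
    ContinuousOn (fun x => divAt I b Ω x w x η) U := by
  intro x hx
  refine ContinuousAt.continuousWithinAt ?_
  have hO := (isOpen_extChartAt_source (I := I) x).inter hU
  have hmem : x ∈ (extChartAt I x).source ∩ U := ⟨mem_extChartAt_source x, hx⟩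
  refine ((continuousOn_divAt hΩ hU hw x η).continuousAt (hO.mem_nhds hmem)).congr ?_
  filter_upwards [hO.mem_nhds hmem] with z hz
  exact divAt_eq_divAt hΩ hU hw hz.1 (mem_extChartAt_source z) hz.2 η

/-- The divergence theorem for scalar test functions. -/
theorem integral_field_tder_eq_div (hΩ : IsVolumeForm I b Ω) {w : N → (E →L[ℝ] F) →ₗ[ℝ] ℝ}
    {U : Set N} (hU : IsOpen U) (hw : SmoothDualField I w U) {g : N → ℝ}
    (hg : ContMDiff I 𝓘(ℝ, ℝ) ∞ g) (hgc : HasCompactSupport g) (hgs : tsupport g ⊆ U) (η : F) :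
    ∫ x, w x ((tder I 𝓘(ℝ, ℝ) g x).smulRight η) ∂(volMeasure I b Ω) =
      - ∫ x, g x * divAt I b Ω x w x η ∂(volMeasure I b Ω) := by
  have : LocallyCompactSpace H := I.locallyCompactSpace
  have : LocallyCompactSpace N := ChartedSpace.locallyCompactSpace H N
  have := isLocallyFiniteMeasure_volMeasure hΩ
  -- a partition of unity on the support of `g`, subordinate to chart domains
  obtain ⟨t, -, ht⟩ := hgc.isCompact.elim_nhds_subcover (fun x : N => (extChartAt I x).source)
    fun x _ => extChartAt_source_mem_nhds x
  obtain ⟨f, hf⟩ := SmoothPartitionOfUnity.exists_isSubordinate I (isClosed_tsupport g)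
    (fun c : t => (extChartAt I (c : N)).source) (fun c => isOpen_extChartAt_source (c : N))
    (fun x hx => by
      obtain ⟨c, hc, hxc⟩ := Set.mem_iUnion₂.1 (ht hx)
      exact Set.mem_iUnion.2 ⟨⟨c, hc⟩, hxc⟩)
  set gc : t → N → ℝ := fun c x => f c x * g x with hgc'
  have hsum : ∀ x, g x = ∑ c, gc c x := by
    intro x
    by_cases hx : x ∈ tsupport g
    · have h1 := f.sum_eq_one hx
      rw [finsum_eq_sum_of_fintype] at h1
      rw [← Finset.sum_mul, h1, one_mul]
    · have h1 := image_eq_zero_of_notMem_tsupport hx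
      simp [hgc', h1]
  have hgcs : ∀ c, ContMDiff I 𝓘(ℝ, ℝ) ∞ (gc c) := fun c => (f c).contMDiff.mul hg
  have hgcc : ∀ c, HasCompactSupport (gc c) := fun c => hgc.mul_left
  have hgct : ∀ c, tsupport (gc c) ⊆ (extChartAt I (c : N)).source ∩ U := fun c =>
    Set.subset_inter ((tsupport_mul_subset_left).trans (hf c))
      ((tsupport_mul_subset_right).trans hgs)
  have hgcU : ∀ c, tsupport (gc c) ⊆ U := fun c => (hgct c).trans Set.inter_subset_right
  have hi2 : ∀ c, Integrable (fun x => gc c x * divAt I b Ω x w x η) (volMeasure I b Ω) := by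
    intro c
    have : Continuous fun x => gc c x * divAt I b Ω x w x η :=
      ((hgcs c).continuous.continuousOn.mul
        (continuousOn_divergence hΩ hU hw η)).continuous_of_tsupport_subset hU
        ((tsupport_mul_subset_left).trans (hgcU c))
    exact this.integrable_of_hasCompactSupport (hgcc c).mul_right
  have hz : ∀ c, ∀ x ∉ tsupport (gc c),
      w x ((tder I 𝓘(ℝ, ℝ) (gc c) x).smulRight η) = 0 := by
    intro c x hx
    have : gc c =ᶠ[𝓝 x] fun _ => 0 := notMem_tsupport_iff_eventuallyEq.1 hx
    rw [tder_congr this, tder_const]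
    simp
  have hi1 : ∀ c, Integrable (fun x => w x ((tder I 𝓘(ℝ, ℝ) (gc c) x).smulRight η))
      (volMeasure I b Ω) := by
    intro c
    have hts : tsupport (fun x => w x ((tder I 𝓘(ℝ, ℝ) (gc c) x).smulRight η)) ⊆
        tsupport (gc c) := closure_minimal (fun x hx => by
          by_contra h
          exact hx (hz c x h)) (isClosed_tsupport _)
    have : Continuous fun x => w x ((tder I 𝓘(ℝ, ℝ) (gc c) x).smulRight η) :=
      (continuousOn_field_tder hU hw (hgcs c).contMDiffOn η).continuous_of_tsupport_subset hU
        (hts.trans (hgcU c))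
    exact this.integrable_of_hasCompactSupport
      (HasCompactSupport.of_support_subset_isCompact (hgcc c).isCompact
        ((subset_tsupport _).trans hts))
  have e1 : ∀ x, w x ((tder I 𝓘(ℝ, ℝ) g x).smulRight η) =
      ∑ c, w x ((tder I 𝓘(ℝ, ℝ) (gc c) x).smulRight η) := by
    intro x
    have h1 : tder I 𝓘(ℝ, ℝ) g x = ∑ c, tder I 𝓘(ℝ, ℝ) (gc c) x := by
      rw [show g = fun x => ∑ c, gc c x from funext hsum]
      exact tder_sum fun c => (hgcs c).mdifferentiable (by simp) x
    rw [h1, ← map_sum]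
    congr 1
    ext v
    simp [Finset.sum_smul]
  simp_rw [e1]
  rw [integral_finsetSum _ fun c _ => hi1 c]
  have e2 : ∀ x, g x * divAt I b Ω x w x η = ∑ c, gc c x * divAt I b Ω x w x η := fun x => by
    rw [← Finset.sum_mul, ← hsum]
  simp_rw [e2]
  rw [integral_finsetSum _ fun c _ => hi2 c, ← Finset.sum_neg_distrib]
  refine Finset.sum_congr rfl fun c _ => ?_
  rw [integral_field_tder_eq_divAt hΩ hU hw c (hgcs c) (hgcc c) (hgct c) η]
  congr 1
  refine integral_congr_ae (Filter.Eventually.of_forall fun x => ?_)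
  by_cases hx : x ∈ tsupport (gc c)
  · simp only
    rw [divAt_eq_divAt hΩ hU hw (hgct c hx).1 (mem_extChartAt_source x) (hgct c hx).2]
  · simp [image_eq_zero_of_notMem_tsupport hx]

/-- Linearity of the divergence in the vector argument. -/
theorem divAt_sum (hΩ : IsVolumeForm I b Ω) {w : N → (E →L[ℝ] F) →ₗ[ℝ] ℝ} {U : Set N}
    (hU : IsOpen U) (hw : SmoothDualField I w U) {c x : N} (hx : x ∈ (extChartAt I c).source)
    (hxU : x ∈ U) {ι : Type*} (s : Finset ι) (a : ι → ℝ) (e : ι → F) :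
    divAt I b Ω c w x (∑ k ∈ s, a k • e k) = ∑ k ∈ s, a k * divAt I b Ω c w x (e k) := by
  have hmem := mem_chartSet hx hxU
  have h1 : ∀ i y, fieldComp I c w (elemCovector b i (∑ k ∈ s, a k • e k)) y =
      ∑ k ∈ s, a k * fieldComp I c w (elemCovector b i (e k)) y := by
    intro i y
    have : elemCovector b i (∑ k ∈ s, a k • e k) = ∑ k ∈ s, a k • elemCovector b i (e k) := by
      ext v
      simp only [elemCovector, ContinuousLinearMap.smulRight_apply, sum_apply, smul_apply,
        Finset.smul_sum]
      exact Finset.sum_congr rfl fun k _ => smul_comm _ _ _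
    rw [this, fieldComp, ContinuousLinearMap.finsetSum_comp, map_sum]
    exact Finset.sum_congr rfl fun k _ => by
      rw [ContinuousLinearMap.smul_comp, map_smul, smul_eq_mul]; rfl
  have h2 : ∀ i, fderiv ℝ (fun y => volCoeff I b Ω c y *
        fieldComp I c w (elemCovector b i (∑ k ∈ s, a k • e k)) y) (extChartAt I c x) (b i) =
      ∑ k ∈ s, a k * fderiv ℝ (fun y => volCoeff I b Ω c y *
        fieldComp I c w (elemCovector b i (e k)) y) (extChartAt I c x) (b i) := by
    intro i
    have hd : ∀ k, HasFDerivAt (fun y => volCoeff I b Ω c y *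
        fieldComp I c w (elemCovector b i (e k)) y) _ (extChartAt I c x) := fun k =>
      (((contDiffAt_volCoeff hΩ hmem.1).mul (contDiffAt_fieldComp hU hw c
        (elemCovector b i (e k)) hmem)).differentiableAt (by simp)).hasFDerivAt
    have hs := (HasFDerivAt.fun_sum (u := s) fun k _ => (hd k).const_mul (a k)).fderiv
    have : (fun y => volCoeff I b Ω c y *
        fieldComp I c w (elemCovector b i (∑ k ∈ s, a k • e k)) y) = fun y => ∑ k ∈ s, a k *
        (volCoeff I b Ω c y * fieldComp I c w (elemCovector b i (e k)) y) := by
      funext y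
      rw [h1, Finset.mul_sum]
      exact Finset.sum_congr rfl fun k _ => by ring
    rw [this, hs]
    simp
  simp only [divAt, h2]
  rw [Finset.sum_comm, Finset.mul_sum]
  refine Finset.sum_congr rfl fun k _ => ?_
  rw [← Finset.mul_sum]
  ring

/-- The divergence theorem for vector valued test functions. -/
theorem setIntegral_field_tder_eq_div [FiniteDimensional ℝ F] (hΩ : IsVolumeForm I b Ω)
    {w : N → (E →L[ℝ] F) →ₗ[ℝ] ℝ}
    {U : Set N} (hU : IsOpen U) (hw : SmoothDualField I w U) {K : Set N} (hK : IsCompact K)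
    (hKU : K ⊆ U) {η : N → F} (hη : ContMDiffOn I 𝓘(ℝ, F) ∞ η U) (h0 : ∀ x ∈ U \ K, η x = 0) :
    ∫ x in K, w x (tder I 𝓘(ℝ, F) η x) ∂(volMeasure I b Ω) =
      - ∫ x in K, divAt I b Ω x w x (η x) ∂(volMeasure I b Ω) := by
  have := isLocallyFiniteMeasure_volMeasure hΩ
  let e := Module.finBasis ℝ F
  set p : Fin (Module.finrank ℝ F) → F →L[ℝ] ℝ := fun k =>
    LinearMap.toContinuousLinearMap (e.coord k) with hp
  have hpe : ∀ v, v = ∑ k, p k v • e k := fun v => (e.sum_repr v).symm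
  set g : Fin (Module.finrank ℝ F) → N → ℝ := fun k => U.indicator fun x => p k (η x) with hg
  have hgi : ∀ k, ContMDiff I 𝓘(ℝ, ℝ) ∞ (g k) ∧ tsupport (g k) ⊆ K := fun k =>
    contMDiff_indicator hU hK hKU
      ((p k).contMDiff.comp_contMDiffOn hη)
      fun x hx => by rw [h0 x hx, map_zero]
  have hgU : ∀ k, ∀ x ∈ U, g k x = p k (η x) := fun k x hx => Set.indicator_of_mem hx _
  have hgt : ∀ k, ∀ x ∈ U, tder I 𝓘(ℝ, ℝ) (g k) x = (p k).comp (tder I 𝓘(ℝ, F) η x) := by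
    intro k x hx
    have h1 : g k =ᶠ[𝓝 x] fun x => p k (η x) := by
      filter_upwards [hU.mem_nhds hx] with z hz using hgU k z hz
    rw [tder_congr h1, tder_comp (I' := 𝓘(ℝ, F)) (g := p k) (f := η)
      ((p k).differentiableAt.mdifferentiableAt)
      ((hη.contMDiffAt (hU.mem_nhds hx)).mdifferentiableAt (by simp)), tder_eq_fderiv,
      (p k).fderiv]
  have hKm := hK.isClosed.measurableSet
  have hgc : ∀ k, HasCompactSupport (g k) := fun k =>
    HasCompactSupport.of_support_subset_isCompact hK ((subset_tsupport _).trans (hgi k).2)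
  have e1 : ∫ x in K, w x (tder I 𝓘(ℝ, F) η x) ∂(volMeasure I b Ω) =
      ∫ x in K, ∑ k, w x ((tder I 𝓘(ℝ, ℝ) (g k) x).smulRight (e k)) ∂(volMeasure I b Ω) := by
    refine setIntegral_congr_fun hKm fun x hx => ?_
    rw [← map_sum]
    congr 1
    ext v
    simp only [sum_apply, ContinuousLinearMap.smulRight_apply, hgt _ x (hKU hx),
      ContinuousLinearMap.comp_apply]
    exact hpe _
  have e2 : ∫ x in K, divAt I b Ω x w x (η x) ∂(volMeasure I b Ω) =
      ∫ x in K, ∑ k, g k x * divAt I b Ω x w x (e k) ∂(volMeasure I b Ω) := by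
    refine setIntegral_congr_fun hKm fun x hx => ?_
    rw [← divAt_sum hΩ hU hw (mem_extChartAt_source x) (hKU hx)]
    congr 1
    simp only [hgU _ x (hKU hx)]
    exact hpe _
  rw [e1, e2, integral_finsetSum, integral_finsetSum, ← Finset.sum_neg_distrib]
  · refine Finset.sum_congr rfl fun k _ => ?_
    rw [setIntegral_eq_integral_of_forall_compl_eq_zero,
      setIntegral_eq_integral_of_forall_compl_eq_zero]
    · exact integral_field_tder_eq_div hΩ hU hw (hgi k).1 (hgc k) ((hgi k).2.trans hKU) (e k)
    · intro x hx
      rw [image_eq_zero_of_notMem_tsupport fun h => hx ((hgi k).2 h), zero_mul]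
    · intro x hx
      have : g k =ᶠ[𝓝 x] fun _ => 0 :=
        notMem_tsupport_iff_eventuallyEq.1 fun h => hx ((hgi k).2 h)
      rw [tder_congr this, tder_const]
      simp
  · intro k _
    exact (((hgi k).1.continuous.continuousOn.mul
      (continuousOn_divergence hΩ hU hw (e k))).mono hKU).integrableOn_compact hK
  · intro k _
    exact ((continuousOn_field_tder hU hw (hgi k).1.contMDiffOn (e k)).mono
      hKU).integrableOn_compact hK

end DivergenceTheorem

/-! ### Smooth one-forms and functions on `L(TN, F)` -/

section Forms

variable {E : Type*} [NormedAddCommGroup E] [NormedSpace ℝ E]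
  {H : Type*} [TopologicalSpace H] {I : ModelWithCorners ℝ E H} [I.Boundaryless]
  {N : Type*} [TopologicalSpace N] [ChartedSpace H N] [IsManifold I ∞ N]
  {F : Type*} [NormedAddCommGroup F] [NormedSpace ℝ F]

variable (I) in
/-- Smoothness at a point of a one-form with values in a vector space. -/
def SmoothFormAt (σ : N → E →L[ℝ] F) (x : N) : Prop :=
  ∀ c : N, x ∈ (extChartAt I c).source → ContDiffAt ℝ ∞
    (fun y : E => (σ ((extChartAt I c).symm y)).comp (tder 𝓘(ℝ, E) I (extChartAt I c).symm y))
    (extChartAt I c x)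

variable (I) in
/-- Joint smoothness at a point of a one-parameter family of one-forms. -/
def SmoothFamilyAt (τ : ℝ → N → E →L[ℝ] F) (p : ℝ × N) : Prop :=
  ∀ c : N, p.2 ∈ (extChartAt I c).source → ContDiffAt ℝ ∞
    (fun q : ℝ × E => (τ q.1 ((extChartAt I c).symm q.2)).comp
      (tder 𝓘(ℝ, E) I (extChartAt I c).symm q.2)) (p.1, extChartAt I c p.2)

variable (I) in
/-- The coordinate expression of a function `f` on the bundle `L(TN, F)`. -/
def fibreLocal (f : N → (E →L[ℝ] F) → ℝ) (c : N) (q : E × (E →L[ℝ] F)) : ℝ :=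
  f ((extChartAt I c).symm q.1)
    (q.2.comp (tder I 𝓘(ℝ, E) (extChartAt I c) ((extChartAt I c).symm q.1)))

variable (I) in
/-- Smoothness of a function on the bundle `L(TN, F)`. -/
def SmoothFibreFun (f : N → (E →L[ℝ] F) → ℝ) : Prop :=
  ∀ c : N, ContDiffOn ℝ ∞ (fibreLocal I f c) ((extChartAt I c).target ×ˢ Set.univ)

/-- The fibre derivative of a function on `L(TN, F)` along a one-form `σ`. -/
def fibreD (f : N → (E →L[ℝ] F) → ℝ) (σ : N → E →L[ℝ] F) (x : N) : (E →L[ℝ] F) →ₗ[ℝ] ℝ :=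
  (fderiv ℝ (f x) (σ x) : (E →L[ℝ] F) →ₗ[ℝ] ℝ)

theorem SmoothFibreFun.contDiffAt {f : N → (E →L[ℝ] F) → ℝ} (hf : SmoothFibreFun I f) {c : N}
    {y : E} (hy : y ∈ (extChartAt I c).target) (A : E →L[ℝ] F) :
    ContDiffAt ℝ ∞ (fibreLocal I f c) (y, A) :=
  (hf c (y, A) ⟨hy, trivial⟩).contDiffAt
    (((isOpen_extChartAt_target c).prod isOpen_univ).mem_nhds ⟨hy, trivial⟩)

theorem fibreLocal_comp (f : N → (E →L[ℝ] F) → ℝ) {c : N} {y : E}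
    (hy : y ∈ (extChartAt I c).target) (A : E →L[ℝ] F) :
    fibreLocal I f c (y, A.comp (tder 𝓘(ℝ, E) I (extChartAt I c).symm y)) =
      f ((extChartAt I c).symm y) A := by
  rw [fibreLocal]
  simp only [ContinuousLinearMap.comp_assoc]
  rw [tder_symm_comp_tder_chart hy, ContinuousLinearMap.comp_id]

theorem SmoothFibreFun.differentiableAt {f : N → (E →L[ℝ] F) → ℝ} (hf : SmoothFibreFun I f)
    (x : N) (A : E →L[ℝ] F) : DifferentiableAt ℝ (f x) A := by
  have h1 : f x = fun B : E →L[ℝ] F => fibreLocal I f x (extChartAt I x x,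
      B.comp (tder 𝓘(ℝ, E) I (extChartAt I x).symm (extChartAt I x x))) := by
    funext B
    rw [fibreLocal_comp f (mem_extChartAt_target x), extChartAt_to_inv]
  rw [h1]
  refine DifferentiableAt.comp (g := fibreLocal I f x) A
    ((hf.contDiffAt (mem_extChartAt_target x) _).differentiableAt (by simp)) ?_
  refine (differentiableAt_const _).prodMk ?_
  exact ((ContinuousLinearMap.compL ℝ E E F).flip
    (tder 𝓘(ℝ, E) I (extChartAt I x).symm (extChartAt I x x))).differentiableAt

theorem SmoothFibreFun.hasDerivAt {f : N → (E →L[ℝ] F) → ℝ} (hf : SmoothFibreFun I f)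
    {σ : N → E →L[ℝ] F} {x : N} {τ : ℝ → E →L[ℝ] F} {τ' : E →L[ℝ] F} {t : ℝ}
    (h0 : τ t = σ x) (hτ : HasDerivAt τ τ' t) :
    HasDerivAt (fun ε => f x (τ ε)) (fibreD f σ x τ') t :=
  HasFDerivAt.comp_hasDerivAt t (f := τ) (l := f x) (l' := fderiv ℝ (f x) (σ x))
    (by rw [h0]; exact (hf.differentiableAt x (σ x)).hasFDerivAt) hτ

/-- The fibre derivative of a smooth function along a smooth one-form is a smooth dual field. -/
theorem SmoothFibreFun.smoothDualField {f : N → (E →L[ℝ] F) → ℝ} (hf : SmoothFibreFun I f)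
    {σ : N → E →L[ℝ] F} {U : Set N} (hσ : ∀ x ∈ U, SmoothFormAt I σ x) :
    SmoothDualField I (fibreD f σ) U := by
  intro c A y hy
  have hs := (extChartAt I c).map_target hy.1
  have h1 := hσ _ hy.2 c hs
  rw [(extChartAt I c).right_inv hy.1] at h1
  set σ' : E → E →L[ℝ] F := fun y => (σ ((extChartAt I c).symm y)).comp
    (tder 𝓘(ℝ, E) I (extChartAt I c).symm y) with hσ'
  have h2 : ContDiffAt ℝ ∞ (fun y => fderiv ℝ (fibreLocal I f c) (y, σ' y) (0, A)) y := by
    refine ContDiffAt.clm_apply ?_ contDiffAt_const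
    exact ContDiffAt.comp (g := fderiv ℝ (fibreLocal I f c)) (f := fun y => (y, σ' y)) y
      ((hf.contDiffAt hy.1 _).fderiv_right (m := ∞) (by simp)) (contDiffAt_id.prodMk h1)
  refine (h2.congr_of_eventuallyEq ?_).contDiffWithinAt
  filter_upwards [(isOpen_extChartAt_target (I := I) c).mem_nhds hy.1] with z hz
  have h3 : f ((extChartAt I c).symm z) = fun B => fibreLocal I f c
      (z, B.comp (tder 𝓘(ℝ, E) I (extChartAt I c).symm z)) := by
    funext B; rw [fibreLocal_comp f hz]
  have h4 : HasFDerivAt (fun B : E →L[ℝ] F => (z, B.comp (tder 𝓘(ℝ, E) I (extChartAt I c).symm z)))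
      ((0 : (E →L[ℝ] F) →L[ℝ] E).prod ((ContinuousLinearMap.compL ℝ E E F).flip
        (tder 𝓘(ℝ, E) I (extChartAt I c).symm z))) (σ ((extChartAt I c).symm z)) :=
    (hasFDerivAt_const _ _).prodMk ((ContinuousLinearMap.compL ℝ E E F).flip
        (tder 𝓘(ℝ, E) I (extChartAt I c).symm z)).hasFDerivAt
  have h5 := HasFDerivAt.comp (g := fibreLocal I f c)
    (f := fun B : E →L[ℝ] F => (z, B.comp (tder 𝓘(ℝ, E) I (extChartAt I c).symm z)))
    (σ ((extChartAt I c).symm z))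
    ((hf.contDiffAt hz _).differentiableAt (by simp)).hasFDerivAt h4
  rw [fieldComp, fibreD, h3]
  have h6 := h5.fderiv
  simp only [Function.comp_def] at h6
  rw [ContinuousLinearMap.coe_coe, h6]
  simp only [ContinuousLinearMap.comp_apply, ContinuousLinearMap.prod_apply,
    ContinuousLinearMap.flip_apply, ContinuousLinearMap.compL_apply,
    zero_apply, ContinuousLinearMap.comp_assoc]
  rw [tder_chart_comp_tder_symm hz, ContinuousLinearMap.comp_id]

theorem SmoothFibreFun.contMDiffAt {f : N → (E →L[ℝ] F) → ℝ} (hf : SmoothFibreFun I f)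
    {τ : ℝ → N → E →L[ℝ] F} {p : ℝ × N} (hτ : SmoothFamilyAt I τ p) :
    ContMDiffAt (𝓘(ℝ, ℝ).prod I) 𝓘(ℝ, ℝ) ∞ (fun q : ℝ × N => f q.2 (τ q.1 q.2)) p := by
  set φ := extChartAt I p.2 with hφ
  set τ' : ℝ × E → E →L[ℝ] F := fun q => (τ q.1 (φ.symm q.2)).comp
    (tder 𝓘(ℝ, E) I φ.symm q.2) with hτ'
  have h1 : ContDiffAt ℝ ∞ τ' (p.1, φ p.2) := hτ p.2 (mem_extChartAt_source p.2)
  have h2 : ContDiffAt ℝ ∞ (fun q : ℝ × E => fibreLocal I f p.2 (q.2, τ' q)) (p.1, φ p.2) :=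
    ContDiffAt.comp (g := fibreLocal I f p.2) (f := fun q : ℝ × E => (q.2, τ' q)) (p.1, φ p.2)
      (hf.contDiffAt (mem_extChartAt_target p.2) _) (contDiffAt_snd.prodMk h1)
  have h3 : ContMDiffAt (𝓘(ℝ, ℝ).prod I) 𝓘(ℝ, ℝ × E) ∞ (fun q : ℝ × N => (q.1, φ q.2)) p :=
    contMDiffAt_fst.prodMk_space
      (ContMDiffAt.comp (g := φ) (f := Prod.snd) p contMDiffAt_extChartAt contMDiffAt_snd)
  have h4 := ContMDiffAt.comp (g := fun q : ℝ × E => fibreLocal I f p.2 (q.2, τ' q)) p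
    (contMDiffAt_iff_contDiffAt.2 h2) h3
  refine h4.congr_of_eventuallyEq ?_
  have : ∀ᶠ q in 𝓝 p, q.2 ∈ φ.source := continuousAt_snd.eventually_mem
    ((isOpen_extChartAt_source (I := I) p.2).mem_nhds (mem_extChartAt_source p.2))
  filter_upwards [this] with q hq
  simp only [Function.comp_def, hτ']
  rw [fibreLocal_comp f (φ.map_source hq), φ.left_inv hq]

theorem SmoothFamilyAt.smoothFormAt {τ : ℝ → N → E →L[ℝ] F} {p : ℝ × N}
    (h : SmoothFamilyAt I τ p) : SmoothFormAt I (τ p.1) p.2 := fun c hc =>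
  ContDiffAt.comp (g := fun q : ℝ × E => (τ q.1 ((extChartAt I c).symm q.2)).comp
      (tder 𝓘(ℝ, E) I (extChartAt I c).symm q.2)) (f := fun y => (p.1, y)) _ (h c hc)
    (contDiffAt_const.prodMk contDiffAt_id)

theorem SmoothFormAt.add_smul {σ β : N → E →L[ℝ] F} {x : N} (hσ : SmoothFormAt I σ x)
    (hβ : SmoothFormAt I β x) (t : ℝ) :
    SmoothFamilyAt I (fun ε x => σ x + ε • β x) (t, x) := fun c hc => by
  have h1 := ContDiffAt.comp (t, extChartAt I c x) (f := fun q : ℝ × E => q.2) (hσ c hc)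
    contDiffAt_snd
  have h2 := ContDiffAt.comp (t, extChartAt I c x) (f := fun q : ℝ × E => q.2) (hβ c hc)
    contDiffAt_snd
  have h3 := h1.add ((contDiffAt_fst (𝕜 := ℝ) (E := ℝ) (F := E)).smul h2)
  refine h3.congr_of_eventuallyEq (Filter.Eventually.of_forall fun q => ?_)
  ext v
  simp

theorem SmoothFormAt.sub {σ β : N → E →L[ℝ] F} {x : N} (hσ : SmoothFormAt I σ x)
    (hβ : SmoothFormAt I β x) : SmoothFormAt I (fun x => σ x - β x) x := fun c hc => by
  refine ((hσ c hc).sub (hβ c hc)).congr_of_eventuallyEq (Filter.Eventually.of_forall fun q => ?_)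
  ext v
  simp

theorem smoothFormAt_tder {η : N → F} {x : N} (hη : ContMDiffAt I 𝓘(ℝ, F) ∞ η x) :
    SmoothFormAt I (fun x => tder I 𝓘(ℝ, F) η x) x := fun c hc => by
  have hy := (extChartAt I c).map_source hc
  have h0 : ContMDiffAt I 𝓘(ℝ, F) ∞ η ((extChartAt I c).symm (extChartAt I c x)) := by
    rwa [(extChartAt I c).left_inv hc]
  have h1 := (contDiffAt_of_contMDiffAt hy h0).fderiv_right (m := ∞) (by simp)
  refine h1.congr_of_eventuallyEq ?_
  have hev := (contMDiffAt_iff_contMDiffAt_nhds (by simp)).1 (h0.of_le (m := 1) (by simp))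
  have hc' := (contMDiffAt_chart_symm hy).continuousAt
  filter_upwards [(isOpen_extChartAt_target (I := I) c).mem_nhds hy, hc'.eventually hev] with z hz hd
  rw [tder_eq_fderiv_comp hz (hd.mdifferentiableAt (by simp)), ContinuousLinearMap.comp_assoc,
    tder_chart_comp_tder_symm hz, ContinuousLinearMap.comp_id]

end Forms

/-! ### Variations of the right logarithmic derivative -/

section LieForms

variable {E : Type*} [NormedAddCommGroup E] [NormedSpace ℝ E]
  {H : Type*} [TopologicalSpace H] {I : ModelWithCorners ℝ E H} [I.Boundaryless]
  {N : Type*} [TopologicalSpace N] [ChartedSpace H N] [IsManifold I ∞ N]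
  {EG : Type*} [NormedAddCommGroup EG] [NormedSpace ℝ EG] [FiniteDimensional ℝ EG]
  {G : Type*} [TopologicalSpace G] [ChartedSpace EG G] [Group G] [LieGroup 𝓘(ℝ, EG) ∞ G]

variable (EG G) in
/-- The map `b ↦ (a ↦ [a, b])` as a continuous linear map. -/
def adRightL : EG →L[ℝ] EG →L[ℝ] EG :=
  let B : EG →L[ℝ] EG →L[ℝ] EG := (((chartMulHess EG G).comp (.inl ℝ EG EG)).flip.comp
    (.inr ℝ EG EG))
  B - B.flip

theorem adRightL_apply (b : EG) : adRightL EG G b = adRight G b := by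
  ext a
  simp [adRightL, adRight_apply]

theorem adRight_swap (a b : EG) : adRight G a b = -adRight G b a := by
  rw [adRight_apply, adRight_apply, neg_sub]

theorem SmoothFormAt.adRight_comp {σ : N → E →L[ℝ] EG} {η : N → EG} {x : N}
    (hσ : SmoothFormAt I σ x) (hη : ContMDiffAt I 𝓘(ℝ, EG) ∞ η x) :
    SmoothFormAt I (fun x => (adRight G (η x)).comp (σ x)) x := fun c hc => by
  have hy := (extChartAt I c).map_source hc
  have h0 : ContMDiffAt I 𝓘(ℝ, EG) ∞ η ((extChartAt I c).symm (extChartAt I c x)) := by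
    rwa [(extChartAt I c).left_inv hc]
  have h1 := (adRightL EG G).contDiff.contDiffAt.comp _ (contDiffAt_of_contMDiffAt hy h0)
  refine (h1.clm_comp (hσ c hc)).congr_of_eventuallyEq (Filter.Eventually.of_forall fun q => ?_)
  simp only [Function.comp_def, adRightL_apply]
  rw [ContinuousLinearMap.comp_assoc]

/-- The right logarithmic derivative of a family `S`, as a map of the parameter and the coordinates
jointly, has the velocity and the right logarithmic derivative of `S ε` as its components. -/
theorem rightDer_prod {S : ℝ → N → G} {ε : ℝ} {c : N} {y : E} (hy : y ∈ (extChartAt I c).target)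
    (hS : MDifferentiableAt (𝓘(ℝ, ℝ).prod I) 𝓘(ℝ, EG) (fun q : ℝ × N => S q.1 q.2)
      (ε, (extChartAt I c).symm y)) :
    rightDer 𝓘(ℝ, ℝ × E) (EG := EG) (fun q : ℝ × E => S q.1 ((extChartAt I c).symm q.2)) (ε, y) =
      (rightDer 𝓘(ℝ, ℝ) (EG := EG) (fun t => S t ((extChartAt I c).symm y)) ε).coprod
      ((rightDer I (EG := EG) (S ε) ((extChartAt I c).symm y)).comp
        (tder 𝓘(ℝ, E) I (extChartAt I c).symm y)) := by
  set φ := extChartAt I c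
  have hsym := (contMDiffAt_chart_symm (I := I) hy).mdifferentiableAt (by simp)
  have hpair : MDifferentiableAt 𝓘(ℝ, ℝ × E) (𝓘(ℝ, ℝ).prod I)
      (fun q : ℝ × E => (q.1, φ.symm q.2)) (ε, y) := by
    refine MDifferentiableAt.prodMk differentiableAt_fst.mdifferentiableAt ?_
    exact MDifferentiableAt.comp (g := φ.symm) (I' := 𝓘(ℝ, E)) (f := Prod.snd) (ε, y) hsym
      differentiableAt_snd.mdifferentiableAt
  have hT : MDifferentiableAt 𝓘(ℝ, ℝ × E) 𝓘(ℝ, EG) (fun q : ℝ × E => S q.1 (φ.symm q.2)) (ε, y) :=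
    MDifferentiableAt.comp (g := fun q : ℝ × N => S q.1 q.2) (I' := 𝓘(ℝ, ℝ).prod I) (ε, y) hS hpair
  have hSε : MDifferentiableAt I 𝓘(ℝ, EG) (S ε) (φ.symm y) :=
    MDifferentiableAt.comp (g := fun q : ℝ × N => S q.1 q.2) (I' := 𝓘(ℝ, ℝ).prod I)
      (f := fun x => (ε, x)) (φ.symm y) hS (mdifferentiableAt_const.prodMk mdifferentiableAt_id)
  have h1 := rightDer_comp (I := 𝓘(ℝ, ℝ × E)) (I' := 𝓘(ℝ, ℝ)) (EG := EG)
    (S := fun q : ℝ × E => S q.1 (φ.symm q.2)) (f := fun t : ℝ => (t, y)) (x := ε) hT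
    (differentiableAt_id.prodMk (differentiableAt_const y)).mdifferentiableAt
  have h2 := rightDer_comp (I := 𝓘(ℝ, ℝ × E)) (I' := 𝓘(ℝ, E)) (EG := EG)
    (S := fun q : ℝ × E => S q.1 (φ.symm q.2)) (f := fun z : E => (ε, z)) (x := y) hT
    ((differentiableAt_const ε).prodMk differentiableAt_id).mdifferentiableAt
  have h3 := rightDer_comp (I := I) (I' := 𝓘(ℝ, E)) (EG := EG)
    (S := S ε) (f := φ.symm) (x := y) hSε hsym
  rw [tder_eq_fderiv] at h1 h2
  rw [(hasFDerivAt_prodMk_left (𝕜 := ℝ) ε y).fderiv] at h1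
  rw [(hasFDerivAt_prodMk_right (𝕜 := ℝ) ε y).fderiv] at h2
  simp only at h1 h2
  rw [← h3, h1, h2]
  ext v <;> simp

theorem contMDiffAt_family_chart {S : ℝ → N → G} {ε : ℝ} {c : N} {y : E}
    (hy : y ∈ (extChartAt I c).target)
    (hS : ContMDiffAt (𝓘(ℝ, ℝ).prod I) 𝓘(ℝ, EG) ∞ (fun q : ℝ × N => S q.1 q.2)
      (ε, (extChartAt I c).symm y)) :
    ContMDiffAt 𝓘(ℝ, ℝ × E) 𝓘(ℝ, EG) ∞ (fun q : ℝ × E => S q.1 ((extChartAt I c).symm q.2))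
      (ε, y) := by
  refine ContMDiffAt.comp (g := fun q : ℝ × N => S q.1 q.2) (I' := 𝓘(ℝ, ℝ).prod I)
    (f := fun q : ℝ × E => (q.1, (extChartAt I c).symm q.2)) (ε, y) hS ?_
  refine ContMDiffAt.prodMk contDiffAt_fst.contMDiffAt ?_
  exact ContMDiffAt.comp (g := (extChartAt I c).symm) (I' := 𝓘(ℝ, E)) (f := Prod.snd) (ε, y)
    (contMDiffAt_chart_symm hy) contDiffAt_snd.contMDiffAt

theorem eventually_rightDer_prod {S : ℝ → N → G} {ε : ℝ} {c : N} {y : E}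
    (hy : y ∈ (extChartAt I c).target)
    (hS : ContMDiffAt (𝓘(ℝ, ℝ).prod I) 𝓘(ℝ, EG) ∞ (fun q : ℝ × N => S q.1 q.2)
      (ε, (extChartAt I c).symm y)) :
    ∀ᶠ q : ℝ × E in 𝓝 (ε, y),
      rightDer 𝓘(ℝ, ℝ × E) (EG := EG) (fun q : ℝ × E => S q.1 ((extChartAt I c).symm q.2)) q =
      (rightDer 𝓘(ℝ, ℝ) (EG := EG) (fun t => S t ((extChartAt I c).symm q.2)) q.1).coprod
      ((rightDer I (EG := EG) (S q.1) ((extChartAt I c).symm q.2)).comp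
        (tder 𝓘(ℝ, E) I (extChartAt I c).symm q.2)) := by
  have hev := (contMDiffAt_iff_contMDiffAt_nhds (by simp)).1 (hS.of_le (m := 1) (by simp))
  have hcont : ContinuousAt (fun q : ℝ × E => (q.1, (extChartAt I c).symm q.2)) (ε, y) :=
    continuousAt_fst.prodMk (ContinuousAt.comp (f := Prod.snd) (x := (ε, y))
      (contMDiffAt_chart_symm hy).continuousAt continuousAt_snd)
  have hT : ∀ᶠ q : ℝ × E in 𝓝 (ε, y), q.2 ∈ (extChartAt I c).target :=
    continuousAt_snd.eventually_mem ((isOpen_extChartAt_target (I := I) c).mem_nhds hy)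
  filter_upwards [hcont.eventually hev, hT] with q hq hqT
  exact rightDer_prod hqT (hq.mdifferentiableAt (by simp))

theorem smoothFamilyAt_rightDer {S : ℝ → N → G} {p : ℝ × N}
    (hS : ContMDiffAt (𝓘(ℝ, ℝ).prod I) 𝓘(ℝ, EG) ∞ (fun q : ℝ × N => S q.1 q.2) p) :
    SmoothFamilyAt I (fun ε x => rightDer I (EG := EG) (S ε) x) p := fun c hc => by
  have hy := (extChartAt I c).map_source hc
  have hS' : ContMDiffAt (𝓘(ℝ, ℝ).prod I) 𝓘(ℝ, EG) ∞ (fun q : ℝ × N => S q.1 q.2)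
      (p.1, (extChartAt I c).symm (extChartAt I c p.2)) := by
    rwa [(extChartAt I c).left_inv hc]
  have h1 := contDiffAt_rightDer (contMDiffAt_family_chart hy hS')
  have h2 := h1.clm_comp (contDiffAt_const (c := ContinuousLinearMap.inr ℝ ℝ E))
  refine h2.congr_of_eventuallyEq ?_
  filter_upwards [eventually_rightDer_prod hy hS'] with q hq
  rw [hq]
  ext v
  simp

theorem smoothFormAt_rightDer {s : N → G} {x : N} (hs : ContMDiffAt I 𝓘(ℝ, EG) ∞ s x) :
    SmoothFormAt I (fun x => rightDer I (EG := EG) s x) x :=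
  (smoothFamilyAt_rightDer (S := fun _ => s) (p := (0, x))
    (ContMDiffAt.comp (g := s) (f := Prod.snd) ((0 : ℝ), x) hs contMDiffAt_snd)).smoothFormAt

/-- The right trivialized velocity at parameter `0` of a one-parameter family of maps. -/
def varField (EG : Type*) [NormedAddCommGroup EG] [NormedSpace ℝ EG] {G : Type*}
    [TopologicalSpace G] [ChartedSpace EG G] [Group G] {N : Type*} (S : ℝ → N → G) (x : N) : EG :=
  rightDer 𝓘(ℝ, ℝ) (EG := EG) (fun t => S t x) 0 1

theorem contMDiffAt_varField {S : ℝ → N → G} {x : N}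
    (hS : ContMDiffAt (𝓘(ℝ, ℝ).prod I) 𝓘(ℝ, EG) ∞ (fun q : ℝ × N => S q.1 q.2) (0, x)) :
    ContMDiffAt I 𝓘(ℝ, EG) ∞ (varField EG S) x := by
  refine contMDiffAt_of_contDiffAt (mem_extChartAt_source x) ?_
  have hy := mem_extChartAt_target (I := I) x
  have hS' : ContMDiffAt (𝓘(ℝ, ℝ).prod I) 𝓘(ℝ, EG) ∞ (fun q : ℝ × N => S q.1 q.2)
      (0, (extChartAt I x).symm (extChartAt I x x)) := by
    rwa [extChartAt_to_inv]
  have h1 := contDiffAt_rightDer (contMDiffAt_family_chart hy hS')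
  have hpair : ContDiffAt ℝ ∞ (fun y : E => ((0 : ℝ), y)) (extChartAt I x x) :=
    contDiffAt_const.prodMk contDiffAt_id
  have h2 := (h1.comp _ hpair).clm_apply (contDiffAt_const (c := ((1 : ℝ), (0 : E))))
  refine h2.congr_of_eventuallyEq ?_
  filter_upwards [hpair.continuousAt.eventually (eventually_rightDer_prod hy hS')] with q hq
  simp only [Function.comp_def]
  rw [hq]
  simp [varField]

/-- The variation of the right logarithmic derivative `σ` of a family with right trivialized
velocity `η` is `dη - [σ, η]`. -/
theorem hasDerivAt_rightDer {S : ℝ → N → G} {x : N}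
    (hS : ContMDiffAt (𝓘(ℝ, ℝ).prod I) 𝓘(ℝ, EG) ∞ (fun q : ℝ × N => S q.1 q.2) (0, x)) :
    HasDerivAt (fun ε => rightDer I (EG := EG) (S ε) x)
      (tder I 𝓘(ℝ, EG) (varField EG S) x -
        (adRight G (varField EG S x)).comp (rightDer I (S 0) x)) 0 := by
  set φ := extChartAt I x with hφ
  have hy := mem_extChartAt_target (I := I) x
  have hS' : ContMDiffAt (𝓘(ℝ, ℝ).prod I) 𝓘(ℝ, EG) ∞ (fun q : ℝ × N => S q.1 q.2)
      (0, φ.symm (φ x)) := by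
    rwa [extChartAt_to_inv]
  have hT := contMDiffAt_family_chart hy hS'
  set κ : ℝ × E → (ℝ × E →L[ℝ] EG) := rightDer 𝓘(ℝ, ℝ × E) (EG := EG)
    (fun q : ℝ × E => S q.1 (φ.symm q.2)) with hκ
  have hκd : HasFDerivAt κ (fderiv ℝ κ (0, φ x)) (0, φ x) :=
    ((contDiffAt_rightDer hT).differentiableAt (by simp)).hasFDerivAt
  have hev : ∀ᶠ q : ℝ × E in 𝓝 (0, φ x), κ q =
      (rightDer 𝓘(ℝ, ℝ) (EG := EG) (fun t => S t (φ.symm q.2)) q.1).coprod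
      ((rightDer I (EG := EG) (S q.1) (φ.symm q.2)).comp (tder 𝓘(ℝ, E) I φ.symm q.2)) :=
    eventually_rightDer_prod hy hS'
  have hxx : φ.symm (φ x) = x := extChartAt_to_inv x
  have hself : tder 𝓘(ℝ, E) I φ.symm (φ x) = ContinuousLinearMap.id ℝ E := tder_chart_symm_self x
  -- the derivative of `κ` in the direction of the parameter
  have hε : HasDerivAt (fun ε : ℝ => (κ (ε, φ x)).comp (ContinuousLinearMap.inr ℝ ℝ E))
      ((fderiv ℝ κ (0, φ x) (1, 0)).comp (ContinuousLinearMap.inr ℝ ℝ E)) 0 := by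
    have h1 : HasDerivAt (fun ε : ℝ => (ε, φ x)) ((1 : ℝ), (0 : E)) 0 :=
      (hasDerivAt_id _).prodMk (hasDerivAt_const _ _)
    have h2 := HasFDerivAt.comp_hasDerivAt (0 : ℝ) (f := fun ε : ℝ => (ε, φ x)) (l := κ) hκd h1
    have h3 := (((ContinuousLinearMap.compL ℝ E (ℝ × E) EG).flip
      (ContinuousLinearMap.inr ℝ ℝ E)).hasFDerivAt).comp_hasDerivAt (0 : ℝ) h2
    exact h3
  have hε' : HasDerivAt (fun ε => rightDer I (EG := EG) (S ε) x)
      ((fderiv ℝ κ (0, φ x) (1, 0)).comp (ContinuousLinearMap.inr ℝ ℝ E)) 0 := by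
    refine hε.congr_of_eventuallyEq ?_
    have hc : ContinuousAt (fun ε : ℝ => (ε, φ x)) 0 := (Continuous.prodMk_left (φ x)).continuousAt
    filter_upwards [hc.eventually hev] with ε h
    rw [h, hxx, hself]
    ext v
    simp
  -- the spatial derivative of the velocity
  have hη : tder I 𝓘(ℝ, EG) (varField EG S) x =
      (ContinuousLinearMap.apply ℝ EG ((1 : ℝ), (0 : E))).comp
        ((fderiv ℝ κ (0, φ x)).comp (ContinuousLinearMap.inr ℝ ℝ E)) := by
    have h1 := tder_eq_fderiv_comp (f := varField EG S) hy
      (by rw [hxx]; exact (contMDiffAt_varField hS).mdifferentiableAt (by simp))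
    have h0 : tder I 𝓘(ℝ, E) φ x = ContinuousLinearMap.id ℝ E := tder_chart_self x
    rw [← hφ, hxx, h0, ContinuousLinearMap.comp_id] at h1
    rw [h1]
    have h2 := HasFDerivAt.comp (φ x) (f := fun y : E => ((0 : ℝ), y)) hκd
      (hasFDerivAt_prodMk_right (𝕜 := ℝ) (0 : ℝ) (φ x))
    have h3 := ((ContinuousLinearMap.apply ℝ EG ((1 : ℝ), (0 : E))).hasFDerivAt).comp (φ x) h2
    refine HasFDerivAt.fderiv (h3.congr_of_eventuallyEq ?_)
    have hc : ContinuousAt (fun y : E => ((0 : ℝ), y)) (φ x) :=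
      (Continuous.prodMk_right (0 : ℝ)).continuousAt
    filter_upwards [hc.eventually hev] with z hz
    simp only [Function.comp_def, ContinuousLinearMap.apply_apply]
    rw [hz]
    simp [varField]
  convert hε' using 1
  rw [hη]
  ext v
  have hκ0 := hev.self_of_nhds
  -- the structure equation for the parameter direction and a space direction
  have hst := fderiv_rightDer_sub hT (1, 0) (0, v)
  rw [← hκ] at hst
  have e1 : κ (0, φ x) (1, 0) = varField EG S x := by
    rw [hκ0, hxx]; simp [varField]
  have e2 : κ (0, φ x) (0, v) = rightDer I (EG := EG) (S 0) x v := by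
    rw [hκ0, hxx, hself]; simp
  rw [e1, e2, adRight_swap] at hst
  simp only [sub_apply, ContinuousLinearMap.comp_apply, ContinuousLinearMap.inr_apply,
    ContinuousLinearMap.apply_apply]
  rw [sub_eq_iff_eq_add] at hst
  rw [hst]
  abel

end LieForms

/-! ### Differentiation under the integral sign -/

section Parameter

variable {E : Type*} [NormedAddCommGroup E] [NormedSpace ℝ E]
  {H : Type*} [TopologicalSpace H] {I : ModelWithCorners ℝ E H} [I.Boundaryless]
  {N : Type*} [TopologicalSpace N] [ChartedSpace H N] [IsManifold I ∞ N]
  {F : Type*} [NormedAddCommGroup F] [NormedSpace ℝ F]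

theorem ContMDiffAt.eventually_infty {E' : Type*} [NormedAddCommGroup E'] [NormedSpace ℝ E']
    {H' : Type*} [TopologicalSpace H'] {I' : ModelWithCorners ℝ E' H'} {N' : Type*}
    [TopologicalSpace N'] [ChartedSpace H' N'] [IsManifold I' ∞ N'] {f : N → N'} {x : N}
    (h : ContMDiffAt I I' ∞ f x) : ∀ᶠ y in 𝓝 x, ContMDiffAt I I' 1 f y :=
  (contMDiffAt_iff_contMDiffAt_nhds (by simp)).1 (h.of_le (m := 1) (by simp))

theorem ContMDiffAt.slice_left {E' : Type*} [NormedAddCommGroup E'] [NormedSpace ℝ E']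
    {H' : Type*} [TopologicalSpace H'] {I' : ModelWithCorners ℝ E' H'} {N' : Type*}
    [TopologicalSpace N'] [ChartedSpace H' N'] {k : WithTop ℕ∞} {g : ℝ → N → N'} {t : ℝ} {x : N}
    (hg : ContMDiffAt (𝓘(ℝ, ℝ).prod I) I' k (fun q : ℝ × N => g q.1 q.2) (t, x)) :
    ContMDiffAt 𝓘(ℝ, ℝ) I' k (fun ε => g ε x) t :=
  ContMDiffAt.comp (g := fun q : ℝ × N => g q.1 q.2) (I' := 𝓘(ℝ, ℝ).prod I)
    (f := fun ε => (ε, x)) t hg (contMDiffAt_id.prodMk contMDiffAt_const)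

theorem ContMDiffAt.slice_right {E' : Type*} [NormedAddCommGroup E'] [NormedSpace ℝ E']
    {H' : Type*} [TopologicalSpace H'] {I' : ModelWithCorners ℝ E' H'} {N' : Type*}
    [TopologicalSpace N'] [ChartedSpace H' N'] {k : WithTop ℕ∞} {g : ℝ → N → N'} {t : ℝ} {x : N}
    (hg : ContMDiffAt (𝓘(ℝ, ℝ).prod I) I' k (fun q : ℝ × N => g q.1 q.2) (t, x)) :
    ContMDiffAt I I' k (g t) x :=
  ContMDiffAt.comp (g := fun q : ℝ × N => g q.1 q.2) (I' := 𝓘(ℝ, ℝ).prod I)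
    (f := fun y => (t, y)) x hg (contMDiffAt_const.prodMk contMDiffAt_id)

/-- The partial derivative in the parameter of a jointly smooth family is jointly smooth. -/
theorem contMDiffAt_deriv {g : ℝ → N → F} {p : ℝ × N}
    (hg : ContMDiffAt (𝓘(ℝ, ℝ).prod I) 𝓘(ℝ, F) ∞ (fun q : ℝ × N => g q.1 q.2) p) :
    ContMDiffAt (𝓘(ℝ, ℝ).prod I) 𝓘(ℝ, F) ∞
      (fun q : ℝ × N => deriv (fun ε => g ε q.2) q.1) p := by
  set φ := extChartAt I p.2 with hφ
  have hy : φ p.2 ∈ φ.target := mem_extChartAt_target p.2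
  have hsym := contMDiffAt_chart_symm (I := I) hy
  set T : ℝ × E → F := fun q => g q.1 (φ.symm q.2) with hT
  have h1 : ContDiffAt ℝ ∞ T (p.1, φ p.2) := by
    refine contMDiffAt_iff_contDiffAt.1 ?_
    refine ContMDiffAt.comp (g := fun q : ℝ × N => g q.1 q.2) (I' := 𝓘(ℝ, ℝ).prod I)
      (f := fun q : ℝ × E => (q.1, φ.symm q.2)) (p.1, φ p.2) ?_ ?_
    · have : (p.1, φ.symm (φ p.2)) = p := by rw [hφ, extChartAt_to_inv]
      rw [this]; exact hg
    · refine ContMDiffAt.prodMk contDiffAt_fst.contMDiffAt ?_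
      exact ContMDiffAt.comp (g := φ.symm) (I' := 𝓘(ℝ, E)) (f := Prod.snd) (p.1, φ p.2)
        hsym contDiffAt_snd.contMDiffAt
  have h2 : ContDiffAt ℝ ∞ (fun q => fderiv ℝ T q (1, 0)) (p.1, φ p.2) :=
    (h1.fderiv_right (m := ∞) (by simp)).clm_apply contDiffAt_const
  have h3 : ContMDiffAt (𝓘(ℝ, ℝ).prod I) 𝓘(ℝ, ℝ × E) ∞ (fun q : ℝ × N => (q.1, φ q.2)) p :=
    contMDiffAt_fst.prodMk_space
      (ContMDiffAt.comp (g := φ) (f := Prod.snd) p contMDiffAt_extChartAt contMDiffAt_snd)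
  have h4 := ContMDiffAt.comp (g := fun q => fderiv ℝ T q (1, 0)) p
    (contMDiffAt_iff_contDiffAt.2 h2) h3
  refine h4.congr_of_eventuallyEq ?_
  have hsrc : ∀ᶠ q in 𝓝 p, q.2 ∈ φ.source := continuousAt_snd.eventually_mem
    ((isOpen_extChartAt_source (I := I) p.2).mem_nhds (mem_extChartAt_source p.2))
  have hd := (h1.of_le (m := 1) (by simp)).eventually (by simp)
  filter_upwards [hsrc, h3.continuousAt.eventually hd] with q hq hdq
  have h5 : HasDerivAt (fun ε : ℝ => T (ε, φ q.2)) (fderiv ℝ T (q.1, φ q.2) (1, 0)) q.1 :=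
    HasFDerivAt.comp_hasDerivAt q.1 (f := fun ε : ℝ => (ε, φ q.2)) (l := T)
      (hdq.differentiableAt (by simp)).hasFDerivAt
      ((hasDerivAt_id _).prodMk (hasDerivAt_const _ _))
  have h6 : (fun ε : ℝ => T (ε, φ q.2)) = fun ε => g ε q.2 := by
    funext ε
    simp only [hT]
    rw [φ.left_inv hq]
  rw [h6] at h5
  exact h5.deriv

variable [T2Space N] [SecondCountableTopology N] [MeasurableSpace N] [BorelSpace N]

/-- A family that is smooth at the points of `{t} × K` is continuously differentiable at those of
`[t - δ, t + δ] × K`, by the tube lemma. -/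
theorem eventually_forall_mem_contMDiffAt {E' : Type*} [NormedAddCommGroup E'] [NormedSpace ℝ E']
    {H' : Type*} [TopologicalSpace H'] {I' : ModelWithCorners ℝ E' H'} {N' : Type*}
    [TopologicalSpace N'] [ChartedSpace H' N'] [IsManifold I' ∞ N'] {g : ℝ → N → N'} {K : Set N}
    (hK : IsCompact K) {t : ℝ}
    (hg : ∀ x ∈ K, ContMDiffAt (𝓘(ℝ, ℝ).prod I) I' ∞ (fun q : ℝ × N => g q.1 q.2) (t, x)) :
    ∃ δ > 0, ∀ ε ∈ Metric.closedBall t δ, ∀ x ∈ K,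
      ContMDiffAt (𝓘(ℝ, ℝ).prod I) I' 1 (fun q : ℝ × N => g q.1 q.2) (ε, x) := by
  set O : Set (ℝ × N) := interior {q | ContMDiffAt (𝓘(ℝ, ℝ).prod I) I' 1
    (fun q : ℝ × N => g q.1 q.2) q}
  have hO : {t} ×ˢ K ⊆ O := by
    rintro ⟨ε, x⟩ ⟨rfl, hx⟩
    exact mem_interior_iff_mem_nhds.2 (hg x hx).eventually_infty
  obtain ⟨u, v, hu, -, htu, hKv, huv⟩ := generalized_tube_lemma isCompact_singleton hK
    isOpen_interior hO
  obtain ⟨δ, hδ, hball⟩ := Metric.isOpen_iff.1 hu t (htu rfl)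
  refine ⟨δ / 2, by positivity, fun ε hε x hx => interior_subset (huv ⟨hball ?_, hKv hx⟩)⟩
  exact Metric.closedBall_subset_ball (by linarith) hε

/-- Differentiation under the integral sign over a compact set. -/
theorem hasDerivAt_setIntegral {μ : Measure N} [IsLocallyFiniteMeasure μ] {g : ℝ → N → ℝ}
    {K : Set N} (hK : IsCompact K) {t : ℝ}
    (hg : ∀ x ∈ K, ContMDiffAt (𝓘(ℝ, ℝ).prod I) 𝓘(ℝ, ℝ) ∞ (fun q : ℝ × N => g q.1 q.2) (t, x)) :
    HasDerivAt (fun ε => ∫ x in K, g ε x ∂μ) (∫ x in K, deriv (fun ε => g ε x) t ∂μ) t := by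
  obtain ⟨δ₁, hδ₁, h1⟩ := eventually_forall_mem_contMDiffAt hK hg
  obtain ⟨δ₂, hδ₂, h2⟩ := eventually_forall_mem_contMDiffAt (I' := 𝓘(ℝ, ℝ))
    (g := fun ε x => deriv (fun ε => g ε x) ε) hK
    (fun x hx => contMDiffAt_deriv (hg x hx))
  have hcg : ∀ ε ∈ Metric.closedBall t δ₁, ContinuousOn (g ε) K := fun ε hε x hx =>
    (h1 ε hε x hx).slice_right.continuousAt.continuousWithinAt
  set B := Metric.closedBall t (min δ₁ δ₂) with hB
  have hB1 : B ⊆ Metric.closedBall t δ₁ := Metric.closedBall_subset_closedBall (min_le_left _ _)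
  have hB2 : B ⊆ Metric.closedBall t δ₂ := Metric.closedBall_subset_closedBall (min_le_right _ _)
  have hBn : B ∈ 𝓝 t := Metric.closedBall_mem_nhds t (lt_min hδ₁ hδ₂)
  have hcd : ContinuousOn (fun q : ℝ × N => deriv (fun ε => g ε q.2) q.1) (B ×ˢ K) :=
    fun q hq => (h2 q.1 (hB2 hq.1) q.2 hq.2).continuousAt.continuousWithinAt
  obtain ⟨C, hC⟩ := ((isCompact_closedBall t _).prod hK).exists_bound_of_continuousOn hcd
  have hKm : MeasurableSet K := hK.measurableSet
  have hμK : μ K < ⊤ := hK.measure_lt_top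
  have htB : t ∈ B := mem_of_mem_nhds hBn
  refine (hasDerivAt_integral_of_dominated_loc_of_deriv_le (bound := fun _ => C)
    (F' := fun ε x => deriv (fun ε => g ε x) ε) hBn ?_ ?_ ?_ ?_ ?_ ?_).2
  · filter_upwards [hBn] with ε hε
    exact (hcg ε (hB1 hε)).aestronglyMeasurable hKm
  · exact (hcg t (hB1 htB)).integrableOn_compact hK
  · refine ContinuousOn.aestronglyMeasurable ?_ hKm
    exact hcd.comp (f := fun x => (t, x)) (by fun_prop) fun x hx => ⟨htB, hx⟩
  · refine ae_restrict_of_forall_mem hKm fun x hx ε hε => hC (ε, x) ⟨hε, hx⟩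
  · exact integrableOn_const hμK.ne
  · refine ae_restrict_of_forall_mem hKm fun x hx ε hε => ?_
    exact ((h1 ε (hB1 hε) x hx).slice_left.mdifferentiableAt (by simp)).differentiableAt.hasDerivAt

end Parameter

/-! ### The Euler–Poincaré covector and the first variation -/

section EulerPoincareForm

variable {E : Type*} [NormedAddCommGroup E] [NormedSpace ℝ E] [FiniteDimensional ℝ E]
  {H : Type*} [TopologicalSpace H] {I : ModelWithCorners ℝ E H} [I.Boundaryless]
  {N : Type*} [TopologicalSpace N] [ChartedSpace H N] [IsManifold I ∞ N]
  {d : ℕ} {b : Module.Basis (Fin d) ℝ E}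
  {Ω : ∀ x : N, TangentSpace I x [⋀^Fin d]→ₗ[ℝ] ℝ}
  {EG : Type*} [NormedAddCommGroup EG] [NormedSpace ℝ EG] [FiniteDimensional ℝ EG]
  {G : Type*} [TopologicalSpace G] [ChartedSpace EG G] [Group G] [LieGroup 𝓘(ℝ, EG) ∞ G]
  {f : N → (E →L[ℝ] EG) → ℝ} {σ : N → E →L[ℝ] EG} {U : Set N}

theorem SmoothFibreFun.contMDiffAt_fibreD {F : Type*} [NormedAddCommGroup F] [NormedSpace ℝ F]
    {f : N → (E →L[ℝ] F) → ℝ} {σ : N → E →L[ℝ] F} (hf : SmoothFibreFun I f) {x : N}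
    {α : N → E →L[ℝ] F}
    (hσ : SmoothFormAt I σ x) (hα : SmoothFormAt I α x) :
    ContMDiffAt I 𝓘(ℝ, ℝ) ∞ (fun x => fibreD f σ x (α x)) x := by
  have h1 := contMDiffAt_deriv (g := fun ε x => f x (σ x + ε • α x))
    (hf.contMDiffAt (hσ.add_smul hα 0))
  have h2 := h1.slice_right (g := fun t x => deriv (fun ε => f x (σ x + ε • α x)) t)
  refine h2.congr_of_eventuallyEq (Filter.Eventually.of_forall fun z => ?_)
  have h3 : HasDerivAt (fun ε : ℝ => σ z + ε • α z) (α z) 0 := by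
    simpa using ((hasDerivAt_id (0 : ℝ)).smul_const (α z)).const_add (σ z)
  exact (hf.hasDerivAt (σ := σ) (by simp) h3).deriv.symm

variable (I b Ω G) in
/-- The Euler–Poincaré covector `η ↦ (div Φ)(η) + Φ([σ, η])` of a Lagrangian `f` on `L(TN, 𝔤)` along
a one-form `σ`, where `Φ` is the fibre derivative of `f` along `σ`. -/
def epForm (f : N → (E →L[ℝ] EG) → ℝ) (σ : N → E →L[ℝ] EG) (x : N) (η : EG) : ℝ :=
  divAt I b Ω x (fibreD f σ) x η + fibreD f σ x ((adRight G η).comp (σ x))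

theorem adRight_sum {ι : Type*} (s : Finset ι) (a : ι → ℝ) (e : ι → EG) :
    adRight G (∑ k ∈ s, a k • e k) = ∑ k ∈ s, a k • adRight G (e k) := by
  simp only [← adRightL_apply, map_sum, map_smul]

variable [MeasurableSpace E] [BorelSpace E] [T2Space N]
  [SecondCountableTopology N] [MeasurableSpace N] [BorelSpace N]

/-- Linearity of the Euler–Poincaré covector. -/
theorem epForm_sum (hΩ : IsVolumeForm I b Ω) (hf : SmoothFibreFun I f) (hU : IsOpen U)
    (hσ : ∀ x ∈ U, SmoothFormAt I σ x) {x : N} (hx : x ∈ U) {ι : Type*} (s : Finset ι)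
    (a : ι → ℝ) (e : ι → EG) :
    epForm I b Ω G f σ x (∑ k ∈ s, a k • e k) = ∑ k ∈ s, a k * epForm I b Ω G f σ x (e k) := by
  simp only [epForm]
  rw [divAt_sum hΩ hU (hf.smoothDualField hσ) (mem_extChartAt_source x) hx, adRight_sum]
  simp only [mul_add, Finset.sum_add_distrib]
  congr 1
  have : (∑ k ∈ s, a k • adRight G (e k)).comp (σ x) =
      ∑ k ∈ s, a k • (adRight G (e k)).comp (σ x) := by
    ext v; simp
  rw [this]
  simp

theorem continuousOn_epForm (hΩ : IsVolumeForm I b Ω) (hf : SmoothFibreFun I f) (hU : IsOpen U)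
    (hσ : ∀ x ∈ U, SmoothFormAt I σ x) (e : EG) :
    ContinuousOn (fun x => epForm I b Ω G f σ x e) U := by
  refine (continuousOn_divergence hΩ hU (hf.smoothDualField hσ) e).add fun x hx => ?_
  exact (hf.contMDiffAt_fibreD (hσ x hx) ((hσ x hx).adRight_comp (η := fun _ => e)
    contMDiffAt_const)).continuousAt.continuousWithinAt

theorem continuousOn_epForm_apply (hΩ : IsVolumeForm I b Ω) (hf : SmoothFibreFun I f)
    (hU : IsOpen U) (hσ : ∀ x ∈ U, SmoothFormAt I σ x) {K : Set N} (hKU : K ⊆ U) {η : N → EG}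
    (hη : ContinuousOn η K) :
    ContinuousOn (fun x => epForm I b Ω G f σ x (η x)) K := by
  let B := Module.finBasis ℝ EG
  have h1 : ContinuousOn (fun x => ∑ k, B.repr (η x) k * epForm I b Ω G f σ x (B k)) K := by
    refine continuousOn_finsetSum _ fun k _ => ContinuousOn.mul ?_
      ((continuousOn_epForm hΩ hf hU hσ (B k)).mono hKU)
    exact (LinearMap.toContinuousLinearMap (B.coord k)).continuous.comp_continuousOn hη
  refine h1.congr fun x hx => ?_
  simp only
  rw [← epForm_sum hΩ hf hU hσ (hKU hx), B.sum_repr]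

/-- The first variation of the action, before integration by parts. -/
theorem hasDerivAt_action (hf : SmoothFibreFun I f) {μ : Measure N} [IsLocallyFiniteMeasure μ]
    {K : Set N} (hK : IsCompact K) {τ : ℝ → N → E →L[ℝ] EG} {τ' : N → E →L[ℝ] EG}
    (hτ : ∀ x ∈ K, SmoothFamilyAt I τ (0, x)) (h0 : ∀ x ∈ K, τ 0 x = σ x)
    (hd : ∀ x ∈ K, HasDerivAt (fun ε => τ ε x) (τ' x) 0) :
    HasDerivAt (fun ε => ∫ x in K, f x (τ ε x) ∂μ) (∫ x in K, fibreD f σ x (τ' x) ∂μ) 0 := by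
  have h1 := hasDerivAt_setIntegral (μ := μ) (g := fun ε x => f x (τ ε x)) hK
    (fun x hx => hf.contMDiffAt (hτ x hx))
  convert h1 using 1
  refine setIntegral_congr_fun hK.measurableSet fun x hx => ?_
  exact (hf.hasDerivAt (h0 x hx) (hd x hx)).deriv.symm

/-- Integration by parts in the first variation. -/
theorem setIntegral_variation (hΩ : IsVolumeForm I b Ω) (hf : SmoothFibreFun I f) (hU : IsOpen U)
    (hσ : ∀ x ∈ U, SmoothFormAt I σ x) {K : Set N} (hK : IsCompact K) (hKU : K ⊆ U) {η : N → EG}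
    (hη : ContMDiffOn I 𝓘(ℝ, EG) ∞ η U) (h0 : ∀ x ∈ U \ K, η x = 0) :
    ∫ x in K, fibreD f σ x (tder I 𝓘(ℝ, EG) η x - (adRight G (η x)).comp (σ x))
      ∂(volMeasure I b Ω) = - ∫ x in K, epForm I b Ω G f σ x (η x) ∂(volMeasure I b Ω) := by
  have := isLocallyFiniteMeasure_volMeasure hΩ
  have hηx : ∀ x ∈ U, ContMDiffAt I 𝓘(ℝ, EG) ∞ η x := fun x hx => hη.contMDiffAt (hU.mem_nhds hx)
  have hw := hf.smoothDualField hσ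
  have i1 : IntegrableOn (fun x => fibreD f σ x (tder I 𝓘(ℝ, EG) η x)) K (volMeasure I b Ω) :=
    ContinuousOn.integrableOn_compact hK fun x hx => (hf.contMDiffAt_fibreD (hσ x (hKU hx))
      (smoothFormAt_tder (hηx x (hKU hx)))).continuousAt.continuousWithinAt
  have i2 : IntegrableOn (fun x => fibreD f σ x ((adRight G (η x)).comp (σ x))) K
      (volMeasure I b Ω) :=
    ContinuousOn.integrableOn_compact hK fun x hx => (hf.contMDiffAt_fibreD (hσ x (hKU hx))
      ((hσ x (hKU hx)).adRight_comp (hηx x (hKU hx)))).continuousAt.continuousWithinAt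
  have i3 : IntegrableOn (fun x => epForm I b Ω G f σ x (η x)) K (volMeasure I b Ω) :=
    (continuousOn_epForm_apply hΩ hf hU hσ hKU (hη.continuousOn.mono hKU)).integrableOn_compact hK
  simp only [map_sub]
  rw [integral_sub i1 i2, setIntegral_field_tder_eq_div hΩ hU hw hK hKU hη h0, ← neg_add',
    neg_inj]
  have h4 : ∀ x, divAt I b Ω x (fibreD f σ) x (η x) = epForm I b Ω G f σ x (η x) -
    fibreD f σ x ((adRight G (η x)).comp (σ x)) := fun x => by simp [epForm]
  simp only [h4]
  rw [integral_sub i3 i2, sub_add_cancel]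

/-- The fundamental lemma for the Euler–Poincaré covector. -/
theorem epForm_eq_zero_of_integral (hΩ : IsVolumeForm I b Ω) (hf : SmoothFibreFun I f)
    (hU : IsOpen U) (hσ : ∀ x ∈ U, SmoothFormAt I σ x) {μ : Measure N} [IsLocallyFiniteMeasure μ]
    [μ.IsOpenPosMeasure]
    (h : ∀ η : N → EG, ContMDiff I 𝓘(ℝ, EG) ∞ η → ∀ K ⊆ U, IsCompact K →
      (∀ x ∉ K, η x = 0) → ∫ x in K, epForm I b Ω G f σ x (η x) ∂μ = 0) :
    ∀ x ∈ U, ∀ e : EG, epForm I b Ω G f σ x e = 0 := by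
  intro x hx e
  refine eqOn_zero_of_integral_mul_eq_zero I (μ := μ) hU (continuousOn_epForm hΩ hf hU hσ e)
    (fun g hg hgc hgs => ?_) x hx
  -- test with `g e`, for scalar `g`
  have h1 := h (fun x => g x • e) (hg.smul contMDiff_const) (tsupport g) hgs hgc
    (fun x hx => by rw [image_eq_zero_of_notMem_tsupport hx, zero_smul])
  rw [← h1, ← setIntegral_eq_integral_of_forall_compl_eq_zero (s := tsupport g)]
  · refine setIntegral_congr_fun hgc.measurableSet fun x hx => ?_
    have := epForm_sum hΩ hf hU hσ (hgs hx) (G := G) (Finset.univ : Finset (Fin 1)) (fun _ => g x)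
      (fun _ => e)
    simpa using this.symm
  · intro x hx
    rw [image_eq_zero_of_notMem_tsupport hx, zero_mul]

end EulerPoincareForm

/-! ### Variations with prescribed velocity -/

section GroupVariations

variable {E : Type*} [NormedAddCommGroup E] [NormedSpace ℝ E]
  {H : Type*} [TopologicalSpace H] {I : ModelWithCorners ℝ E H} [I.Boundaryless]
  {N : Type*} [TopologicalSpace N] [ChartedSpace H N] [IsManifold I ∞ N]
  {EG : Type*} [NormedAddCommGroup EG] [NormedSpace ℝ EG]
  {G : Type*} [TopologicalSpace G] [ChartedSpace EG G] [Group G] [LieGroup 𝓘(ℝ, EG) ∞ G]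

theorem varField_eq {S : ℝ → N → G} {x : N}
    (hS : MDifferentiableAt 𝓘(ℝ, ℝ) 𝓘(ℝ, EG) (fun ε => S ε x) 0) :
    varField EG S x = tder 𝓘(ℝ, EG) 𝓘(ℝ, EG) (fun h : G => h * (S 0 x)⁻¹) (S 0 x)
      (tder 𝓘(ℝ, ℝ) 𝓘(ℝ, EG) (fun ε => S ε x) 0 1) := by
  rw [varField, rightDer_eq hS]
  rfl

theorem varField_eq_zero {S : ℝ → N → G} {x : N}
    (hS : MDifferentiableAt 𝓘(ℝ, ℝ) 𝓘(ℝ, EG) (fun ε => S ε x) 0)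
    (h0 : mfderiv 𝓘(ℝ, ℝ) 𝓘(ℝ, EG) (fun ε => S ε x) 0 = 0) : varField EG S x = 0 := by
  have h1 : tder 𝓘(ℝ, ℝ) 𝓘(ℝ, EG) (fun ε => S ε x) 0 = 0 := h0
  rw [varField_eq hS, h1]
  simp

/-- The variation `ε ↦ φ⁻¹(φ(1) + ε η) s` of `s`, with `φ` the chart of the group at `1`. -/
def leftVariation (s : N → G) (η : N → EG) (ε : ℝ) (x : N) : G :=
  (extChartAt 𝓘(ℝ, EG) (1 : G)).symm (chartOne EG G + ε • η x) * s x

theorem leftVariation_zero (s : N → G) (η : N → EG) (x : N) : leftVariation s η 0 x = s x := by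
  rw [leftVariation, zero_smul, add_zero, chart_symm_chartOne, one_mul]

theorem leftVariation_of_eq_zero (s : N → G) {η : N → EG} {x : N} (h : η x = 0) (ε : ℝ) :
    leftVariation s η ε x = s x := by
  rw [leftVariation, h, smul_zero, add_zero, chart_symm_chartOne, one_mul]

/-- Every `η` is the right trivialized velocity of a variation of `s`. -/
theorem varField_leftVariation (s : N → G) (η : N → EG) (x : N) :
    varField EG (leftVariation s η) x = η x := by
  set ψ := extChartAt 𝓘(ℝ, EG) (1 : G)
  have h1 : varField EG (leftVariation s η) x = rightDer 𝓘(ℝ, ℝ) (EG := EG)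
      (fun ε : ℝ => ψ.symm (chartOne EG G + ε • η x)) 0 1 := by
    rw [varField, show (fun ε => leftVariation s η ε x) =
      fun ε => ψ.symm (chartOne EG G + ε • η x) * s x from rfl, rightDer_mul_const]
  have hl : HasDerivAt (fun ε : ℝ => chartOne EG G + ε • η x) (η x) 0 := by
    simpa using ((hasDerivAt_id (0 : ℝ)).smul_const (η x)).const_add (chartOne EG G)
  have h0 : chartOne EG G + (0 : ℝ) • η x = chartOne EG G := by simp
  have hsym : MDifferentiableAt 𝓘(ℝ, EG) 𝓘(ℝ, EG) ψ.symm (chartOne EG G) :=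
    (contMDiffAt_chart_symm chartOne_mem).mdifferentiableAt (by simp)
  have hS : MDifferentiableAt 𝓘(ℝ, ℝ) 𝓘(ℝ, EG) (fun ε : ℝ => ψ.symm (chartOne EG G + ε • η x)) 0 :=
    MDifferentiableAt.comp (g := ψ.symm) (I' := 𝓘(ℝ, EG)) (f := fun ε : ℝ => chartOne EG G + ε • η x)
      0 (by rw [h0]; exact hsym) hl.differentiableAt.mdifferentiableAt
  rw [h1, rightDer_eq hS, h0, chart_symm_chartOne]
  have h2 : tder 𝓘(ℝ, ℝ) 𝓘(ℝ, EG) (fun ε : ℝ => ψ.symm (chartOne EG G + ε • η x)) 0 =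
      (tder 𝓘(ℝ, EG) 𝓘(ℝ, EG) ψ.symm (chartOne EG G)).comp
        (fderiv ℝ (fun ε : ℝ => chartOne EG G + ε • η x) 0) := by
    have := tder_comp (I := 𝓘(ℝ, ℝ)) (I' := 𝓘(ℝ, EG)) (I'' := 𝓘(ℝ, EG)) (g := ψ.symm)
      (f := fun ε : ℝ => chartOne EG G + ε • η x) (x := 0) (by rw [h0]; exact hsym)
      hl.differentiableAt.mdifferentiableAt
    rw [this, h0, tder_eq_fderiv]
  have h3 : tder 𝓘(ℝ, EG) 𝓘(ℝ, EG) (fun h : G => h * (1 : G)⁻¹) 1 = ContinuousLinearMap.id ℝ EG := by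
    have : (fun h : G => h * (1 : G)⁻¹) = fun h => h := by funext h; simp
    rw [this, tder_id]
  have h4 : tder 𝓘(ℝ, EG) 𝓘(ℝ, EG) ψ.symm (chartOne EG G) = ContinuousLinearMap.id ℝ EG :=
    tder_chart_symm_self (I := 𝓘(ℝ, EG)) (1 : G)
  rw [h3, h2, h4]
  simp [hl.hasFDerivAt.fderiv]

/-- The variation `leftVariation s η` is smooth for small parameters: if `η` has compact support,
then `φ(1) + ε η` stays in a ball inside the chart target. -/
theorem exists_contMDiffOn_leftVariation {s : N → G} {U : Set N}
    (hs : ContMDiffOn I 𝓘(ℝ, EG) ∞ s U) {η : N → EG} (hη : ContMDiff I 𝓘(ℝ, EG) ∞ η)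
    (hc : HasCompactSupport η) :
    ∃ r > 0, ContMDiffOn (𝓘(ℝ, ℝ).prod I) 𝓘(ℝ, EG) ∞
      (fun q : ℝ × N => leftVariation s η q.1 q.2) (Set.Ioo (-r) r ×ˢ U) := by
  set ψ := extChartAt 𝓘(ℝ, EG) (1 : G)
  obtain ⟨δ, hδ, hball⟩ := Metric.isOpen_iff.1 (isOpen_extChartAt_target (I := 𝓘(ℝ, EG)) (1 : G))
    _ (chartOne_mem (EG := EG) (G := G))
  obtain ⟨C, hC⟩ := hc.exists_bound_of_continuous hη.continuous
  -- `C` may be negative if `N` is empty, and the radius needs a positive denominator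
  have hC0 : 0 < max C 0 + 1 := by positivity
  refine ⟨δ / (max C 0 + 1), by positivity, ?_⟩
  have hmem : ∀ q : ℝ × N, q ∈ Set.Ioo (-(δ / (max C 0 + 1))) (δ / (max C 0 + 1)) ×ˢ U →
      chartOne EG G + q.1 • η q.2 ∈ ψ.target := by
    rintro ⟨ε, x⟩ ⟨hε, -⟩
    refine hball ?_
    rw [mem_ball_iff_norm, add_sub_cancel_left, norm_smul]
    have h1 : |ε| < δ / (max C 0 + 1) := abs_lt.2 hε
    have h2 : ‖η x‖ ≤ max C 0 := (hC x).trans (le_max_left _ _)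
    calc ‖ε‖ * ‖η x‖ ≤ |ε| * (max C 0 + 1) := by
          rw [Real.norm_eq_abs]; gcongr; linarith
      _ < δ / (max C 0 + 1) * (max C 0 + 1) := by gcongr
      _ = δ := by field_simp
  intro q hq
  have h1 : ContMDiffAt (𝓘(ℝ, ℝ).prod I) 𝓘(ℝ, EG) ∞
      (fun q : ℝ × N => chartOne EG G + q.1 • η q.2) q :=
    contMDiffAt_const.add (contMDiffAt_fst.smul
      (ContMDiffAt.comp (g := η) (f := Prod.snd) q hη.contMDiffAt contMDiffAt_snd))
  have h2 : ContMDiffAt (𝓘(ℝ, ℝ).prod I) 𝓘(ℝ, EG) ∞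
      (fun q : ℝ × N => ψ.symm (chartOne EG G + q.1 • η q.2)) q :=
    ContMDiffAt.comp (g := ψ.symm) (I' := 𝓘(ℝ, EG)) q (contMDiffAt_chart_symm (hmem q hq)) h1
  have h3 : ContMDiffWithinAt (𝓘(ℝ, ℝ).prod I) 𝓘(ℝ, EG) ∞ (fun q : ℝ × N => s q.2)
      (Set.Ioo (-(δ / (max C 0 + 1))) (δ / (max C 0 + 1)) ×ˢ U) q :=
    ContMDiffWithinAt.comp (g := s) (f := Prod.snd) (t := U) q (hs q.2 hq.2)
      contMDiffWithinAt_snd (fun p hp => hp.2)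
  exact h2.contMDiffWithinAt.mul h3

end GroupVariations

/-! ### Right invariant functions on the first jet bundle -/

section Jets

variable {E : Type*} [NormedAddCommGroup E] [NormedSpace ℝ E]
  {H : Type*} [TopologicalSpace H] {I : ModelWithCorners ℝ E H} [I.Boundaryless]
  {N : Type*} [TopologicalSpace N] [ChartedSpace H N] [IsManifold I ∞ N]
  {EG : Type*} [NormedAddCommGroup EG] [NormedSpace ℝ EG]
  {G : Type*} [TopologicalSpace G] [ChartedSpace EG G] [Group G]

/-- Right invariance of a function on the first jet bundle of `N × G → N`. -/
def RightInvariantJet (L : N → G → (E →L[ℝ] EG) → ℝ) : Prop :=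
  ∀ (x : N) (g h : G) (A : E →L[ℝ] EG),
    L x (g * h) ((tder 𝓘(ℝ, EG) 𝓘(ℝ, EG) (fun k : G => k * h) g).comp A) = L x g A

variable (I) in
/-- The expression in a bundle chart of a function on the first jet bundle of `N × G → N`. -/
def jetCoord (L : N → G → (E →L[ℝ] EG) → ℝ) (c : N) (g₀ : G) (y : E) (z : EG) (A : E →L[ℝ] EG) :
    ℝ :=
  L ((extChartAt I c).symm y) ((extChartAt 𝓘(ℝ, EG) g₀).symm z)
    ((tder 𝓘(ℝ, EG) 𝓘(ℝ, EG) (extChartAt 𝓘(ℝ, EG) g₀).symm z).comp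
      (A.comp (tder I 𝓘(ℝ, E) (extChartAt I c) ((extChartAt I c).symm y))))

theorem RightInvariantJet.eq_reduced {L : N → G → (E →L[ℝ] EG) → ℝ} (hL : RightInvariantJet L)
    (x : N) (g : G) (A : E →L[ℝ] EG) :
    L x g A = L x 1 ((tder 𝓘(ℝ, EG) 𝓘(ℝ, EG) (fun k : G => k * g⁻¹) g).comp A) := by
  rw [← hL x g g⁻¹ A, mul_inv_cancel]

variable [LieGroup 𝓘(ℝ, EG) ∞ G]

/-- A right invariant density along `s` depends on the right logarithmic derivative of `s` only. -/
theorem RightInvariantJet.eq_rightDer {L : N → G → (E →L[ℝ] EG) → ℝ} (hL : RightInvariantJet L)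
    {s : N → G} {x : N} (hs : MDifferentiableAt I 𝓘(ℝ, EG) s x) :
    L x (s x) (tder I 𝓘(ℝ, EG) s x) = L x 1 (rightDer I s x) := by
  rw [hL.eq_reduced, rightDer_eq hs]

/-- A density that is smooth in the bundle charts has a smooth reduced density. -/
theorem smoothFibreFun_of_jetCoord {L : N → G → (E →L[ℝ] EG) → ℝ}
    (hL : ∀ c : N, ContDiffOn ℝ ∞ (fun q : E × EG × (E →L[ℝ] EG) => jetCoord I L c 1 q.1 q.2.1 q.2.2)
      ((extChartAt I c).target ×ˢ ((extChartAt 𝓘(ℝ, EG) (1 : G)).target ×ˢ Set.univ))) :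
    SmoothFibreFun I (fun x => L x 1) := by
  intro c
  have h1 := (hL c).comp (f := fun q : E × (E →L[ℝ] EG) => (q.1, chartOne EG G, q.2))
    (s := (extChartAt I c).target ×ˢ Set.univ) (by fun_prop)
    (fun q hq => ⟨hq.1, chartOne_mem, trivial⟩)
  refine h1.congr fun q hq => ?_
  simp only [Function.comp_def, jetCoord, fibreLocal]
  have h4 : tder 𝓘(ℝ, EG) 𝓘(ℝ, EG) (extChartAt 𝓘(ℝ, EG) (1 : G)).symm (chartOne EG G) =
      ContinuousLinearMap.id ℝ EG := tder_chart_symm_self (I := 𝓘(ℝ, EG)) (1 : G)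
  rw [h4, chart_symm_chartOne, ContinuousLinearMap.id_comp]

end Jets

/-! ### The product rule for the divergence -/

section WeightedDivergence

variable {E : Type*} [NormedAddCommGroup E] [NormedSpace ℝ E] [FiniteDimensional ℝ E]
  {H : Type*} [TopologicalSpace H] {I : ModelWithCorners ℝ E H} [I.Boundaryless]
  {N : Type*} [TopologicalSpace N] [ChartedSpace H N] [IsManifold I ∞ N]
  {d : ℕ} {b : Module.Basis (Fin d) ℝ E}
  {Ω : ∀ x : N, TangentSpace I x [⋀^Fin d]→ₗ[ℝ] ℝ}
  {F : Type*} [NormedAddCommGroup F] [NormedSpace ℝ F]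

theorem fieldComp_eq_sum (b : Module.Basis (Fin d) ℝ E) (c : N) (w : N → (E →L[ℝ] F) →ₗ[ℝ] ℝ)
    (A : E →L[ℝ] F) (y : E) :
    fieldComp I c w A y = ∑ i, fieldComp I c w (elemCovector b i (A (b i))) y := by
  have hA : A = ∑ i, elemCovector b i (A (b i)) := by
    ext v
    simp only [sum_apply, elemCovector, ContinuousLinearMap.smulRight_apply,
      LinearMap.coe_toContinuousLinearMap', Module.Basis.coord_apply]
    conv_lhs => rw [← b.sum_repr v, map_sum]
    simp
  conv_lhs => rw [hA]
  simp only [fieldComp, ContinuousLinearMap.finsetSum_comp, map_sum]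

theorem fieldComp_elemCovector_eq_sum {ι : Type*} [Fintype ι] (B : Module.Basis ι ℝ F) (c : N)
    (w : N → (E →L[ℝ] F) →ₗ[ℝ] ℝ) (i : Fin d) (η : F) (y : E) :
    fieldComp I c w (elemCovector b i η) y =
      ∑ k, B.repr η k * fieldComp I c w (elemCovector b i (B k)) y := by
  have : elemCovector b i η = ∑ k, B.repr η k • elemCovector b i (B k) := by
    ext v
    simp only [elemCovector, ContinuousLinearMap.smulRight_apply, sum_apply, smul_apply]
    conv_lhs => rw [← B.sum_repr η, Finset.smul_sum]
    exact Finset.sum_congr rfl fun k _ => smul_comm _ _ _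
  rw [this]
  simp only [fieldComp, ContinuousLinearMap.finsetSum_comp, map_sum,
    ContinuousLinearMap.smul_comp, map_smul, smul_eq_mul]

variable [MeasurableSpace E] [BorelSpace E] [T2Space N]
  [SecondCountableTopology N] [MeasurableSpace N] [BorelSpace N] [FiniteDimensional ℝ F]

/-- The product rule `div (w(η)) = (div w)(η) + w(dη)`, in the chart at `c`. -/
theorem sum_fderiv_mul_fieldComp (hΩ : IsVolumeForm I b Ω) {w : N → (E →L[ℝ] F) →ₗ[ℝ] ℝ}
    {U : Set N} (hU : IsOpen U) (hw : SmoothDualField I w U) {c : N} {y : E}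
    (hy : y ∈ chartSet I c U) {h : E → F} (hh : DifferentiableAt ℝ h y) :
    ∑ i, fderiv ℝ (fun y' => volCoeff I b Ω c y' * fieldComp I c w (elemCovector b i (h y')) y') y
      (b i) = volCoeff I b Ω c y *
        (divAt I b Ω c w ((extChartAt I c).symm y) (h y) + fieldComp I c w (fderiv ℝ h y) y) := by
  let B := Module.finBasis ℝ F
  let a : Fin (Module.finrank ℝ F) → F →L[ℝ] ℝ := fun k =>
    LinearMap.toContinuousLinearMap (B.coord k)
  have ha : ∀ k η, a k η = B.repr η k := fun _ _ => rfl
  set ρ := volCoeff I b Ω c with hρ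
  let P : Fin d → Fin (Module.finrank ℝ F) → E → ℝ := fun i k y' =>
    ρ y' * fieldComp I c w (elemCovector b i (B k)) y'
  have hP : ∀ i k, HasFDerivAt (P i k) (fderiv ℝ (P i k) y) y := fun i k =>
    (((contDiffAt_volCoeff hΩ hy.1).mul (contDiffAt_fieldComp hU hw c
        (elemCovector b i (B k)) hy)).differentiableAt (by simp)).hasFDerivAt
  have hah : ∀ k, HasFDerivAt (fun y' => a k (h y')) ((a k).comp (fderiv ℝ h y)) y := fun k =>
    (a k).hasFDerivAt.comp y hh.hasFDerivAt
  have h1 : ∀ i, fderiv ℝ (fun y' => ρ y' * fieldComp I c w (elemCovector b i (h y')) y') y (b i) =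
      ∑ k, (a k (h y) * fderiv ℝ (P i k) y (b i) + P i k y * a k (fderiv ℝ h y (b i))) := by
    intro i
    have e : (fun y' => ρ y' * fieldComp I c w (elemCovector b i (h y')) y') =
        fun y' => ∑ k, a k (h y') * P i k y' := by
      funext y'
      rw [fieldComp_elemCovector_eq_sum B, Finset.mul_sum]
      exact Finset.sum_congr rfl fun k _ => by rw [← ha]; simp only [P]; ring
    have hs : fderiv ℝ (fun y' => ∑ k, a k (h y') * P i k y') y = ∑ k, (a k (h y) •
        fderiv ℝ (P i k) y + P i k y • (a k).comp (fderiv ℝ h y)) :=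
      (HasFDerivAt.fun_sum (u := Finset.univ) fun k _ => (hah k).mul (hP i k)).fderiv
    rw [e, hs, sum_apply]
    refine Finset.sum_congr rfl fun k _ => ?_
    simp
  simp only [h1, Finset.sum_add_distrib]
  have hx := (extChartAt I c).map_target hy.1
  have h2 : ∑ i, ∑ k, P i k y * a k (fderiv ℝ h y (b i)) =
      ρ y * fieldComp I c w (fderiv ℝ h y) y := by
    rw [fieldComp_eq_sum b, Finset.mul_sum]
    refine Finset.sum_congr rfl fun i _ => ?_
    rw [fieldComp_elemCovector_eq_sum B, Finset.mul_sum]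
    exact Finset.sum_congr rfl fun k _ => by rw [← ha]; simp only [P]; ring
  have h3 : ∑ i, ∑ k, a k (h y) * fderiv ℝ (P i k) y (b i) =
      ρ y * divAt I b Ω c w ((extChartAt I c).symm y) (h y) := by
    conv_rhs => rw [← B.sum_repr (h y)]
    rw [divAt_sum hΩ hU hw hx hy.2, Finset.sum_comm, Finset.mul_sum]
    refine Finset.sum_congr rfl fun k _ => ?_
    rw [divAt, (extChartAt I c).right_inv hy.1, ← Finset.mul_sum, ha]
    have := volCoeff_ne_zero hΩ hy.1
    simp only [P, hρ]
    field_simp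
  rw [h2, h3]
  ring

end WeightedDivergence

/-! ### Variations in a chart of the group -/

section ChartVariations

variable {E : Type*} [NormedAddCommGroup E] [NormedSpace ℝ E]
  {H : Type*} [TopologicalSpace H] {I : ModelWithCorners ℝ E H} [I.Boundaryless]
  {N : Type*} [TopologicalSpace N] [ChartedSpace H N] [IsManifold I ∞ N]
  {EG : Type*} [NormedAddCommGroup EG] [NormedSpace ℝ EG]
  {G : Type*} [TopologicalSpace G] [ChartedSpace EG G] [Group G]

/-- The variation `ε ↦ ψ⁻¹(ψ(s) + ε v)` of `s`, with `ψ` the chart of the group at `g₀`. -/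
def chartVariation (g₀ : G) (s : N → G) (v : N → EG) (ε : ℝ) (x : N) : G :=
  (extChartAt 𝓘(ℝ, EG) g₀).symm (extChartAt 𝓘(ℝ, EG) g₀ (s x) + ε • v x)

variable (EG) in
/-- The right trivialization `v ↦ (T ψ⁻¹ v) g⁻¹` of the coordinate vectors at `g`, with `ψ` the
chart of the group at `g₀`. -/
def chartTriv (g₀ g : G) : EG →L[ℝ] EG :=
  (tder 𝓘(ℝ, EG) 𝓘(ℝ, EG) (fun h : G => h * g⁻¹) g).comp
    (tder 𝓘(ℝ, EG) 𝓘(ℝ, EG) (extChartAt 𝓘(ℝ, EG) g₀).symm (extChartAt 𝓘(ℝ, EG) g₀ g))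

variable [LieGroup 𝓘(ℝ, EG) ∞ G]

/-- The coordinate vectors at `g` exhaust the Lie algebra. -/
theorem chartTriv_surjective {g₀ g : G} (hg : g ∈ (extChartAt 𝓘(ℝ, EG) g₀).source) :
    Function.Surjective (chartTriv EG g₀ g) := by
  have hz := (extChartAt 𝓘(ℝ, EG) g₀).map_source hg
  have h1 := tder_symm_comp_tder_chart (I := 𝓘(ℝ, EG)) hz
  rw [(extChartAt 𝓘(ℝ, EG) g₀).left_inv hg] at h1
  have h2 : (tder 𝓘(ℝ, EG) 𝓘(ℝ, EG) (fun h : G => h * g⁻¹) g).comp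
      (tder 𝓘(ℝ, EG) 𝓘(ℝ, EG) (fun h : G => h * g) 1) = ContinuousLinearMap.id ℝ EG := by
    have h := tder_comp (I := 𝓘(ℝ, EG)) (I' := 𝓘(ℝ, EG)) (I'' := 𝓘(ℝ, EG))
      (g := fun h : G => h * g⁻¹) (f := fun h : G => h * g) (x := 1)
      ((contMDiff_mul_const g⁻¹).mdifferentiable (by simp) _)
      ((contMDiff_mul_const g).mdifferentiable (by simp) _)
    simp only [mul_inv_cancel_right, one_mul] at h
    rw [← h, tder_id]
  intro η
  refine ⟨tder 𝓘(ℝ, EG) 𝓘(ℝ, EG) (extChartAt 𝓘(ℝ, EG) g₀) g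
    (tder 𝓘(ℝ, EG) 𝓘(ℝ, EG) (fun h : G => h * g) 1 η), ?_⟩
  rw [chartTriv, ContinuousLinearMap.comp_apply, ← ContinuousLinearMap.comp_apply _
    (tder 𝓘(ℝ, EG) 𝓘(ℝ, EG) (extChartAt 𝓘(ℝ, EG) g₀) g), h1, ContinuousLinearMap.id_apply,
    ← ContinuousLinearMap.comp_apply, h2, ContinuousLinearMap.id_apply]

theorem contMDiffAt_chart_comp {g₀ : G} {s : N → G} {x : N} (hs : ContMDiffAt I 𝓘(ℝ, EG) ∞ s x)
    (hx : s x ∈ (extChartAt 𝓘(ℝ, EG) g₀).source) :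
    ContMDiffAt I 𝓘(ℝ, EG) ∞ (fun x => extChartAt 𝓘(ℝ, EG) g₀ (s x)) x :=
  ContMDiffAt.comp (g := extChartAt 𝓘(ℝ, EG) g₀) x (contMDiffAt_chart hx) hs

variable {g₀ : G} {s : N → G} {v : N → EG} {x : N}

theorem contMDiffAt_chartVariation (hs : ContMDiffAt I 𝓘(ℝ, EG) ∞ s x)
    (hx : s x ∈ (extChartAt 𝓘(ℝ, EG) g₀).source) (hv : ContMDiffAt I 𝓘(ℝ, EG) ∞ v x) :
    ContMDiffAt (𝓘(ℝ, ℝ).prod I) 𝓘(ℝ, EG) ∞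
      (fun q : ℝ × N => chartVariation g₀ s v q.1 q.2) (0, x) := by
  refine ContMDiffAt.comp (g := (extChartAt 𝓘(ℝ, EG) g₀).symm) (I' := 𝓘(ℝ, EG))
    (f := fun q : ℝ × N => extChartAt 𝓘(ℝ, EG) g₀ (s q.2) + q.1 • v q.2) (0, x) ?_ ?_
  · simp only [zero_smul, add_zero]
    exact contMDiffAt_chart_symm ((extChartAt 𝓘(ℝ, EG) g₀).map_source hx)
  · exact (ContMDiffAt.comp (g := fun x => extChartAt 𝓘(ℝ, EG) g₀ (s x)) (f := Prod.snd)
      ((0 : ℝ), x) (contMDiffAt_chart_comp hs hx) contMDiffAt_snd).add (contMDiffAt_fst.smul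
      (ContMDiffAt.comp (g := v) (f := Prod.snd) ((0 : ℝ), x) hv contMDiffAt_snd))

theorem chartVariation_zero (hx : s x ∈ (extChartAt 𝓘(ℝ, EG) g₀).source) :
    chartVariation g₀ s v 0 x = s x := by
  rw [chartVariation, zero_smul, add_zero, (extChartAt 𝓘(ℝ, EG) g₀).left_inv hx]

theorem eventually_mem_chart_source (hs : ContinuousAt s x)
    (hx : s x ∈ (extChartAt 𝓘(ℝ, EG) g₀).source) :
    ∀ᶠ z in 𝓝 x, s z ∈ (extChartAt 𝓘(ℝ, EG) g₀).source :=
  hs.eventually_mem ((isOpen_extChartAt_source (I := 𝓘(ℝ, EG)) g₀).mem_nhds hx)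

theorem rightDer_chartVariation_zero (hs : ContMDiffAt I 𝓘(ℝ, EG) ∞ s x)
    (hx : s x ∈ (extChartAt 𝓘(ℝ, EG) g₀).source) :
    rightDer I (EG := EG) (chartVariation g₀ s v 0) x = rightDer I s x :=
  rightDer_congr (by
    filter_upwards [eventually_mem_chart_source hs.continuousAt hx] with z hz
      using chartVariation_zero hz)

theorem varField_chartVariation (hx : s x ∈ (extChartAt 𝓘(ℝ, EG) g₀).source) :
    varField EG (chartVariation g₀ s v) x = chartTriv EG g₀ (s x) (v x) := by
  set ψ := extChartAt 𝓘(ℝ, EG) g₀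
  have hl : HasDerivAt (fun ε : ℝ => ψ (s x) + ε • v x) (v x) 0 := by
    simpa using ((hasDerivAt_id (0 : ℝ)).smul_const (v x)).const_add (ψ (s x))
  have h0 : ψ (s x) + (0 : ℝ) • v x = ψ (s x) := by rw [zero_smul, add_zero]
  have hsym : MDifferentiableAt 𝓘(ℝ, EG) 𝓘(ℝ, EG) ψ.symm (ψ (s x) + (0 : ℝ) • v x) := by
    rw [h0]; exact (contMDiffAt_chart_symm (ψ.map_source hx)).mdifferentiableAt (by simp)
  have hS : MDifferentiableAt 𝓘(ℝ, ℝ) 𝓘(ℝ, EG) (fun ε : ℝ => chartVariation g₀ s v ε x) 0 :=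
    MDifferentiableAt.comp (g := ψ.symm) (I' := 𝓘(ℝ, EG)) (f := fun ε : ℝ => ψ (s x) + ε • v x)
      0 hsym hl.differentiableAt.mdifferentiableAt
  have h2 : tder 𝓘(ℝ, ℝ) 𝓘(ℝ, EG) (fun ε : ℝ => chartVariation g₀ s v ε x) 0 =
      (tder 𝓘(ℝ, EG) 𝓘(ℝ, EG) ψ.symm (ψ (s x))).comp
        (fderiv ℝ (fun ε : ℝ => ψ (s x) + ε • v x) 0) := by
    have := tder_comp (I := 𝓘(ℝ, ℝ)) (I' := 𝓘(ℝ, EG)) (I'' := 𝓘(ℝ, EG)) (g := ψ.symm)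
      (f := fun ε : ℝ => ψ (s x) + ε • v x) (x := 0) hsym
      hl.differentiableAt.mdifferentiableAt
    rw [h0, tder_eq_fderiv] at this
    exact this
  have h3 : fderiv ℝ (fun ε : ℝ => ψ (s x) + ε • v x) 0 1 = v x := by
    rw [hl.hasFDerivAt.fderiv]; simp
  rw [varField_eq hS, h2, chartVariation_zero hx, chartTriv, ContinuousLinearMap.comp_apply, h3]
  rfl

theorem tder_chartVariation {ε : ℝ} (hs : ContMDiffAt I 𝓘(ℝ, EG) ∞ s x)
    (hx : s x ∈ (extChartAt 𝓘(ℝ, EG) g₀).source) (hv : ContMDiffAt I 𝓘(ℝ, EG) ∞ v x)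
    (hε : extChartAt 𝓘(ℝ, EG) g₀ (s x) + ε • v x ∈ (extChartAt 𝓘(ℝ, EG) g₀).target) :
    MDifferentiableAt I 𝓘(ℝ, EG) (chartVariation g₀ s v ε) x ∧
    tder I 𝓘(ℝ, EG) (chartVariation g₀ s v ε) x =
      (tder 𝓘(ℝ, EG) 𝓘(ℝ, EG) (extChartAt 𝓘(ℝ, EG) g₀).symm
        (extChartAt 𝓘(ℝ, EG) g₀ (s x) + ε • v x)).comp
      (tder I 𝓘(ℝ, EG) (fun x => extChartAt 𝓘(ℝ, EG) g₀ (s x) + ε • v x) x) := by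
  have hsym : MDifferentiableAt 𝓘(ℝ, EG) 𝓘(ℝ, EG) (extChartAt 𝓘(ℝ, EG) g₀).symm
      (extChartAt 𝓘(ℝ, EG) g₀ (s x) + ε • v x) :=
    (contMDiffAt_chart_symm hε).mdifferentiableAt (by simp)
  have hd : MDifferentiableAt I 𝓘(ℝ, EG) (fun x => extChartAt 𝓘(ℝ, EG) g₀ (s x) + ε • v x) x :=
    ((contMDiffAt_chart_comp hs hx).add
      ((contMDiffAt_const : ContMDiffAt I 𝓘(ℝ, ℝ) ∞ (fun _ : N => ε) x).smul hv)).mdifferentiableAt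
        (by simp)
  exact ⟨MDifferentiableAt.comp (g := (extChartAt 𝓘(ℝ, EG) g₀).symm) (I' := 𝓘(ℝ, EG)) x hsym hd,
    tder_comp (g := (extChartAt 𝓘(ℝ, EG) g₀).symm)
      (f := fun x => extChartAt 𝓘(ℝ, EG) g₀ (s x) + ε • v x) hsym hd⟩

end ChartVariations

/-! ### The Euler–Lagrange expression in a bundle chart -/

section CoordinateEulerLagrange

variable {E : Type*} [NormedAddCommGroup E] [NormedSpace ℝ E] [FiniteDimensional ℝ E]
  {H : Type*} [TopologicalSpace H] {I : ModelWithCorners ℝ E H} [I.Boundaryless]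
  {N : Type*} [TopologicalSpace N] [ChartedSpace H N] [IsManifold I ∞ N]
  {EG : Type*} [NormedAddCommGroup EG] [NormedSpace ℝ EG] [FiniteDimensional ℝ EG]
  {G : Type*} [TopologicalSpace G] [ChartedSpace EG G] [Group G] [LieGroup 𝓘(ℝ, EG) ∞ G]
  {L : N → G → (E →L[ℝ] EG) → ℝ} {g₀ : G} {s : N → G}

/-- A right invariant density in a bundle chart, in terms of the reduced density. -/
theorem jetCoord_eq_reduced (hL : RightInvariantJet L) {c : N} {y : E} {z : EG}
    (hz : z ∈ (extChartAt 𝓘(ℝ, EG) g₀).target) (A : E →L[ℝ] EG) :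
    jetCoord I L c g₀ y z A = L ((extChartAt I c).symm y) 1
      ((chartTriv EG g₀ ((extChartAt 𝓘(ℝ, EG) g₀).symm z)).comp
        (A.comp (tder I 𝓘(ℝ, E) (extChartAt I c) ((extChartAt I c).symm y)))) := by
  rw [jetCoord, hL.eq_reduced, chartTriv, (extChartAt 𝓘(ℝ, EG) g₀).right_inv hz,
    ContinuousLinearMap.comp_assoc]

theorem chartTriv_comp_tder {x : N} (hs : ContMDiffAt I 𝓘(ℝ, EG) ∞ s x)
    (hx : s x ∈ (extChartAt 𝓘(ℝ, EG) g₀).source) :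
    (chartTriv EG g₀ (s x)).comp (tder I 𝓘(ℝ, EG) (fun x => extChartAt 𝓘(ℝ, EG) g₀ (s x)) x) =
      rightDer I s x := by
  have hz := (extChartAt 𝓘(ℝ, EG) g₀).map_source hx
  have h1 := tder_comp (g := (extChartAt 𝓘(ℝ, EG) g₀).symm)
      (f := fun x => extChartAt 𝓘(ℝ, EG) g₀ (s x)) (x := x)
      ((contMDiffAt_chart_symm hz).mdifferentiableAt (by simp))
      ((contMDiffAt_chart_comp hs hx).mdifferentiableAt (by simp))
  have h2 : tder I 𝓘(ℝ, EG) (fun x => (extChartAt 𝓘(ℝ, EG) g₀).symm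
      (extChartAt 𝓘(ℝ, EG) g₀ (s x))) x = tder I 𝓘(ℝ, EG) s x :=
    tder_congr (by
      filter_upwards [eventually_mem_chart_source hs.continuousAt hx] with z hz
        using (extChartAt 𝓘(ℝ, EG) g₀).left_inv hz)
  rw [h2] at h1
  rw [rightDer_eq (hs.mdifferentiableAt (by simp)), chartTriv, ContinuousLinearMap.comp_assoc, h1]

theorem tder_chart_comp_eq {c : N} {y : E} (hy : y ∈ (extChartAt I c).target)
    (hs : ContMDiffAt I 𝓘(ℝ, EG) ∞ s ((extChartAt I c).symm y))
    (hx : s ((extChartAt I c).symm y) ∈ (extChartAt 𝓘(ℝ, EG) g₀).source) :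
    tder I 𝓘(ℝ, EG) (fun x => extChartAt 𝓘(ℝ, EG) g₀ (s x)) ((extChartAt I c).symm y) =
      (fderiv ℝ (fun y => extChartAt 𝓘(ℝ, EG) g₀ (s ((extChartAt I c).symm y))) y).comp
        (tder I 𝓘(ℝ, E) (extChartAt I c) ((extChartAt I c).symm y)) :=
  tder_eq_fderiv_comp (f := fun x => extChartAt 𝓘(ℝ, EG) g₀ (s x)) hy
    ((contMDiffAt_chart_comp hs hx).mdifferentiableAt (by simp))

/-- The momenta of the density in a bundle chart are the components of the fibre derivative of the
reduced density. -/
theorem fderiv_jetCoord_fibre (hL : RightInvariantJet L) (hf : SmoothFibreFun I (fun x => L x 1))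
    {c : N} {y : E} (hy : y ∈ (extChartAt I c).target)
    (hs : ContMDiffAt I 𝓘(ℝ, EG) ∞ s ((extChartAt I c).symm y))
    (hx : s ((extChartAt I c).symm y) ∈ (extChartAt 𝓘(ℝ, EG) g₀).source) (B : E →L[ℝ] EG) :
    fderiv ℝ (fun A => jetCoord I L c g₀ y
        (extChartAt 𝓘(ℝ, EG) g₀ (s ((extChartAt I c).symm y))) A)
      (fderiv ℝ (fun y => extChartAt 𝓘(ℝ, EG) g₀ (s ((extChartAt I c).symm y))) y) B =
    fieldComp I c (fibreD (fun x => L x 1) (rightDer I s))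
      ((chartTriv EG g₀ (s ((extChartAt I c).symm y))).comp B) y := by
  set x := (extChartAt I c).symm y with hxdef
  set T := tder I 𝓘(ℝ, E) (extChartAt I c) x with hT
  set R := chartTriv EG g₀ (s x) with hR
  set A₀ := fderiv ℝ (fun y => extChartAt 𝓘(ℝ, EG) g₀ (s ((extChartAt I c).symm y))) y
  have h1 : (fun A => jetCoord I L c g₀ y (extChartAt 𝓘(ℝ, EG) g₀ (s x)) A) =
      fun A : E →L[ℝ] EG => L x 1 (R.comp (A.comp T)) := by
    funext A
    rw [jetCoord_eq_reduced hL ((extChartAt 𝓘(ℝ, EG) g₀).map_source hx),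
      (extChartAt 𝓘(ℝ, EG) g₀).left_inv hx]
  let Λ : (E →L[ℝ] EG) →L[ℝ] (E →L[ℝ] EG) := (ContinuousLinearMap.compL ℝ E EG EG R).comp
    ((ContinuousLinearMap.compL ℝ E E EG).flip T)
  have hΛ : ∀ A, Λ A = R.comp (A.comp T) := fun _ => rfl
  have h2 : Λ A₀ = rightDer I s x := by
    rw [hΛ, ← chartTriv_comp_tder hs hx, tder_chart_comp_eq hy hs hx]
  have h3 : HasFDerivAt (fun A : E →L[ℝ] EG => L x 1 (R.comp (A.comp T)))
      ((fderiv ℝ (L x 1) (Λ A₀)).comp Λ) A₀ :=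
    HasFDerivAt.comp (g := L x 1) (f := Λ) A₀ (hf.differentiableAt x (Λ A₀)).hasFDerivAt
      Λ.hasFDerivAt
  rw [h1, h3.fderiv, h2]
  rfl

/-- The derivative of the density in a bundle chart in the group coordinates, at fixed fibre
coordinates: it is the variation of the reduced density along the family `chartVariation` with
constant `v`, whose coordinate derivative does not depend on the parameter. -/
theorem hasDerivAt_jetCoord_base (hL : RightInvariantJet L)
    (hf : SmoothFibreFun I (fun x => L x 1))
    {c : N} {y : E} (hy : y ∈ (extChartAt I c).target)
    (hs : ContMDiffAt I 𝓘(ℝ, EG) ∞ s ((extChartAt I c).symm y))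
    (hx : s ((extChartAt I c).symm y) ∈ (extChartAt 𝓘(ℝ, EG) g₀).source) (v : EG) :
    HasDerivAt (fun ε : ℝ => jetCoord I L c g₀ y
        (extChartAt 𝓘(ℝ, EG) g₀ (s ((extChartAt I c).symm y)) + ε • v)
        (fderiv ℝ (fun y => extChartAt 𝓘(ℝ, EG) g₀ (s ((extChartAt I c).symm y))) y))
      (fibreD (fun x => L x 1) (rightDer I s) ((extChartAt I c).symm y)
        (tder I 𝓘(ℝ, EG) (fun x => chartTriv EG g₀ (s x) v) ((extChartAt I c).symm y) -
          (adRight G (chartTriv EG g₀ (s ((extChartAt I c).symm y)) v)).comp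
            (rightDer I s ((extChartAt I c).symm y)))) 0 := by
  set x := (extChartAt I c).symm y with hxdef
  set S := chartVariation g₀ s (fun _ : N => v) with hS
  have hv : ContMDiffAt I 𝓘(ℝ, EG) ∞ (fun _ : N => v) x := contMDiffAt_const
  have h1 := hasDerivAt_rightDer (contMDiffAt_chartVariation hs hx hv)
  have hη : tder I 𝓘(ℝ, EG) (varField EG S) x =
      tder I 𝓘(ℝ, EG) (fun x => chartTriv EG g₀ (s x) v) x := tder_congr (by
    filter_upwards [eventually_mem_chart_source hs.continuousAt hx] with z hz
      using varField_chartVariation hz)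
  have h2 := hf.hasDerivAt (σ := rightDer I s) (x := x)
    (rightDer_chartVariation_zero hs hx) h1
  rw [← hS, hη, hS, varField_chartVariation hx, rightDer_chartVariation_zero hs hx] at h2
  refine h2.congr_of_eventuallyEq ?_
  have hc : ContinuousAt (fun ε : ℝ => extChartAt 𝓘(ℝ, EG) g₀ (s x) + ε • v) 0 := by fun_prop
  have hev : ∀ᶠ ε : ℝ in 𝓝 0, extChartAt 𝓘(ℝ, EG) g₀ (s x) + ε • v ∈
      (extChartAt 𝓘(ℝ, EG) g₀).target := by
    refine hc.eventually_mem ((isOpen_extChartAt_target (I := 𝓘(ℝ, EG)) g₀).mem_nhds ?_)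
    rw [zero_smul, add_zero]
    exact (extChartAt 𝓘(ℝ, EG) g₀).map_source hx
  filter_upwards [hev] with ε hε
  obtain ⟨hd, he⟩ := tder_chartVariation hs hx hv hε
  rw [← hL.eq_rightDer hd, he]
  have h3 : tder I 𝓘(ℝ, EG) (fun x => extChartAt 𝓘(ℝ, EG) g₀ (s x) + ε • v) x =
      tder I 𝓘(ℝ, EG) (fun x => extChartAt 𝓘(ℝ, EG) g₀ (s x)) x := by
    rw [tder_add ((contMDiffAt_chart_comp hs hx).mdifferentiableAt (by simp))
      mdifferentiableAt_const, tder_const, add_zero]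
  rw [h3, tder_chart_comp_eq hy hs hx]
  rfl

/-- The trivialization of coordinate vectors is smooth, as the velocity of a smooth family. -/
theorem contMDiffAt_chartTriv {x : N} (hs : ContMDiffAt I 𝓘(ℝ, EG) ∞ s x)
    (hx : s x ∈ (extChartAt 𝓘(ℝ, EG) g₀).source) {v : N → EG}
    (hv : ContMDiffAt I 𝓘(ℝ, EG) ∞ v x) :
    ContMDiffAt I 𝓘(ℝ, EG) ∞ (fun x => chartTriv EG g₀ (s x) (v x)) x := by
  refine (contMDiffAt_varField (contMDiffAt_chartVariation hs hx hv)).congr_of_eventuallyEq ?_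
  filter_upwards [eventually_mem_chart_source hs.continuousAt hx] with z hz
    using (varField_chartVariation hz).symm

variable {d : ℕ} {b : Module.Basis (Fin d) ℝ E}
  {Ω : ∀ x : N, TangentSpace I x [⋀^Fin d]→ₗ[ℝ] ℝ}
  [MeasurableSpace E] [BorelSpace E] [T2Space N]
  [SecondCountableTopology N] [MeasurableSpace N] [BorelSpace N]

/-- The Euler–Lagrange expression in a bundle chart is the density of the volume form times the
Euler–Poincaré covector of the reduced density. -/
theorem eulerLagrange_sub_eq_epForm (hΩ : IsVolumeForm I b Ω) (hL : RightInvariantJet L)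
    (hf : SmoothFibreFun I (fun x => L x 1))
    (hsm : ∀ (c : N) (g₀ : G), ContDiffOn ℝ ∞
      (fun q : E × EG × (E →L[ℝ] EG) => jetCoord I L c g₀ q.1 q.2.1 q.2.2)
      ((extChartAt I c).target ×ˢ ((extChartAt 𝓘(ℝ, EG) g₀).target ×ˢ Set.univ)))
    {U : Set N} (hU : IsOpen U) (hs : ∀ x ∈ U, ContMDiffAt I 𝓘(ℝ, EG) ∞ s x)
    {c : N} {y : E} (hy : y ∈ chartSet I c U)
    (hx : s ((extChartAt I c).symm y) ∈ (extChartAt 𝓘(ℝ, EG) g₀).source) (v : EG) :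
    ∑ i, fderiv ℝ (fun y' => volCoeff I b Ω c y' * fderiv ℝ (fun A => jetCoord I L c g₀ y'
        (extChartAt 𝓘(ℝ, EG) g₀ (s ((extChartAt I c).symm y'))) A)
      (fderiv ℝ (fun y => extChartAt 𝓘(ℝ, EG) g₀ (s ((extChartAt I c).symm y))) y')
        (elemCovector b i v)) y (b i) -
    volCoeff I b Ω c y * fderiv ℝ (fun z => jetCoord I L c g₀ y z
        (fderiv ℝ (fun y => extChartAt 𝓘(ℝ, EG) g₀ (s ((extChartAt I c).symm y))) y))
      (extChartAt 𝓘(ℝ, EG) g₀ (s ((extChartAt I c).symm y))) v =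
    volCoeff I b Ω c y * epForm I b Ω G (fun x => L x 1) (rightDer I s) ((extChartAt I c).symm y)
      (chartTriv EG g₀ (s ((extChartAt I c).symm y)) v) := by
  set x := (extChartAt I c).symm y with hxdef
  set u : E → EG := fun y => extChartAt 𝓘(ℝ, EG) g₀ (s ((extChartAt I c).symm y)) with hu
  set η : N → EG := fun x => chartTriv EG g₀ (s x) v with hη
  have hsx := hs x hy.2
  have hxs : x ∈ (extChartAt I c).source := (extChartAt I c).map_target hy.1
  have hηs : ContMDiffAt I 𝓘(ℝ, EG) ∞ η x := contMDiffAt_chartTriv hsx hx contMDiffAt_const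
  have hσ : ∀ x ∈ U, SmoothFormAt I (rightDer I (EG := EG) s) x :=
    fun x hx => smoothFormAt_rightDer (hs x hx)
  have hw := hf.smoothDualField hσ
  -- the base derivative
  have hbase : fderiv ℝ (fun z => jetCoord I L c g₀ y z (fderiv ℝ u y)) (u y) v =
      fibreD (fun x => L x 1) (rightDer I s) x
        (tder I 𝓘(ℝ, EG) η x - (adRight G (η x)).comp (rightDer I s x)) := by
    have hz : u y ∈ (extChartAt 𝓘(ℝ, EG) g₀).target := (extChartAt 𝓘(ℝ, EG) g₀).map_source hx
    have hd : ContDiffAt ℝ ∞ (fun q : E × EG × (E →L[ℝ] EG) =>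
        jetCoord I L c g₀ q.1 q.2.1 q.2.2) (y, u y, fderiv ℝ u y) :=
      (hsm c g₀ _ ⟨hy.1, hz, trivial⟩).contDiffAt (((isOpen_extChartAt_target (I := I) c).prod
        ((isOpen_extChartAt_target (I := 𝓘(ℝ, EG)) g₀).prod isOpen_univ)).mem_nhds
        ⟨hy.1, hz, trivial⟩)
    have hd2 : DifferentiableAt ℝ (fun z => jetCoord I L c g₀ y z (fderiv ℝ u y)) (u y) :=
      DifferentiableAt.comp (g := fun q : E × EG × (E →L[ℝ] EG) =>
        jetCoord I L c g₀ q.1 q.2.1 q.2.2) (f := fun z => (y, z, fderiv ℝ u y)) (u y)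
        (hd.differentiableAt (by simp)) (by fun_prop)
    have hl : HasDerivAt (fun ε : ℝ => u y + ε • v) v 0 := by
      simpa using ((hasDerivAt_id (0 : ℝ)).smul_const v).const_add (u y)
    have h1 := HasFDerivAt.comp_hasDerivAt (0 : ℝ) (f := fun ε : ℝ => u y + ε • v)
      (l := fun z => jetCoord I L c g₀ y z (fderiv ℝ u y))
      (l' := fderiv ℝ (fun z => jetCoord I L c g₀ y z (fderiv ℝ u y)) (u y))
      (by simp only [zero_smul, add_zero]; exact hd2.hasFDerivAt) hl
    exact h1.unique (hasDerivAt_jetCoord_base hL hf hy.1 hsx hx v)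
  rw [hbase]
  -- the momenta
  have hmom : ∀ i, (fun y' => volCoeff I b Ω c y' * fderiv ℝ (fun A => jetCoord I L c g₀ y'
        (u y') A) (fderiv ℝ u y') (elemCovector b i v)) =ᶠ[𝓝 y]
      fun y' => volCoeff I b Ω c y' * fieldComp I c (fibreD (fun x => L x 1) (rightDer I s))
        (elemCovector b i (η ((extChartAt I c).symm y'))) y' := by
    intro i
    have hc := (contMDiffAt_chart_symm (I := I) hy.1).continuousAt
    filter_upwards [(isOpen_chartSet c hU).mem_nhds hy,
      hc.eventually (eventually_mem_chart_source hsx.continuousAt hx)] with z hz hz'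
    rw [fderiv_jetCoord_fibre hL hf hz.1 (hs _ hz.2) hz']
    congr 2
    ext e
    simp [elemCovector, hη]
  have hsum : ∀ i, fderiv ℝ (fun y' => volCoeff I b Ω c y' * fderiv ℝ (fun A =>
        jetCoord I L c g₀ y' (u y') A) (fderiv ℝ u y') (elemCovector b i v)) y (b i) =
      fderiv ℝ (fun y' => volCoeff I b Ω c y' *
        fieldComp I c (fibreD (fun x => L x 1) (rightDer I s))
        (elemCovector b i (η ((extChartAt I c).symm y'))) y') y (b i) := fun i => by
    rw [(hmom i).fderiv_eq]
  rw [Finset.sum_congr rfl fun i _ => hsum i, sum_fderiv_mul_fieldComp hΩ hU hw hy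
    (h := fun y' => η ((extChartAt I c).symm y'))
    ((contDiffAt_of_contMDiffAt hy.1 hηs).differentiableAt (by simp)),
    divAt_eq_divAt hΩ hU hw hxs (mem_extChartAt_source x) hy.2]
  have h5 : fieldComp I c (fibreD (fun x => L x 1) (rightDer I s))
      (fderiv ℝ (fun y' => η ((extChartAt I c).symm y')) y) y =
      fibreD (fun x => L x 1) (rightDer I s) x (tder I 𝓘(ℝ, EG) η x) := by
    rw [fieldComp, ← tder_eq_fderiv_comp hy.1 (hηs.mdifferentiableAt (by simp))]
  rw [h5, map_sub, epForm]
  ring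

end CoordinateEulerLagrange

/-! ### Charts and the volume form of `ℝ × M` -/

section SpacetimeCharts

variable {n : ℕ} {M : Type*} [TopologicalSpace M] [ChartedSpace (EuclideanSpace ℝ (Fin n)) M]

theorem stBasis_zero : stBasis n 0 = (1, 0) := by
  have : (finSumFinEquiv.trans (finCongr (Nat.add_comm 1 n))).symm 0 = Sum.inl 0 := by
    rw [Equiv.symm_apply_eq]; rfl
  rw [stBasis, Module.Basis.reindex_apply, this]
  simp

theorem stBasis_succ (i : Fin n) : stBasis n i.succ = (0, spaceBasis n i) := by
  have : (finSumFinEquiv.trans (finCongr (Nat.add_comm 1 n))).symm i.succ = Sum.inr i := by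
    rw [Equiv.symm_apply_eq]
    ext
    simp
  rw [stBasis, Module.Basis.reindex_apply, this]
  simp

theorem stBasis_coord_zero (p : ℝ × EuclideanSpace ℝ (Fin n)) : (stBasis n).coord 0 p = p.1 := by
  have h : (stBasis n).coord 0 = LinearMap.fst ℝ ℝ (EuclideanSpace ℝ (Fin n)) := by
    refine (stBasis n).ext fun i => ?_
    refine Fin.cases ?_ (fun i => ?_) i
    · rw [Module.Basis.coord_apply, Module.Basis.repr_self]; simp [stBasis_zero]
    · rw [Module.Basis.coord_apply, Module.Basis.repr_self]
      simp [stBasis_succ, Fin.succ_ne_zero]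
  rw [h]; rfl

theorem stBasis_coord_succ (i : Fin n) (p : ℝ × EuclideanSpace ℝ (Fin n)) :
    (stBasis n).coord i.succ p = (spaceBasis n).coord i p.2 := by
  have h : (stBasis n).coord i.succ =
      ((spaceBasis n).coord i).comp (LinearMap.snd ℝ ℝ (EuclideanSpace ℝ (Fin n))) := by
    refine (stBasis n).ext fun j => ?_
    refine Fin.cases ?_ (fun j => ?_) j
    · rw [Module.Basis.coord_apply, Module.Basis.repr_self]
      simp [stBasis_zero]
    · rw [Module.Basis.coord_apply, Module.Basis.repr_self]
      simp [stBasis_succ, Finsupp.single_apply]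
  rw [h]; rfl

theorem stChart_symm_apply (x₀ : ℝ × M) (q : ℝ × EuclideanSpace ℝ (Fin n)) :
    (extChartAt (stModel n) x₀).symm q = (q.1, (extChartAt (𝓡 n) x₀.2).symm q.2) := by
  rw [extChartAt_prod, extChartAt_model_space_eq_id]; rfl

theorem stChart_apply (x₀ x : ℝ × M) :
    extChartAt (stModel n) x₀ x = (x.1, extChartAt (𝓡 n) x₀.2 x.2) := by
  rw [extChartAt_prod, extChartAt_model_space_eq_id]; rfl

theorem stChart_target (x₀ : ℝ × M) :
    (extChartAt (stModel n) x₀).target = Set.univ ×ˢ (extChartAt (𝓡 n) x₀.2).target := by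
  rw [extChartAt_prod, extChartAt_model_space_eq_id]; rfl

theorem stChart_source (x₀ : ℝ × M) :
    (extChartAt (stModel n) x₀).source = Set.univ ×ˢ (extChartAt (𝓡 n) x₀.2).source := by
  rw [extChartAt_prod, extChartAt_model_space_eq_id]; rfl

variable [IsManifold (𝓡 n) ∞ M]

theorem tder_stChart_symm (x₀ : ℝ × M) {q : ℝ × EuclideanSpace ℝ (Fin n)}
    (hq : q.2 ∈ (extChartAt (𝓡 n) x₀.2).target) :
    tder 𝓘(ℝ, ℝ × EuclideanSpace ℝ (Fin n)) (stModel n) (extChartAt (stModel n) x₀).symm q =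
      (ContinuousLinearMap.id ℝ ℝ).prodMap
        (tder 𝓘(ℝ, EuclideanSpace ℝ (Fin n)) (𝓡 n) (extChartAt (𝓡 n) x₀.2).symm q.2) := by
  have h1 : ((extChartAt (stModel n) x₀).symm : _ → ℝ × M) =
      Prod.map (fun t : ℝ => t) (extChartAt (𝓡 n) x₀.2).symm := by
    funext q; exact stChart_symm_apply x₀ q
  have h2 : tder (𝓘(ℝ, ℝ).prod 𝓘(ℝ, EuclideanSpace ℝ (Fin n))) (stModel n)
      (Prod.map (fun t : ℝ => t) (extChartAt (𝓡 n) x₀.2).symm) q = (tder 𝓘(ℝ, ℝ) 𝓘(ℝ, ℝ)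
      (fun t : ℝ => t) q.1).prodMap (tder 𝓘(ℝ, EuclideanSpace ℝ (Fin n)) (𝓡 n)
      (extChartAt (𝓡 n) x₀.2).symm q.2) :=
    mfderiv_prodMap (I := 𝓘(ℝ, ℝ)) (J := 𝓘(ℝ, ℝ)) (I' := 𝓡 n) (J' := 𝓡 n) (p := q)
    (f := fun t : ℝ => t) (g := (extChartAt (𝓡 n) x₀.2).symm) mdifferentiableAt_id
    ((contMDiffAt_chart_symm (I := 𝓡 n) hq).mdifferentiableAt (by simp))
  rw [← modelWithCornersSelf_prod, chartedSpaceSelf_prod] at h2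
  have h3 : tder 𝓘(ℝ, ℝ) 𝓘(ℝ, ℝ) (fun t : ℝ => t) q.1 = ContinuousLinearMap.id ℝ ℝ := tder_id _
  rw [h1, ← h3, h2]

theorem tder_stChart (x₀ : ℝ × M) {x : ℝ × M} (hx : x.2 ∈ (extChartAt (𝓡 n) x₀.2).source) :
    tder (stModel n) 𝓘(ℝ, ℝ × EuclideanSpace ℝ (Fin n)) (extChartAt (stModel n) x₀) x =
      (ContinuousLinearMap.id ℝ ℝ).prodMap
        (tder (𝓡 n) 𝓘(ℝ, EuclideanSpace ℝ (Fin n)) (extChartAt (𝓡 n) x₀.2) x.2) := by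
  have h1 : (extChartAt (stModel n) x₀ : ℝ × M → _) =
      Prod.map (fun t : ℝ => t) (extChartAt (𝓡 n) x₀.2) := by
    funext q; exact stChart_apply x₀ q
  have h2 : tder (stModel n) (𝓘(ℝ, ℝ).prod 𝓘(ℝ, EuclideanSpace ℝ (Fin n)))
      (Prod.map (fun t : ℝ => t) (extChartAt (𝓡 n) x₀.2)) x = (tder 𝓘(ℝ, ℝ) 𝓘(ℝ, ℝ)
      (fun t : ℝ => t) x.1).prodMap (tder (𝓡 n) 𝓘(ℝ, EuclideanSpace ℝ (Fin n))
      (extChartAt (𝓡 n) x₀.2) x.2) :=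
    mfderiv_prodMap (I := 𝓘(ℝ, ℝ)) (J := 𝓘(ℝ, ℝ)) (I' := 𝓡 n) (J' := 𝓡 n) (p := x)
    (f := fun t : ℝ => t) (g := extChartAt (𝓡 n) x₀.2) mdifferentiableAt_id
    ((contMDiffAt_chart (I := 𝓡 n) hx).mdifferentiableAt (by simp))
  rw [← modelWithCornersSelf_prod, chartedSpaceSelf_prod] at h2
  have h3 : tder 𝓘(ℝ, ℝ) 𝓘(ℝ, ℝ) (fun t : ℝ => t) x.1 = ContinuousLinearMap.id ℝ ℝ := tder_id _
  rw [h1, ← h3, h2]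

variable {Ω : ∀ m : M, TangentSpace (𝓡 n) m [⋀^Fin n]→ₗ[ℝ] ℝ}

/-- The charts of `ℝ × M` do not change the time coordinate, so that the coefficient of `dt ∧ Ω` is
that of `Ω`. In the alternatization only the term that feeds `∂ₜ` to `dt` contributes. -/
theorem volCoeff_dtWedge (x₀ : ℝ × M) {q : ℝ × EuclideanSpace ℝ (Fin n)}
    (hq : q.2 ∈ (extChartAt (𝓡 n) x₀.2).target) :
    volCoeff (stModel n) (stBasis n) (dtWedge Ω) x₀ q =
      volCoeff (𝓡 n) (spaceBasis n) Ω x₀.2 q.2 := by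
  rw [volCoeff_eq, volCoeff_eq, tder_stChart_symm x₀ hq]
  set T := tder 𝓘(ℝ, EuclideanSpace ℝ (Fin n)) (𝓡 n) (extChartAt (𝓡 n) x₀.2).symm q.2
  have h1 : ((extChartAt (stModel n) x₀).symm q).2 = (extChartAt (𝓡 n) x₀.2).symm q.2 := by
    rw [stChart_symm_apply]
  let Ω' : M → (EuclideanSpace ℝ (Fin n) [⋀^Fin n]→ₗ[ℝ] ℝ) := Ω
  change AlternatingMap.alternatizeUncurryFin
    ((LinearMap.fst ℝ ℝ (EuclideanSpace ℝ (Fin n))).smulRight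
      ((Ω' ((extChartAt (stModel n) x₀).symm q).2).compLinearMap
        (LinearMap.snd ℝ ℝ (EuclideanSpace ℝ (Fin n)))))
    (fun i => ((ContinuousLinearMap.id ℝ ℝ).prodMap T) (stBasis n i)) =
    Ω' ((extChartAt (𝓡 n) x₀.2).symm q.2) (fun i => T (spaceBasis n i))
  rw [h1, AlternatingMap.alternatizeUncurryFin_apply, Fin.sum_univ_succ, Finset.sum_eq_zero]
  · have h2 : (Fin.removeNth 0 fun i => ((ContinuousLinearMap.id ℝ ℝ).prodMap T) (stBasis n i)) =
        fun i => (0, T (spaceBasis n i)) := by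
      funext i
      simp [Fin.removeNth, stBasis_succ]
    rw [h2]
    simp [stBasis_zero]
  · intro i _
    simp [stBasis_succ]

theorem isVolumeForm_dtWedge (hΩ : IsVolumeForm (𝓡 n) (spaceBasis n) Ω) :
    IsVolumeForm (stModel n) (stBasis n) (dtWedge Ω) := by
  refine ⟨fun x h => ?_, fun x₀ => ?_⟩
  · have h1 := mem_extChartAt_target (I := 𝓡 n) x.2
    have h2 := volCoeff_dtWedge (Ω := Ω) x (q := extChartAt (stModel n) x x)
      (by rw [stChart_apply]; exact h1)
    have h3 := volCoeff_ne_zero hΩ h1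
    refine h3 ?_
    rw [stChart_apply] at h2
    rw [← h2, volCoeff, ← stChart_apply, extChartAt_to_inv, h]
    rfl
  · have h1 : ContDiffOn ℝ ∞ (fun q : ℝ × EuclideanSpace ℝ (Fin n) =>
        volCoeff (𝓡 n) (spaceBasis n) Ω x₀.2 q.2) (extChartAt (stModel n) x₀).target :=
      (hΩ.smooth x₀.2).comp (f := Prod.snd) contDiffOn_snd fun q hq => by
        rw [stChart_target] at hq; exact hq.2
    refine h1.congr fun q hq => volCoeff_dtWedge x₀ ?_
    rw [stChart_target] at hq
    exact hq.2

end SpacetimeCharts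

/-! ### Time and space components on `ℝ × M` -/

section SpacetimeSplitting

variable {n : ℕ} {M : Type*} [TopologicalSpace M] [ChartedSpace (EuclideanSpace ℝ (Fin n)) M]
  [IsManifold (𝓡 n) ∞ M] {F : Type*} [NormedAddCommGroup F] [NormedSpace ℝ F]

/-- The linear map `(τ, u) ↦ τ v + a(u)`. -/
def splitForm (v : F) (a : EuclideanSpace ℝ (Fin n) →L[ℝ] F) :
    (ℝ × EuclideanSpace ℝ (Fin n)) →L[ℝ] F :=
  (ContinuousLinearMap.toSpanSingleton ℝ v).coprod a

theorem splitForm_apply (v : F) (a : EuclideanSpace ℝ (Fin n) →L[ℝ] F)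
    (p : ℝ × EuclideanSpace ℝ (Fin n)) : splitForm v a p = p.1 • v + a p.2 := by
  simp [splitForm]

theorem splitForm_eq_add (v : F) (a : EuclideanSpace ℝ (Fin n) →L[ℝ] F) :
    splitForm v a = splitForm v 0 + splitForm 0 a := by
  ext <;> simp [splitForm_apply]

theorem tder_spacetime {E' : Type*} [NormedAddCommGroup E'] [NormedSpace ℝ E']
    {H' : Type*} [TopologicalSpace H'] {I' : ModelWithCorners ℝ E' H'} {N' : Type*}
    [TopologicalSpace N'] [ChartedSpace H' N'] {f : ℝ × M → N'} {t : ℝ} {m : M}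
    (hf : MDifferentiableAt (stModel n) I' f (t, m)) :
    tder (stModel n) I' f (t, m) = splitForm (tder 𝓘(ℝ, ℝ) I' (fun τ => f (τ, m)) t 1)
      (tder (𝓡 n) I' (fun m => f (t, m)) m) := by
  ext p
  · have h := mfderiv_prod_eq_add_apply (v := ((1 : ℝ), (0 : EuclideanSpace ℝ (Fin n)))) hf
    change tder (stModel n) I' f (t, m) (1, 0) = tder 𝓘(ℝ, ℝ) I' (fun τ => f (τ, m)) t 1 +
      tder (𝓡 n) I' (fun m => f (t, m)) m 0 at h
    simp [splitForm_apply, h]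
  · have h := mfderiv_prod_eq_add_apply (v := ((0 : ℝ), (p : EuclideanSpace ℝ (Fin n)))) hf
    change tder (stModel n) I' f (t, m) (0, p) = tder 𝓘(ℝ, ℝ) I' (fun τ => f (τ, m)) t 0 +
      tder (𝓡 n) I' (fun m => f (t, m)) m p at h
    simp [splitForm_apply, h]

theorem tder_spacetime_vector {f : ℝ × M → F} {t : ℝ} {m : M}
    (hf : MDifferentiableAt (stModel n) 𝓘(ℝ, F) f (t, m)) :
    tder (stModel n) 𝓘(ℝ, F) f (t, m) = splitForm (deriv (fun τ => f (τ, m)) t)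
      (tder (𝓡 n) 𝓘(ℝ, F) (fun m => f (t, m)) m) := by
  rw [tder_spacetime hf, tder_eq_fderiv]
  rfl

theorem rightDer_spacetime {EG : Type*} [NormedAddCommGroup EG] [NormedSpace ℝ EG]
    {G : Type*} [TopologicalSpace G] [ChartedSpace EG G] [Group G] [LieGroup 𝓘(ℝ, EG) ∞ G]
    {s : ℝ × M → G} {t : ℝ} {m : M} (hs : MDifferentiableAt (stModel n) 𝓘(ℝ, EG) s (t, m)) :
    rightDer (stModel n) s (t, m) = splitForm (rightDer 𝓘(ℝ, ℝ) (EG := EG) (fun τ => s (τ, m)) t 1)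
      (rightDer (𝓡 n) (EG := EG) (fun m => s (t, m)) m) := by
  have h : MDifferentiableAt (stModel n) 𝓘(ℝ, EG) (fun x => s x * (s (t, m))⁻¹) (t, m) :=
    MDifferentiableAt.comp (g := fun k : G => k * (s (t, m))⁻¹) (I' := 𝓘(ℝ, EG)) (t, m)
      ((contMDiff_mul_const _).mdifferentiable (by simp) _) hs
  exact tder_spacetime h

theorem splitForm_comp_prodMap (v : F) (a : EuclideanSpace ℝ (Fin n) →L[ℝ] F)
    (T : EuclideanSpace ℝ (Fin n) →L[ℝ] EuclideanSpace ℝ (Fin n)) :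
    (splitForm v a).comp ((ContinuousLinearMap.id ℝ ℝ).prodMap T) = splitForm v (a.comp T) := by
  ext <;> simp [splitForm_apply]

/-- The time component `v ↦ w(v dt)` of a dual field on spacetime. -/
def timeMomentum (w : ℝ × M → ((ℝ × EuclideanSpace ℝ (Fin n)) →L[ℝ] F) →ₗ[ℝ] ℝ) (x : ℝ × M) :
    F →ₗ[ℝ] ℝ where
  toFun v := w x (splitForm v 0)
  map_add' v v' := by
    rw [← map_add]; congr 1; ext <;> simp [splitForm_apply]
  map_smul' c v := by
    rw [RingHom.id_apply, ← map_smul]; congr 1; ext <;> simp [splitForm_apply]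

/-- The space component of a dual field on spacetime at time `t`. -/
def spaceMomentum (w : ℝ × M → ((ℝ × EuclideanSpace ℝ (Fin n)) →L[ℝ] F) →ₗ[ℝ] ℝ) (t : ℝ) (m : M) :
    (EuclideanSpace ℝ (Fin n) →L[ℝ] F) →ₗ[ℝ] ℝ where
  toFun a := w (t, m) (splitForm 0 a)
  map_add' a a' := by
    rw [← map_add]; congr 1; ext <;> simp [splitForm_apply]
  map_smul' c a := by
    rw [RingHom.id_apply, ← map_smul]; congr 1; ext <;> simp [splitForm_apply]

variable {w : ℝ × M → ((ℝ × EuclideanSpace ℝ (Fin n)) →L[ℝ] F) →ₗ[ℝ] ℝ}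

theorem apply_splitForm (x : ℝ × M) (v : F) (a : EuclideanSpace ℝ (Fin n) →L[ℝ] F) :
    w x (splitForm v a) = timeMomentum w x v + spaceMomentum w x.1 x.2 a := by
  rw [splitForm_eq_add, map_add]; rfl

theorem fieldComp_spacetime (x₀ : ℝ × M) {q : ℝ × EuclideanSpace ℝ (Fin n)}
    (hq : q.2 ∈ (extChartAt (𝓡 n) x₀.2).target) (v : F) (a : EuclideanSpace ℝ (Fin n) →L[ℝ] F) :
    fieldComp (stModel n) x₀ w (splitForm v a) q =
      timeMomentum w (q.1, (extChartAt (𝓡 n) x₀.2).symm q.2) v +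
        fieldComp (𝓡 n) x₀.2 (spaceMomentum w q.1) a q.2 := by
  have hs := (extChartAt (𝓡 n) x₀.2).map_target hq
  rw [fieldComp, stChart_symm_apply, tder_stChart x₀ (x := (q.1, _)) hs, splitForm_comp_prodMap,
    apply_splitForm]
  rfl

theorem smoothDualField_spaceMomentum {U : Set (ℝ × M)} (hU : IsOpen U)
    (hw : SmoothDualField (stModel n) w U) {t : ℝ} {V : Set M} (hV : ∀ m ∈ V, (t, m) ∈ U) :
    SmoothDualField (𝓡 n) (spaceMomentum w t) V := by
  intro c a y hy
  have hmem : (t, y) ∈ chartSet (stModel n) ((t, c) : ℝ × M) U := by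
    refine ⟨?_, ?_⟩
    · rw [stChart_target]; exact ⟨trivial, hy.1⟩
    · rw [Set.mem_preimage, stChart_symm_apply]; exact hV _ hy.2
  have h1 := ContDiffAt.comp (f := fun z => (t, z)) y
    (contDiffAt_fieldComp hU hw (t, c) (splitForm 0 a) hmem)
    (contDiffAt_const.prodMk contDiffAt_id)
  refine (h1.congr_of_eventuallyEq ?_).contDiffWithinAt
  filter_upwards [(isOpen_extChartAt_target (I := 𝓡 n) c).mem_nhds hy.1] with z hz
  simp only [Function.comp_def]
  rw [fieldComp_spacetime (t, c) hz, map_zero, zero_add]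

variable {Ω : ∀ m : M, TangentSpace (𝓡 n) m [⋀^Fin n]→ₗ[ℝ] ℝ}

theorem differentiableAt_timeMomentum {U : Set (ℝ × M)} (hU : IsOpen U)
    (hw : SmoothDualField (stModel n) w U) {x : ℝ × M} (hx : x ∈ U) (η : F) :
    DifferentiableAt ℝ (fun τ => timeMomentum w (τ, x.2) η) x.1 := by
  have hmem := mem_chartSet (I := stModel n) (mem_extChartAt_source x) hx
  have h1 := ((contDiffAt_fieldComp hU hw x (splitForm η 0) hmem).differentiableAt (by simp))
  rw [stChart_apply] at h1
  have h2 := DifferentiableAt.comp (f := fun τ : ℝ => (τ, extChartAt (𝓡 n) x.2 x.2)) x.1 h1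
    (by fun_prop)
  refine h2.congr_of_eventuallyEq (Filter.Eventually.of_forall fun τ => ?_)
  simp only [Function.comp_def]
  rw [fieldComp_spacetime x (mem_extChartAt_target x.2)]
  simp only
  rw [extChartAt_to_inv]
  simp [fieldComp]

/-- The divergence on spacetime splits as `∂ₜ` of the time component plus the divergence on space of
the space component. -/
theorem divAt_spacetime (hΩ : IsVolumeForm (𝓡 n) (spaceBasis n) Ω) {U : Set (ℝ × M)}
    (hU : IsOpen U) (hw : SmoothDualField (stModel n) w U) {x : ℝ × M} (hx : x ∈ U) (η : F) :
    divAt (stModel n) (stBasis n) (dtWedge Ω) x w x η =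
      deriv (fun τ => timeMomentum w (τ, x.2) η) x.1 +
        divAt (𝓡 n) (spaceBasis n) Ω x.2 (spaceMomentum w x.1) x.2 η := by
  set y := extChartAt (𝓡 n) x.2 x.2 with hy
  have hyt : y ∈ (extChartAt (𝓡 n) x.2).target := mem_extChartAt_target x.2
  have hΩX := isVolumeForm_dtWedge hΩ
  have hmem : (x.1, y) ∈ chartSet (stModel n) x U := by
    have := mem_chartSet (I := stModel n) (mem_extChartAt_source x) hx
    rwa [stChart_apply] at this
  set ρ := volCoeff (𝓡 n) (spaceBasis n) Ω x.2 with hρ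
  set ρX := volCoeff (stModel n) (stBasis n) (dtWedge Ω) x with hρX
  have hd : ∀ A, HasFDerivAt (fun q => ρX q * fieldComp (stModel n) x w A q)
      (fderiv ℝ (fun q => ρX q * fieldComp (stModel n) x w A q) (x.1, y)) (x.1, y) := fun A =>
    (((contDiffAt_volCoeff hΩX hmem.1).mul (contDiffAt_fieldComp hU hw x A hmem)).differentiableAt
      (by simp)).hasFDerivAt
  have hcov0 : elemCovector (stBasis n) 0 η = splitForm η 0 := by
    ext <;> simp [elemCovector, splitForm_apply, -Module.Basis.coord_apply, stBasis_coord_zero]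
  have hcovs : ∀ i : Fin n, elemCovector (stBasis n) i.succ η =
      splitForm 0 (elemCovector (spaceBasis n) i η) := fun i => by
    ext <;> simp [elemCovector, splitForm_apply, -Module.Basis.coord_apply, stBasis_coord_succ]
  have h0 : fderiv ℝ (fun q => ρX q * fieldComp (stModel n) x w (elemCovector (stBasis n) 0 η) q)
      (x.1, y) (stBasis n 0) = ρ y * deriv (fun τ => timeMomentum w (τ, x.2) η) x.1 := by
    rw [stBasis_zero]
    have h1 := HasFDerivAt.comp_hasDerivAt x.1 (f := fun τ : ℝ => (τ, y))
      (l := fun q => ρX q * fieldComp (stModel n) x w (elemCovector (stBasis n) 0 η) q)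
      (hd _) ((hasDerivAt_id _).prodMk (hasDerivAt_const _ _))
    refine h1.unique ?_
    have h2 := ((differentiableAt_timeMomentum hU hw hx η).hasDerivAt).const_mul (ρ y)
    refine h2.congr_of_eventuallyEq (Filter.Eventually.of_forall fun τ => ?_)
    simp only [Function.comp_def]
    rw [hcov0, fieldComp_spacetime x hyt, hρX, volCoeff_dtWedge x hyt]
    simp only [hy]
    rw [extChartAt_to_inv]
    simp [fieldComp, hρ]
  have hs : ∀ i : Fin n, fderiv ℝ (fun q => ρX q * fieldComp (stModel n) x w
      (elemCovector (stBasis n) i.succ η) q) (x.1, y) (stBasis n i.succ) =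
      fderiv ℝ (fun z => ρ z * fieldComp (𝓡 n) x.2 (spaceMomentum w x.1)
        (elemCovector (spaceBasis n) i η) z) y (spaceBasis n i) := by
    intro i
    rw [stBasis_succ]
    have h1 := HasFDerivAt.comp y (f := fun z => (x.1, z))
      (g := fun q => ρX q * fieldComp (stModel n) x w (elemCovector (stBasis n) i.succ η) q)
      (hd _) (hasFDerivAt_prodMk_right (𝕜 := ℝ) x.1 y)
    have h2 : (fun z => ρ z * fieldComp (𝓡 n) x.2 (spaceMomentum w x.1)
        (elemCovector (spaceBasis n) i η) z) =ᶠ[𝓝 y]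
        (fun q => ρX q * fieldComp (stModel n) x w (elemCovector (stBasis n) i.succ η) q) ∘
          fun z => (x.1, z) := by
      filter_upwards [(isOpen_extChartAt_target (I := 𝓡 n) x.2).mem_nhds hyt] with z hz
      simp only [Function.comp_def]
      rw [hcovs, fieldComp_spacetime x hz, hρX, volCoeff_dtWedge x hz, map_zero, zero_add]
    rw [h2.fderiv_eq, h1.fderiv]
    simp
  have hne := volCoeff_ne_zero hΩ hyt
  have hc : ρX (x.1, y) = ρ y := volCoeff_dtWedge x hyt
  rw [divAt, divAt, stChart_apply, ← hy, ← hρ, ← hρX, Fin.sum_univ_succ, h0,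
    Finset.sum_congr rfl fun i _ => hs i, hc, mul_add, inv_mul_cancel_left₀ hne]

theorem smoothFormAt_splitForm {η : ℝ × M → F} {x : ℝ × M}
    (hη : ContMDiffAt (stModel n) 𝓘(ℝ, F) ∞ η x) :
    SmoothFormAt (stModel n) (fun x => splitForm (η x) (0 : EuclideanSpace ℝ (Fin n) →L[ℝ] F)) x := by
  intro c hc
  have hy := (extChartAt (stModel n) c).map_source hc
  have h1 := contDiffAt_of_contMDiffAt hy (by rwa [(extChartAt (stModel n) c).left_inv hc])
  let Λ : F →L[ℝ] ((ℝ × EuclideanSpace ℝ (Fin n)) →L[ℝ] F) :=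
    ContinuousLinearMap.smulRightL ℝ _ F (ContinuousLinearMap.fst ℝ ℝ (EuclideanSpace ℝ (Fin n)))
  refine (Λ.contDiff.contDiffAt.comp _ h1).congr_of_eventuallyEq ?_
  filter_upwards [(isOpen_extChartAt_target (I := stModel n) c).mem_nhds hy] with q hq
  rw [stChart_target] at hq
  rw [tder_stChart_symm c hq.2, splitForm_comp_prodMap]
  ext <;> simp [splitForm_apply, Λ]

end SpacetimeSplitting

/-! ### Integration by parts over space and over time -/

section SpacetimeVariation

/-- The product rule for `p(τ)(ζ(τ))` with `p(τ)` linear, from pointwise differentiability of `p`.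
-/
theorem hasDerivAt_linear_apply {F : Type*} [NormedAddCommGroup F] [NormedSpace ℝ F]
    [FiniteDimensional ℝ F] {p : ℝ → F →ₗ[ℝ] ℝ} {t : ℝ}
    (hp : ∀ e, DifferentiableAt ℝ (fun τ => p τ e) t) {ζ : ℝ → F} {ζ' : F}
    (hζ : HasDerivAt ζ ζ' t) :
    HasDerivAt (fun τ => p τ (ζ τ)) (deriv (fun τ => p τ (ζ t)) t + p t ζ') t := by
  let B := Module.finBasis ℝ F
  have hexp : ∀ (q : F →ₗ[ℝ] ℝ) (v : F), q v = ∑ k, B.repr v k * q (B k) := fun q v => by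
    conv_lhs => rw [← B.sum_repr v, map_sum]
    simp
  have hk : ∀ k, HasDerivAt (fun τ => B.repr (ζ τ) k) (B.repr ζ' k) t := fun k =>
    (LinearMap.toContinuousLinearMap (B.coord k)).hasFDerivAt.comp_hasDerivAt t hζ
  have h1 : HasDerivAt (fun τ => ∑ k, B.repr (ζ τ) k * p τ (B k))
      (∑ k, (B.repr ζ' k * p t (B k) + B.repr (ζ t) k * deriv (fun τ => p τ (B k)) t)) t :=
    HasDerivAt.fun_sum fun k _ => (hk k).mul (hp (B k)).hasDerivAt
  have h2 : HasDerivAt (fun τ => ∑ k, B.repr (ζ t) k * p τ (B k))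
      (∑ k, B.repr (ζ t) k * deriv (fun τ => p τ (B k)) t) t :=
    HasDerivAt.fun_sum fun k _ => (hp (B k)).hasDerivAt.const_mul _
  simp only [← hexp] at h1 h2
  rw [h2.deriv, hexp (p t) ζ']
  convert h1 using 1
  rw [Finset.sum_add_distrib, add_comm]

variable {n : ℕ} {M : Type*} [TopologicalSpace M] [T2Space M] [SecondCountableTopology M]
  [ChartedSpace (EuclideanSpace ℝ (Fin n)) M] [IsManifold (𝓡 n) ∞ M]
  [MeasurableSpace M] [BorelSpace M]
  {EG : Type*} [NormedAddCommGroup EG] [NormedSpace ℝ EG] [FiniteDimensional ℝ EG]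
  {G : Type*} [TopologicalSpace G] [ChartedSpace EG G] [Group G] [LieGroup 𝓘(ℝ, EG) ∞ G]
  {Ω : ∀ m : M, TangentSpace (𝓡 n) m [⋀^Fin n]→ₗ[ℝ] ℝ}
  {f : ℝ × M → ((ℝ × EuclideanSpace ℝ (Fin n)) →L[ℝ] EG) → ℝ}
  {σ : ℝ × M → (ℝ × EuclideanSpace ℝ (Fin n)) →L[ℝ] EG} {U : Set (ℝ × M)}

theorem contMDiffAt_timeMomentum (hf : SmoothFibreFun (stModel n) f) {x : ℝ × M}
    (hσ : SmoothFormAt (stModel n) σ x) {η : ℝ × M → EG}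
    (hη : ContMDiffAt (stModel n) 𝓘(ℝ, EG) ∞ η x) :
    ContMDiffAt (stModel n) 𝓘(ℝ, ℝ) ∞ (fun x => timeMomentum (fibreD f σ) x (η x)) x :=
  hf.contMDiffAt_fibreD hσ (smoothFormAt_splitForm hη)

theorem contMDiffAt_dt {F : Type*} [NormedAddCommGroup F] [NormedSpace ℝ F]
    {η : ℝ × M → F} {x : ℝ × M} (hη : ContMDiffAt (stModel n) 𝓘(ℝ, F) ∞ η x) :
    ContMDiffAt (stModel n) 𝓘(ℝ, F) ∞ (fun x => deriv (fun τ => η (τ, x.2)) x.1) x :=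
  contMDiffAt_deriv (g := fun τ m => η (τ, m)) hη

theorem ContMDiffAt.differentiableAt_time {F : Type*} [NormedAddCommGroup F] [NormedSpace ℝ F]
    {η : ℝ × M → F} {t : ℝ} {m : M} (hη : ContMDiffAt (stModel n) 𝓘(ℝ, F) ∞ η (t, m)) :
    DifferentiableAt ℝ (fun τ => η (τ, m)) t :=
  ((ContMDiffAt.slice_left (g := fun τ m => η (τ, m)) hη).mdifferentiableAt
    (by simp)).differentiableAt

/-- Integration by parts over space, at a fixed time, in the first variation. -/
theorem setIntegral_slice_variation (hΩ : IsVolumeForm (𝓡 n) (spaceBasis n) Ω)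
    (hf : SmoothFibreFun (stModel n) f) (hU : IsOpen U)
    (hσ : ∀ x ∈ U, SmoothFormAt (stModel n) σ x) {t : ℝ} {V K : Set M} (hV : IsOpen V)
    (hVU : ∀ m ∈ V, (t, m) ∈ U) (hK : IsCompact K) (hKV : K ⊆ V) {η : ℝ × M → EG}
    (hη : ∀ m ∈ V, ContMDiffAt (stModel n) 𝓘(ℝ, EG) ∞ η (t, m))
    (h0 : ∀ m ∈ V \ K, η (t, m) = 0) :
    ∫ m in K, fibreD f σ (t, m) (tder (stModel n) 𝓘(ℝ, EG) η (t, m) -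
        (adRight G (η (t, m))).comp (σ (t, m))) ∂(volMeasure (𝓡 n) (spaceBasis n) Ω) =
      ∫ m in K, deriv (fun τ => timeMomentum (fibreD f σ) (τ, m) (η (τ, m))) t
        ∂(volMeasure (𝓡 n) (spaceBasis n) Ω) -
      ∫ m in K, epForm (stModel n) (stBasis n) (dtWedge Ω) G f σ (t, m) (η (t, m))
        ∂(volMeasure (𝓡 n) (spaceBasis n) Ω) := by
  set μ := volMeasure (𝓡 n) (spaceBasis n) Ω
  have : IsLocallyFiniteMeasure μ := isLocallyFiniteMeasure_volMeasure hΩ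
  have hΩX := isVolumeForm_dtWedge hΩ
  have hw := hf.smoothDualField hσ
  have hwt := smoothDualField_spaceMomentum hU hw hVU
  have hσt : ∀ m ∈ V, SmoothFormAt (stModel n) σ (t, m) := fun m hm => hσ _ (hVU m hm)
  have hslice : ∀ m ∈ V, ContMDiffAt (𝓡 n) 𝓘(ℝ, EG) ∞ (fun m => η (t, m)) m := fun m hm =>
    (ContMDiffAt.slice_right (g := fun τ m => η (τ, m)) (hη m hm))
  have hint : ∀ g : ℝ × M → ℝ, (∀ m ∈ V, ContMDiffAt (stModel n) 𝓘(ℝ, ℝ) ∞ g (t, m)) →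
      IntegrableOn (fun m => g (t, m)) K μ := fun g hg =>
    ContinuousOn.integrableOn_compact hK fun m hm => (ContMDiffAt.slice_right
      (g := fun τ m => g (τ, m)) (hg m (hKV hm))).continuousAt.continuousWithinAt
  have hI : ∀ m ∈ V, ContMDiffAt (stModel n) 𝓘(ℝ, ℝ) ∞
      (fun x => timeMomentum (fibreD f σ) x (η x)) (t, m) := fun m hm =>
    contMDiffAt_timeMomentum hf (hσt m hm) (hη m hm)
  have i1 := hint (fun x => fibreD f σ x (tder (stModel n) 𝓘(ℝ, EG) η x -
      (adRight G (η x)).comp (σ x))) fun m hm => hf.contMDiffAt_fibreD (hσt m hm)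
    ((smoothFormAt_tder (hη m hm)).sub ((hσt m hm).adRight_comp (hη m hm)))
  have i2 := hint (fun x => deriv (fun τ => timeMomentum (fibreD f σ) (τ, x.2) (η (τ, x.2))) x.1)
    fun m hm => contMDiffAt_dt (hI m hm)
  have i3 : IntegrableOn (fun m => epForm (stModel n) (stBasis n) (dtWedge Ω) G f σ (t, m)
      (η (t, m))) K μ := by
    have hc := continuousOn_epForm_apply (G := G) (K := {t} ×ˢ K) hΩX hf hU hσ
      (by rintro ⟨_, m⟩ ⟨rfl, hm⟩; exact hVU m (hKV hm)) (η := η)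
      (by rintro ⟨_, m⟩ ⟨rfl, hm⟩; exact (hη m (hKV hm)).continuousAt.continuousWithinAt)
    exact (hc.comp (f := fun m => (t, m)) (by fun_prop)
      fun m hm => ⟨rfl, hm⟩).integrableOn_compact hK
  have hsplit : ∀ m ∈ V, tder (stModel n) 𝓘(ℝ, EG) η (t, m) =
      splitForm (deriv (fun τ => η (τ, m)) t) (tder (𝓡 n) 𝓘(ℝ, EG) (fun m => η (t, m)) m) :=
    fun m hm => tder_spacetime_vector ((hη m hm).mdifferentiableAt (by simp))
  -- each term of the splitting is continuous on `K`
  have i4 : IntegrableOn (fun m => spaceMomentum (fibreD f σ) t m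
      (tder (𝓡 n) 𝓘(ℝ, EG) (fun m => η (t, m)) m)) K μ := by
    have a1 := hint (fun x => fibreD f σ x (tder (stModel n) 𝓘(ℝ, EG) η x)) fun m hm =>
      hf.contMDiffAt_fibreD (hσt m hm) (smoothFormAt_tder (hη m hm))
    have a2 := hint (fun x => timeMomentum (fibreD f σ) x (deriv (fun τ => η (τ, x.2)) x.1))
      fun m hm => contMDiffAt_timeMomentum hf (hσt m hm) (contMDiffAt_dt (hη m hm))
    refine (a1.sub a2).congr_fun (fun m hm => ?_) hK.measurableSet
    simp only [Pi.sub_apply]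
    rw [hsplit m (hKV hm), apply_splitForm, add_sub_cancel_left]
  -- the integrand is a total time derivative, minus the Euler–Poincaré covector, plus a divergence
  have hpt : ∀ m ∈ K, fibreD f σ (t, m) (tder (stModel n) 𝓘(ℝ, EG) η (t, m) -
        (adRight G (η (t, m))).comp (σ (t, m))) =
      deriv (fun τ => timeMomentum (fibreD f σ) (τ, m) (η (τ, m))) t -
      epForm (stModel n) (stBasis n) (dtWedge Ω) G f σ (t, m) (η (t, m)) +
      (spaceMomentum (fibreD f σ) t m (tder (𝓡 n) 𝓘(ℝ, EG) (fun m => η (t, m)) m) +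
      divAt (𝓡 n) (spaceBasis n) Ω m (spaceMomentum (fibreD f σ) t) m (η (t, m))) := by
    intro m hm
    have hx := hVU m (hKV hm)
    have hd := hasDerivAt_linear_apply (p := fun τ => timeMomentum (fibreD f σ) (τ, m))
      (fun e => differentiableAt_timeMomentum hU hw hx e)
      (hη m (hKV hm)).differentiableAt_time.hasDerivAt
    rw [hd.deriv, epForm, divAt_spacetime hΩ hU hw hx, map_sub, hsplit m (hKV hm),
      apply_splitForm]
    ring
  have i5 : IntegrableOn (fun m => divAt (𝓡 n) (spaceBasis n) Ω m (spaceMomentum (fibreD f σ) t) m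
      (η (t, m))) K μ := by
    refine (((i1.sub i2).add i3).sub i4).congr_fun (fun m hm => ?_) hK.measurableSet
    simp only [Pi.sub_apply, Pi.add_apply]
    rw [hpt m hm]
    ring
  have hdiv := setIntegral_field_tder_eq_div hΩ hV hwt hK hKV
    (η := fun m => η (t, m)) (fun m hm => (hslice m hm).contMDiffWithinAt) h0
  have aux : ∀ a₁ a₂ a₃ a₄ : M → ℝ, IntegrableOn a₁ K μ → IntegrableOn a₂ K μ →
      IntegrableOn a₃ K μ → IntegrableOn a₄ K μ →
      ∫ m in K, (a₁ m - a₂ m + (a₃ m + a₄ m)) ∂μ =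
        ∫ m in K, a₁ m ∂μ - ∫ m in K, a₂ m ∂μ + (∫ m in K, a₃ m ∂μ + ∫ m in K, a₄ m ∂μ) :=
    fun a₁ a₂ a₃ a₄ h₁ h₂ h₃ h₄ => by
      rw [integral_add (f := fun m => a₁ m - a₂ m) (g := fun m => a₃ m + a₄ m) (h₁.sub h₂)
        (h₃.add h₄), integral_sub h₁ h₂, integral_add h₃ h₄]
  rw [setIntegral_congr_fun hK.measurableSet hpt]
  refine (aux _ _ _ _ i2 i3 i4 i5).trans ?_
  rw [hdiv, neg_add_cancel, add_zero]

/-- The iterated integral over time and space as an integral over spacetime. -/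
theorem intervalIntegral_setIntegral_eq {μ : Measure M} [IsLocallyFiniteMeasure μ]
    {t₁ t₂ : ℝ} (ht : t₁ ≤ t₂) {K : Set M} (hK : IsCompact K) {g : ℝ × M → ℝ}
    (hg : ContinuousOn g (Set.Icc t₁ t₂ ×ˢ K)) :
    ∫ t in t₁..t₂, ∫ m in K, g (t, m) ∂μ =
      ∫ x in Set.Icc t₁ t₂ ×ˢ K, g x ∂((volume : Measure ℝ).prod μ) := by
  rw [setIntegral_prod g (hg.integrableOn_compact (isCompact_Icc.prod hK)),
    intervalIntegral.integral_of_le ht, integral_Icc_eq_integral_Ioc]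

/-- The first variation of the action over `[t₁, t₂] × K`, before integration by parts. -/
theorem hasDerivAt_timeAction (hf : SmoothFibreFun (stModel n) f) {μ : Measure M}
    [IsLocallyFiniteMeasure μ] {t₁ t₂ : ℝ} (ht : t₁ ≤ t₂) {K : Set M} (hK : IsCompact K)
    {τ : ℝ → ℝ × M → (ℝ × EuclideanSpace ℝ (Fin n)) →L[ℝ] EG}
    {τ' : ℝ × M → (ℝ × EuclideanSpace ℝ (Fin n)) →L[ℝ] EG}
    (hτ : ∀ x ∈ Set.Icc t₁ t₂ ×ˢ K, SmoothFamilyAt (stModel n) τ (0, x))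
    (h0 : ∀ x ∈ Set.Icc t₁ t₂ ×ˢ K, τ 0 x = σ x)
    (hd : ∀ x ∈ Set.Icc t₁ t₂ ×ˢ K, HasDerivAt (fun ε => τ ε x) (τ' x) 0) :
    HasDerivAt (fun ε => ∫ t in t₁..t₂, ∫ m in K, f (t, m) (τ ε (t, m)) ∂μ)
      (∫ x in Set.Icc t₁ t₂ ×ˢ K, fibreD f σ x (τ' x) ∂((volume : Measure ℝ).prod μ)) 0 := by
  have hKK : IsCompact (Set.Icc t₁ t₂ ×ˢ K) := isCompact_Icc.prod hK
  refine (hasDerivAt_action hf (μ := (volume : Measure ℝ).prod μ) hKK hτ h0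
    hd).congr_of_eventuallyEq ?_
  obtain ⟨δ, hδ, h1⟩ := eventually_forall_mem_contMDiffAt (I' := 𝓘(ℝ, ℝ))
    (g := fun ε x => f x (τ ε x)) hKK (fun x hx => hf.contMDiffAt (hτ x hx))
  filter_upwards [Metric.closedBall_mem_nhds (0 : ℝ) hδ] with ε hε
  exact intervalIntegral_setIntegral_eq ht hK (g := fun x => f x (τ ε x)) fun x hx =>
    (ContMDiffAt.slice_right (g := fun ε x => f x (τ ε x))
      (h1 ε hε x hx)).continuousAt.continuousWithinAt

/-- Integration by parts over time and space in the first variation. -/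
theorem setIntegral_time_variation (hΩ : IsVolumeForm (𝓡 n) (spaceBasis n) Ω)
    (hf : SmoothFibreFun (stModel n) f) {J : Set ℝ} (hJ : IsOpen J) {V K : Set M} (hV : IsOpen V)
    (hσ : ∀ x ∈ J ×ˢ V, SmoothFormAt (stModel n) σ x) (hK : IsCompact K) (hKV : K ⊆ V)
    {t₁ t₂ : ℝ} (ht : t₁ ≤ t₂) (htJ : Set.Icc t₁ t₂ ⊆ J) {η : ℝ × M → EG}
    (hη : ∀ x ∈ J ×ˢ V, ContMDiffAt (stModel n) 𝓘(ℝ, EG) ∞ η x)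
    (h0 : ∀ t ∈ J, ∀ m ∈ V \ K, η (t, m) = 0)
    (h1 : ∀ m ∈ V, η (t₁, m) = 0) (h2 : ∀ m ∈ V, η (t₂, m) = 0) :
    ∫ x in Set.Icc t₁ t₂ ×ˢ K, fibreD f σ x (tder (stModel n) 𝓘(ℝ, EG) η x -
        (adRight G (η x)).comp (σ x))
        ∂((volume : Measure ℝ).prod (volMeasure (𝓡 n) (spaceBasis n) Ω)) =
      - ∫ x in Set.Icc t₁ t₂ ×ˢ K, epForm (stModel n) (stBasis n) (dtWedge Ω) G f σ x (η x)
        ∂((volume : Measure ℝ).prod (volMeasure (𝓡 n) (spaceBasis n) Ω)) := by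
  set μ := volMeasure (𝓡 n) (spaceBasis n) Ω
  have : IsLocallyFiniteMeasure μ := isLocallyFiniteMeasure_volMeasure hΩ
  have hΩX := isVolumeForm_dtWedge hΩ
  have hU : IsOpen (J ×ˢ V) := hJ.prod hV
  have hKU : Set.Icc t₁ t₂ ×ˢ K ⊆ J ×ˢ V := Set.prod_mono htJ hKV
  have hKK : IsCompact (Set.Icc t₁ t₂ ×ˢ K) := isCompact_Icc.prod hK
  have hint : ∀ g : ℝ × M → ℝ, (∀ x ∈ J ×ˢ V, ContMDiffAt (stModel n) 𝓘(ℝ, ℝ) ∞ g x) →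
      IntegrableOn g (Set.Icc t₁ t₂ ×ˢ K) ((volume : Measure ℝ).prod μ) := fun g hg =>
    ContinuousOn.integrableOn_compact hKK fun x hx =>
      (hg x (hKU hx)).continuousAt.continuousWithinAt
  have hI : ∀ x ∈ J ×ˢ V, ContMDiffAt (stModel n) 𝓘(ℝ, ℝ) ∞
      (fun x => timeMomentum (fibreD f σ) x (η x)) x := fun x hx =>
    contMDiffAt_timeMomentum hf (hσ x hx) (hη x hx)
  have i1 := hint (fun x => fibreD f σ x (tder (stModel n) 𝓘(ℝ, EG) η x -
      (adRight G (η x)).comp (σ x))) fun x hx => hf.contMDiffAt_fibreD (hσ x hx)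
    ((smoothFormAt_tder (hη x hx)).sub ((hσ x hx).adRight_comp (hη x hx)))
  have i2 := hint (fun x => deriv (fun τ => timeMomentum (fibreD f σ) (τ, x.2) (η (τ, x.2))) x.1)
    fun x hx => contMDiffAt_dt (hI x hx)
  have i3 : IntegrableOn (fun x => epForm (stModel n) (stBasis n) (dtWedge Ω) G f σ x (η x))
      (Set.Icc t₁ t₂ ×ˢ K) ((volume : Measure ℝ).prod μ) :=
    (continuousOn_epForm_apply (G := G) hΩX hf hU hσ hKU (fun x hx =>
      (hη x (hKU hx)).continuousAt.continuousWithinAt)).integrableOn_compact hKK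
  rw [setIntegral_prod _ i1, setIntegral_prod _ i3]
  have hsl : ∀ t ∈ Set.Icc t₁ t₂, _ := fun t h => setIntegral_slice_variation (G := G) hΩ hf hU hσ
    (t := t) hV (fun m hm => ⟨htJ h, hm⟩) hK hKV (η := η) (fun m hm => hη _ ⟨htJ h, hm⟩)
    (fun m hm => h0 t (htJ h) m hm)
  rw [setIntegral_congr_fun measurableSet_Icc hsl]
  rw [IntegrableOn, ← Measure.prod_restrict] at i2 i3
  have j2 := i2.integral_prod_left
  have j3 := i3.integral_prod_left
  rw [integral_sub j2 j3]
  -- the total time derivative integrates to the boundary terms, which vanish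
  have hA : ∀ t ∈ Set.Icc t₁ t₂, HasDerivAt
      (fun t => ∫ m in K, timeMomentum (fibreD f σ) (t, m) (η (t, m)) ∂μ)
      (∫ m in K, deriv (fun τ => timeMomentum (fibreD f σ) (τ, m) (η (τ, m))) t ∂μ) t :=
    fun t h => hasDerivAt_setIntegral hK
      (g := fun t m => timeMomentum (fibreD f σ) (t, m) (η (t, m)))
      (fun m hm => hI (t, m) ⟨htJ h, hKV hm⟩)
  have hFTC : ∫ t in Set.Icc t₁ t₂, ∫ m in K,
      deriv (fun τ => timeMomentum (fibreD f σ) (τ, m) (η (τ, m))) t ∂μ = 0 := by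
    rw [integral_Icc_eq_integral_Ioc, ← intervalIntegral.integral_of_le ht,
      intervalIntegral.integral_eq_sub_of_hasDerivAt (by rwa [Set.uIcc_of_le ht])
        ((intervalIntegrable_iff_integrableOn_Icc_of_le ht).2 j2)]
    have e1 : ∫ m in K, timeMomentum (fibreD f σ) (t₁, m) (η (t₁, m)) ∂μ = 0 :=
      setIntegral_eq_zero_of_forall_eq_zero fun m hm => by rw [h1 m (hKV hm), map_zero]
    have e2 : ∫ m in K, timeMomentum (fibreD f σ) (t₂, m) (η (t₂, m)) ∂μ = 0 :=
      setIntegral_eq_zero_of_forall_eq_zero fun m hm => by rw [h2 m (hKV hm), map_zero]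
    rw [e1, e2, sub_zero]
  rw [hFTC, zero_sub]

end SpacetimeVariation

/-! ### The covariant statements -/

section Covariant

variable {n : ℕ} {M : Type*} [TopologicalSpace M] [T2Space M] [SecondCountableTopology M]
  [ChartedSpace (EuclideanSpace ℝ (Fin n)) M] [IsManifold (𝓡 n) ∞ M]
  [MeasurableSpace M] [BorelSpace M]
  {EG : Type*} [NormedAddCommGroup EG] [NormedSpace ℝ EG] [FiniteDimensional ℝ EG]
  {G : Type*} [TopologicalSpace G] [ChartedSpace EG G] [Group G] [LieGroup 𝓘(ℝ, EG) ∞ G]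
  {Ω : ∀ m : M, TangentSpace (𝓡 n) m [⋀^Fin n]→ₗ[ℝ] ℝ}
  {L : JetFunction n M EG G} {U : Set (ℝ × M)} {s : ℝ × M → G}

/-- A function on the jet bundle with the model space in place of the tangent spaces. -/
def plainJet (L : JetFunction n M EG G) :
    ℝ × M → G → ((ℝ × EuclideanSpace ℝ (Fin n)) →L[ℝ] EG) → ℝ := L

/-- The reduced density with the model space in place of the tangent spaces. -/
def plainReduced (L : JetFunction n M EG G) :
    ℝ × M → ((ℝ × EuclideanSpace ℝ (Fin n)) →L[ℝ] EG) → ℝ := fun x => plainJet L x 1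

theorem rightInvariantJet_plainJet (hinv : JetInvariant L) : RightInvariantJet (plainJet L) := hinv

theorem contDiffOn_jetCoord_plainJet (hL : JetSmooth L) (c : ℝ × M) (g₀ : G) : ContDiffOn ℝ ∞
    (fun q : (ℝ × EuclideanSpace ℝ (Fin n)) × EG × ((ℝ × EuclideanSpace ℝ (Fin n)) →L[ℝ] EG) =>
      jetCoord (stModel n) (plainJet L) c g₀ q.1 q.2.1 q.2.2)
    ((extChartAt (stModel n) c).target ×ˢ ((extChartAt 𝓘(ℝ, EG) g₀).target ×ˢ Set.univ)) :=
  hL c g₀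

theorem smoothFibreFun_plainReduced (hL : JetSmooth L) :
    SmoothFibreFun (stModel n) (plainReduced L) :=
  smoothFibreFun_of_jetCoord fun c => contDiffOn_jetCoord_plainJet hL c 1

/-- The reduced first jet extension with the model space in place of the tangent spaces. -/
def plainReducedJet (s : ℝ × M → G) (x : ℝ × M) : (ℝ × EuclideanSpace ℝ (Fin n)) →L[ℝ] EG :=
  reducedJet s x

theorem plainReducedJet_eq_rightDer {x : ℝ × M}
    (hs : MDifferentiableAt (stModel n) 𝓘(ℝ, EG) s x) :
    plainReducedJet s x = rightDer (stModel n) (EG := EG) s x := (rightDer_eq hs).symm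

/-- The density along the first jet extension of `s` is the reduced density along the right
logarithmic derivative of `s`. -/
theorem jet_eq_plainReduced (hinv : JetInvariant L) {x : ℝ × M}
    (hs : MDifferentiableAt (stModel n) 𝓘(ℝ, EG) s x) :
    L x (s x) (mfderiv (stModel n) 𝓘(ℝ, EG) s x) = plainReduced L x (rightDer (stModel n) s x) :=
  (rightInvariantJet_plainJet hinv).eq_rightDer hs

/-- The fibre derivative of the reduced density with the model space in place of the tangent
spaces. -/
def plainFibreDeriv (L : JetFunction n M EG G) (s : ℝ × M → G) (x : ℝ × M)
    (ζ : (ℝ × EuclideanSpace ℝ (Fin n)) →L[ℝ] EG) : ℝ :=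
  deriv (fun ε : ℝ => plainReduced L x (plainReducedJet s x + ε • ζ)) 0

theorem plainFibreDeriv_eq_fibreD (hL : JetSmooth L) {x : ℝ × M}
    (hs : MDifferentiableAt (stModel n) 𝓘(ℝ, EG) s x)
    (ζ : (ℝ × EuclideanSpace ℝ (Fin n)) →L[ℝ] EG) :
    plainFibreDeriv L s x ζ = fibreD (plainReduced L) (rightDer (stModel n) s) x ζ := by
  have h3 : HasDerivAt (fun ε : ℝ => rightDer (stModel n) (EG := EG) s x + ε • ζ) ζ 0 := by
    simpa using ((hasDerivAt_id (0 : ℝ)).smul_const ζ).const_add (rightDer (stModel n) s x)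
  rw [← ((smoothFibreFun_plainReduced hL).hasDerivAt (σ := rightDer (stModel n) s)
    (by simp) h3).deriv, plainFibreDeriv, plainReducedJet_eq_rightDer hs]

theorem covariantEulerPoincare_iff_plain :
    CovariantEulerPoincare Ω (reducedDensity L) U (reducedJet s) ↔
      ∀ x ∈ U, ∀ e : EG, divergence (stModel n) (stBasis n) (F := EG) (dtWedge Ω)
        (fun x => plainFibreDeriv L s x) x e =
          - plainFibreDeriv L s x ((adRight G e).comp (plainReducedJet s x)) := Iff.rfl

/-- The covariant Euler–Poincaré equations say that the Euler–Poincaré covector vanishes. -/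
theorem covariantEulerPoincare_iff (hL : JetSmooth L) (hU : IsOpen U)
    (hs : ∀ x ∈ U, ContMDiffAt (stModel n) 𝓘(ℝ, EG) ∞ s x) :
    CovariantEulerPoincare Ω (reducedDensity L) U (reducedJet s) ↔
      ∀ x ∈ U, ∀ e : EG, epForm (stModel n) (stBasis n) (dtWedge Ω) G (plainReduced L)
        (rightDer (stModel n) s) x e = 0 := by
  have hd : ∀ x ∈ U, MDifferentiableAt (stModel n) 𝓘(ℝ, EG) s x :=
    fun x hx => (hs x hx).mdifferentiableAt (by simp)
  rw [covariantEulerPoincare_iff_plain]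
  refine forall₂_congr fun x hx => forall_congr' fun e => ?_
  have h1 : divergence (stModel n) (stBasis n) (F := EG) (dtWedge Ω)
      (fun x => plainFibreDeriv L s x) x e =
      divAt (stModel n) (stBasis n) (dtWedge Ω) x
        (fibreD (plainReduced L) (rightDer (stModel n) s)) x e := by
    -- unfolds the divergence; the summands below involve only values near `x`, where `s` is smooth
    have hdiv : ∀ w : ℝ × M → ((ℝ × EuclideanSpace ℝ (Fin n)) →L[ℝ] EG) → ℝ,
        divergence (stModel n) (stBasis n) (F := EG) (dtWedge Ω) (fun x => w x) x e =
          (volCoeff (stModel n) (stBasis n) (dtWedge Ω) x (extChartAt (stModel n) x x))⁻¹ *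
          ∑ i, fderiv ℝ (fun y => volCoeff (stModel n) (stBasis n) (dtWedge Ω) x y *
            w ((extChartAt (stModel n) x).symm y) ((elemCovector (stBasis n) i e).comp
              (tder (stModel n) 𝓘(ℝ, ℝ × EuclideanSpace ℝ (Fin n)) (extChartAt (stModel n) x)
                ((extChartAt (stModel n) x).symm y)))) (extChartAt (stModel n) x x)
            (stBasis n i) := fun _ => rfl
    rw [hdiv, divAt]
    congr 1
    refine Finset.sum_congr rfl fun i _ => ?_
    have hev : ∀ᶠ y in 𝓝 (extChartAt (stModel n) x x), (extChartAt (stModel n) x).symm y ∈ U := by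
      have hc := (contMDiffAt_chart_symm (I := stModel n) (mem_extChartAt_target x)).continuousAt
      refine hc.eventually_mem ?_
      rw [extChartAt_to_inv]
      exact hU.mem_nhds hx
    rw [Filter.EventuallyEq.fderiv_eq]
    filter_upwards [hev] with y hy
    congr 1
    exact plainFibreDeriv_eq_fibreD hL (hd _ hy) _
  rw [h1, plainFibreDeriv_eq_fibreD hL (hd x hx), plainReducedJet_eq_rightDer (hd x hx), epForm,
    eq_neg_iff_add_eq_zero]

/-- The covariant Euler–Lagrange equations hold if and only if the Euler–Poincaré covector vanishes.
The coordinate covectors `v` at `s(x)` reach all of the Lie algebra, and `volCoeff` has no zeros. -/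
theorem covariantEulerLagrange_iff (hΩ : IsVolumeForm (𝓡 n) (spaceBasis n) Ω) (hL : JetSmooth L)
    (hinv : JetInvariant L) (hU : IsOpen U)
    (hs : ∀ x ∈ U, ContMDiffAt (stModel n) 𝓘(ℝ, EG) ∞ s x) :
    CovariantEulerLagrange Ω L U s ↔
      ∀ x ∈ U, ∀ e : EG, epForm (stModel n) (stBasis n) (dtWedge Ω) G (plainReduced L)
        (rightDer (stModel n) s) x e = 0 := by
  have hΩX := isVolumeForm_dtWedge hΩ
  have key := fun (c : ℝ × M) (g₀ : G) (y : ℝ × EuclideanSpace ℝ (Fin n))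
      (hy : y ∈ chartSet (stModel n) c U)
      (hx : s ((extChartAt (stModel n) c).symm y) ∈ (extChartAt 𝓘(ℝ, EG) g₀).source) (v : EG) =>
    eulerLagrange_sub_eq_epForm (b := stBasis n) hΩX (rightInvariantJet_plainJet hinv)
      (smoothFibreFun_plainReduced hL) (contDiffOn_jetCoord_plainJet hL) hU hs hy hx v
  constructor
  · intro h x hx e
    have hmem := mem_chartSet (I := stModel n) (mem_extChartAt_source x) hx
    have hsx : s ((extChartAt (stModel n) x).symm (extChartAt (stModel n) x x)) ∈
        (extChartAt 𝓘(ℝ, EG) (s x)).source := by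
      rw [extChartAt_to_inv]; exact mem_extChartAt_source (s x)
    obtain ⟨v, rfl⟩ := chartTriv_surjective (mem_extChartAt_source (I := 𝓘(ℝ, EG)) (s x)) e
    have h1 := h x (s x) (extChartAt (stModel n) x x) hmem.1 hmem.2 hsx v
    have h2 := key x (s x) _ hmem hsx v
    have h3 := (mul_eq_zero.1 (h2.symm.trans (sub_eq_zero.2 h1))).resolve_left
      (volCoeff_ne_zero hΩX hmem.1)
    rw [extChartAt_to_inv] at h3
    exact h3
  · intro h c g₀ ρ σ y hy hyU hsx v
    exact sub_eq_zero.1 ((key c g₀ y ⟨hy, hyU⟩ hsx v).trans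
      (mul_eq_zero_of_right _ (h _ hyU _)))

/-- The first variation for `δσ = dη - [σ, η]` is minus the integral of the Euler–Poincaré covector
at `η`, and `η` is an arbitrary function with compact support. -/
theorem covariantReducedPrinciple_iff (hΩ : IsVolumeForm (𝓡 n) (spaceBasis n) Ω)
    (hL : JetSmooth L) (hU : IsOpen U)
    (hs : ∀ x ∈ U, ContMDiffAt (stModel n) 𝓘(ℝ, EG) ∞ s x) :
    CovariantReducedPrinciple (volMeasure (stModel n) (stBasis n) (dtWedge Ω)) (reducedDensity L) U
        (reducedJet s) ↔
      ∀ x ∈ U, ∀ e : EG, epForm (stModel n) (stBasis n) (dtWedge Ω) G (plainReduced L)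
        (rightDer (stModel n) s) x e = 0 := by
  have hΩX := isVolumeForm_dtWedge hΩ
  have := isLocallyFiniteMeasure_volMeasure hΩX
  have := isOpenPosMeasure_volMeasure hΩX
  have hf := smoothFibreFun_plainReduced hL
  have hσ : ∀ x ∈ U, SmoothFormAt (stModel n) (rightDer (stModel n) (EG := EG) s) x :=
    fun x hx => smoothFormAt_rightDer (hs x hx)
  have key : ∀ K ⊆ U, IsCompact K → ∀ η : ℝ × M → EG, ContMDiff (stModel n) 𝓘(ℝ, EG) ∞ η →
      (∀ x ∉ K, η x = 0) → HasDerivAt (fun ε : ℝ => ∫ x in K, reducedDensity L x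
        (reducedJet s x + ε • (lieD (stModel n) (G := G) η x -
          (bracketRight (η x)).comp (reducedJet s x)))
            ∂(volMeasure (stModel n) (stBasis n) (dtWedge Ω)))
        (- ∫ x in K, epForm (stModel n) (stBasis n) (dtWedge Ω) G (plainReduced L)
          (rightDer (stModel n) s) x (η x) ∂(volMeasure (stModel n) (stBasis n) (dtWedge Ω))) 0 := by
    intro K hKU hK η hη h0
    have h1 := hasDerivAt_action (σ := rightDer (stModel n) s) hf
      (μ := volMeasure (stModel n) (stBasis n) (dtWedge Ω)) hK
      (τ := fun ε x => rightDer (stModel n) s x + ε • (tder (stModel n) 𝓘(ℝ, EG) η x -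
        (adRight G (η x)).comp (rightDer (stModel n) s x)))
      (τ' := fun x => tder (stModel n) 𝓘(ℝ, EG) η x -
        (adRight G (η x)).comp (rightDer (stModel n) s x))
      (fun x hx => (hσ x (hKU hx)).add_smul ((smoothFormAt_tder hη.contMDiffAt).sub
        ((hσ x (hKU hx)).adRight_comp hη.contMDiffAt)) 0)
      (fun x hx => by simp)
      (fun x hx => by
        simpa using ((hasDerivAt_id (0 : ℝ)).smul_const (tder (stModel n) 𝓘(ℝ, EG) η x -
          (adRight G (η x)).comp (rightDer (stModel n) s x))).const_add (rightDer (stModel n) s x))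
    rw [setIntegral_variation hΩX hf hU hσ hK hKU hη.contMDiffOn fun x hx => h0 x hx.2] at h1
    refine h1.congr_of_eventuallyEq (Filter.Eventually.of_forall fun ε => ?_)
    refine setIntegral_congr_fun hK.measurableSet fun x hx => ?_
    exact congrArg (fun B : (ℝ × EuclideanSpace ℝ (Fin n)) →L[ℝ] EG => plainReduced L x
      (B + ε • (tder (stModel n) 𝓘(ℝ, EG) η x - (adRight G (η x)).comp B)))
      (plainReducedJet_eq_rightDer ((hs x (hKU hx)).mdifferentiableAt (by simp)))
  constructor
  · intro h
    refine epForm_eq_zero_of_integral hΩX hf hU hσ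
      (μ := volMeasure (stModel n) (stBasis n) (dtWedge Ω)) fun η hη K hKU hK h0 => ?_
    have h1 := (key K hKU hK η hη h0).unique (h K hKU hK η hη.contMDiffOn h0)
    linarith
  · intro h K hKU hK η hη h0
    exact (key K hKU hK η (contMDiffOn_univ.1 hη) h0).congr_deriv (neg_eq_zero.2
      (setIntegral_eq_zero_of_forall_eq_zero fun x hx => h x (hKU hx) _))

/-- A variation of `s` with velocity `η` induces `δσ = dη - [σ, η]`, and every `η` with compact
support arises, from `leftVariation`. -/
theorem covariantPrinciple_iff (hΩ : IsVolumeForm (𝓡 n) (spaceBasis n) Ω)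
    (hL : JetSmooth L) (hinv : JetInvariant L) (hU : IsOpen U)
    (hs : ∀ x ∈ U, ContMDiffAt (stModel n) 𝓘(ℝ, EG) ∞ s x) :
    CovariantPrinciple (volMeasure (stModel n) (stBasis n) (dtWedge Ω)) L U s ↔
      ∀ x ∈ U, ∀ e : EG, epForm (stModel n) (stBasis n) (dtWedge Ω) G (plainReduced L)
        (rightDer (stModel n) s) x e = 0 := by
  have hΩX := isVolumeForm_dtWedge hΩ
  have := isLocallyFiniteMeasure_volMeasure hΩX
  have := isOpenPosMeasure_volMeasure hΩX
  have hf := smoothFibreFun_plainReduced hL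
  have hσ : ∀ x ∈ U, SmoothFormAt (stModel n) (rightDer (stModel n) (EG := EG) s) x :=
    fun x hx => smoothFormAt_rightDer (hs x hx)
  have key : ∀ K ⊆ U, IsCompact K → ∀ r > (0 : ℝ), ∀ S : ℝ → ℝ × M → G,
      ContMDiffOn (𝓘(ℝ, ℝ).prod (stModel n)) 𝓘(ℝ, EG) ∞ (fun q : ℝ × (ℝ × M) => S q.1 q.2)
        (Set.Ioo (-r) r ×ˢ U) → (∀ x ∈ U, S 0 x = s x) →
      (∀ x ∈ U \ K, varField EG S x = 0) →
      HasDerivAt (fun ε : ℝ => ∫ x in K, L x (S ε x) (mfderiv (stModel n) 𝓘(ℝ, EG) (S ε) x)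
            ∂(volMeasure (stModel n) (stBasis n) (dtWedge Ω)))
        (- ∫ x in K, epForm (stModel n) (stBasis n) (dtWedge Ω) G (plainReduced L)
          (rightDer (stModel n) s) x (varField EG S x)
            ∂(volMeasure (stModel n) (stBasis n) (dtWedge Ω))) 0 := by
    intro K hKU hK r hr S hS hS0 h0
    have hSx : ∀ ε ∈ Set.Ioo (-r) r, ∀ x ∈ U, ContMDiffAt (𝓘(ℝ, ℝ).prod (stModel n)) 𝓘(ℝ, EG) ∞
        (fun q : ℝ × (ℝ × M) => S q.1 q.2) (ε, x) := fun ε hε x hx =>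
      hS.contMDiffAt ((isOpen_Ioo.prod hU).mem_nhds ⟨hε, hx⟩)
    have h0r : (0 : ℝ) ∈ Set.Ioo (-r) r := ⟨by linarith, hr⟩
    have hS0' : ∀ x ∈ U, rightDer (stModel n) (EG := EG) (S 0) x = rightDer (stModel n) s x :=
      fun x hx => rightDer_congr (by filter_upwards [hU.mem_nhds hx] with z hz using hS0 z hz)
    have h1 := hasDerivAt_action (σ := rightDer (stModel n) s) hf
      (μ := volMeasure (stModel n) (stBasis n) (dtWedge Ω)) hK
      (τ := fun ε x => rightDer (stModel n) (S ε) x)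
      (τ' := fun x => tder (stModel n) 𝓘(ℝ, EG) (varField EG S) x -
        (adRight G (varField EG S x)).comp (rightDer (stModel n) s x))
      (fun x hx => smoothFamilyAt_rightDer (hSx 0 h0r x (hKU hx)))
      (fun x hx => hS0' x (hKU hx))
      (fun x hx => by
        have := hasDerivAt_rightDer (hSx 0 h0r x (hKU hx))
        rwa [hS0' x (hKU hx)] at this)
    rw [setIntegral_variation hΩX hf hU hσ hK hKU (fun x hx => (contMDiffAt_varField
      (hSx 0 h0r x hx)).contMDiffWithinAt) h0] at h1
    refine h1.congr_of_eventuallyEq ?_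
    filter_upwards [Ioo_mem_nhds h0r.1 h0r.2] with ε hε
    refine setIntegral_congr_fun hK.measurableSet fun x hx => ?_
    exact jet_eq_plainReduced hinv ((ContMDiffAt.slice_right (g := S)
      (hSx ε hε x (hKU hx))).mdifferentiableAt (by simp))
  constructor
  · intro h
    refine epForm_eq_zero_of_integral hΩX hf hU hσ
      (μ := volMeasure (stModel n) (stBasis n) (dtWedge Ω)) fun η hη K hKU hK h0 => ?_
    obtain ⟨r, hr, hS⟩ := exists_contMDiffOn_leftVariation (G := G) (s := s) (U := U)
      (fun x hx => (hs x hx).contMDiffWithinAt) hη (HasCompactSupport.intro hK h0)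
    have h1 := key K hKU hK r hr (leftVariation s η) hS (fun x _ => leftVariation_zero s η x)
      (fun x hx => by rw [varField_leftVariation, h0 x hx.2])
    have h2 := h K hKU hK r hr (leftVariation s η) hS (fun x _ => leftVariation_zero s η x)
      (fun x hx => by
        have : (fun ε => leftVariation s η ε x) = fun _ => s x :=
          funext fun ε => leftVariation_of_eq_zero s (h0 x hx.2) ε
        rw [this]
        exact mfderiv_const)
    have h3 := h1.unique h2
    simp only [varField_leftVariation] at h3
    linarith
  · intro h K hKU hK r hr S hS hS0 h0
    have h1 := key K hKU hK r hr S hS hS0 fun x hx => varField_eq_zero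
      ((ContMDiffAt.slice_left (g := S) (hS.contMDiffAt ((isOpen_Ioo.prod hU).mem_nhds
        ⟨⟨by linarith, hr⟩, hx.1⟩))).mdifferentiableAt (by simp)) (h0 x hx)
    exact h1.congr_deriv (neg_eq_zero.2
      (setIntegral_eq_zero_of_forall_eq_zero fun x hx => h x (hKU hx) _))

end Covariant

/-! ### Hamilton's principle and the constrained variational principle -/

section Dynamic

variable {n : ℕ} {M : Type*} [TopologicalSpace M] [T2Space M] [SecondCountableTopology M]
  [ChartedSpace (EuclideanSpace ℝ (Fin n)) M] [IsManifold (𝓡 n) ∞ M]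
  [MeasurableSpace M] [BorelSpace M]
  {EG : Type*} [NormedAddCommGroup EG] [NormedSpace ℝ EG] [FiniteDimensional ℝ EG]
  {G : Type*} [TopologicalSpace G] [ChartedSpace EG G] [Group G] [LieGroup 𝓘(ℝ, EG) ∞ G]
  {Ω : ∀ m : M, TangentSpace (𝓡 n) m [⋀^Fin n]→ₗ[ℝ] ℝ}
  {L : JetFunction n M EG G} {J : Set ℝ} {V : Set M} {s : ℝ × M → G}

/-- The Lagrangian `L₀` along a curve of maps, in terms of the reduced density. -/
theorem zeroLagrangian_eq (hinv : JetInvariant L) (μ : Measure M) {C : ℝ → M → G} {t : ℝ}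
    {K : Set M} (hK : MeasurableSet K)
    (hC : ∀ m ∈ K, MDifferentiableAt (stModel n) 𝓘(ℝ, EG) (fun x : ℝ × M => C x.1 x.2) (t, m)) :
    zeroLagrangian μ L K t (C t) (velocity C t) = ∫ m in K, plainReduced L (t, m)
      (rightDer (stModel n) (EG := EG) (fun x : ℝ × M => C x.1 x.2) (t, m)) ∂μ := by
  refine setIntegral_congr_fun hK fun m hm => ?_
  refine Eq.trans ?_ (jet_eq_plainReduced hinv (hC m hm))
  have h0 : mfderiv (𝓡 n) 𝓘(ℝ, EG) (C t) m - (leftTrans (EG := EG) (C t m)).comp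
      (0 : TangentSpace (𝓡 n) m →L[ℝ] LieAlg EG G) = mfderiv (𝓡 n) 𝓘(ℝ, EG) (C t) m := by
    rw [ContinuousLinearMap.comp_zero, sub_zero]
  refine Eq.trans (congrArg (fun a : EuclideanSpace ℝ (Fin n) →L[ℝ] EG => plainJet L (t, m) (C t m)
    (splitForm (tder 𝓘(ℝ, ℝ) 𝓘(ℝ, EG) (fun τ => C τ m) t 1) a)) h0) ?_
  exact congrArg (plainJet L (t, m) (C t m)) (tder_spacetime (hC m hm)).symm

/-- `l(t, ν, γ)` is the integral of the reduced density at `(ν, -γ)`: at `χ = 1` the space component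
`dχ - χ γ` is `-γ`. -/
theorem reducedLagrangian_eq (μ : Measure M) (K : Set M) (t : ℝ)
    (ν : M → EG) (γ : M → EuclideanSpace ℝ (Fin n) →L[ℝ] EG) :
    reducedLagrangian (EG := EG) (G := G) μ L K t ν γ =
      ∫ m in K, plainReduced L (t, m) (splitForm (ν m) (-γ m)) ∂μ := by
  refine integral_congr_ae (Filter.Eventually.of_forall fun m => ?_)
  have h1 : tder (𝓡 n) 𝓘(ℝ, EG) (fun _ : M => (1 : G)) m = 0 := mfderiv_const
  have h2 : tder 𝓘(ℝ, EG) 𝓘(ℝ, EG) (fun h : G => 1 * h) 1 = ContinuousLinearMap.id ℝ EG := by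
    simp only [one_mul]
    exact mfderiv_id
  have h3 : tder (𝓡 n) 𝓘(ℝ, EG) (fun _ : M => (1 : G)) m -
      (tder 𝓘(ℝ, EG) 𝓘(ℝ, EG) (fun h : G => 1 * h) 1).comp (γ m) = -γ m := by
    rw [h1, h2, zero_sub, ContinuousLinearMap.id_comp]
  exact congrArg (fun a : EuclideanSpace ℝ (Fin n) →L[ℝ] EG => plainJet L (t, m) 1
    (splitForm (ν m) a)) h3

theorem epForm_zero (hΩ : IsVolumeForm (stModel n) (stBasis n) (dtWedge Ω))
    {f : ℝ × M → ((ℝ × EuclideanSpace ℝ (Fin n)) →L[ℝ] EG) → ℝ}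
    (hf : SmoothFibreFun (stModel n) f) {U : Set (ℝ × M)} (hU : IsOpen U)
    {σ : ℝ × M → (ℝ × EuclideanSpace ℝ (Fin n)) →L[ℝ] EG}
    (hσ : ∀ x ∈ U, SmoothFormAt (stModel n) σ x) {x : ℝ × M} (hx : x ∈ U) :
    epForm (stModel n) (stBasis n) (dtWedge Ω) G f σ x 0 = 0 := by
  simpa using epForm_sum (G := G) hΩ hf hU hσ hx (∅ : Finset ℕ) (fun _ => 0) (fun _ => 0)

/-- Compact subsets of `J × V` lie in products `[t₁, t₂] × K`, off the endpoints. -/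
theorem exists_Icc_prod_of_isCompact (hJ : IsOpen J) (hJ' : J.OrdConnected) {K : Set (ℝ × M)}
    (hK : IsCompact K) (hKJ : K ⊆ J ×ˢ V) (hne : K.Nonempty) :
    ∃ t₁ ∈ J, ∃ t₂ ∈ J, t₁ < t₂ ∧ Set.Icc t₁ t₂ ⊆ J ∧ K ⊆ Set.Ioo t₁ t₂ ×ˢ (Prod.snd '' K) := by
  have hc : IsCompact (Prod.fst '' K) := hK.image continuous_fst
  obtain ⟨a, ha, hamin⟩ := hc.exists_isLeast (hne.image _)
  obtain ⟨b, hb, hbmax⟩ := hc.exists_isGreatest (hne.image _)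
  have hsub : Prod.fst '' K ⊆ J := by
    rintro _ ⟨x, hx, rfl⟩; exact (hKJ hx).1
  obtain ⟨t₁, ht₁, hs₁⟩ := exists_Ioc_subset_of_mem_nhds (hJ.mem_nhds (hsub ha)) ⟨a - 1, by simp⟩
  obtain ⟨t₂, ht₂, hs₂⟩ := exists_Ico_subset_of_mem_nhds (hJ.mem_nhds (hsub hb)) ⟨b + 1, by simp⟩
  have hab : a ≤ b := hamin hb
  have m₁ : (t₁ + a) / 2 ∈ J := hs₁ ⟨by linarith, by linarith⟩
  have m₂ : (b + t₂) / 2 ∈ J := hs₂ ⟨by linarith, by linarith⟩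
  refine ⟨_, m₁, _, m₂, by linarith, hJ'.out m₁ m₂, fun x hx => ⟨⟨?_, ?_⟩, x, hx, rfl⟩⟩
  · have := hamin ⟨x, hx, rfl⟩; linarith
  · have := hbmax ⟨x, hx, rfl⟩; linarith

/-- Hamilton's principle for `L₀` holds if and only if the Euler–Poincaré covector vanishes. A test
function on spacetime with compact support vanishes near the endpoints of a suitable time interval,
hence is admissible as a velocity. -/
theorem hamiltonPrinciple_iff (hΩ : IsVolumeForm (𝓡 n) (spaceBasis n) Ω)
    (hL : JetSmooth L) (hinv : JetInvariant L) (hJ : IsOpen J) (hJ' : J.OrdConnected)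
    (hV : IsOpen V) (hs : ∀ x ∈ J ×ˢ V, ContMDiffAt (stModel n) 𝓘(ℝ, EG) ∞ s x) :
    HamiltonPrinciple (volMeasure (𝓡 n) (spaceBasis n) Ω) L J V (fun t m => s (t, m)) ↔
      ∀ x ∈ J ×ˢ V, ∀ e : EG, epForm (stModel n) (stBasis n) (dtWedge Ω) G (plainReduced L)
        (rightDer (stModel n) s) x e = 0 := by
  have hΩX := isVolumeForm_dtWedge hΩ
  set μ := volMeasure (𝓡 n) (spaceBasis n) Ω with hμ
  have : IsLocallyFiniteMeasure μ := isLocallyFiniteMeasure_volMeasure hΩ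
  have : μ.IsOpenPosMeasure := isOpenPosMeasure_volMeasure hΩ
  have hU := hJ.prod hV
  have hf := smoothFibreFun_plainReduced hL
  have hσ : ∀ x ∈ J ×ˢ V, SmoothFormAt (stModel n) (rightDer (stModel n) (EG := EG) s) x :=
    fun x hx => smoothFormAt_rightDer (hs x hx)
  have key : ∀ t₁ ∈ J, ∀ t₂ ∈ J, t₁ < t₂ → ∀ K ⊆ V, IsCompact K → ∀ r > (0 : ℝ),
      ∀ S : ℝ → ℝ × M → G,
      ContMDiffOn (𝓘(ℝ, ℝ).prod (stModel n)) 𝓘(ℝ, EG) ∞ (fun q : ℝ × (ℝ × M) => S q.1 q.2)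
        (Set.Ioo (-r) r ×ˢ (J ×ˢ V)) → (∀ x ∈ J ×ˢ V, S 0 x = s x) →
      (∀ t ∈ J, ∀ m ∈ V \ K, varField EG S (t, m) = 0) →
      (∀ m ∈ V, varField EG S (t₁, m) = 0) → (∀ m ∈ V, varField EG S (t₂, m) = 0) →
      HasDerivAt (fun ε : ℝ => ∫ t in t₁..t₂, zeroLagrangian μ L K t (fun m => S ε (t, m))
          (velocity (fun t m => S ε (t, m)) t))
        (- ∫ x in Set.Icc t₁ t₂ ×ˢ K, epForm (stModel n) (stBasis n) (dtWedge Ω) G (plainReduced L)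
          (rightDer (stModel n) s) x (varField EG S x) ∂((volume : Measure ℝ).prod μ)) 0 := by
    intro t₁ ht₁ t₂ ht₂ hlt K hKV hK r hr S hS hS0 h0 hv1 hv2
    have hSx : ∀ ε ∈ Set.Ioo (-r) r, ∀ x ∈ J ×ˢ V, ContMDiffAt (𝓘(ℝ, ℝ).prod (stModel n)) 𝓘(ℝ, EG)
        ∞ (fun q : ℝ × (ℝ × M) => S q.1 q.2) (ε, x) := fun ε hε x hx =>
      hS.contMDiffAt ((isOpen_Ioo.prod hU).mem_nhds ⟨hε, hx⟩)
    have h0r : (0 : ℝ) ∈ Set.Ioo (-r) r := ⟨by linarith, hr⟩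
    have hS0' : ∀ x ∈ J ×ˢ V, rightDer (stModel n) (EG := EG) (S 0) x = rightDer (stModel n) s x :=
      fun x hx => rightDer_congr (by filter_upwards [hU.mem_nhds hx] with z hz using hS0 z hz)
    have htJ : Set.Icc t₁ t₂ ⊆ J := hJ'.out ht₁ ht₂
    have hKU : Set.Icc t₁ t₂ ×ˢ K ⊆ J ×ˢ V := Set.prod_mono htJ hKV
    have h1 := hasDerivAt_timeAction (σ := rightDer (stModel n) s) hf
      (μ := μ) hlt.le hK
      (τ := fun ε x => rightDer (stModel n) (S ε) x)
      (τ' := fun x => tder (stModel n) 𝓘(ℝ, EG) (varField EG S) x -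
        (adRight G (varField EG S x)).comp (rightDer (stModel n) s x))
      (fun x hx => smoothFamilyAt_rightDer (hSx 0 h0r x (hKU hx)))
      (fun x hx => hS0' x (hKU hx))
      (fun x hx => by
        have := hasDerivAt_rightDer (hSx 0 h0r x (hKU hx))
        rwa [hS0' x (hKU hx)] at this)
    rw [setIntegral_time_variation hΩ hf hJ hV hσ hK hKV hlt.le htJ (fun x hx => contMDiffAt_varField
      (hSx 0 h0r x hx)) h0 hv1 hv2] at h1
    refine h1.congr_of_eventuallyEq ?_
    filter_upwards [Ioo_mem_nhds h0r.1 h0r.2] with ε hε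
    refine intervalIntegral.integral_congr fun t ht => ?_
    rw [Set.uIcc_of_le hlt.le] at ht
    exact zeroLagrangian_eq hinv μ (C := fun t m => S ε (t, m)) hK.measurableSet fun m hm =>
      (ContMDiffAt.slice_right (g := S) (hSx ε hε (t, m) ⟨htJ ht, hKV hm⟩)).mdifferentiableAt
        (by simp)
  constructor
  · intro h
    refine epForm_eq_zero_of_integral hΩX hf hU hσ
      (μ := (volume : Measure ℝ).prod μ) fun η hη K hKU hK h0 => ?_
    rcases K.eq_empty_or_nonempty with rfl | hne
    · simp
    obtain ⟨t₁, ht₁, t₂, ht₂, hlt, htJ, hKsub⟩ := exists_Icc_prod_of_isCompact hJ hJ' hK hKU hne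
    have hK' : IsCompact (Prod.snd '' K) := hK.image continuous_snd
    have hK'V : Prod.snd '' K ⊆ V := by
      rintro _ ⟨x, hx, rfl⟩; exact (hKU hx).2
    have hz : ∀ t m, m ∉ Prod.snd '' K → η (t, m) = 0 := fun t m hm =>
      h0 _ fun hx => hm ⟨_, hx, rfl⟩
    have hz₁ : ∀ m, η (t₁, m) = 0 := fun m => h0 _ fun hx => lt_irrefl _ (hKsub hx).1.1
    have hz₂ : ∀ m, η (t₂, m) = 0 := fun m => h0 _ fun hx => lt_irrefl _ (hKsub hx).1.2
    obtain ⟨r, hr, hS⟩ := exists_contMDiffOn_leftVariation (G := G) (s := s) (U := J ×ˢ V)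
      (fun x hx => (hs x hx).contMDiffWithinAt) hη (HasCompactSupport.intro hK h0)
    have hconst : ∀ x, η x = 0 →
        mfderiv 𝓘(ℝ, ℝ) 𝓘(ℝ, EG) (fun ε => leftVariation s η ε x) 0 = 0 := fun x hx => by
      have : (fun ε => leftVariation s η ε x) = fun _ => s x :=
        funext fun ε => leftVariation_of_eq_zero s hx ε
      rw [this]
      exact mfderiv_const
    have h1 := key t₁ ht₁ t₂ ht₂ hlt _ hK'V hK' r hr (leftVariation s η) hS
      (fun x _ => leftVariation_zero s η x)
      (fun t _ m hm => by rw [varField_leftVariation, hz t m hm.2])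
      (fun m _ => by rw [varField_leftVariation, hz₁])
      (fun m _ => by rw [varField_leftVariation, hz₂])
    have h2 := h t₁ ht₁ t₂ ht₂ hlt _ hK'V hK' r hr (fun ε t m => leftVariation s η ε (t, m)) hS
      (fun t _ m _ => leftVariation_zero s η (t, m))
      (fun t _ m hm => hconst _ (hz t m hm.2))
      (fun m _ => hconst _ (hz₁ m)) (fun m _ => hconst _ (hz₂ m))
    have h3 := h1.unique h2
    simp only [varField_leftVariation] at h3
    rw [neg_eq_zero] at h3
    rw [← h3]
    -- `η` vanishes off `K`, so that the integrals over `K` and over the product agree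
    refine (setIntegral_eq_of_subset_of_forall_sdiff_eq_zero
      (measurableSet_Icc.prod hK'.measurableSet)
      (hKsub.trans (Set.prod_mono Set.Ioo_subset_Icc_self subset_rfl)) fun x hx => ?_).symm
    rw [h0 x hx.2]
    exact epForm_zero hΩX hf hU hσ (⟨htJ hx.1.1, hK'V hx.1.2⟩)
  · intro h t₁ ht₁ t₂ ht₂ hlt K hKV hK r hr C hC hC0 h0 hv1 hv2
    have hvar : ∀ t ∈ J, ∀ m ∈ V, mfderiv 𝓘(ℝ, ℝ) 𝓘(ℝ, EG) (fun ε => C ε t m) 0 = 0 →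
        varField EG (fun ε x => C ε x.1 x.2) (t, m) = 0 := fun t ht m hm h0 => varField_eq_zero
      ((ContMDiffAt.slice_left (g := fun ε (x : ℝ × M) => C ε x.1 x.2)
        (hC.contMDiffAt ((isOpen_Ioo.prod hU).mem_nhds
        ⟨⟨by linarith, hr⟩, ⟨ht, hm⟩⟩))).mdifferentiableAt (by simp)) h0
    have h1 := key t₁ ht₁ t₂ ht₂ hlt K hKV hK r hr (fun ε x => C ε x.1 x.2) hC
      (fun x hx => hC0 _ hx.1 _ hx.2) (fun t ht m hm => hvar t ht m hm.1 (h0 t ht m hm))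
      (fun m hm => hvar _ ht₁ m hm (hv1 m hm)) (fun m hm => hvar _ ht₂ m hm (hv2 m hm))
    exact h1.congr_deriv (neg_eq_zero.2 (setIntegral_eq_zero_of_forall_eq_zero fun x hx =>
      h x ⟨hJ'.out ht₁ ht₂ hx.1, hKV hx.2⟩ _))

/-- The infinitesimal variation `(ζ' - [ν, ζ], -d^γ ζ)` of `(ν, γ)` is that of `σ` along `ζ`. -/
theorem splitForm_variation (ε : ℝ) (ν ζ ζ' : EG) (A dζ : EuclideanSpace ℝ (Fin n) →L[ℝ] EG) :
    splitForm (ν + ε • (ζ' - adRight G ζ ν)) (-(-A + ε • (-(dζ + (adRight G ζ).comp (-A))))) =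
      splitForm ν A + ε • (splitForm ζ' dζ - (adRight G ζ).comp (splitForm ν A)) := by
  ext
  · simp [splitForm_apply]
  · simp only [splitForm_apply, ContinuousLinearMap.comp_apply, ContinuousLinearMap.inr_apply,
      add_apply, sub_apply, neg_apply,
      smul_apply, zero_smul, zero_add, map_neg]
    module

/-- `ν = χ' χ⁻¹` with values in the model space. -/
def plainNu (s : ℝ × M → G) (t : ℝ) (m : M) : EG := nuOf (fun t m => s (t, m)) t m

/-- `γ = -dχ χ⁻¹` with values in the model space. -/
def plainGamma (s : ℝ × M → G) (t : ℝ) (m : M) : EuclideanSpace ℝ (Fin n) →L[ℝ] EG :=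
  gammaOf (fun t m => s (t, m)) t m

theorem plainNu_eq {t : ℝ} {m : M} (hs : MDifferentiableAt (stModel n) 𝓘(ℝ, EG) s (t, m)) :
    plainNu s t m = rightDer 𝓘(ℝ, ℝ) (EG := EG) (fun τ => s (τ, m)) t 1 := by
  have h : MDifferentiableAt 𝓘(ℝ, ℝ) 𝓘(ℝ, EG) (fun τ => s (τ, m)) t :=
    MDifferentiableAt.comp (g := s) (I' := stModel n) (f := fun τ => (τ, m)) t hs
      (mdifferentiableAt_id.prodMk mdifferentiableAt_const)
  exact (congrArg (fun A : ℝ →L[ℝ] EG => A 1) (rightDer_eq h)).symm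

theorem plainGamma_eq {t : ℝ} {m : M} (hs : MDifferentiableAt (stModel n) 𝓘(ℝ, EG) s (t, m)) :
    plainGamma s t m =
      -rightDer (𝓡 n) (EG := EG) (fun m => s (t, m)) m := by
  have h : MDifferentiableAt (𝓡 n) 𝓘(ℝ, EG) (fun m => s (t, m)) m :=
    MDifferentiableAt.comp (g := s) (I' := stModel n) (f := fun m => (t, m)) m hs
      (mdifferentiableAt_const.prodMk mdifferentiableAt_id)
  exact (congrArg (fun A : EuclideanSpace ℝ (Fin n) →L[ℝ] EG => -A) (rightDer_eq h)).symm

/-- The variations `δν`, `δγ` are the components of `δσ = dζ - [σ, ζ]`, and test functions on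
spacetime with compact support are admissible as `ζ`. -/
theorem constrainedPrinciple_iff (hΩ : IsVolumeForm (𝓡 n) (spaceBasis n) Ω)
    (hL : JetSmooth L) (hJ : IsOpen J) (hJ' : J.OrdConnected)
    (hV : IsOpen V) (hs : ∀ x ∈ J ×ˢ V, ContMDiffAt (stModel n) 𝓘(ℝ, EG) ∞ s x) :
    ConstrainedPrinciple (reducedLagrangian (volMeasure (𝓡 n) (spaceBasis n) Ω) L) J V
      (nuOf fun t m => s (t, m)) (gammaOf fun t m => s (t, m)) ↔
      ∀ x ∈ J ×ˢ V, ∀ e : EG, epForm (stModel n) (stBasis n) (dtWedge Ω) G (plainReduced L)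
        (rightDer (stModel n) s) x e = 0 := by
  have hΩX := isVolumeForm_dtWedge hΩ
  set μ := volMeasure (𝓡 n) (spaceBasis n) Ω with hμ
  have : IsLocallyFiniteMeasure μ := isLocallyFiniteMeasure_volMeasure hΩ
  have : μ.IsOpenPosMeasure := isOpenPosMeasure_volMeasure hΩ
  have hU := hJ.prod hV
  have hf := smoothFibreFun_plainReduced hL
  have hσ : ∀ x ∈ J ×ˢ V, SmoothFormAt (stModel n) (rightDer (stModel n) (EG := EG) s) x :=
    fun x hx => smoothFormAt_rightDer (hs x hx)
  have hd : ∀ x ∈ J ×ˢ V, MDifferentiableAt (stModel n) 𝓘(ℝ, EG) s x :=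
    fun x hx => (hs x hx).mdifferentiableAt (by simp)
  have key : ∀ t₁ ∈ J, ∀ t₂ ∈ J, t₁ < t₂ → ∀ K ⊆ V, IsCompact K → ∀ ζ : ℝ × M → EG,
      (∀ x ∈ J ×ˢ V, ContMDiffAt (stModel n) 𝓘(ℝ, EG) ∞ ζ x) →
      (∀ t ∈ J, ∀ m ∉ K, ζ (t, m) = 0) → (∀ m, ζ (t₁, m) = 0) → (∀ m, ζ (t₂, m) = 0) →
      HasDerivAt (fun ε : ℝ => ∫ t in t₁..t₂, reducedLagrangian (G := G) μ L K t
        (fun m => plainNu s t m + ε • (deriv (fun τ => ζ (τ, m)) t -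
          adRight G (ζ (t, m)) (plainNu s t m)) : M → EG)
        (fun m => plainGamma s t m + ε • (-(tder (𝓡 n) 𝓘(ℝ, EG) (fun m => ζ (t, m)) m +
            (adRight G (ζ (t, m))).comp (plainGamma s t m))) :
              M → EuclideanSpace ℝ (Fin n) →L[ℝ] EG))
        (- ∫ x in Set.Icc t₁ t₂ ×ˢ K, epForm (stModel n) (stBasis n) (dtWedge Ω) G (plainReduced L)
          (rightDer (stModel n) s) x (ζ x) ∂((volume : Measure ℝ).prod μ)) 0 := by
    intro t₁ ht₁ t₂ ht₂ hlt K hKV hK ζ hζ h0 hv1 hv2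
    have htJ : Set.Icc t₁ t₂ ⊆ J := hJ'.out ht₁ ht₂
    have hKU : Set.Icc t₁ t₂ ×ˢ K ⊆ J ×ˢ V := Set.prod_mono htJ hKV
    have h1 := hasDerivAt_timeAction (σ := rightDer (stModel n) s) hf
      (μ := μ) hlt.le hK
      (τ := fun ε x => rightDer (stModel n) s x + ε • (tder (stModel n) 𝓘(ℝ, EG) ζ x -
        (adRight G (ζ x)).comp (rightDer (stModel n) s x)))
      (τ' := fun x => tder (stModel n) 𝓘(ℝ, EG) ζ x -
        (adRight G (ζ x)).comp (rightDer (stModel n) s x))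
      (fun x hx => (hσ x (hKU hx)).add_smul ((smoothFormAt_tder (hζ x (hKU hx))).sub
        ((hσ x (hKU hx)).adRight_comp (hζ x (hKU hx)))) 0)
      (fun x hx => by simp)
      (fun x hx => by
        simpa using ((hasDerivAt_id (0 : ℝ)).smul_const (tder (stModel n) 𝓘(ℝ, EG) ζ x -
          (adRight G (ζ x)).comp (rightDer (stModel n) s x))).const_add (rightDer (stModel n) s x))
    rw [setIntegral_time_variation hΩ hf hJ hV hσ hK hKV hlt.le htJ hζ
      (fun t ht m hm => h0 t ht m hm.2) (fun m _ => hv1 m) (fun m _ => hv2 m)] at h1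
    refine h1.congr_of_eventuallyEq (Filter.Eventually.of_forall fun ε => ?_)
    refine intervalIntegral.integral_congr fun t ht => ?_
    rw [Set.uIcc_of_le hlt.le] at ht
    refine (reducedLagrangian_eq (G := G) μ K t _ _).trans ?_
    refine setIntegral_congr_fun hK.measurableSet fun m hm => ?_
    have hx : (t, m) ∈ J ×ˢ V := ⟨htJ ht, hKV hm⟩
    refine congrArg (plainReduced L (t, m)) ?_
    have e1 := splitForm_variation (G := G) ε (rightDer 𝓘(ℝ, ℝ) (EG := EG) (fun τ => s (τ, m)) t 1)
      (ζ (t, m)) (deriv (fun τ => ζ (τ, m)) t) (rightDer (𝓡 n) (EG := EG) (fun m => s (t, m)) m)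
      (tder (𝓡 n) 𝓘(ℝ, EG) (fun m => ζ (t, m)) m)
    rw [← rightDer_spacetime (hd _ hx), ← tder_spacetime_vector
      ((hζ _ hx).mdifferentiableAt (by simp)), ← plainNu_eq (hd _ hx), ← plainGamma_eq (hd _ hx)] at e1
    exact e1
  constructor
  · intro h
    refine epForm_eq_zero_of_integral hΩX hf hU hσ
      (μ := (volume : Measure ℝ).prod μ) fun η hη K hKU hK h0 => ?_
    rcases K.eq_empty_or_nonempty with rfl | hne
    · simp
    obtain ⟨t₁, ht₁, t₂, ht₂, hlt, htJ, hKsub⟩ := exists_Icc_prod_of_isCompact hJ hJ' hK hKU hne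
    have hK' : IsCompact (Prod.snd '' K) := hK.image continuous_snd
    have hK'V : Prod.snd '' K ⊆ V := by
      rintro _ ⟨x, hx, rfl⟩; exact (hKU hx).2
    have hz : ∀ t ∈ J, ∀ m ∉ Prod.snd '' K, η (t, m) = 0 := fun t _ m hm =>
      h0 _ fun hx => hm ⟨_, hx, rfl⟩
    have hz₁ : ∀ m, η (t₁, m) = 0 := fun m => h0 _ fun hx => lt_irrefl _ (hKsub hx).1.1
    have hz₂ : ∀ m, η (t₂, m) = 0 := fun m => h0 _ fun hx => lt_irrefl _ (hKsub hx).1.2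
    have h1 := key t₁ ht₁ t₂ ht₂ hlt _ hK'V hK' η (fun x _ => hη.contMDiffAt) hz hz₁ hz₂
    have h2 := h t₁ ht₁ t₂ ht₂ hlt _ hK'V hK' (fun t m => η (t, m)) hη.contMDiffOn hz hz₁ hz₂
    have h3 := neg_eq_zero.1 (h1.unique h2)
    rw [← h3]
    -- `η` vanishes off `K`, so that the integrals over `K` and over the product agree
    refine (setIntegral_eq_of_subset_of_forall_sdiff_eq_zero
      (measurableSet_Icc.prod hK'.measurableSet)
      (hKsub.trans (Set.prod_mono Set.Ioo_subset_Icc_self subset_rfl)) fun x hx => ?_).symm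
    rw [h0 x hx.2]
    exact epForm_zero hΩX hf hU hσ (⟨htJ hx.1.1, hK'V hx.1.2⟩)
  · intro h t₁ ht₁ t₂ ht₂ hlt K hKV hK ζ hζ h0 hv1 hv2
    have h1 := key t₁ ht₁ t₂ ht₂ hlt K hKV hK (fun x => ζ x.1 x.2)
      (fun x hx => (hζ x hx).contMDiffAt (hU.mem_nhds hx)) h0 hv1 hv2
    exact h1.congr_deriv (neg_eq_zero.2 (setIntegral_eq_zero_of_forall_eq_zero fun x hx =>
      h x ⟨hJ'.out ht₁ ht₂ hx.1, hKV hx.2⟩ _))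

end Dynamic

/-! ### The Euler–Lagrange equations on `F(V, G)` -/

section CoordinateEulerLagrange

variable {n : ℕ} {M : Type*} [TopologicalSpace M] [T2Space M] [SecondCountableTopology M]
  [ChartedSpace (EuclideanSpace ℝ (Fin n)) M] [IsManifold (𝓡 n) ∞ M]
  [MeasurableSpace M] [BorelSpace M]
  {EG : Type*} [NormedAddCommGroup EG] [NormedSpace ℝ EG] [FiniteDimensional ℝ EG]
  {G : Type*} [TopologicalSpace G] [ChartedSpace EG G] [Group G] [LieGroup 𝓘(ℝ, EG) ∞ G]
  {Ω : ∀ m : M, TangentSpace (𝓡 n) m [⋀^Fin n]→ₗ[ℝ] ℝ}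
  {L : JetFunction n M EG G} {J : Set ℝ} {V : Set M} {s : ℝ × M → G}

/-- The first variation of the action over a region of space, at a fixed time. -/
theorem hasDerivAt_sliceAction {f : ℝ × M → ((ℝ × EuclideanSpace ℝ (Fin n)) →L[ℝ] EG) → ℝ}
    {σ : ℝ × M → (ℝ × EuclideanSpace ℝ (Fin n)) →L[ℝ] EG} (hf : SmoothFibreFun (stModel n) f)
    {μ : Measure M} [IsLocallyFiniteMeasure μ] {K : Set M} (hK : IsCompact K) {t : ℝ}
    {τ : ℝ → ℝ × M → (ℝ × EuclideanSpace ℝ (Fin n)) →L[ℝ] EG}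
    {τ' : ℝ × M → (ℝ × EuclideanSpace ℝ (Fin n)) →L[ℝ] EG}
    (hτ : ∀ m ∈ K, SmoothFamilyAt (stModel n) τ (0, (t, m)))
    (h0 : ∀ m ∈ K, τ 0 (t, m) = σ (t, m))
    (hd : ∀ m ∈ K, HasDerivAt (fun ε => τ ε (t, m)) (τ' (t, m)) 0) :
    HasDerivAt (fun ε => ∫ m in K, f (t, m) (τ ε (t, m)) ∂μ)
      (∫ m in K, fibreD f σ (t, m) (τ' (t, m)) ∂μ) 0 := by
  have h1 := hasDerivAt_setIntegral (I := 𝓡 n) (μ := μ) (g := fun ε m => f (t, m) (τ ε (t, m))) hK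
    (t := 0) (fun m hm => ContMDiffAt.comp (I' := 𝓘(ℝ, ℝ).prod (stModel n))
      (g := fun q : ℝ × (ℝ × M) => f q.2 (τ q.1 q.2))
      (f := fun q : ℝ × M => (q.1, (t, q.2))) (0, m) (hf.contMDiffAt (hτ m hm))
      (contMDiffAt_fst.prodMk (contMDiffAt_const.prodMk contMDiffAt_snd)))
  convert h1 using 1
  refine setIntegral_congr_fun hK.measurableSet fun m hm => ?_
  exact (hf.hasDerivAt (h0 m hm) (hd m hm)).deriv.symm

theorem coordLagrangian_eq (μ : Measure M) (g₀ : G) (K : Set M) (t : ℝ) (u u' : M → EG) :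
    coordLagrangian μ L g₀ K t u u' = ∫ m in K, plainJet L (t, m)
      ((extChartAt 𝓘(ℝ, EG) g₀).symm (u m))
      (splitForm (tder 𝓘(ℝ, EG) 𝓘(ℝ, EG) (extChartAt 𝓘(ℝ, EG) g₀).symm (u m) (u' m))
        (tder (𝓡 n) 𝓘(ℝ, EG) (fun m => (extChartAt 𝓘(ℝ, EG) g₀).symm (u m)) m)) ∂μ := by
  refine integral_congr_ae (Filter.Eventually.of_forall fun m => ?_)
  have h0 : mfderiv (𝓡 n) 𝓘(ℝ, EG) (fun m => (extChartAt 𝓘(ℝ, EG) g₀).symm (u m)) m -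
      (leftTrans (EG := EG) ((extChartAt 𝓘(ℝ, EG) g₀).symm (u m))).comp
      (0 : TangentSpace (𝓡 n) m →L[ℝ] LieAlg EG G) =
      mfderiv (𝓡 n) 𝓘(ℝ, EG) (fun m => (extChartAt 𝓘(ℝ, EG) g₀).symm (u m)) m := by
    rw [ContinuousLinearMap.comp_zero, sub_zero]
  exact congrArg (fun a : EuclideanSpace ℝ (Fin n) →L[ℝ] EG => plainJet L (t, m)
    ((extChartAt 𝓘(ℝ, EG) g₀).symm (u m))
    (splitForm (tder 𝓘(ℝ, EG) 𝓘(ℝ, EG) (extChartAt 𝓘(ℝ, EG) g₀).symm (u m) (u' m)) a)) h0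

/-- The Lagrangian in the coordinates of the group, in terms of the reduced density. -/
theorem plainJet_chart_symm (hinv : JetInvariant L) {g₀ : G} {U : ℝ × M → EG} {t : ℝ} {m : M}
    (hU : ContMDiffAt (stModel n) 𝓘(ℝ, EG) ∞ U (t, m))
    (ht : U (t, m) ∈ (extChartAt 𝓘(ℝ, EG) g₀).target) (v : EG) :
    plainJet L (t, m) ((extChartAt 𝓘(ℝ, EG) g₀).symm (U (t, m)))
      (splitForm (tder 𝓘(ℝ, EG) 𝓘(ℝ, EG) (extChartAt 𝓘(ℝ, EG) g₀).symm (U (t, m))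
          (deriv (fun τ => U (τ, m)) t + v))
        (tder (𝓡 n) 𝓘(ℝ, EG) (fun m => (extChartAt 𝓘(ℝ, EG) g₀).symm (U (t, m))) m)) =
    plainReduced L (t, m) ((chartTriv EG g₀ ((extChartAt 𝓘(ℝ, EG) g₀).symm (U (t, m)))).comp
      (tder (stModel n) 𝓘(ℝ, EG) U (t, m) + splitForm v 0)) := by
  have hsp : MDifferentiableAt (𝓡 n) 𝓘(ℝ, EG) (fun m => U (t, m)) m :=
    (ContMDiffAt.slice_right (g := fun t m => U (t, m)) hU).mdifferentiableAt (by simp)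
  rw [tder_comp (g := (extChartAt 𝓘(ℝ, EG) g₀).symm) (f := fun m => U (t, m))
    ((contMDiffAt_chart_symm ht).mdifferentiableAt (by simp)) hsp,
    (rightInvariantJet_plainJet hinv).eq_reduced, plainReduced, chartTriv,
    (extChartAt 𝓘(ℝ, EG) g₀).right_inv ht, tder_spacetime_vector (hU.mdifferentiableAt (by simp))]
  congr 1
  ext <;> simp [splitForm_apply]

/-- Along `s`, the time derivative of the momentum `∂L₀/∂u'` in the direction `w` exceeds `∂L₀/∂u`
in that direction by the integral of the Euler–Poincaré covector at the trivialization of `w`. -/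
theorem hasDerivAt_coordMomentum (hΩ : IsVolumeForm (𝓡 n) (spaceBasis n) Ω)
    (hL : JetSmooth L) (hinv : JetInvariant L) {U : Set (ℝ × M)} (hU : IsOpen U)
    (hs : ∀ x ∈ U, ContMDiffAt (stModel n) 𝓘(ℝ, EG) ∞ s x) {g₀ : G}
    (hsU : ∀ x ∈ U, s x ∈ (extChartAt 𝓘(ℝ, EG) g₀).source) {t : ℝ} {K : Set M} (hK : IsCompact K)
    (hKU : ∀ m ∈ K, (t, m) ∈ U) {w : M → EG} (hw : ContMDiff (𝓡 n) 𝓘(ℝ, EG) ∞ w)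
    (h0 : ∀ m ∉ K, w m = 0) :
    let μ := volMeasure (𝓡 n) (spaceBasis n) Ω
    let u := fun τ m => extChartAt 𝓘(ℝ, EG) g₀ (s (τ, m))
    let u' := fun τ m => deriv (fun τ' => u τ' m) τ
    HasDerivAt (fun τ => deriv (fun ε : ℝ => coordLagrangian μ L g₀ K τ (u τ) (u' τ + ε • w)) 0)
      (deriv (fun ε : ℝ => coordLagrangian μ L g₀ K t (u t + ε • w) (u' t)) 0 +
        ∫ m in K, epForm (stModel n) (stBasis n) (dtWedge Ω) G (plainReduced L)
          (rightDer (stModel n) s) (t, m) (chartTriv EG g₀ (s (t, m)) (w m)) ∂μ) t := by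
  intro μ u u'
  have : IsLocallyFiniteMeasure μ := isLocallyFiniteMeasure_volMeasure hΩ
  have hf := smoothFibreFun_plainReduced hL
  have hσ : ∀ x ∈ U, SmoothFormAt (stModel n) (rightDer (stModel n) (EG := EG) s) x :=
    fun x hx => smoothFormAt_rightDer (hs x hx)
  set η : ℝ × M → EG := fun x => chartTriv EG g₀ (s x) (w x.2) with hη
  have hw2 : ∀ x : ℝ × M, ContMDiffAt (stModel n) 𝓘(ℝ, EG) ∞ (fun x : ℝ × M => w x.2) x :=
    fun x => hw.contMDiffAt.comp (f := Prod.snd) x contMDiffAt_snd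
  have hηs : ∀ x ∈ U, ContMDiffAt (stModel n) 𝓘(ℝ, EG) ∞ η x := fun x hx =>
    contMDiffAt_chartTriv (hs x hx) (hsU x hx) (hw2 x)
  -- the momentum in the direction `w`, for times near `t`
  have hev : ∀ᶠ τ in 𝓝 t, ∀ m ∈ K, (τ, m) ∈ U := by
    refine hK.eventually_forall_of_forall_eventually fun m hm => ?_
    exact hU.mem_nhds (hKU m hm)
  have hmom : ∀ τ, (∀ m ∈ K, (τ, m) ∈ U) →
      deriv (fun ε : ℝ => coordLagrangian μ L g₀ K τ (u τ) (u' τ + ε • w)) 0 =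
        ∫ m in K, timeMomentum (fibreD (plainReduced L) (rightDer (stModel n) s)) (τ, m)
          (η (τ, m)) ∂μ := by
    intro τ hτ
    have h1 := hasDerivAt_sliceAction (σ := rightDer (stModel n) (EG := EG) s) hf (μ := μ) hK
      (t := τ) (τ := fun ε x => rightDer (stModel n) s x + ε • splitForm (η x) 0)
      (τ' := fun x => splitForm (η x) 0)
      (fun m hm => (hσ _ (hτ m hm)).add_smul (smoothFormAt_splitForm (hηs _ (hτ m hm))) 0)
      (fun m hm => by simp)
      (fun m hm => by
        simpa using ((hasDerivAt_id (0 : ℝ)).smul_const (splitForm (η (τ, m))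
          (0 : EuclideanSpace ℝ (Fin n) →L[ℝ] EG))).const_add (rightDer (stModel n) s (τ, m)))
    refine (h1.congr_of_eventuallyEq (Filter.Eventually.of_forall fun ε => ?_)).deriv
    refine (coordLagrangian_eq μ g₀ K τ _ _).trans ?_
    refine setIntegral_congr_fun hK.measurableSet fun m hm => ?_
    have hx := hτ m hm
    refine (plainJet_chart_symm hinv (U := fun x => extChartAt 𝓘(ℝ, EG) g₀ (s x))
      (contMDiffAt_chart_comp (hs _ hx) (hsU _ hx))
      ((extChartAt 𝓘(ℝ, EG) g₀).map_source (hsU _ hx)) (ε • w m)).trans ?_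
    rw [(extChartAt 𝓘(ℝ, EG) g₀).left_inv (hsU _ hx), ContinuousLinearMap.comp_add,
      chartTriv_comp_tder (hs _ hx) (hsU _ hx)]
    congr 2
    ext <;> simp [splitForm_apply, hη]
  have h2 := hasDerivAt_setIntegral (I := 𝓡 n) (μ := μ) hK (t := t)
    (g := fun τ m => timeMomentum (fibreD (plainReduced L) (rightDer (stModel n) s)) (τ, m)
      (η (τ, m))) fun m hm => contMDiffAt_timeMomentum hf (hσ _ (hKU m hm)) (hηs _ (hKU m hm))
  have hLHS := h2.congr_of_eventuallyEq (hev.mono hmom)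
  -- the variation of the coordinates in the direction `w`
  have hS := fun m hm => contMDiffAt_chartVariation (hs _ (hKU m hm)) (hsU _ (hKU m hm)) (hw2 (t, m))
  have hz : ∀ m ∈ K, rightDer (stModel n) (EG := EG) (chartVariation g₀ s (fun x => w x.2) 0) (t, m) =
      rightDer (stModel n) s (t, m) := fun m hm =>
    rightDer_chartVariation_zero (hs _ (hKU m hm)) (hsU _ (hKU m hm))
  have h3 := hasDerivAt_sliceAction (σ := rightDer (stModel n) (EG := EG) s) hf (μ := μ) hK
    (t := t) (τ := fun ε x => rightDer (stModel n) (chartVariation g₀ s (fun x => w x.2) ε) x)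
    (τ' := fun x => tder (stModel n) 𝓘(ℝ, EG) η x - (adRight G (η x)).comp (rightDer (stModel n) s x))
    (fun m hm => smoothFamilyAt_rightDer (hS m hm)) hz
    (fun m hm => by
      have h := hasDerivAt_rightDer (hS m hm)
      have h' : varField EG (chartVariation g₀ s fun x : ℝ × M => w x.2) =ᶠ[𝓝 (t, m)] η := by
        filter_upwards [hU.mem_nhds (hKU m hm)] with x hx using varField_chartVariation (hsU x hx)
      rwa [hz m hm, tder_congr h', h'.eq_of_nhds] at h)
  -- for small `ε` the varied coordinates stay in the chart target, uniformly on `K`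
  have hεev : ∀ᶠ ε : ℝ in 𝓝 0, ∀ m ∈ K,
      extChartAt 𝓘(ℝ, EG) g₀ (s (t, m)) + ε • w m ∈ (extChartAt 𝓘(ℝ, EG) g₀).target := by
    refine hK.eventually_forall_of_forall_eventually fun m hm => ?_
    have hc : ContinuousAt (fun q : ℝ × M => extChartAt 𝓘(ℝ, EG) g₀ (s (t, q.2)) + q.1 • w q.2)
        (0, m) := by
      have c1 := (contMDiffAt_chart_comp (hs _ (hKU m hm)) (hsU _ (hKU m hm))).continuousAt
      have c2 : ContinuousAt (fun q : ℝ × M => (t, q.2)) (0, m) := by fun_prop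
      refine (ContinuousAt.comp (g := fun x => extChartAt 𝓘(ℝ, EG) g₀ (s x))
        (f := fun q : ℝ × M => (t, q.2)) c1 c2).add ?_
      exact continuousAt_fst.smul (hw.continuous.continuousAt.comp continuousAt_snd)
    refine hc.eventually_mem ((isOpen_extChartAt_target (I := 𝓘(ℝ, EG)) g₀).mem_nhds ?_)
    simp only [zero_smul, add_zero]
    exact (extChartAt 𝓘(ℝ, EG) g₀).map_source (hsU _ (hKU m hm))
  have hRHS : deriv (fun ε : ℝ => coordLagrangian μ L g₀ K t (u t + ε • w) (u' t)) 0 =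
      ∫ m in K, fibreD (plainReduced L) (rightDer (stModel n) s) (t, m)
        (tder (stModel n) 𝓘(ℝ, EG) η (t, m) -
          (adRight G (η (t, m))).comp (rightDer (stModel n) s (t, m))) ∂μ := by
    refine (h3.congr_of_eventuallyEq ?_).deriv
    filter_upwards [hεev] with ε hε
    refine (coordLagrangian_eq μ g₀ K t _ _).trans ?_
    refine setIntegral_congr_fun hK.measurableSet fun m hm => ?_
    have hx := hKU m hm
    have hd := tder_chartVariation (ε := ε) (hs _ hx) (hsU _ hx) (hw2 (t, m)) (hε m hm)
    have h := plainJet_chart_symm hinv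
      (U := fun x => extChartAt 𝓘(ℝ, EG) g₀ (s x) + ε • w x.2) (t := t) (m := m)
      ((contMDiffAt_chart_comp (hs _ hx) (hsU _ hx)).add
      ((contMDiffAt_const : ContMDiffAt (stModel n) 𝓘(ℝ, ℝ) ∞ (fun _ : ℝ × M => ε) (t, m)).smul
        (hw2 (t, m)))) (hε m hm) 0
    have hz0 : splitForm (0 : EG) (0 : EuclideanSpace ℝ (Fin n) →L[ℝ] EG) = 0 := by
      ext <;> simp [splitForm_apply]
    rw [hz0, add_zero, add_zero] at h
    simp only [deriv_add_const] at h
    refine h.trans ?_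
    rw [chartTriv, (extChartAt 𝓘(ℝ, EG) g₀).right_inv (hε m hm), ContinuousLinearMap.comp_assoc]
    rw [rightDer_eq hd.1, hd.2]
    rfl
  -- integration by parts over `K` leaves the time derivative of the momentum
  have hsl := setIntegral_slice_variation (G := G) hΩ hf hU hσ
    (t := t) (V := {m | (t, m) ∈ U}) (hU.preimage (by fun_prop)) (fun m hm => hm) hK hKU (η := η)
    (fun m hm => hηs _ hm) (fun m hm => by simp only [hη, h0 m hm.2, map_zero])
  rw [hRHS, hsl, sub_add_cancel]
  exact hLHS

/-- The Euler–Lagrange equations on `F(V, G)` hold if and only if the Euler–Poincaré covector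
vanishes: at a point, the chart of the group at the value of `s` provides enough test functions. -/
theorem eulerLagrange_iff (hΩ : IsVolumeForm (𝓡 n) (spaceBasis n) Ω)
    (hL : JetSmooth L) (hinv : JetInvariant L) (hJ : IsOpen J) (hV : IsOpen V)
    (hs : ∀ x ∈ J ×ˢ V, ContMDiffAt (stModel n) 𝓘(ℝ, EG) ∞ s x) :
    EulerLagrange (volMeasure (𝓡 n) (spaceBasis n) Ω) L J V (fun t m => s (t, m)) ↔
      ∀ x ∈ J ×ˢ V, ∀ e : EG, epForm (stModel n) (stBasis n) (dtWedge Ω) G (plainReduced L)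
        (rightDer (stModel n) s) x e = 0 := by
  have hΩX := isVolumeForm_dtWedge hΩ
  set μ := volMeasure (𝓡 n) (spaceBasis n) Ω with hμ
  have : IsLocallyFiniteMeasure μ := isLocallyFiniteMeasure_volMeasure hΩ
  have : μ.IsOpenPosMeasure := isOpenPosMeasure_volMeasure hΩ
  have hf := smoothFibreFun_plainReduced hL
  have hσ : ∀ x ∈ J ×ˢ V, SmoothFormAt (stModel n) (rightDer (stModel n) (EG := EG) s) x :=
    fun x hx => smoothFormAt_rightDer (hs x hx)
  have hsc : ContinuousOn s (J ×ˢ V) := fun x hx => (hs x hx).continuousAt.continuousWithinAt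
  let U : G → Set (ℝ × M) := fun g₀ => J ×ˢ V ∩ s ⁻¹' (extChartAt 𝓘(ℝ, EG) g₀).source
  have hU : ∀ g₀, IsOpen (U g₀) := fun g₀ =>
    hsc.isOpen_inter_preimage (hJ.prod hV) (isOpen_extChartAt_source g₀)
  constructor
  · rintro h ⟨t, m₀⟩ hx e
    obtain ⟨v, rfl⟩ := chartTriv_surjective (mem_extChartAt_source (I := 𝓘(ℝ, EG)) (s (t, m₀))) e
    set g₀ := s (t, m₀) with hg₀
    have hV' : IsOpen {m | (t, m) ∈ U g₀} := (hU g₀).preimage (by fun_prop)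
    refine eqOn_zero_of_integral_mul_eq_zero (𝓡 n) (μ := μ) hV'
      (f := fun m => epForm (stModel n) (stBasis n) (dtWedge Ω) G (plainReduced L)
        (rightDer (stModel n) s) (t, m) (chartTriv EG g₀ (s (t, m)) v)) ?_ ?_ m₀
        ⟨hx, mem_extChartAt_source (I := 𝓘(ℝ, EG)) (s (t, m₀))⟩
    · have hc := continuousOn_epForm_apply (G := G) (K := U g₀) hΩX hf (hJ.prod hV) hσ
        Set.inter_subset_left (η := fun x => chartTriv EG g₀ (s x) v) fun x hx =>
          (contMDiffAt_chartTriv (hs x hx.1) hx.2 (v := fun _ => v)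
            contMDiffAt_const).continuousAt.continuousWithinAt
      exact hc.comp (f := fun m => (t, m)) (by fun_prop) fun m hm => hm
    · intro g hg hgc hgs
      have hw : ContMDiff (𝓡 n) 𝓘(ℝ, EG) ∞ fun m => g m • v := hg.smul contMDiff_const
      have h0 : ∀ m ∉ tsupport g, g m • v = 0 := fun m hm => by
        rw [image_eq_zero_of_notMem_tsupport hm, zero_smul]
      have h1 := hasDerivAt_coordMomentum hΩ hL hinv (hU g₀)
        (fun x hx => hs x hx.1) (fun x hx => hx.2)
        (t := t) (K := tsupport g) hgc hgs hw h0
      have h2 := h g₀ t hx.1 (tsupport g) (fun m hm => (hgs hm).1.2) hgc (fun m hm => (hgs hm).2)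
        _ hw h0
      have h3 := h1.unique h2
      rw [add_eq_left] at h3
      rw [← h3, ← setIntegral_eq_integral_of_forall_compl_eq_zero (s := tsupport g)
        (fun m hm => by rw [image_eq_zero_of_notMem_tsupport hm, zero_mul])]
      refine setIntegral_congr_fun (isClosed_tsupport g).measurableSet fun m hm => ?_
      have := epForm_sum (G := G) hΩX hf (hJ.prod hV) hσ (hgs hm).1 {(0 : ℕ)} (fun _ => g m)
        (fun _ => chartTriv EG g₀ (s (t, m)) v)
      simp only [Finset.sum_singleton] at this
      rw [map_smul, this]
  · intro h g₀ t ht K hKV hK hKs w hw h0 u u'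
    have h1 := hasDerivAt_coordMomentum hΩ hL hinv (hU g₀)
        (fun x hx => hs x hx.1) (fun x hx => hx.2)
        (t := t) hK (fun m hm => ⟨⟨ht, hKV hm⟩, hKs m hm⟩) hw h0
    have h2 : ∫ m in K, epForm (stModel n) (stBasis n) (dtWedge Ω) G (plainReduced L)
        (rightDer (stModel n) s) (t, m) (chartTriv EG g₀ (s (t, m)) (w m)) ∂μ = 0 :=
      setIntegral_eq_zero_of_forall_eq_zero fun m hm => h (t, m) ⟨ht, hKV hm⟩ _
    exact HasDerivAt.congr_deriv h1 (add_eq_left.2 h2)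

end CoordinateEulerLagrange

/-! ### Uniqueness of dual fields -/

section DualFieldUniqueness

variable {E : Type*} [NormedAddCommGroup E] [NormedSpace ℝ E] [FiniteDimensional ℝ E]
  {H : Type*} [TopologicalSpace H] {I : ModelWithCorners ℝ E H} [I.Boundaryless]
  {N : Type*} [TopologicalSpace N] [ChartedSpace H N] [IsManifold I ∞ N]
  {F : Type*} [NormedAddCommGroup F] [NormedSpace ℝ F]

theorem SmoothFormAt.smul {σ : N → E →L[ℝ] F} {g : N → ℝ} {x : N} (hg : ContMDiffAt I 𝓘(ℝ, ℝ) ∞ g x)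
    (hσ : SmoothFormAt I σ x) : SmoothFormAt I (fun x => g x • σ x) x := fun c hc => by
  have h1 := contDiffAt_of_contMDiffAt ((extChartAt I c).map_source hc)
    (by rwa [(extChartAt I c).left_inv hc])
  refine (h1.smul (hσ c hc)).congr_of_eventuallyEq (Filter.Eventually.of_forall fun q => ?_)
  ext v
  simp

theorem divAt_neg {d : ℕ} {b : Module.Basis (Fin d) ℝ E}
    {Ω : ∀ x : N, TangentSpace I x [⋀^Fin d]→ₗ[ℝ] ℝ} (w : N → (E →L[ℝ] F) →ₗ[ℝ] ℝ) (c x : N)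
    (η : F) : divAt I b Ω c (fun x => -w x) x η = -divAt I b Ω c w x η := by
  simp only [divAt, fieldComp, LinearMap.neg_apply, mul_neg, fderiv_fun_neg, neg_apply,
    Finset.sum_neg_distrib]

theorem divAt_congr {d : ℕ} {b : Module.Basis (Fin d) ℝ E}
    {Ω : ∀ x : N, TangentSpace I x [⋀^Fin d]→ₗ[ℝ] ℝ} {w w' : N → (E →L[ℝ] F) →ₗ[ℝ] ℝ} {x : N}
    (h : w =ᶠ[𝓝 x] w') (η : F) : divAt I b Ω x w x η = divAt I b Ω x w' x η := by
  have hc := (contMDiffAt_chart_symm (I := I) (mem_extChartAt_target x)).continuousAt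
  rw [ContinuousAt, extChartAt_to_inv] at hc
  simp only [divAt]
  congr 1
  refine Finset.sum_congr rfl fun i _ => ?_
  rw [Filter.EventuallyEq.fderiv_eq]
  filter_upwards [hc.eventually h] with y hy
  rw [fieldComp, fieldComp, hy]

/-- Every covector is the differential of a smooth function. -/
theorem exists_contMDiff_tder_eq [T2Space N] (x : N) (a : E →L[ℝ] ℝ) :
    ∃ f : N → ℝ, ContMDiff I 𝓘(ℝ, ℝ) ∞ f ∧ tder I 𝓘(ℝ, ℝ) f x = a := by
  let β : SmoothBumpFunction I x := Classical.arbitrary _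
  set φ := extChartAt I x with hφ
  set a' := a.comp (tder 𝓘(ℝ, E) I φ.symm (φ x)) with ha'
  have hy : φ x ∈ φ.target := mem_extChartAt_target x
  have hchart : ContMDiffOn I 𝓘(ℝ, ℝ) ∞ (fun z => a' (φ z)) (chartAt H x).source := fun z hz =>
    (a'.contDiff.contDiffAt.contMDiffAt.comp (f := φ) z
      (contMDiffAt_chart (by rwa [extChartAt_source]))).contMDiffWithinAt
  refine ⟨fun z => β z • a' (φ z), β.contMDiff_smul hchart, ?_⟩
  have h1 : (fun z => β z • a' (φ z)) =ᶠ[𝓝 x] fun z => a' (φ z) := by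
    filter_upwards [β.eventuallyEq_one] with z hz
    rw [hz]
    simp
  have hd : MDifferentiableAt I 𝓘(ℝ, E) φ x :=
    (contMDiffAt_chart (mem_extChartAt_source x)).mdifferentiableAt (by simp)
  have h2 := tder_comp (I' := 𝓘(ℝ, E)) (I'' := 𝓘(ℝ, ℝ)) (g := a') (f := φ) (x := x)
    a'.differentiableAt.mdifferentiableAt hd
  have h3 := tder_symm_comp_tder_chart (I := I) hy
  rw [hφ, extChartAt_to_inv, ← hφ] at h3
  rw [tder_congr h1, h2, tder_eq_fderiv, ContinuousLinearMap.fderiv, ha',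
    ContinuousLinearMap.comp_assoc, h3, ContinuousLinearMap.comp_id]

theorem tder_smul_const {f : N → ℝ} {x : N} (hf : MDifferentiableAt I 𝓘(ℝ, ℝ) f x) (η : F) :
    tder I 𝓘(ℝ, F) (fun z => f z • η) x = (tder I 𝓘(ℝ, ℝ) f x).smulRight η := by
  have h1 := tder_comp (I := I) (I' := 𝓘(ℝ, ℝ)) (I'' := 𝓘(ℝ, F))
    (g := (ContinuousLinearMap.id ℝ ℝ).smulRight η) (f := f) (x := x)
    ((ContinuousLinearMap.id ℝ ℝ).smulRight η).differentiableAt.mdifferentiableAt hf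
  rw [tder_eq_fderiv, ContinuousLinearMap.fderiv] at h1
  exact h1.trans (by ext; simp)

theorem SmoothDualField.sub {w w' : N → (E →L[ℝ] F) →ₗ[ℝ] ℝ} {U : Set N}
    (hw : SmoothDualField I w U) (hw' : SmoothDualField I w' U) :
    SmoothDualField I (fun x => w x - w' x) U := fun c A => (hw c A).sub (hw' c A)

/-- The fundamental lemma of the calculus of variations for dual fields. -/
theorem SmoothDualField.eq_zero_of_integral [T2Space N] [SecondCountableTopology N]
    [MeasurableSpace N] [BorelSpace N] {w : N → (E →L[ℝ] F) →ₗ[ℝ] ℝ} {U : Set N} (hU : IsOpen U)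
    (hw : SmoothDualField I w U) {μ : Measure N} [IsLocallyFiniteMeasure μ] [μ.IsOpenPosMeasure]
    (h : ∀ g : N → ℝ, ContMDiff I 𝓘(ℝ, ℝ) ∞ g → HasCompactSupport g → tsupport g ⊆ U →
      ∀ f : N → ℝ, ContMDiff I 𝓘(ℝ, ℝ) ∞ f → ∀ η : F,
        ∫ x, g x * w x ((tder I 𝓘(ℝ, ℝ) f x).smulRight η) ∂μ = 0) : ∀ x ∈ U, ∀ A, w x A = 0 := by
  intro x hx A
  have key : ∀ (a : E →L[ℝ] ℝ) (η : F), w x (a.smulRight η) = 0 := by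
    intro a η
    obtain ⟨f, hf, rfl⟩ := exists_contMDiff_tder_eq (I := I) x a
    have hc := continuousOn_field_tder hU hw (g := f) hf.contMDiffOn η
    exact eqOn_zero_of_integral_mul_eq_zero I (μ := μ) hU hc
      (fun g hg hgc hgs => h g hg hgc hgs f hf η) x hx
  let b := Module.finBasis ℝ E
  -- the covectors `a ⊗ η` span
  have hA : A = ∑ i, (LinearMap.toContinuousLinearMap (b.coord i)).smulRight (A (b i)) := by
    ext v
    conv_lhs => rw [← b.sum_repr v, map_sum]
    simp
  rw [hA, map_sum]
  exact Finset.sum_eq_zero fun i _ => key _ _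

variable {EG : Type*} [NormedAddCommGroup EG] [NormedSpace ℝ EG]
  {G : Type*} [TopologicalSpace G] [ChartedSpace EG G] [Group G]

/-- Componentwise smoothness of a Lie algebra valued one-form in charts, as smoothness of its
coordinate expression. -/
theorem formSmoothOn_iff {U : Set N} (hU : IsOpen U) {α : N → E →L[ℝ] EG} :
    FormSmoothOn (EG := EG) (G := G) I α U ↔ ∀ x ∈ U, SmoothFormAt I α x := by
  have hplain : FormSmoothOn (EG := EG) (G := G) I α U ↔ ∀ (c : N) (e : E), ContDiffOn ℝ ∞
      (fun y => ((α ((extChartAt I c).symm y)).comp (tder 𝓘(ℝ, E) I (extChartAt I c).symm y)) e)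
      (chartSet I c U) := Iff.rfl
  rw [hplain]
  constructor
  · intro h x hx c hc
    have hmem := mem_chartSet (I := I) hc hx
    exact (contDiffOn_clm_apply.2 (h c) _ hmem).contDiffAt ((isOpen_chartSet c hU).mem_nhds hmem)
  · intro h c
    refine contDiffOn_clm_apply.1 fun y hy => ContDiffAt.contDiffWithinAt ?_
    have h1 := h _ hy.2 c ((extChartAt I c).map_target hy.1)
    rwa [(extChartAt I c).right_inv hy.1] at h1

end DualFieldUniqueness

/-! ### The affine Euler–Poincaré equations -/

section AffineEulerPoincare

variable {n : ℕ} {M : Type*} [TopologicalSpace M] [T2Space M] [SecondCountableTopology M]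
  [ChartedSpace (EuclideanSpace ℝ (Fin n)) M] [IsManifold (𝓡 n) ∞ M]
  [MeasurableSpace M] [BorelSpace M]
  {EG : Type*} [NormedAddCommGroup EG] [NormedSpace ℝ EG] [FiniteDimensional ℝ EG]
  {G : Type*} [TopologicalSpace G] [ChartedSpace EG G] [Group G] [LieGroup 𝓘(ℝ, EG) ∞ G]
  {Ω : ∀ m : M, TangentSpace (𝓡 n) m [⋀^Fin n]→ₗ[ℝ] ℝ}
  {L : JetFunction n M EG G} {J : Set ℝ} {V : Set M} {s : ℝ × M → G}

theorem smoothFormAt_splitForm_space {F : Type*} [NormedAddCommGroup F] [NormedSpace ℝ F]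
    {α : M → EuclideanSpace ℝ (Fin n) →L[ℝ] F} {t : ℝ} {m : M} (hα : SmoothFormAt (𝓡 n) α m) :
    SmoothFormAt (stModel n) (fun x : ℝ × M => splitForm (0 : F) (α x.2)) (t, m) := by
  intro c hc
  have hc' : m ∈ (extChartAt (𝓡 n) c.2).source := by
    rw [stChart_source] at hc; exact hc.2
  have h1 := hα c.2 hc'
  let Λ : (EuclideanSpace ℝ (Fin n) →L[ℝ] F) →L[ℝ] ((ℝ × EuclideanSpace ℝ (Fin n)) →L[ℝ] F) :=
    (ContinuousLinearMap.compL ℝ (ℝ × EuclideanSpace ℝ (Fin n)) (EuclideanSpace ℝ (Fin n)) F).flip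
      (ContinuousLinearMap.snd ℝ ℝ (EuclideanSpace ℝ (Fin n)))
  have h2 := Λ.contDiff.contDiffAt.comp _ (ContDiffAt.comp (f := Prod.snd)
    (extChartAt (stModel n) c (t, m)) (by rw [stChart_apply]; exact h1) contDiffAt_snd)
  refine h2.congr_of_eventuallyEq ?_
  filter_upwards [(isOpen_extChartAt_target (I := stModel n) c).mem_nhds
    ((extChartAt (stModel n) c).map_source hc)] with q hq
  rw [stChart_target] at hq
  rw [tder_stChart_symm c hq.2, splitForm_comp_prodMap, stChart_symm_apply]
  ext <;> simp [splitForm_apply, Λ]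

theorem rightDer_eq_splitForm {t : ℝ} {m : M}
    (hs : MDifferentiableAt (stModel n) 𝓘(ℝ, EG) s (t, m)) :
    rightDer (stModel n) s (t, m) = splitForm (plainNu (EG := EG) s t m) (-plainGamma s t m) := by
  rw [rightDer_spacetime hs, plainNu_eq hs, plainGamma_eq hs, neg_neg]

/-- The time component of the fibre derivative is the functional derivative in `ν`. -/
theorem isNuDerivative_timeMomentum (hL : JetSmooth L) (μ : Measure M) [IsLocallyFiniteMeasure μ]
    {t : ℝ} (hs : ∀ m ∈ V, ContMDiffAt (stModel n) 𝓘(ℝ, EG) ∞ s (t, m)) :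
    IsNuDerivative (EG := EG) (G := G) μ (fun D => reducedLagrangian μ L D t) V
      (plainNu (EG := EG) s t) (plainGamma (EG := EG) s t)
      (fun m => timeMomentum (F := EG) (fibreD (plainReduced L)
        (rightDer (stModel n) (EG := EG) s)) (t, m)) := by
  have hf := smoothFibreFun_plainReduced hL
  have hσ : ∀ m ∈ V, SmoothFormAt (stModel n) (rightDer (stModel n) (EG := EG) s) (t, m) :=
    fun m hm => smoothFormAt_rightDer (hs m hm)
  refine ⟨?_, ?_⟩
  · intro (η : EG) m hm
    exact (ContMDiffAt.slice_right (g := fun t m => timeMomentum (fibreD (plainReduced L)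
      (rightDer (stModel n) (EG := EG) s)) (t, m) η) (contMDiffAt_timeMomentum hf (hσ m hm)
        (contMDiffAt_const (c := η)))).contMDiffWithinAt
  · intro K hKV hK (ζ : M → EG) hζ _
    have hζ' : ContMDiff (𝓡 n) 𝓘(ℝ, EG) ∞ ζ := contMDiffOn_univ.1 hζ
    have h1 := hasDerivAt_sliceAction (σ := rightDer (stModel n) (EG := EG) s) hf (μ := μ) hK
      (t := t) (τ := fun ε x => rightDer (stModel n) s x + ε • splitForm (ζ x.2) 0)
      (τ' := fun x => splitForm (ζ x.2) 0)
      (fun m hm => (hσ _ (hKV hm)).add_smul (smoothFormAt_splitForm (hζ'.contMDiffAt.comp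
        (f := Prod.snd) (t, m) contMDiffAt_snd)) 0)
      (fun m hm => by simp)
      (fun m hm => by
        simpa using ((hasDerivAt_id (0 : ℝ)).smul_const (splitForm (ζ m)
          (0 : EuclideanSpace ℝ (Fin n) →L[ℝ] EG))).const_add (rightDer (stModel n) s (t, m)))
    refine h1.congr_of_eventuallyEq (Filter.Eventually.of_forall fun ε => ?_)
    refine (reducedLagrangian_eq (G := G) μ K t _ _).trans ?_
    refine setIntegral_congr_fun hK.measurableSet fun m hm => ?_
    refine congrArg (plainReduced L (t, m)) ?_
    have e1 : ∀ z : EG, splitForm (plainNu s t m + ε • z) (-plainGamma s t m) =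
        rightDer (stModel n) s (t, m) +
          ε • splitForm z (0 : EuclideanSpace ℝ (Fin n) →L[ℝ] EG) := fun z => by
      rw [rightDer_eq_splitForm ((hs m (hKV hm)).mdifferentiableAt (by simp))]
      ext <;> simp [splitForm_apply]
    exact e1 _

/-- Minus the space component of the fibre derivative is the functional derivative in `γ`; the sign
is that of `γ = -dχ χ⁻¹`. -/
theorem isGammaDerivative_spaceMomentum (hL : JetSmooth L) (μ : Measure M)
    [IsLocallyFiniteMeasure μ] {U : Set (ℝ × M)} (hU : IsOpen U)
    {t : ℝ} (hVU : ∀ m ∈ V, (t, m) ∈ U) (hs : ∀ x ∈ U, ContMDiffAt (stModel n) 𝓘(ℝ, EG) ∞ s x) :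
    IsGammaDerivative (EG := EG) (G := G) μ (fun D => reducedLagrangian μ L D t) V
      (plainNu (EG := EG) s t) (plainGamma (EG := EG) s t)
      (fun m => -spaceMomentum (F := EG) (fibreD (plainReduced L) (rightDer (stModel n) s)) t m) := by
  have hf := smoothFibreFun_plainReduced hL
  have hσ : ∀ x ∈ U, SmoothFormAt (stModel n) (rightDer (stModel n) (EG := EG) s) x :=
    fun x hx => smoothFormAt_rightDer (hs x hx)
  refine ⟨fun c A => (smoothDualField_spaceMomentum hU (hf.smoothDualField hσ) hVU c A).neg, ?_⟩
  intro K hKV hK (α : M → EuclideanSpace ℝ (Fin n) →L[ℝ] EG) hα _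
  have hα' := (formSmoothOn_iff (G := G) isOpen_univ (α := α)).1 hα
  -- the variation `ε α` of `γ` is the variation `-ε α` of the space component of `σ`
  set β : M → EuclideanSpace ℝ (Fin n) →L[ℝ] EG := fun m => (-1 : ℝ) • α m with hβ
  have hβ' : ∀ m, SmoothFormAt (𝓡 n) β m := fun m =>
    (hα' m trivial).smul (contMDiffAt_const (c := (-1 : ℝ)))
  have h1 := hasDerivAt_sliceAction (σ := rightDer (stModel n) (EG := EG) s) hf (μ := μ) hK
    (t := t) (τ := fun ε x => rightDer (stModel n) s x + ε • splitForm 0 (β x.2))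
    (τ' := fun x => splitForm 0 (β x.2))
    (fun m hm => (hσ _ (hVU m (hKV hm))).add_smul (smoothFormAt_splitForm_space (hβ' m)) 0)
    (fun m hm => by simp)
    (fun m hm => by
      simpa using ((hasDerivAt_id (0 : ℝ)).smul_const (splitForm (0 : EG) (β m))).const_add
        (rightDer (stModel n) s (t, m)))
  have h2 : ∀ m, fibreD (plainReduced L) (rightDer (stModel n) s) (t, m) (splitForm 0 (β m)) =
      (-spaceMomentum (fibreD (plainReduced L) (rightDer (stModel n) (EG := EG) s)) t m) (α m) :=
    fun m => by
      rw [LinearMap.neg_apply, ← neg_one_mul, ← smul_eq_mul, ← map_smul]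
      rfl
  simp only [h2] at h1
  refine h1.congr_of_eventuallyEq (Filter.Eventually.of_forall fun ε => ?_)
  refine (reducedLagrangian_eq (G := G) μ K t _ _).trans ?_
  refine setIntegral_congr_fun hK.measurableSet fun m hm => ?_
  refine congrArg (plainReduced L (t, m)) ?_
  have e1 : ∀ a : EuclideanSpace ℝ (Fin n) →L[ℝ] EG,
      splitForm (plainNu s t m) (-(plainGamma s t m + ε • a)) =
        rightDer (stModel n) s (t, m) + ε • splitForm 0 ((-1 : ℝ) • a) := fun a => by
    rw [rightDer_eq_splitForm ((hs _ (hVU m (hKV hm))).mdifferentiableAt (by simp))]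
    ext
    · simp [splitForm_apply]
    · simp [splitForm_apply, add_comm]
  exact e1 _

/-- The functional derivative in `ν` is unique. -/
theorem IsNuDerivative.eqOn {μ : Measure M} [IsLocallyFiniteMeasure μ] [μ.IsOpenPosMeasure]
    (hV : IsOpen V) {l : Set M → (M → LieAlg EG G) →
      (∀ m : M, TangentSpace (𝓡 n) m →L[ℝ] LieAlg EG G) → ℝ} {ν : M → LieAlg EG G}
    {γ : ∀ m : M, TangentSpace (𝓡 n) m →L[ℝ] LieAlg EG G} {p q : M → (EG →ₗ[ℝ] ℝ)}
    (hp : IsNuDerivative μ l V ν γ p) (hq : IsNuDerivative μ l V ν γ q) :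
    ∀ m ∈ V, ∀ η, p m η = q m η := by
  intro m hm η
  have cp : ContinuousOn (fun m => p m η) V := (hp.1 η).continuousOn
  have cq : ContinuousOn (fun m => q m η) V := (hq.1 η).continuousOn
  refine sub_eq_zero.1 (eqOn_zero_of_integral_mul_eq_zero (𝓡 n) (μ := μ) hV (cp.sub cq)
    (fun g hg hgc hgs => ?_) m hm)
  have hw : ContMDiff (𝓡 n) 𝓘(ℝ, EG) ∞ fun m => g m • η := hg.smul contMDiff_const
  have h0 : ∀ m ∉ tsupport g, g m • η = 0 := fun m hm => by
    rw [image_eq_zero_of_notMem_tsupport hm, zero_smul]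
  have h1 : ∫ m in tsupport g, p m (g m • η) ∂μ = ∫ m in tsupport g, q m (g m • η) ∂μ :=
    (hp.2 _ hgs hgc _ hw.contMDiffOn h0).unique (hq.2 _ hgs hgc _ hw.contMDiffOn h0)
  simp only [map_smul, smul_eq_mul] at h1
  rw [← setIntegral_eq_integral_of_forall_compl_eq_zero (s := tsupport g)
    (fun m hm => by rw [image_eq_zero_of_notMem_tsupport hm, zero_mul])]
  simp only [Pi.sub_apply, mul_sub]
  rw [integral_sub, h1, sub_self]
  · exact (hg.continuous.continuousOn.mul (cp.mono hgs)).integrableOn_compact hgc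
  · exact (hg.continuous.continuousOn.mul (cq.mono hgs)).integrableOn_compact hgc

/-- The functional derivative in `γ` is unique: the products `g df ⊗ η` are enough test forms. -/
theorem IsGammaDerivative.eqOn {μ : Measure M} [IsLocallyFiniteMeasure μ] [μ.IsOpenPosMeasure]
    (hV : IsOpen V) {l : Set M → (M → LieAlg EG G) →
      (∀ m : M, TangentSpace (𝓡 n) m →L[ℝ] LieAlg EG G) → ℝ} {ν : M → LieAlg EG G}
    {γ : ∀ m : M, TangentSpace (𝓡 n) m →L[ℝ] LieAlg EG G}
    {p q : M → (EuclideanSpace ℝ (Fin n) →L[ℝ] EG) →ₗ[ℝ] ℝ}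
    (hp : IsGammaDerivative μ l V ν γ p) (hq : IsGammaDerivative μ l V ν γ q) :
    ∀ m ∈ V, p m = q m := by
  have sp : SmoothDualField (𝓡 n) p V := hp.1
  have sq : SmoothDualField (𝓡 n) q V := hq.1
  suffices h : ∀ m ∈ V, ∀ A, (p m - q m) A = 0 from fun m hm =>
    LinearMap.ext fun A => sub_eq_zero.1 (h m hm A)
  refine (sp.sub sq).eq_zero_of_integral (μ := μ) hV fun g hg hgc hgs f hf η => ?_
  set α : M → EuclideanSpace ℝ (Fin n) →L[ℝ] EG := fun m =>
    g m • (tder (𝓡 n) 𝓘(ℝ, ℝ) f m).smulRight η with hα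
  have hform : ∀ m, SmoothFormAt (𝓡 n) (fun m => (tder (𝓡 n) 𝓘(ℝ, ℝ) f m).smulRight η) m := by
    intro m
    have h := smoothFormAt_tder (η := fun m => f m • η) (x := m)
      (hf.smul contMDiff_const).contMDiffAt
    simpa only [tder_smul_const (hf.mdifferentiable (by simp) _)] using h
  have hαs : FormSmoothOn (EG := EG) (G := G) (𝓡 n) α Set.univ :=
    (formSmoothOn_iff (G := G) isOpen_univ).2 fun m _ =>
      (hform m).smul hg.contMDiffAt
  have h0 : ∀ m ∉ tsupport g, α m = 0 := fun m hm => by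
    rw [hα]; simp only; rw [image_eq_zero_of_notMem_tsupport hm, zero_smul]
  have h1 : ∫ m in tsupport g, p m (α m) ∂μ = ∫ m in tsupport g, q m (α m) ∂μ :=
    (hp.2 _ hgs hgc _ hαs h0).unique (hq.2 _ hgs hgc _ hαs h0)
  simp only [hα, map_smul, smul_eq_mul] at h1
  have cp := continuousOn_field_tder hV sp (g := f) hf.contMDiffOn η
  have cq := continuousOn_field_tder hV sq (g := f) hf.contMDiffOn η
  rw [← setIntegral_eq_integral_of_forall_compl_eq_zero (s := tsupport g)
    (fun m hm => by rw [image_eq_zero_of_notMem_tsupport hm, zero_mul])]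
  simp only [LinearMap.sub_apply, mul_sub]
  rw [integral_sub, h1, sub_self]
  · exact (hg.continuous.continuousOn.mul (cp.mono hgs)).integrableOn_compact hgc
  · exact (hg.continuous.continuousOn.mul (cq.mono hgs)).integrableOn_compact hgc

/-- The affine Euler–Poincaré equation at a point, for the components of the fibre derivative, is
the covariant Euler–Poincaré equation. -/
theorem affineEulerPoincare_at_iff (hΩ : IsVolumeForm (𝓡 n) (spaceBasis n) Ω) (hL : JetSmooth L)
    {U : Set (ℝ × M)} (hU : IsOpen U) (hs : ∀ x ∈ U, ContMDiffAt (stModel n) 𝓘(ℝ, EG) ∞ s x)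
    {t : ℝ} {m : M} (hx : (t, m) ∈ U) (η : EG) :
    HasDerivAt
      (fun τ => timeMomentum (fibreD (plainReduced L) (rightDer (stModel n) (EG := EG) s)) (τ, m) η)
      (-(timeMomentum (fibreD (plainReduced L) (rightDer (stModel n) (EG := EG) s)) (t, m)
          (adRight G η (plainNu s t m))) +
        (divAt (𝓡 n) (spaceBasis n) Ω m
          (fun m => -spaceMomentum (F := EG)
            (fibreD (plainReduced L) (rightDer (stModel n) (EG := EG) s)) t m)
            m η -
          (-spaceMomentum (fibreD (plainReduced L) (rightDer (stModel n) (EG := EG) s)) t m)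
            ((adRight G η).comp (plainGamma s t m)))) t ↔
      epForm (stModel n) (stBasis n) (dtWedge Ω) G (plainReduced L) (rightDer (stModel n) s)
        (t, m) η = 0 := by
  have hw := (smoothFibreFun_plainReduced hL).smoothDualField
    (σ := rightDer (stModel n) (EG := EG) s) fun x hx => smoothFormAt_rightDer (hs x hx)
  have hd := (differentiableAt_timeMomentum hU hw hx η).hasDerivAt
  have hc : (adRight G η).comp (splitForm (plainNu s t m) (-plainGamma (n := n) s t m)) =
      splitForm (adRight G η (plainNu s t m)) (-(adRight G η).comp (plainGamma (n := n) s t m)) := by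
    ext <;> simp [splitForm_apply]
  rw [epForm, divAt_spacetime hΩ hU hw hx,
    rightDer_eq_splitForm ((hs _ hx).mdifferentiableAt (by simp)), hc, apply_splitForm, divAt_neg,
    LinearMap.neg_apply, map_neg]
  constructor
  · intro h
    rw [h.deriv]
    ring
  · intro h
    exact hd.congr_deriv (by linear_combination h)

/-- The affine Euler–Poincaré equations hold if and only if the Euler–Poincaré covector vanishes,
since the functional derivatives are the components of the fibre derivative. -/
theorem affineEulerPoincare_iff (hΩ : IsVolumeForm (𝓡 n) (spaceBasis n) Ω)
    (hL : JetSmooth L) (hJ : IsOpen J) (hV : IsOpen V)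
    (hs : ∀ x ∈ J ×ˢ V, ContMDiffAt (stModel n) 𝓘(ℝ, EG) ∞ s x) :
    AffineEulerPoincare (volMeasure (𝓡 n) (spaceBasis n) Ω) Ω
      (reducedLagrangian (volMeasure (𝓡 n) (spaceBasis n) Ω) L) J V
      (nuOf fun t m => s (t, m)) (gammaOf fun t m => s (t, m)) ↔
      ∀ x ∈ J ×ˢ V, ∀ e : EG, epForm (stModel n) (stBasis n) (dtWedge Ω) G (plainReduced L)
        (rightDer (stModel n) s) x e = 0 := by
  set μ := volMeasure (𝓡 n) (spaceBasis n) Ω with hμ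
  have : IsLocallyFiniteMeasure μ := isLocallyFiniteMeasure_volMeasure hΩ
  have : μ.IsOpenPosMeasure := isOpenPosMeasure_volMeasure hΩ
  have hU := hJ.prod hV
  have hp₀ := fun t (ht : t ∈ J) => isNuDerivative_timeMomentum hL μ (V := V) (t := t)
    fun m hm => hs (t, m) ⟨ht, hm⟩
  have hw₀ := fun t (ht : t ∈ J) => isGammaDerivative_spaceMomentum hL μ (V := V) hU (t := t)
    (fun m hm => ⟨ht, hm⟩) hs
  constructor
  · rintro ⟨p, w, hp, hw, h⟩ ⟨t, m⟩ hx η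
    obtain ⟨ht, hm⟩ := hx
    refine (affineEulerPoincare_at_iff hΩ hL hU hs ⟨ht, hm⟩ η).1 ?_
    have e1 : ∀ τ ∈ J, ∀ m ∈ V, ∀ η : EG, timeMomentum (fibreD (plainReduced L)
        (rightDer (stModel n) (EG := EG) s)) (τ, m) η = (p τ m : EG →ₗ[ℝ] ℝ) η :=
      fun τ hτ => (hp₀ τ hτ).eqOn hV (hp τ hτ)
    have e2 : ∀ m ∈ V, -spaceMomentum (fibreD (plainReduced L) (rightDer (stModel n) (EG := EG) s))
        t m = (w t m : (EuclideanSpace ℝ (Fin n) →L[ℝ] EG) →ₗ[ℝ] ℝ) :=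
      (hw₀ t ht).eqOn hV (hw t ht)
    have hdiv : divAt (𝓡 n) (spaceBasis n) Ω m (fun m => -spaceMomentum (fibreD (plainReduced L)
        (rightDer (stModel n) (EG := EG) s)) t m) m η =
        divAt (𝓡 n) (spaceBasis n) Ω m (F := EG) (w t) m η :=
      divAt_congr (by filter_upwards [hV.mem_nhds hm] with m' hm' using e2 m' hm') η
    rw [hdiv, e2 m hm, e1 t ht m hm]
    refine HasDerivAt.congr_of_eventuallyEq (h t ht m hm η) ?_
    filter_upwards [hJ.mem_nhds ht] with τ hτ using e1 τ hτ m hm η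
  · intro h
    exact ⟨fun t m => timeMomentum (F := EG) (fibreD (plainReduced L)
        (rightDer (stModel n) (EG := EG) s)) (t, m), fun t m => -spaceMomentum (F := EG) (fibreD (plainReduced L)
        (rightDer (stModel n) (EG := EG) s)) t m, hp₀, hw₀, fun t ht m hm (η : EG) =>
        (affineEulerPoincare_at_iff hΩ hL hU hs ⟨ht, hm⟩ η).2 (h (t, m) ⟨ht, hm⟩ η)⟩

end AffineEulerPoincare

/-! ### The derivative of the inverse -/

section InverseDerivative

variable {E : Type*} [NormedAddCommGroup E] [NormedSpace ℝ E]
  {H : Type*} [TopologicalSpace H] {I : ModelWithCorners ℝ E H}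
  {N : Type*} [TopologicalSpace N] [ChartedSpace H N] [IsManifold I ∞ N]
  {EG : Type*} [NormedAddCommGroup EG] [NormedSpace ℝ EG]
  {G : Type*} [TopologicalSpace G] [ChartedSpace EG G] [Group G] [LieGroup 𝓘(ℝ, EG) ∞ G]

/-- `χ dχ⁻¹ = -dχ χ⁻¹`. -/
theorem tder_mul_inv {χ : N → G} {m : N} (hχ : MDifferentiableAt I 𝓘(ℝ, EG) χ m) :
    tder I 𝓘(ℝ, EG) (fun q => χ m * (χ q)⁻¹) m = -rightDer I (EG := EG) χ m := by
  have hmul : MDifferentiableAt (I.prod I) 𝓘(ℝ, EG) (fun p : N × N => χ p.1 * (χ p.2)⁻¹) (m, m) := by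
    have h1 : MDifferentiableAt (I.prod I) 𝓘(ℝ, EG) (fun p : N × N => χ p.1) (m, m) :=
      MDifferentiableAt.comp (g := χ) (f := Prod.fst) (m, m) hχ mdifferentiableAt_fst
    have h2 : MDifferentiableAt (I.prod I) 𝓘(ℝ, EG) (fun p : N × N => χ p.2) (m, m) :=
      MDifferentiableAt.comp (g := χ) (f := Prod.snd) (m, m) hχ mdifferentiableAt_snd
    have h3 : ContMDiff (𝓘(ℝ, EG).prod 𝓘(ℝ, EG)) 𝓘(ℝ, EG) ∞ fun g : G × G => g.1 * g.2⁻¹ :=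
      contMDiff_fst.mul (contMDiff_inv 𝓘(ℝ, EG) ∞ |>.comp contMDiff_snd)
    exact MDifferentiableAt.comp (g := fun g : G × G => g.1 * g.2⁻¹)
      (f := fun p : N × N => (χ p.1, χ p.2)) (m, m) (h3.mdifferentiable (by simp) _)
      (h1.prodMk h2)
  have hdiag : tder I (I.prod I) (fun p : N => (p, p)) m =
      (ContinuousLinearMap.id ℝ E).prod (ContinuousLinearMap.id ℝ E) := by
    have h := mfderiv_prodMk (I := I) (I' := I) (I'' := I) (f := fun p : N => p) (g := fun p : N => p)
      (x := m) mdifferentiableAt_id mdifferentiableAt_id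
    exact h.trans (by rw [show (fun p : N => p) = id from rfl, mfderiv_id]; rfl)
  have hcomp := tder_comp (g := fun p : N × N => χ p.1 * (χ p.2)⁻¹) (f := fun p : N => (p, p))
    (x := m) (I := I) (I' := I.prod I) (I'' := 𝓘(ℝ, EG)) hmul
    (mdifferentiableAt_id.prodMk mdifferentiableAt_id)
  have hone : tder I 𝓘(ℝ, EG) (fun p : N => χ p * (χ p)⁻¹) m = 0 := by
    simp only [mul_inv_cancel]
    exact mfderiv_const
  rw [hdiag] at hcomp
  ext u
  -- the product rule for `χ(p) χ(q)⁻¹`, which is constant on the diagonal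
  have h := mfderiv_prod_eq_add_apply (v := ((u : E), (u : E))) hmul
  change tder (I.prod I) 𝓘(ℝ, EG) (fun p : N × N => χ p.1 * (χ p.2)⁻¹) (m, m) (u, u) =
    rightDer I (EG := EG) χ m u + tder I 𝓘(ℝ, EG) (fun q => χ m * (χ q)⁻¹) m u at h
  have h2 : tder (I.prod I) 𝓘(ℝ, EG) (fun p : N × N => χ p.1 * (χ p.2)⁻¹) (m, m) (u, u) = 0 := by
    have := congrArg (fun A : E →L[ℝ] EG => A u) (hcomp.symm.trans hone)
    simpa using this
  rw [h2] at h
  rw [neg_apply]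
  exact (neg_eq_of_add_eq_zero_right h.symm).symm

end InverseDerivative

/-! ### Reduction of the Lagrangians -/

section Reduction

variable {n : ℕ} {M : Type*} [TopologicalSpace M] [T2Space M] [SecondCountableTopology M]
  [ChartedSpace (EuclideanSpace ℝ (Fin n)) M] [IsManifold (𝓡 n) ∞ M]
  [MeasurableSpace M] [BorelSpace M]
  {EG : Type*} [NormedAddCommGroup EG] [NormedSpace ℝ EG] [FiniteDimensional ℝ EG]
  {G : Type*} [TopologicalSpace G] [ChartedSpace EG G] [Group G] [LieGroup 𝓘(ℝ, EG) ∞ G]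
  {L : JetFunction n M EG G} {V : Set M} {s : ℝ × M → G}

theorem nuOf_gammaOf_eq {t : ℝ} {m : M} (hs : MDifferentiableAt (stModel n) 𝓘(ℝ, EG) s (t, m)) :
    nuOf (EG := EG) (fun t m => s (t, m)) t m = timePart (reducedJet (n := n) s (t, m)) ∧
      gammaOf (EG := EG) (fun t m => s (t, m)) t m = -spacePart (reducedJet (n := n) s (t, m)) := by
  have h : plainReducedJet s (t, m) =
      splitForm (plainNu (EG := EG) s t m) (-plainGamma (n := n) s t m) := by
    rw [plainReducedJet_eq_rightDer hs, rightDer_eq_splitForm hs]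
  have h1 : plainNu (EG := EG) s t m =
      plainReducedJet s (t, m) ((1 : ℝ), (0 : EuclideanSpace ℝ (Fin n))) := by
    rw [h]; simp [splitForm_apply]
  have h2 : plainGamma (n := n) (EG := EG) s t m = -(plainReducedJet s (t, m)).comp
      (ContinuousLinearMap.inr ℝ ℝ (EuclideanSpace ℝ (Fin n))) := by
    rw [h]; ext; simp [splitForm_apply]
  exact ⟨h1, h2⟩

theorem jet_eq_reducedDensity (hinv : JetInvariant L) (x : ℝ × M) (g : G)
    (A : TangentSpace (stModel n) x →L[ℝ] TangentSpace 𝓘(ℝ, EG) g) :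
    L x g A = reducedDensity L x ((rightTriv g).comp A) :=
  (rightInvariantJet_plainJet hinv).eq_reduced x g A

/-- `Ad_g = T R_{g⁻¹} ∘ T L_g`. -/
theorem tder_conj (g : G) : tder 𝓘(ℝ, EG) 𝓘(ℝ, EG) (fun h : G => g * h * g⁻¹) 1 =
    (tder 𝓘(ℝ, EG) 𝓘(ℝ, EG) (fun h : G => h * g⁻¹) g).comp
      (tder 𝓘(ℝ, EG) 𝓘(ℝ, EG) (fun h : G => g * h) 1) := by
  have h := tder_comp (I := 𝓘(ℝ, EG)) (I' := 𝓘(ℝ, EG)) (I'' := 𝓘(ℝ, EG))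
    (g := fun h : G => h * g⁻¹) (f := fun h : G => g * h) (x := 1)
    ((contMDiff_mul_const _).mdifferentiable (by simp) _)
    ((contMDiff_mul_left (I := 𝓘(ℝ, EG)) (n := ∞) (a := g)).mdifferentiable (by simp) _)
  simpa only [mul_one] using h

/-- Right translation by `χ⁻¹` takes `(χ', dχ - χ γ)` to `(χ' χ⁻¹, -(χ γ χ⁻¹ + χ dχ⁻¹))`, pointwise.
-/
theorem instLagrangian_eq_reducedLagrangian (hinv : JetInvariant L) (μ : Measure M)
    (hV : IsOpen V) {D : Set M} (hDV : D ⊆ V) (hD : MeasurableSet D) (t : ℝ) {χ : M → G}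
    (hχ : ContMDiffOn (𝓡 n) 𝓘(ℝ, EG) ∞ χ V) (v : ∀ m, TangentSpace 𝓘(ℝ, EG) (χ m))
    (γ : ∀ m : M, TangentSpace (𝓡 n) m →L[ℝ] LieAlg EG G) :
    instLagrangian μ L D t χ v γ =
      reducedLagrangian μ L D t (fun m => rightTriv (χ m) (v m)) (affineAct χ γ) := by
  have hpt : ∀ m ∈ V, ∀ (u : EG) (c : EuclideanSpace ℝ (Fin n) →L[ℝ] EG),
      plainJet L (t, m) (χ m) (splitForm u (tder (𝓡 n) 𝓘(ℝ, EG) χ m -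
        (tder 𝓘(ℝ, EG) 𝓘(ℝ, EG) (fun h : G => χ m * h) 1).comp c)) =
      plainReduced L (t, m) (splitForm
        (tder 𝓘(ℝ, EG) 𝓘(ℝ, EG) (fun h : G => h * (χ m)⁻¹) (χ m) u)
        (-((tder 𝓘(ℝ, EG) 𝓘(ℝ, EG) (fun h : G => χ m * h * (χ m)⁻¹) 1).comp c +
          (tder 𝓘(ℝ, EG) 𝓘(ℝ, EG) (fun h : G => χ m * h) (χ m)⁻¹).comp
            (tder (𝓡 n) 𝓘(ℝ, EG) (fun m' => (χ m')⁻¹) m)))) := by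
    intro m hm u c
    have hd : MDifferentiableAt (𝓡 n) 𝓘(ℝ, EG) χ m :=
      (hχ.contMDiffAt (hV.mem_nhds hm)).mdifferentiableAt (by simp)
    have h1 := tder_comp (I := 𝓡 n) (I' := 𝓘(ℝ, EG)) (I'' := 𝓘(ℝ, EG))
      (g := fun h : G => χ m * h) (f := fun m' => (χ m')⁻¹) (x := m)
      ((contMDiff_mul_left (I := 𝓘(ℝ, EG)) (n := ∞)).mdifferentiable (by simp) _)
      (MDifferentiableAt.comp (g := fun g : G => g⁻¹) (I' := 𝓘(ℝ, EG)) m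
        ((contMDiff_inv 𝓘(ℝ, EG) ∞).mdifferentiable (by simp) _) hd)
    rw [← h1, tder_mul_inv hd, rightDer_eq hd, tder_conj,
      (rightInvariantJet_plainJet hinv).eq_reduced, plainReduced]
    congr 1
    ext
    · simp [splitForm_apply]
    · simp [splitForm_apply, sub_eq_add_neg]
  refine Eq.trans ?_ (reducedLagrangian_eq (G := G) μ D t _ _).symm
  exact setIntegral_congr_fun hD fun m hm => hpt m (hDV hm) (v m) (γ m)

/-- The integrand is continuous on `K`. -/
theorem integrableOn_reducedDensity (hL : JetSmooth L) {μ : Measure M} [IsLocallyFiniteMeasure μ]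
    (hV : IsOpen V) {K : Set M} (hKV : K ⊆ V) (hK : IsCompact K) (t : ℝ) {ν : M → EG}
    {γ : M → EuclideanSpace ℝ (Fin n) →L[ℝ] EG} (hν : ContMDiffOn (𝓡 n) 𝓘(ℝ, EG) ∞ ν V)
    (hγ : ∀ m ∈ V, SmoothFormAt (𝓡 n) γ m) :
    IntegrableOn (fun m => plainReduced L (t, m) (splitForm (ν m) (-γ m))) K μ := by
  have hf := smoothFibreFun_plainReduced hL
  refine ContinuousOn.integrableOn_compact hK fun m hm => ContinuousAt.continuousWithinAt ?_
  have hν' : ContMDiffAt (stModel n) 𝓘(ℝ, EG) ∞ (fun x : ℝ × M => ν x.2) (t, m) :=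
    (hν.contMDiffAt (hV.mem_nhds (hKV hm))).comp (f := Prod.snd) (t, m) contMDiffAt_snd
  -- `(ν, -γ)` is the member at parameter `-1` of the smooth family `(ν, ε γ)`
  have h1 := hf.contMDiffAt ((smoothFormAt_splitForm hν').add_smul
    (smoothFormAt_splitForm_space (t := t) (hγ m (hKV hm))) (-1))
  have h2 := ContMDiffAt.slice_right (g := fun t m => plainReduced L (t, m)
    (splitForm (ν m) 0 + (-1 : ℝ) • splitForm 0 (γ m)))
    (ContMDiffAt.slice_right (g := fun (ε : ℝ) (x : ℝ × M) => plainReduced L x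
    (splitForm (ν x.2) 0 + ε • splitForm 0 (γ x.2))) h1)
  refine h2.continuousAt.congr (Filter.Eventually.of_forall fun m => ?_)
  simp only
  congr 1
  ext <;> simp [splitForm_apply]

end Reduction

end

theorem theorem4p3
    {n : ℕ} {M : Type*} [TopologicalSpace M] [T2Space M] [SecondCountableTopology M]
    [ChartedSpace (EuclideanSpace ℝ (Fin n)) M] [IsManifold (𝓡 n) ∞ M]
    [MeasurableSpace M] [BorelSpace M]
    {EG : Type*} [NormedAddCommGroup EG] [NormedSpace ℝ EG] [FiniteDimensional ℝ EG]
    {G : Type*} [TopologicalSpace G] [T2Space G] [ChartedSpace EG G] [Group G]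
    [LieGroup 𝓘(ℝ, EG) ∞ G]
    (Ω : ∀ m : M, TangentSpace (𝓡 n) m [⋀^Fin n]→ₗ[ℝ] ℝ)
    (hvol : IsVolumeForm (𝓡 n) (spaceBasis n) Ω)
    (L : JetFunction n M EG G) (hL : JetSmooth L) (hinv : JetInvariant L)
    (J : Set ℝ) (hJ : IsOpen J) (hJ' : J.OrdConnected) (V : Set M) (hV : IsOpen V)
    (s : ℝ × M → G) (hs : ContMDiffOn (stModel n) 𝓘(ℝ, EG) ∞ s (J ×ˢ V)) :
    let μM : Measure M := volMeasure (𝓡 n) (spaceBasis n) Ω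
    let μX : Measure (ℝ × M) := volMeasure (stModel n) (stBasis n) (dtWedge Ω)
    let χ : ℝ → M → G := fun t m => s (t, m)
    let ν : ℝ → M → LieAlg EG G := nuOf χ
    let γ : ℝ → ∀ m : M, TangentSpace (𝓡 n) m →L[ℝ] LieAlg EG G := gammaOf χ
    let σ : ∀ x : ℝ × M, TangentSpace (stModel n) x →L[ℝ] LieAlg EG G := reducedJet s
    let l := reducedLagrangian μM L
    let ℓ := reducedDensity L
    -- the reduced variables agree
    (∀ t ∈ J, ∀ m ∈ V, ν t m = timePart (σ (t, m)) ∧ γ t m = -spacePart (σ (t, m))) ∧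
    -- `ℓ` is the reduction of the density and `l` the reduction of the instantaneous Lagrangian
    (∀ (x : ℝ × M) (g : G) (A : TangentSpace (stModel n) x →L[ℝ] TangentSpace 𝓘(ℝ, EG) g),
      L x g A = ℓ x ((rightTriv g).comp A)) ∧
    (∀ D ⊆ V, MeasurableSet D → ∀ (t : ℝ) (χ₀ : M → G)
      (v : ∀ m, TangentSpace 𝓘(ℝ, EG) (χ₀ m))
      (γ₀ : ∀ m : M, TangentSpace (𝓡 n) m →L[ℝ] LieAlg EG G),
      ContMDiffOn (𝓡 n) 𝓘(ℝ, EG) ∞ χ₀ V →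
      instLagrangian μM L D t χ₀ v γ₀
        = l D t (fun m => rightTriv (χ₀ m) (v m)) (affineAct χ₀ γ₀)) ∧
    -- the relation between the reduced Lagrangians, with convergence over compact regions
    (∀ D ⊆ V, MeasurableSet D → ∀ (t : ℝ) (ν₀ : M → LieAlg EG G)
      (γ₀ : ∀ m : M, TangentSpace (𝓡 n) m →L[ℝ] LieAlg EG G),
      l D t ν₀ γ₀ = ∫ m in D, ℓ (t, m) (splitMap t m (ν₀ m) (-γ₀ m)) ∂μM) ∧
    (∀ K ⊆ V, IsCompact K → ∀ (t : ℝ) (ν₀ : M → LieAlg EG G)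
      (γ₀ : ∀ m : M, TangentSpace (𝓡 n) m →L[ℝ] LieAlg EG G),
      LieSmoothOn (𝓡 n) ν₀ V → FormSmoothOn (𝓡 n) γ₀ V →
      IntegrableOn (fun m => ℓ (t, m) (splitMap t m (ν₀ m) (-γ₀ m))) K μM) ∧
    -- the eight equivalent formulations
    List.TFAE [
      HamiltonPrinciple μM L J V χ,
      EulerLagrange μM L J V χ,
      ConstrainedPrinciple l J V ν γ,
      AffineEulerPoincare μM Ω l J V ν γ,
      CovariantPrinciple μX L (J ×ˢ V) s,
      CovariantEulerLagrange Ω L (J ×ˢ V) s,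
      CovariantReducedPrinciple μX ℓ (J ×ˢ V) σ,
      CovariantEulerPoincare Ω ℓ (J ×ˢ V) σ] := by
  intro μM μX χ ν γ σ l ℓ
  have hU : IsOpen (J ×ˢ V) := hJ.prod hV
  have hs' : ∀ x ∈ J ×ˢ V, ContMDiffAt (stModel n) 𝓘(ℝ, EG) ∞ s x :=
    fun x hx => hs.contMDiffAt (hU.mem_nhds hx)
  have hloc : IsLocallyFiniteMeasure μM := isLocallyFiniteMeasure_volMeasure hvol
  refine ⟨fun t ht m hm => nuOf_gammaOf_eq ((hs' (t, m) ⟨ht, hm⟩).mdifferentiableAt (by simp)),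
    jet_eq_reducedDensity hinv,
    fun D hDV hD t χ₀ v γ₀ hχ₀ => instLagrangian_eq_reducedLagrangian hinv μM hV hDV hD t hχ₀ v γ₀,
    fun D _ _ t ν₀ γ₀ => reducedLagrangian_eq (EG := EG) (G := G) μM D t ν₀ γ₀,
    fun K hKV hK t ν₀ γ₀ hν₀ hγ₀ => integrableOn_reducedDensity (EG := EG) hL hV hKV hK t hν₀
      ((formSmoothOn_iff (EG := EG) (G := G) hV).1 hγ₀), ?_⟩
  have h8 := covariantEulerPoincare_iff (Ω := Ω) hL hU hs'
  tfae_have 1 ↔ 8 := (hamiltonPrinciple_iff hvol hL hinv hJ hJ' hV hs').trans h8.symm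
  tfae_have 2 ↔ 8 := (eulerLagrange_iff hvol hL hinv hJ hV hs').trans h8.symm
  tfae_have 3 ↔ 8 := (constrainedPrinciple_iff hvol hL hJ hJ' hV hs').trans h8.symm
  tfae_have 4 ↔ 8 := (affineEulerPoincare_iff hvol hL hJ hV hs').trans h8.symm
  tfae_have 5 ↔ 8 := (covariantPrinciple_iff hvol hL hinv hU hs').trans h8.symm
  tfae_have 6 ↔ 8 := (covariantEulerLagrange_iff hvol hL hinv hU hs').trans h8.symm
  tfae_have 7 ↔ 8 := (covariantReducedPrinciple_iff hvol hL hU hs').trans h8.symm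
  tfae_finish
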